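/- A full-duplex discrete memoryless cognitive relay channel has finite alphabets and a transition probability $p(y_1,y_2,y\mid x_1,x_2)$. Sender $S_1$ encodes its message $w_1$ as $x_1^n(w_1)$; sender $S_2$, which also relays, sends $x_{2k}(w_2,y^{k-1})$ at time $k$, where $y$ is what $S_2$ receives; receiver $T_1$ decodes $w_1$ from $y_1^n$ and $T_2$ decodes $w_2$ from $y_2^n$. The messages are independent and uniform on sets of sizes $\lceil 2^{nR_1}\rceil$ and $\lceil 2^{nR_2}\rceil$. A pair $(R_1,R_2)$ of nonnegative rates is achievable if for every $\epsilon>0$ and all large $n$ there is such a code with average probability of $(\hat W_1,\hat W_2)\ne(W_1,W_2)$ at most $\epsilon$. For a distribution $$P_2=p(t_{10})p(u_{10}|t_{10})p(u_{11})p(x_1|t_{10},u_{10},u_{11})p(u_{21})p(u_{22}|u_{21},t_{10})p(x_2|t_{10},u_{21},u_{22})p(y_1,y_2,y|x_1,x_2)$$ with finite auxiliary alphabets, let (in bits) $$\begin{aligned} I_1&=I(U_{22};T_{10}|U_{21}), & I_2&=I(U_{10};Y|T_{10}),\\ I_3&=I(X_1;Y_1|T_{10},U_{10},U_{11},U_{21}),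 & I_4&=I(U_{10},X_1;Y_1|T_{10},U_{11},U_{21})+I(T_{10};Y_1),\\ I_5&=I(U_{11},X_1;Y_1|T_{10},U_{10},U_{21}), & I_6&=I(U_{10},U_{11},X_1;Y_1|T_{10},U_{21})+I(T_{10};Y_1),\\ I_7&=I(X_1,U_{21};Y_1|T_{10},U_{10},U_{11}), & I_8&=I(U_{10},X_1,U_{21};Y_1|T_{10},U_{11})+I(T_{10};Y_1),\\ I_9&=I(U_{11},X_1,U_{21};Y_1|T_{10},U_{10}), & I_{10}&=I(T_{10},U_{10},U_{11},X_1,U_{21};Y_1),\\ I_{11}&=I(U_{22};Y_2|U_{21},U_{11}), & I_{12}&=I(U_{21},U_{22};Y_2|U_{11}),\\ I_{13}&=I(U_{11},U_{22};Y_2|U_{21}), & I_{14}&=I(U_{11},U_{21},U_{22};Y_2). \end{aligned}$$ Let $\mathcal R$ be the union over all $P_2$ of the sets of pairs $R_1,R_2\ge 0$ with $$\begin{aligned} R_1&\le\min\{I_2+I_5,I_6\},\\ R_2&\le I_{12}-I_1,\\ R_1+R_2&\le\min\{I_2+I_7,I_8\}+I_{13}-I_1,\\ R_1+R_2&\le\min\{I_2+I_3,I_4\}+I_{14}-I_1,\\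 R_1+R_2&\le\min\{I_2+I_9,I_{10}\}+I_{11}-I_1,\\ 2R_1+R_2&\le\min\{I_2+I_3,I_4\}+\min\{I_2+I_9,I_{10}\}+I_{13}-I_1,\\ R_1+2R_2&\le\min\{I_2+I_7,I_8\}+I_{11}-I_1+I_{14}-I_1. \end{aligned}$$ The HK-PDF-binning scheme with distribution $P_2$ and rates $R_{10},R_{11},R_{12},R_{21},R_{22},R_{22}'\ge 0$ uses $b+1$ blocks of length $n$. In each of the first $b$ blocks it sends new message parts $(w_{10},w_{11},w_{12})$ of $S_1$ and $(w_{21},w_{22})$ of $S_2$; in the last block it sends fixed ones. Below, $w_{10}'$ is the part $w_{10}$ of the previous block (a fixed one before the first block). * Codebooks, drawn independently for each block, with independent symbols: $t_{10}^n(w_{10}')$ from $p(t_{10})$; $u_{10}^n(w_{10}|w_{10}')$ from $p(u_{10}|t_{10})$; $u_{11}^n(w_{11})$ from $p(u_{11})$; $x_1^n(w_{12}|w_{11},w_{10},w_{10}')$ from $p(x_1|t_{10},u_{10},u_{11})$; $u_{21}^n(w_{21})$ from $p(u_{21})$; $u_{22}^n(w_{22},v_{22}|w_{21})$ from $p(u_{22}|u_{21})$,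 with $\lceil 2^{nR_{22}'}\rceil$ values of $v_{22}$; $x_2^n(w_{10}',w_{21},w_{22},v_{22})$ from $p(x_2|t_{10},u_{21},u_{22})$. * $S_1$ sends $x_1^n(w_{12}|w_{11},w_{10},w_{10}')$. $S_2$ uses its estimate of $w_{10}'$, looks for a $v_{22}$ such that $(t_{10}^n(w_{10}'),u_{21}^n(w_{21}),u_{22}^n(w_{22},v_{22}|w_{21}))$ is jointly typical, and sends $x_2^n(w_{10}',w_{21},w_{22},v_{22})$. At the end of the block it estimates $w_{10}$ as the unique index for which $(t_{10}^n(w_{10}'),u_{10}^n(w_{10}|w_{10}'),y^n)$ is jointly typical. * $T_1$, using its estimate of $w_{10}'$, decodes the $(w_{10},w_{11},w_{12})$ of a block from that block and the next one, as the unique triple for which, for some $w_{21}$, $(t_{10}^n(w_{10}'),u_{10}^n(w_{10}|w_{10}'),u_{11}^n(w_{11}),x_1^n(w_{12}|w_{11},w_{10},w_{10}'),u_{21}^n(w_{21}),y_1^n)$ is jointly typical in the block and $(t_{10}^n(w_{10}),y_1^n)$ is jointly typical in the next block. $T_2$ decodes $(w_{21},w_{22})$ as the unique pair for which, for some $(w_{11},v_{22})$,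 $(u_{11}^n(w_{11}),u_{21}^n(w_{21}),u_{22}^n(w_{22},v_{22}|w_{21}),y_2^n)$ is jointly typical. Typicality is strong typicality, with one parameter for binning and one for decoding. The scheme achieves $(R_1,R_2)$ if there is a $P_2$ such that for every $\delta>0$ there are rates with $R_{10}+R_{11}+R_{12}\ge R_1-\delta$ and $R_{21}+R_{22}\ge R_2-\delta$, and typicality parameters, for which, for every $b$, the error probability averaged over the messages and the random codebooks tends to $0$ as $n\to\infty$. **Theorem.** For every such channel: 1. The HK-PDF-binning scheme achieves every pair in $\mathcal R$. 2. The convex hull of $\mathcal R$ is achievable: each of its points is a limit of achievable rate pairs. 3. The convex hull of $\mathcal R$ contains the PDF-binning region, that is, the convex hull of the union, over $p(t_{10})p(u_{10}|t_{10})p(x_1|t_{10},u_{10})p(u_2|t_{10})p(x_2|t_{10},u_2)p(y_1,y_2,y|x_1,x_2)$, of the sets of pairs $R_1,R_2\ge0$ with $R_1\le I(U_{10};Y|T_{10})+I(X_1;Y_1|U_{10},T_{10})$, $R_1\le I(T_{10},U_{10},X_1;Y_1)$ and $R_2\le I(U_2;Y_2)-I(U_2;T_{10})$. 4. The convex hull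 of $\mathcal R$ contains the Han–Kobayashi region of the interference channel $p(y_1,y_2|x_1,x_2)$, that is, the convex hull of the union, over $p(u_1)p(x_1|u_1)p(u_2)p(x_2|u_2)p(y_1,y_2|x_1,x_2)$, of the sets of pairs $R_1,R_2\ge0$ with $$\begin{aligned} R_1&\le I(X_1;Y_1|U_2),\\ R_2&\le I(X_2;Y_2|U_1),\\ R_1+R_2&\le I(X_1;Y_1|U_1,U_2)+I(X_2,U_1;Y_2),\\ R_1+R_2&\le I(X_2;Y_2|U_1,U_2)+I(X_1,U_2;Y_1),\\ R_1+R_2&\le I(X_1,U_2;Y_1|U_1)+I(X_2,U_1;Y_2|U_2),\\ 2R_1+R_2&\le I(X_1;Y_1|U_1,U_2)+I(X_1,U_2;Y_1)+I(X_2,U_1;Y_2|U_2),\\ R_1+2R_2&\le I(X_2;Y_2|U_1,U_2)+I(X_2,U_1;Y_2)+I(X_1,U_2;Y_1|U_1). \end{aligned}$$ -/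

import Mathlib

open Filter Topology

/-! Finite-alphabet probability: events, conditional mutual information (in bits), typicality. -/

open Classical in
/-- Probability of the event `E` under the mass function `p`. -/
noncomputable def prob {Ω : Type*} [Fintype Ω] (p : Ω → ℝ) (E : Ω → Prop) : ℝ :=
  ∑ ω, if E ω then p ω else 0

/-- Conditional mutual information `I(A; B | C)` in bits of the random variables `A`, `B`, `C`
on the finite probability space `(Ω, p)`:
the expectation of `log₂ (P(a,b,c) P(c) / (P(a,c) P(b,c)))`. -/
noncomputable def condMI {Ω α β γ : Type*} [Fintype Ω] (p : Ω → ℝ)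
    (A : Ω → α) (B : Ω → β) (C : Ω → γ) : ℝ :=
  ∑ ω, p ω * Real.logb 2
    ((prob p (fun η => A η = A ω ∧ B η = B ω ∧ C η = C ω) * prob p (fun η => C η = C ω)) /
      (prob p (fun η => A η = A ω ∧ C η = C ω) * prob p (fun η => B η = B ω ∧ C η = C ω)))

/-- Mutual information `I(A; B)` in bits. -/
noncomputable def mutualInfo {Ω α β : Type*} [Fintype Ω] (p : Ω → ℝ)
    (A : Ω → α) (B : Ω → β) : ℝ :=
  condMI p A B (fun _ => ())

open Classical in
/-- The sequence `s` is (robustly, strongly) `ε`-typical for the law of `A` under `p`: the empirical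
frequency of every symbol is within a factor `1 ± ε` of its probability. -/
def Typical {Ω α : Type*} [Fintype Ω] (p : Ω → ℝ) (A : Ω → α) (ε : ℝ) {n : ℕ}
    (s : Fin n → α) : Prop :=
  ∀ a : α, |((Finset.univ.filter (fun k => s k = a)).card : ℝ) / n - prob p (fun ω => A ω = a)|
    ≤ ε * prob p (fun ω => A ω = a)

/-! The full-duplex cognitive relay channel, codes and achievable rates. -/

/-- A full-duplex discrete memoryless cognitive relay channel `p(y₁, y₂, y | x₁, x₂)`. -/
structure CRC (X₁ X₂ Y₁ Y₂ Y : Type*) [Fintype Y₁] [Fintype Y₂] [Fintype Y] where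
  trans : X₁ → X₂ → Y₁ × Y₂ × Y → ℝ
  trans_mem : ∀ x₁ x₂, trans x₁ x₂ ∈ stdSimplex ℝ (Y₁ × Y₂ × Y)

/-- A code of block length `n` with message sets `M₁`, `M₂`: the first encoder is a block encoder,
the second one chooses its `k`-th symbol from its message and its strictly past received symbols. -/
structure CRCCode (X₁ X₂ Y₁ Y₂ Y : Type*) (n : ℕ) (M₁ M₂ : Type*) where
  enc₁ : M₁ → Fin n → X₁
  enc₂ : M₂ → (k : Fin n) → (Fin k → Y) → X₂
  dec₁ : (Fin n → Y₁) → M₁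
  dec₂ : (Fin n → Y₂) → M₂

open Classical in
/-- Average error probability `P{(Ŵ₁, Ŵ₂) ≠ (W₁, W₂)}`, with independent uniform messages. -/
noncomputable def CRCCode.errorProb {X₁ X₂ Y₁ Y₂ Y : Type*}
    [Fintype Y₁] [Fintype Y₂] [Fintype Y] {n : ℕ} {M₁ M₂ : Type*} [Fintype M₁] [Fintype M₂]
    (c : CRCCode X₁ X₂ Y₁ Y₂ Y n M₁ M₂) (ch : CRC X₁ X₂ Y₁ Y₂ Y) : ℝ :=
  ((Fintype.card M₁ : ℝ) * (Fintype.card M₂ : ℝ))⁻¹ *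
    ∑ w₁ : M₁, ∑ w₂ : M₂, ∑ y₁ : Fin n → Y₁, ∑ y₂ : Fin n → Y₂, ∑ y : Fin n → Y,
      if c.dec₁ y₁ = w₁ ∧ c.dec₂ y₂ = w₂ then 0
      else ∏ k : Fin n,
        ch.trans (c.enc₁ w₁ k) (c.enc₂ w₂ k (fun j => y ⟨j, j.2.trans k.2⟩)) (y₁ k, y₂ k, y k)

/-- The number `⌈2^{nR}⌉` of messages of rate `R` at block length `n`. -/
noncomputable def numMsg (n : ℕ) (R : ℝ) : ℕ := ⌈(2 : ℝ) ^ ((n : ℝ) * R)⌉₊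

instance instNeZeroNumMsg (n : ℕ) (R : ℝ) : NeZero (numMsg n R) :=
  ⟨(Nat.ceil_pos.mpr (Real.rpow_pos_of_pos two_pos _)).ne'⟩

/-- The message set `[1, 2^{nR}]`. -/
abbrev Msg (n : ℕ) (R : ℝ) : Type := Fin (numMsg n R)

/-- The set of achievable rate pairs: for every `ε > 0` there are, for all large `n`,
`(2^{nR₁}, 2^{nR₂}, n)` codes with average error probability at most `ε`. -/
def CRC.achievable {X₁ X₂ Y₁ Y₂ Y : Type*} [Fintype Y₁] [Fintype Y₂] [Fintype Y]
    (ch : CRC X₁ X₂ Y₁ Y₂ Y) : Set (ℝ × ℝ) :=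
  {R | 0 ≤ R.1 ∧ 0 ≤ R.2 ∧ ∀ ε : ℝ, 0 < ε → ∀ᶠ n : ℕ in atTop,
    ∃ c : CRCCode X₁ X₂ Y₁ Y₂ Y n (Msg n R.1) (Msg n R.2), c.errorProb ch ≤ ε}

/-! Input distributions of the Han-Kobayashi PDF-binning scheme and its rate region. -/

/-- The factors `p(t₁₀) p(u₁₀|t₁₀) p(u₁₁) p(x₁|t₁₀,u₁₀,u₁₁) p(u₂₁) p(u₂₂|u₂₁,t₁₀) p(x₂|t₁₀,u₂₁,u₂₂)`
of an input distribution, with arbitrary finite alphabets of the auxiliary variables. -/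
structure HKPDFDist (X₁ X₂ : Type*) [Fintype X₁] [Fintype X₂] where
  (kT₁₀ kU₁₀ kU₁₁ kU₂₁ kU₂₂ : ℕ)
  pT₁₀ : Fin kT₁₀ → ℝ
  pU₁₀ : Fin kT₁₀ → Fin kU₁₀ → ℝ
  pU₁₁ : Fin kU₁₁ → ℝ
  pX₁ : Fin kT₁₀ → Fin kU₁₀ → Fin kU₁₁ → X₁ → ℝ
  pU₂₁ : Fin kU₂₁ → ℝ
  pU₂₂ : Fin kU₂₁ → Fin kT₁₀ → Fin kU₂₂ → ℝ
  pX₂ : Fin kT₁₀ → Fin kU₂₁ → Fin kU₂₂ → X₂ → ℝ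
  pT₁₀_mem : pT₁₀ ∈ stdSimplex ℝ (Fin kT₁₀)
  pU₁₀_mem : ∀ t, pU₁₀ t ∈ stdSimplex ℝ (Fin kU₁₀)
  pU₁₁_mem : pU₁₁ ∈ stdSimplex ℝ (Fin kU₁₁)
  pX₁_mem : ∀ t u v, pX₁ t u v ∈ stdSimplex ℝ X₁
  pU₂₁_mem : pU₂₁ ∈ stdSimplex ℝ (Fin kU₂₁)
  pU₂₂_mem : ∀ u t, pU₂₂ u t ∈ stdSimplex ℝ (Fin kU₂₂)
  pX₂_mem : ∀ t u v, pX₂ t u v ∈ stdSimplex ℝ X₂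

/-- A joint realization of all the variables of the scheme. -/
structure HKPDFSample (T₁₀ U₁₀ U₁₁ X₁ U₂₁ U₂₂ X₂ Y₁ Y₂ Y : Type*) where
  t₁₀ : T₁₀
  u₁₀ : U₁₀
  u₁₁ : U₁₁
  x₁ : X₁
  u₂₁ : U₂₁
  u₂₂ : U₂₂
  x₂ : X₂
  y₁ : Y₁
  y₂ : Y₂
  y : Y

instance instFintypeHKPDFSample {T₁₀ U₁₀ U₁₁ X₁ U₂₁ U₂₂ X₂ Y₁ Y₂ Y : Type*} [Fintype T₁₀] [Fintype U₁₀] [Fintype U₁₁]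
    [Fintype X₁] [Fintype U₂₁] [Fintype U₂₂] [Fintype X₂] [Fintype Y₁] [Fintype Y₂] [Fintype Y] :
    Fintype (HKPDFSample T₁₀ U₁₀ U₁₁ X₁ U₂₁ U₂₂ X₂ Y₁ Y₂ Y) :=
  Fintype.ofEquiv (T₁₀ × U₁₀ × U₁₁ × X₁ × U₂₁ × U₂₂ × X₂ × Y₁ × Y₂ × Y)
    { toFun := fun ⟨a, b, c, d, e, f, g, h, i, j⟩ => ⟨a, b, c, d, e, f, g, h, i, j⟩
      invFun := fun ⟨a, b, c, d, e, f, g, h, i, j⟩ => ⟨a, b, c, d, e, f, g, h, i, j⟩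
      left_inv := fun _ => rfl
      right_inv := fun _ => rfl }

namespace HKPDFDist

/-- The sample space of all variables of the scheme. -/
abbrev Sample {X₁ X₂ : Type*} [Fintype X₁] [Fintype X₂] (P : HKPDFDist X₁ X₂)
    (Y₁ Y₂ Y : Type*) : Type _ :=
  HKPDFSample (Fin P.kT₁₀) (Fin P.kU₁₀) (Fin P.kU₁₁) X₁ (Fin P.kU₂₁) (Fin P.kU₂₂) X₂ Y₁ Y₂ Y

section

variable {X₁ X₂ Y₁ Y₂ Y : Type*} [Fintype X₁] [Fintype X₂] [Fintype Y₁] [Fintype Y₂] [Fintype Y]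

/-- The joint distribution `P₂` of the auxiliary variables, the inputs and the outputs. -/
def joint (P : HKPDFDist X₁ X₂) (ch : CRC X₁ X₂ Y₁ Y₂ Y) (s : P.Sample Y₁ Y₂ Y) : ℝ :=
  P.pT₁₀ s.t₁₀ * P.pU₁₀ s.t₁₀ s.u₁₀ * P.pU₁₁ s.u₁₁ * P.pX₁ s.t₁₀ s.u₁₀ s.u₁₁ s.x₁ *
    P.pU₂₁ s.u₂₁ * P.pU₂₂ s.u₂₁ s.t₁₀ s.u₂₂ * P.pX₂ s.t₁₀ s.u₂₁ s.u₂₂ s.x₂ *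
    ch.trans s.x₁ s.x₂ (s.y₁, s.y₂, s.y)

variable (P : HKPDFDist X₁ X₂) (ch : CRC X₁ X₂ Y₁ Y₂ Y)

/-- `I₁ = I(U₂₂; T₁₀ | U₂₁)` -/
noncomputable def I₁ : ℝ :=
  condMI (P.joint ch) (·.u₂₂) (·.t₁₀) (·.u₂₁)

/-- `I₂ = I(U₁₀; Y | T₁₀)` -/
noncomputable def I₂ : ℝ :=
  condMI (P.joint ch) (·.u₁₀) (·.y) (·.t₁₀)

/-- `I₃ = I(X₁; Y₁ | T₁₀, U₁₀, U₁₁, U₂₁)` -/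
noncomputable def I₃ : ℝ :=
  condMI (P.joint ch) (·.x₁) (·.y₁) (fun s => (s.t₁₀, s.u₁₀, s.u₁₁, s.u₂₁))

/-- `I₄ = I(U₁₀, X₁; Y₁ | T₁₀, U₁₁, U₂₁) + I(T₁₀; Y₁)` -/
noncomputable def I₄ : ℝ :=
  condMI (P.joint ch) (fun s => (s.u₁₀, s.x₁)) (·.y₁) (fun s => (s.t₁₀, s.u₁₁, s.u₂₁)) +
    mutualInfo (P.joint ch) (·.t₁₀) (·.y₁)

/-- `I₅ = I(U₁₁, X₁; Y₁ | T₁₀, U₁₀, U₂₁)` -/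
noncomputable def I₅ : ℝ :=
  condMI (P.joint ch) (fun s => (s.u₁₁, s.x₁)) (·.y₁) (fun s => (s.t₁₀, s.u₁₀, s.u₂₁))

/-- `I₆ = I(U₁₀, U₁₁, X₁; Y₁ | T₁₀, U₂₁) + I(T₁₀; Y₁)` -/
noncomputable def I₆ : ℝ :=
  condMI (P.joint ch) (fun s => (s.u₁₀, s.u₁₁, s.x₁)) (·.y₁) (fun s => (s.t₁₀, s.u₂₁)) +
    mutualInfo (P.joint ch) (·.t₁₀) (·.y₁)

/-- `I₇ = I(X₁, U₂₁; Y₁ | T₁₀, U₁₀, U₁₁)` -/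
noncomputable def I₇ : ℝ :=
  condMI (P.joint ch) (fun s => (s.x₁, s.u₂₁)) (·.y₁) (fun s => (s.t₁₀, s.u₁₀, s.u₁₁))

/-- `I₈ = I(U₁₀, X₁, U₂₁; Y₁ | T₁₀, U₁₁) + I(T₁₀; Y₁)` -/
noncomputable def I₈ : ℝ :=
  condMI (P.joint ch) (fun s => (s.u₁₀, s.x₁, s.u₂₁)) (·.y₁) (fun s => (s.t₁₀, s.u₁₁)) +
    mutualInfo (P.joint ch) (·.t₁₀) (·.y₁)

/-- `I₉ = I(U₁₁, X₁, U₂₁; Y₁ | T₁₀, U₁₀)` -/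
noncomputable def I₉ : ℝ :=
  condMI (P.joint ch) (fun s => (s.u₁₁, s.x₁, s.u₂₁)) (·.y₁) (fun s => (s.t₁₀, s.u₁₀))

/-- `I₁₀ = I(T₁₀, U₁₀, U₁₁, X₁, U₂₁; Y₁)` -/
noncomputable def I₁₀ : ℝ :=
  mutualInfo (P.joint ch) (fun s => (s.t₁₀, s.u₁₀, s.u₁₁, s.x₁, s.u₂₁)) (·.y₁)

/-- `I₁₁ = I(U₂₂; Y₂ | U₂₁, U₁₁)` -/
noncomputable def I₁₁ : ℝ :=
  condMI (P.joint ch) (·.u₂₂) (·.y₂) (fun s => (s.u₂₁, s.u₁₁))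

/-- `I₁₂ = I(U₂₁, U₂₂; Y₂ | U₁₁)` -/
noncomputable def I₁₂ : ℝ :=
  condMI (P.joint ch) (fun s => (s.u₂₁, s.u₂₂)) (·.y₂) (·.u₁₁)

/-- `I₁₃ = I(U₁₁, U₂₂; Y₂ | U₂₁)` -/
noncomputable def I₁₃ : ℝ :=
  condMI (P.joint ch) (fun s => (s.u₁₁, s.u₂₂)) (·.y₂) (·.u₂₁)

/-- `I₁₄ = I(U₁₁, U₂₁, U₂₂; Y₂)` -/
noncomputable def I₁₄ : ℝ :=
  mutualInfo (P.joint ch) (fun s => (s.u₁₁, s.u₂₁, s.u₂₂)) (·.y₂)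

/-- The set of nonnegative rate pairs that satisfy the seven inequalities for the distribution `P₂`. -/
def region : Set (ℝ × ℝ) :=
  {R | 0 ≤ R.1 ∧ 0 ≤ R.2 ∧
    R.1 ≤ min (P.I₂ ch + P.I₅ ch) (P.I₆ ch) ∧
    R.2 ≤ P.I₁₂ ch - P.I₁ ch ∧
    R.1 + R.2 ≤ min (P.I₂ ch + P.I₇ ch) (P.I₈ ch) + P.I₁₃ ch - P.I₁ ch ∧
    R.1 + R.2 ≤ min (P.I₂ ch + P.I₃ ch) (P.I₄ ch) + P.I₁₄ ch - P.I₁ ch ∧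
    R.1 + R.2 ≤ min (P.I₂ ch + P.I₉ ch) (P.I₁₀ ch) + P.I₁₁ ch - P.I₁ ch ∧
    2 * R.1 + R.2 ≤ min (P.I₂ ch + P.I₃ ch) (P.I₄ ch) + min (P.I₂ ch + P.I₉ ch) (P.I₁₀ ch) +
      P.I₁₃ ch - P.I₁ ch ∧
    R.1 + 2 * R.2 ≤ min (P.I₂ ch + P.I₇ ch) (P.I₈ ch) + P.I₁₁ ch - P.I₁ ch +
      P.I₁₄ ch - P.I₁ ch}

end

end HKPDFDist

/-- The union of the rate regions over all distributions `P₂`. -/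
def CRC.hkpdfRegion {X₁ X₂ Y₁ Y₂ Y : Type*} [Fintype X₁] [Fintype X₂] [Fintype Y₁] [Fintype Y₂]
    [Fintype Y] (ch : CRC X₁ X₂ Y₁ Y₂ Y) : Set (ℝ × ℝ) :=
  ⋃ P : HKPDFDist X₁ X₂, P.region ch

/-! The Han-Kobayashi PDF-binning scheme with `b + 1` blocks of length `n` that carry `b` message
tuples: random codebooks, encoders and decoders. Blocks are numbered `0, …, b`; the message tuple of
index `i < b` is sent in block `i`, and the message of block `b` is the fixed one `0`, which is also
the "previous" message of block `0`. -/

/-- Rates of the parts of the two messages and (`r₂₂'`) of the bins. -/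
structure HKPDFRates where
  (r₁₀ r₁₁ r₁₂ r₂₁ r₂₂ r₂₂' : ℝ)

/-- One realization of the codebooks, one for each block. Arguments: block, then message indices;
the first index of `t₁₀`, `u₁₀`, `x₁`, `x₂` is the previous forwarded message `w₁₀'`. -/
structure HKPDFBook {X₁ X₂ : Type*} [Fintype X₁] [Fintype X₂] (P : HKPDFDist X₁ X₂)
    (r : HKPDFRates) (n b : ℕ) where
  /-- `t₁₀(w₁₀')` -/
  t₁₀ : Fin (b + 1) → Msg n r.r₁₀ → Fin n → Fin P.kT₁₀
  /-- `u₁₀(w₁₀ | w₁₀')` -/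
  u₁₀ : Fin (b + 1) → Msg n r.r₁₀ → Msg n r.r₁₀ → Fin n → Fin P.kU₁₀
  /-- `u₁₁(w₁₁)` -/
  u₁₁ : Fin (b + 1) → Msg n r.r₁₁ → Fin n → Fin P.kU₁₁
  /-- `x₁(w₁₂ | w₁₁, w₁₀, w₁₀')` -/
  x₁ : Fin (b + 1) → Msg n r.r₁₀ → Msg n r.r₁₀ → Msg n r.r₁₁ → Msg n r.r₁₂ → Fin n → X₁
  /-- `u₂₁(w₂₁)` -/
  u₂₁ : Fin (b + 1) → Msg n r.r₂₁ → Fin n → Fin P.kU₂₁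
  /-- `u₂₂(w₂₂, v₂₂ | w₂₁)` -/
  u₂₂ : Fin (b + 1) → Msg n r.r₂₁ → Msg n r.r₂₂ → Msg n r.r₂₂' → Fin n → Fin P.kU₂₂
  /-- `x₂(w₁₀', w₂₁, w₂₂, v₂₂)` -/
  x₂ : Fin (b + 1) → Msg n r.r₁₀ → Msg n r.r₂₁ → Msg n r.r₂₂ → Msg n r.r₂₂' → Fin n → X₂

open Classical in
/-- The unique element that satisfies `S`, and the default value `d` if there is no such element. -/
noncomputable def uniqueOr {α : Type*} (S : α → Prop) (d : α) : α :=
  if h : ∃! a, S a then h.choose else d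

open Classical in
/-- Some element that satisfies `S`, and the default value `d` if there is none. -/
noncomputable def someOr {α : Type*} (S : α → Prop) (d : α) : α :=
  if h : ∃ a, S a then h.choose else d

/-- The `i`-th block of a sequence of `b + 1` blocks of length `n`. -/
def blockOf {α : Type*} {n b : ℕ} (y : Fin ((b + 1) * n) → α) (i : Fin (b + 1)) : Fin n → α :=
  fun l => y (finProdFinEquiv (i, l))

/-- The message sent in block `i`: the `i`-th one for `i < b`, and the default `d` in block `b`. -/
def blockMsg {α : Type*} {b : ℕ} (w : Fin b → α) (d : α) (i : Fin (b + 1)) : α :=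
  if h : (i : ℕ) < b then w ⟨i, h⟩ else d

/-- The message sent in the block before block `i`, and the default `d` for `i = 0`. -/
def prevMsg {α : Type*} {b : ℕ} (w : Fin b → α) (d : α) (i : Fin (b + 1)) : α :=
  if h : 0 < (i : ℕ) then w ⟨(i : ℕ) - 1, by omega⟩ else d

/-- Message tuples `(w₁₀, w₁₁, w₁₂)` of the first user in one block. -/
abbrev HKPDFRates.Msg₁ (r : HKPDFRates) (n : ℕ) : Type := Msg n r.r₁₀ × Msg n r.r₁₁ × Msg n r.r₁₂

/-- Message tuples `(w₂₁, w₂₂)` of the second user in one block. -/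
abbrev HKPDFRates.Msg₂ (r : HKPDFRates) (n : ℕ) : Type := Msg n r.r₂₁ × Msg n r.r₂₂

namespace HKPDFBook

section

variable {X₁ X₂ Y₁ Y₂ Y : Type*} [Fintype X₁] [Fintype X₂] [Fintype Y₁] [Fintype Y₂] [Fintype Y]
  {P : HKPDFDist X₁ X₂} {r : HKPDFRates} {n b : ℕ}

/-- The probability of the codebooks: superposition coding, with independent blocks; `u₂₂` is drawn
given `u₂₁` alone, according to `p(u₂₂|u₂₁) = ∑ p(t₁₀) p(u₂₂|u₂₁,t₁₀)`. -/
noncomputable def weight (bk : HKPDFBook P r n b) : ℝ :=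
  ∏ i,
    (∏ w', ∏ k, P.pT₁₀ (bk.t₁₀ i w' k)) *
    (∏ w', ∏ w, ∏ k, P.pU₁₀ (bk.t₁₀ i w' k) (bk.u₁₀ i w' w k)) *
    (∏ w, ∏ k, P.pU₁₁ (bk.u₁₁ i w k)) *
    (∏ w', ∏ w₁₀, ∏ w₁₁, ∏ w₁₂, ∏ k,
      P.pX₁ (bk.t₁₀ i w' k) (bk.u₁₀ i w' w₁₀ k) (bk.u₁₁ i w₁₁ k) (bk.x₁ i w' w₁₀ w₁₁ w₁₂ k)) *
    (∏ w, ∏ k, P.pU₂₁ (bk.u₂₁ i w k)) *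
    (∏ w₂₁, ∏ w₂₂, ∏ v, ∏ k,
      ∑ t, P.pT₁₀ t * P.pU₂₂ (bk.u₂₁ i w₂₁ k) t (bk.u₂₂ i w₂₁ w₂₂ v k)) *
    (∏ w', ∏ w₂₁, ∏ w₂₂, ∏ v, ∏ k,
      P.pX₂ (bk.t₁₀ i w' k) (bk.u₂₁ i w₂₁ k) (bk.u₂₂ i w₂₁ w₂₂ v k) (bk.x₂ i w' w₂₁ w₂₂ v k))

variable (bk : HKPDFBook P r n b) (ch : CRC X₁ X₂ Y₁ Y₂ Y)

/-- Conditional binning at the second sender in block `i`: some bin index `v₂₂` for which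
`(t₁₀(w₁₀'), u₂₁(w₂₁), u₂₂(w₂₂, v₂₂ | w₂₁))` is jointly typical. -/
noncomputable def bin (ε : ℝ) (i : Fin (b + 1)) (w' : Msg n r.r₁₀) (m : r.Msg₂ n) :
    Msg n r.r₂₂' :=
  someOr (fun v => Typical (P.joint ch) (fun s => (s.t₁₀, s.u₂₁, s.u₂₂)) ε
    (fun k => (bk.t₁₀ i w' k, bk.u₂₁ i m.1 k, bk.u₂₂ i m.1 m.2 v k))) 0

/-- Partial decoding at the second sender in block `i`, with estimate `w'` of the previous forwarded
message: the unique `w₁₀` for which `(t₁₀(w'), u₁₀(w₁₀ | w'), y)` is jointly typical. -/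
noncomputable def relayDec (ε : ℝ) (i : Fin (b + 1)) (w' : Msg n r.r₁₀) (y : Fin n → Y) :
    Msg n r.r₁₀ :=
  uniqueOr (fun w => Typical (P.joint ch) (fun s => (s.t₁₀, s.u₁₀, s.y)) ε
    (fun k => (bk.t₁₀ i w' k, bk.u₁₀ i w' w k, y k))) 0

/-- The second sender's estimate, from the `m` symbols received so far, of the forwarded message that
precedes block `i`; all blocks before block `i` have to be complete. -/
noncomputable def relayEst (ε : ℝ) {m : ℕ} (y : Fin m → Y) : ℕ → Msg n r.r₁₀
  | 0 => 0
  | i + 1 =>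
    if h : i < b + 1 ∧ n * (i + 1) ≤ m then
      bk.relayDec ch ε ⟨i, h.1⟩ (relayEst ε y i)
        (fun l => y ⟨l + n * i, by
          have h1 := l.2
          have h2 := h.2
          rw [Nat.mul_add] at h2
          omega⟩)
    else 0

/-- Decoding at the first receiver, from the blocks `j` and `j + 1`, with estimate `w'` of the previous
forwarded message: the unique tuple `(w₁₀, w₁₁, w₁₂)` for which, for some `w₂₁`,
`(t₁₀(w'), u₁₀(w₁₀ | w'), u₁₁(w₁₁), x₁(w₁₂ | w₁₁, w₁₀, w'), u₂₁(w₂₁), y₁)` is jointly typical in block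
`j` and `(t₁₀(w₁₀), y₁)` is jointly typical in block `j + 1`. -/
noncomputable def recvDec₁ (ε : ℝ) (j : Fin b) (w' : Msg n r.r₁₀)
    (y₁ : Fin ((b + 1) * n) → Y₁) : r.Msg₁ n :=
  uniqueOr (fun w =>
    ∃ w₂₁, Typical (P.joint ch) (fun s => (s.t₁₀, s.u₁₀, s.u₁₁, s.x₁, s.u₂₁, s.y₁)) ε
        (fun k => (bk.t₁₀ j.castSucc w' k, bk.u₁₀ j.castSucc w' w.1 k, bk.u₁₁ j.castSucc w.2.1 k,
          bk.x₁ j.castSucc w' w.1 w.2.1 w.2.2 k, bk.u₂₁ j.castSucc w₂₁ k,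
          blockOf y₁ j.castSucc k)) ∧
      Typical (P.joint ch) (fun s => (s.t₁₀, s.y₁)) ε
        (fun k => (bk.t₁₀ j.succ w.1 k, blockOf y₁ j.succ k))) (0, 0, 0)

/-- The first receiver's estimate of the forwarded message that precedes block `j`. -/
noncomputable def recvEst₁ (ε : ℝ) (y₁ : Fin ((b + 1) * n) → Y₁) : ℕ → Msg n r.r₁₀
  | 0 => 0
  | j + 1 => if h : j < b then (bk.recvDec₁ ch ε ⟨j, h⟩ (recvEst₁ ε y₁ j) y₁).1 else 0

/-- Decoding at the second receiver from block `j`: the unique pair `(w₂₁, w₂₂)` for which, for some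
`(w₁₁, v₂₂)`, `(u₁₁(w₁₁), u₂₁(w₂₁), u₂₂(w₂₂, v₂₂ | w₂₁), y₂)` is jointly typical. -/
noncomputable def recvDec₂ (ε : ℝ) (j : Fin b) (y₂ : Fin ((b + 1) * n) → Y₂) : r.Msg₂ n :=
  uniqueOr (fun w =>
    ∃ w₁₁ v, Typical (P.joint ch) (fun s => (s.u₁₁, s.u₂₁, s.u₂₂, s.y₂)) ε
      (fun k => (bk.u₁₁ j.castSucc w₁₁ k, bk.u₂₁ j.castSucc w.1 k,
        bk.u₂₂ j.castSucc w.1 w.2 v k, blockOf y₂ j.castSucc k))) (0, 0)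

/-- The code of block length `(b + 1) n` that is defined by the codebooks, with typicality parameter
`ε'` for binning and `ε` for decoding. -/
noncomputable def code (ε' ε : ℝ) :
    CRCCode X₁ X₂ Y₁ Y₂ Y ((b + 1) * n) (Fin b → r.Msg₁ n) (Fin b → r.Msg₂ n) where
  enc₁ w k :=
    let i := k.divNat
    let w' := prevMsg (fun j => (w j).1) 0 i
    let m := blockMsg w (0, 0, 0) i
    bk.x₁ i w' m.1 m.2.1 m.2.2 k.modNat
  enc₂ w k y :=
    let i := k.divNat
    let w' := bk.relayEst ch ε y i
    let m := blockMsg w (0, 0) i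
    bk.x₂ i w' m.1 m.2 (bk.bin ch ε' i w' m) k.modNat
  dec₁ y₁ j := bk.recvDec₁ ch ε j (bk.recvEst₁ ch ε y₁ j) y₁
  dec₂ y₂ j := bk.recvDec₂ ch ε j y₂

end

end HKPDFBook

set_option synthInstance.maxSize 1000 in
set_option synthInstance.maxHeartbeats 200000 in
/-- The average error probability of the random codebooks of the scheme. -/
noncomputable def HKPDFDist.ensembleError {X₁ X₂ Y₁ Y₂ Y : Type*} [Fintype X₁] [Fintype X₂]
    [Fintype Y₁] [Fintype Y₂] [Fintype Y] (P : HKPDFDist X₁ X₂) (ch : CRC X₁ X₂ Y₁ Y₂ Y)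
    (ε' ε : ℝ) (r : HKPDFRates) (b n : ℕ) : ℝ :=
  ∑ t₁₀, ∑ u₁₀, ∑ u₁₁, ∑ x₁, ∑ u₂₁, ∑ u₂₂, ∑ x₂,
    let bk : HKPDFBook P r n b := ⟨t₁₀, u₁₀, u₁₁, x₁, u₂₁, u₂₂, x₂⟩
    bk.weight * (bk.code ch ε' ε).errorProb ch

/-- The rate pairs that the Han-Kobayashi PDF-binning scheme achieves (without time sharing): for some distribution and every
`δ > 0` there are rates of the message parts with `R₁ - δ ≤ R₁₀ + R₁₁ + R₁₂` and `R₂ - δ ≤ R₂₁ + R₂₂`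
such that, whatever the number of blocks, the average error probability of the scheme tends to zero
as the length `n` of the blocks tends to infinity. (The factor `b / (b + 1)` by which the rates over all
blocks fall short of those per block tends to one as `b → ∞`.) -/
def CRC.hkpdfAchieved {X₁ X₂ Y₁ Y₂ Y : Type*} [Fintype X₁] [Fintype X₂] [Fintype Y₁] [Fintype Y₂]
    [Fintype Y] (ch : CRC X₁ X₂ Y₁ Y₂ Y) : Set (ℝ × ℝ) :=
  {R | ∃ P : HKPDFDist X₁ X₂, ∀ δ : ℝ, 0 < δ → ∃ (r : HKPDFRates) (ε' ε : ℝ),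
    0 ≤ r.r₁₀ ∧ 0 ≤ r.r₁₁ ∧ 0 ≤ r.r₁₂ ∧ 0 ≤ r.r₂₁ ∧ 0 ≤ r.r₂₂ ∧ 0 ≤ r.r₂₂' ∧ 0 < ε' ∧ 0 < ε ∧
    R.1 - δ ≤ r.r₁₀ + r.r₁₁ + r.r₁₂ ∧ R.2 - δ ≤ r.r₂₁ + r.r₂₂ ∧
    ∀ b : ℕ, Tendsto (fun n : ℕ => P.ensembleError ch ε' ε r b n) atTop (𝓝 0)}

/-! The PDF-binning region. -/

/-- The factors `p(t₁₀) p(u₁₀|t₁₀) p(x₁|t₁₀,u₁₀) p(u₂|t₁₀) p(x₂|t₁₀,u₂)` of an input distribution. -/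
structure PDFDist (X₁ X₂ : Type*) [Fintype X₁] [Fintype X₂] where
  (kT₁₀ kU₁₀ kU₂ : ℕ)
  pT₁₀ : Fin kT₁₀ → ℝ
  pU₁₀ : Fin kT₁₀ → Fin kU₁₀ → ℝ
  pX₁ : Fin kT₁₀ → Fin kU₁₀ → X₁ → ℝ
  pU₂ : Fin kT₁₀ → Fin kU₂ → ℝ
  pX₂ : Fin kT₁₀ → Fin kU₂ → X₂ → ℝ
  pT₁₀_mem : pT₁₀ ∈ stdSimplex ℝ (Fin kT₁₀)
  pU₁₀_mem : ∀ t, pU₁₀ t ∈ stdSimplex ℝ (Fin kU₁₀)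
  pX₁_mem : ∀ t u, pX₁ t u ∈ stdSimplex ℝ X₁
  pU₂_mem : ∀ t, pU₂ t ∈ stdSimplex ℝ (Fin kU₂)
  pX₂_mem : ∀ t u, pX₂ t u ∈ stdSimplex ℝ X₂

namespace PDFDist

section

variable {X₁ X₂ Y₁ Y₂ Y : Type*} [Fintype X₁] [Fintype X₂] [Fintype Y₁] [Fintype Y₂] [Fintype Y]

/-- The joint distribution `P₁` of `(T₁₀, U₁₀, X₁, U₂, X₂, Y₁, Y₂, Y)`. -/
def joint (P : PDFDist X₁ X₂) (ch : CRC X₁ X₂ Y₁ Y₂ Y) :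
    Fin P.kT₁₀ × Fin P.kU₁₀ × X₁ × Fin P.kU₂ × X₂ × Y₁ × Y₂ × Y → ℝ :=
  fun (t, u, x₁, u₂, x₂, y) =>
    P.pT₁₀ t * P.pU₁₀ t u * P.pX₁ t u x₁ * P.pU₂ t u₂ * P.pX₂ t u₂ x₂ * ch.trans x₁ x₂ y

/-- The set of nonnegative rate pairs with
`R₁ ≤ I(U₁₀; Y | T₁₀) + I(X₁; Y₁ | U₁₀, T₁₀)`, `R₁ ≤ I(T₁₀, U₁₀, X₁; Y₁)` and
`R₂ ≤ I(U₂; Y₂) - I(U₂; T₁₀)`. -/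
def region (P : PDFDist X₁ X₂) (ch : CRC X₁ X₂ Y₁ Y₂ Y) : Set (ℝ × ℝ) :=
  {R | 0 ≤ R.1 ∧ 0 ≤ R.2 ∧
    R.1 ≤ condMI (P.joint ch) (fun (_, u₁₀, _, _, _, _, _, _) => u₁₀)
          (fun (_, _, _, _, _, _, _, y) => y) (fun (t₁₀, _, _, _, _, _, _, _) => t₁₀) +
        condMI (P.joint ch) (fun (_, _, x₁, _, _, _, _, _) => x₁)
          (fun (_, _, _, _, _, y₁, _, _) => y₁) (fun (t₁₀, u₁₀, _, _, _, _, _, _) => (u₁₀, t₁₀)) ∧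
    R.1 ≤ mutualInfo (P.joint ch) (fun (t₁₀, u₁₀, x₁, _, _, _, _, _) => (t₁₀, u₁₀, x₁))
          (fun (_, _, _, _, _, y₁, _, _) => y₁) ∧
    R.2 ≤ mutualInfo (P.joint ch) (fun (_, _, _, u₂, _, _, _, _) => u₂)
          (fun (_, _, _, _, _, _, y₂, _) => y₂) -
        mutualInfo (P.joint ch) (fun (_, _, _, u₂, _, _, _, _) => u₂)
          (fun (t₁₀, _, _, _, _, _, _, _) => t₁₀)}

end

end PDFDist

/-- The union of the PDF-binning regions over all distributions `P₁`. -/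
def CRC.pdfRegion {X₁ X₂ Y₁ Y₂ Y : Type*} [Fintype X₁] [Fintype X₂] [Fintype Y₁] [Fintype Y₂]
    [Fintype Y] (ch : CRC X₁ X₂ Y₁ Y₂ Y) : Set (ℝ × ℝ) :=
  ⋃ P : PDFDist X₁ X₂, P.region ch

/-! The Han-Kobayashi region of the interference channel `p(y₁, y₂ | x₁, x₂)`. -/

/-- The factors `p(u₁) p(x₁|u₁) p(u₂) p(x₂|u₂)` of an input distribution; `U₁` and `U₂` carry the public
messages. -/
structure HKDist (X₁ X₂ : Type*) [Fintype X₁] [Fintype X₂] where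
  (kU₁ kU₂ : ℕ)
  pU₁ : Fin kU₁ → ℝ
  pX₁ : Fin kU₁ → X₁ → ℝ
  pU₂ : Fin kU₂ → ℝ
  pX₂ : Fin kU₂ → X₂ → ℝ
  pU₁_mem : pU₁ ∈ stdSimplex ℝ (Fin kU₁)
  pX₁_mem : ∀ u, pX₁ u ∈ stdSimplex ℝ X₁
  pU₂_mem : pU₂ ∈ stdSimplex ℝ (Fin kU₂)
  pX₂_mem : ∀ u, pX₂ u ∈ stdSimplex ℝ X₂

namespace HKDist

section

variable {X₁ X₂ Y₁ Y₂ Y : Type*} [Fintype X₁] [Fintype X₂] [Fintype Y₁] [Fintype Y₂] [Fintype Y]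

/-- The joint distribution of `(U₁, X₁, U₂, X₂, Y₁, Y₂)`. -/
def joint (P : HKDist X₁ X₂) (ch : CRC X₁ X₂ Y₁ Y₂ Y) :
    Fin P.kU₁ × X₁ × Fin P.kU₂ × X₂ × Y₁ × Y₂ → ℝ :=
  fun (u₁, x₁, u₂, x₂, y₁, y₂) =>
    P.pU₁ u₁ * P.pX₁ u₁ x₁ * P.pU₂ u₂ * P.pX₂ u₂ x₂ * ∑ y, ch.trans x₁ x₂ (y₁, y₂, y)

/-- The set of nonnegative rate pairs that satisfy the Han-Kobayashi inequalities. -/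
def region (P : HKDist X₁ X₂) (ch : CRC X₁ X₂ Y₁ Y₂ Y) : Set (ℝ × ℝ) :=
  let p := P.joint ch
  let U₁ := fun ((u₁, _, _, _, _, _) : Fin P.kU₁ × X₁ × Fin P.kU₂ × X₂ × Y₁ × Y₂) => u₁
  let X₁' := fun ((_, x₁, _, _, _, _) : Fin P.kU₁ × X₁ × Fin P.kU₂ × X₂ × Y₁ × Y₂) => x₁
  let U₂ := fun ((_, _, u₂, _, _, _) : Fin P.kU₁ × X₁ × Fin P.kU₂ × X₂ × Y₁ × Y₂) => u₂
  let X₂' := fun ((_, _, _, x₂, _, _) : Fin P.kU₁ × X₁ × Fin P.kU₂ × X₂ × Y₁ × Y₂) => x₂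
  let Y₁' := fun ((_, _, _, _, y₁, _) : Fin P.kU₁ × X₁ × Fin P.kU₂ × X₂ × Y₁ × Y₂) => y₁
  let Y₂' := fun ((_, _, _, _, _, y₂) : Fin P.kU₁ × X₁ × Fin P.kU₂ × X₂ × Y₁ × Y₂) => y₂
  -- private message, private and own public, private and other public, all: receivers 1 and 2
  let a₁ := condMI p X₁' Y₁' (fun s => (U₁ s, U₂ s))
  let d₁ := condMI p X₁' Y₁' U₂
  let e₁ := condMI p (fun s => (X₁' s, U₂ s)) Y₁' U₁
  let g₁ := mutualInfo p (fun s => (X₁' s, U₂ s)) Y₁'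
  let a₂ := condMI p X₂' Y₂' (fun s => (U₁ s, U₂ s))
  let d₂ := condMI p X₂' Y₂' U₁
  let e₂ := condMI p (fun s => (X₂' s, U₁ s)) Y₂' U₂
  let g₂ := mutualInfo p (fun s => (X₂' s, U₁ s)) Y₂'
  {R | 0 ≤ R.1 ∧ 0 ≤ R.2 ∧ R.1 ≤ d₁ ∧ R.2 ≤ d₂ ∧
    R.1 + R.2 ≤ a₁ + g₂ ∧ R.1 + R.2 ≤ a₂ + g₁ ∧ R.1 + R.2 ≤ e₁ + e₂ ∧
    2 * R.1 + R.2 ≤ a₁ + g₁ + e₂ ∧ R.1 + 2 * R.2 ≤ a₂ + g₂ + e₁}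

end

end HKDist

/-- The union of the Han-Kobayashi regions over all input distributions. -/
def CRC.hkRegion {X₁ X₂ Y₁ Y₂ Y : Type*} [Fintype X₁] [Fintype X₂] [Fintype Y₁] [Fintype Y₂]
    [Fintype Y] (ch : CRC X₁ X₂ Y₁ Y₂ Y) : Set (ℝ × ℝ) :=
  ⋃ P : HKDist X₁ X₂, P.region ch

set_option linter.unusedSectionVars false
set_option linter.unusedSimpArgs false
set_option synthInstance.maxSize 1000
set_option synthInstance.maxHeartbeats 200000

/-! ### Finite expectations, probabilities and entropies -/

/-! Part 1 is random coding for the rates of the message parts, followed by their elimination. With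
a bin rate just above I₁ the scheme needs the system `RatesFit`: R₁₀ ≤ I₂ at the second sender, one
bound among I₃, …, I₁₀ for each pattern of wrong indices at T₁, and one among I₁₁, …, I₁₄, less I₁,
for each pattern at T₂. Eliminating the part rates yields the seven inequalities of the region
together with three further ones and the requirement I₁ ≤ I₁₁. These extras do not shrink the union
over all distributions. Whenever one of them fails, some auxiliary variable is harmful, and the pair
fits a distribution in which U₂₂ is dropped, U₁₁ is dropped, or U₂₁ is merged into U₂₂
(`HKPDFDist.exists_ratesFit`).

For the error probability, the true code is compared with an idealized one in which the second
sender knows w₁₀'. On the event `HKPDFBook.Good`, where the sent codewords are typical with the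
outputs and no wrong ones are, all estimates are right and both output laws agree. Both laws have
total mass one, so the error probability is at most the idealized probability that `Good` fails
(`sum_error_le`). A union bound remains. The sent codewords are typical by covering for the bins
(`expect_no_typical_le`) and conditional typicality (`expect_not_typical_le`). Wrong codewords are
independent of the output given the sent ones (`expect_layers`), so packing (`expect_typical_le`)
applies to each pattern. If w₁₀ is wrong, the test in the next block involves an independent
codebook, and its exponent I(T₁₀;Y₁) is added; this is the extra term in I₄, I₆, I₈ and the
chain-rule part of I₁₀. Wrong tuples are counted with factors M − 1, which vanish at rate zero, so a
part without messages imposes no constraint and the degenerate boundary cases are covered.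

Part 2 follows by time sharing. The set `CRC.approachable` of pairs that are reached up to any loss
δ contains what the scheme achieves and is convex, because codes can be used one after the other.
Its nonnegative pairs are limits of achievable ones.

Parts 3 and 4 are specializations. Constant U₁₁ and U₂₁ give PDF-binning; constant T₁₀ and U₁₀ with
U₂₂ = X₂ give the Han–Kobayashi region. -/

open Classical in
/-- The indicator of a proposition. -/
noncomputable def ind (E : Prop) : ℝ := if E then 1 else 0

lemma ind_true {E : Prop} (h : E) : ind E = 1 := by simp [ind, h]

lemma ind_false {E : Prop} (h : ¬E) : ind E = 0 := by simp [ind, h]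

lemma ind_nonneg (E : Prop) : 0 ≤ ind E := by unfold ind; split_ifs <;> norm_num

lemma ind_le_one (E : Prop) : ind E ≤ 1 := by unfold ind; split_ifs <;> norm_num

lemma ind_mono {E F : Prop} (h : E → F) : ind E ≤ ind F := by
  by_cases hE : E
  · rw [ind_true hE, ind_true (h hE)]
  · rw [ind_false hE]; exact ind_nonneg F

lemma ind_or_le (E F : Prop) : ind (E ∨ F) ≤ ind E + ind F := by
  by_cases hE : E
  · rw [ind_true hE, ind_true (Or.inl hE)]; linarith [ind_nonneg F]
  · by_cases hF : F
    · rw [ind_true hF, ind_true (Or.inr hF)]; linarith [ind_nonneg E]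
    · rw [ind_false (by tauto)]; linarith [ind_nonneg E, ind_nonneg F]

lemma ind_exists_le {ι : Type*} [Fintype ι] (E : ι → Prop) : ind (∃ i, E i) ≤ ∑ i, ind (E i) := by
  by_cases h : ∃ i, E i
  · rw [ind_true h]
    obtain ⟨i, hi⟩ := h
    rw [← ind_true hi]
    exact Finset.single_le_sum (f := fun i => ind (E i)) (fun i _ => ind_nonneg _) (Finset.mem_univ i)
  · rw [ind_false h]
    exact Finset.sum_nonneg fun i _ => ind_nonneg _

lemma ind_and (E F : Prop) : ind (E ∧ F) = ind E * ind F := by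
  by_cases hE : E <;> by_cases hF : F <;> simp [ind, hE, hF]

lemma ind_not (E : Prop) : ind (¬E) = 1 - ind E := by
  by_cases hE : E <;> simp [ind, hE]

/-- The expectation of `f` under the mass function `q`. -/
noncomputable def expect {A : Type*} [Fintype A] (q f : A → ℝ) : ℝ := ∑ a, q a * f a

section expect

variable {A B C : Type*} [Fintype A] [Fintype B] [Fintype C]

lemma expect_congr {q f g : A → ℝ} (h : ∀ a, f a = g a) : expect q f = expect q g := by
  simp [expect, h]

lemma expect_comm (q : A → ℝ) (q' : B → ℝ) (f : A → B → ℝ) :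
    expect q (fun a => expect q' (fun b => f a b)) =
      expect q' (fun b => expect q (fun a => f a b)) := by
  simp only [expect, Finset.mul_sum]
  rw [Finset.sum_comm]
  exact Finset.sum_congr rfl fun _ _ => Finset.sum_congr rfl fun _ _ => by ring

lemma expect_mono {q f g : A → ℝ} (hq : ∀ a, 0 ≤ q a) (h : ∀ a, f a ≤ g a) :
    expect q f ≤ expect q g :=
  Finset.sum_le_sum fun a _ => mul_le_mul_of_nonneg_left (h a) (hq a)

lemma expect_nonneg {q f : A → ℝ} (hq : ∀ a, 0 ≤ q a) (h : ∀ a, 0 ≤ f a) : 0 ≤ expect q f :=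
  Finset.sum_nonneg fun a _ => mul_nonneg (hq a) (h a)

lemma expect_add (q f g : A → ℝ) :
    expect q (fun a => f a + g a) = expect q f + expect q g := by
  simp [expect, mul_add, Finset.sum_add_distrib]

lemma expect_sum {ι : Type*} (s : Finset ι) (q : A → ℝ) (f : ι → A → ℝ) :
    expect q (fun a => ∑ i ∈ s, f i a) = ∑ i ∈ s, expect q (f i) := by
  simp only [expect, Finset.mul_sum]
  exact Finset.sum_comm

lemma expect_mul_left (q : A → ℝ) (c : ℝ) (f : A → ℝ) :
    expect q (fun a => c * f a) = c * expect q f := by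
  simp only [expect, Finset.mul_sum]
  exact Finset.sum_congr rfl fun _ _ => by ring

lemma expect_const {q : A → ℝ} (hq : ∑ a, q a = 1) (c : ℝ) : expect q (fun _ => c) = c := by
  simp [expect, ← Finset.sum_mul, hq]

lemma expect_le {q f : A → ℝ} (hq : q ∈ stdSimplex ℝ A) {c : ℝ} (h : ∀ a, f a ≤ c) :
    expect q f ≤ c :=
  (expect_mono hq.1 h).trans_eq (expect_const hq.2 c)

/-- A product of two kernels merges two expectations. -/
lemma expect_expect (q : A → ℝ) (q' : A → B → ℝ) (f : A → B → ℝ) :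
    expect q (fun a => expect (q' a) (f a)) =
      expect (fun z : A × B => q z.1 * q' z.1 z.2) (fun z => f z.1 z.2) := by
  simp only [expect, Finset.mul_sum, Fintype.sum_prod_type, mul_assoc]

lemma prob_eq_expect (p : A → ℝ) (E : A → Prop) : prob p E = expect p (fun a => ind (E a)) := by
  simp [prob, expect, ind]

end expect

/-! ### Probabilities and laws of random variables. -/

section prob

variable {Ω α β γ : Type*} [Fintype Ω] {p : Ω → ℝ}

lemma prob_nonneg (hp : ∀ ω, 0 ≤ p ω) (E : Ω → Prop) : 0 ≤ prob p E :=
  Finset.sum_nonneg fun ω _ => by split_ifs <;> simp [hp]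

lemma prob_mono (hp : ∀ ω, 0 ≤ p ω) {E F : Ω → Prop} (h : ∀ ω, E ω → F ω) :
    prob p E ≤ prob p F := by
  rw [prob_eq_expect, prob_eq_expect]
  exact expect_mono hp fun ω => ind_mono (h ω)

lemma prob_congr {E F : Ω → Prop} (h : ∀ ω, E ω ↔ F ω) : prob p E = prob p F := by
  rw [funext fun ω => propext (h ω)]

lemma prob_true (hp : p ∈ stdSimplex ℝ Ω) {E : Ω → Prop} (h : ∀ ω, E ω) : prob p E = 1 := by
  simp [prob, h, hp.2]

lemma le_prob (hp : ∀ ω, 0 ≤ p ω) {E : Ω → Prop} {ω : Ω} (h : E ω) : p ω ≤ prob p E := by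
  rw [prob_eq_expect]
  have := Finset.single_le_sum (f := fun ω => p ω * ind (E ω))
    (fun i _ => mul_nonneg (hp i) (ind_nonneg _)) (Finset.mem_univ ω)
  rwa [ind_true h, mul_one] at this

lemma expect_comp [Fintype α] (p : Ω → ℝ) (A : Ω → α) (g : α → ℝ) :
    expect p (fun ω => g (A ω)) = expect (fun a => prob p (fun ω => A ω = a)) g := by
  classical
  simp only [expect, prob, Finset.sum_mul]
  rw [Finset.sum_comm]
  refine Finset.sum_congr rfl fun ω _ => ?_
  rw [Finset.sum_eq_single (A ω)] <;> aesop

lemma sum_prob_and [Fintype α] (p : Ω → ℝ) (A : Ω → α) (E : Ω → Prop) :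
    ∑ a, prob p (fun ω => A ω = a ∧ E ω) = prob p E := by
  classical
  simp only [prob]
  rw [Finset.sum_comm]
  refine Finset.sum_congr rfl fun ω _ => ?_
  rw [Finset.sum_eq_single (A ω)] <;> aesop

lemma law_mem [Fintype α] (hp : p ∈ stdSimplex ℝ Ω) (A : Ω → α) :
    (fun a => prob p (fun ω => A ω = a)) ∈ stdSimplex ℝ α := by
  refine ⟨fun a => prob_nonneg hp.1 _, ?_⟩
  have := sum_prob_and p A (fun _ => True)
  simp only [and_true] at this
  rw [this, prob_true hp fun _ => trivial]

end prob

/-! ### Entropies of partitions and the basic Shannon inequalities. -/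

/-- The entropy in bits of the partition of the sample space by the equivalence relation `r`. -/
noncomputable def relEntropy {Ω : Type*} [Fintype Ω] (p : Ω → ℝ) (r : Ω → Ω → Prop) : ℝ :=
  -∑ ω, p ω * Real.logb 2 (prob p (fun η => r η ω))

section entropy

variable {Ω α β γ : Type*} [Fintype Ω] {p : Ω → ℝ}

/-- Indexing entropies by equivalence relations instead of random variables makes the bracketing and
order of tuples irrelevant: a tuple becomes a conjunction of equalities. Identities and inequalities
between information quantities thus become linear arithmetic in entropies. -/
lemma condMI_eq_relEntropy (hp : ∀ ω, 0 ≤ p ω) (A : Ω → α) (B : Ω → β) (C : Ω → γ) :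
    condMI p A B C = relEntropy p (fun η ω => A η = A ω ∧ C η = C ω) +
      relEntropy p (fun η ω => B η = B ω ∧ C η = C ω) -
      relEntropy p (fun η ω => A η = A ω ∧ B η = B ω ∧ C η = C ω) -
      relEntropy p (fun η ω => C η = C ω) := by
  simp only [condMI, relEntropy]
  rw [← sub_eq_zero]
  simp only [← Finset.sum_neg_distrib, ← Finset.sum_add_distrib, ← Finset.sum_sub_distrib]
  refine Finset.sum_eq_zero fun ω _ => ?_
  rcases (hp ω).eq_or_lt with h | h
  · simp [← h]
  have key : ∀ E : Ω → Prop, E ω → prob p E ≠ 0 := fun E hE => (h.trans_le (le_prob hp hE)).ne'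
  have h1 := key (fun η => A η = A ω ∧ B η = B ω ∧ C η = C ω) ⟨rfl, rfl, rfl⟩
  have h2 := key (fun η => C η = C ω) rfl
  have h3 := key (fun η => A η = A ω ∧ C η = C ω) ⟨rfl, rfl⟩
  have h4 := key (fun η => B η = B ω ∧ C η = C ω) ⟨rfl, rfl⟩
  rw [Real.logb_div (mul_ne_zero h1 h2) (mul_ne_zero h3 h4), Real.logb_mul h1 h2,
    Real.logb_mul h3 h4]
  ring

lemma mutualInfo_eq_relEntropy (hp : p ∈ stdSimplex ℝ Ω) (A : Ω → α) (B : Ω → β) :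
    mutualInfo p A B = relEntropy p (fun η ω => A η = A ω) + relEntropy p (fun η ω => B η = B ω) -
      relEntropy p (fun η ω => A η = A ω ∧ B η = B ω) := by
  have h : relEntropy p (fun _ _ => True) = 0 := by
    simp [relEntropy, prob_true hp]
  rw [mutualInfo, condMI_eq_relEntropy hp.1]
  simp [h]

/-- Gibbs' inequality: with x the argument of the logarithm, ln x ≥ 1 − 1/x, and the expectation of
1/x, which is `g`, is at most one. -/
lemma condMI_nonneg [Fintype α] [Fintype β] [Fintype γ] (hp : p ∈ stdSimplex ℝ Ω)
    (A : Ω → α) (B : Ω → β) (C : Ω → γ) : 0 ≤ condMI p A B C := by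
  classical
  set P3 : α × β × γ → ℝ := fun w => prob p (fun η => A η = w.1 ∧ B η = w.2.1 ∧ C η = w.2.2) with hP3
  set PAC : α → γ → ℝ := fun a c => prob p (fun η => A η = a ∧ C η = c) with hPAC
  set PBC : β → γ → ℝ := fun b c => prob p (fun η => B η = b ∧ C η = c) with hPBC
  set PC : γ → ℝ := fun c => prob p (fun η => C η = c) with hPC
  set g : α × β × γ → ℝ := fun w =>
    (PAC w.1 w.2.2 * PBC w.2.1 w.2.2) / (P3 w * PC w.2.2) with hg
  have hlaw : ∀ w : α × β × γ, prob p (fun ω => (A ω, B ω, C ω) = w) = P3 w := by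
    intro w
    exact prob_congr fun ω => by simp [Prod.ext_iff]
  have hle : ∑ ω, p ω * g (A ω, B ω, C ω) ≤ 1 := by
    have := expect_comp p (fun ω => (A ω, B ω, C ω)) g
    simp only [expect, hlaw] at this
    rw [this]
    -- Only an inequality: triples of probability zero contribute nothing on the left, while the
    -- product of their marginals may be positive.
    have hc : ∀ c, ∑ a, ∑ b, P3 (a, b, c) * g (a, b, c) ≤ PC c := by
      intro c
      have hPA : ∑ a, PAC a c = PC c := sum_prob_and p A (fun ω => C ω = c)
      have hPB : ∑ b, PBC b c = PC c := sum_prob_and p B (fun ω => C ω = c)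
      have h0 : 0 ≤ PC c := prob_nonneg hp.1 _
      calc ∑ a, ∑ b, P3 (a, b, c) * g (a, b, c)
          ≤ ∑ a, ∑ b, PAC a c * PBC b c / PC c := by
            refine Finset.sum_le_sum fun a _ => Finset.sum_le_sum fun b _ => ?_
            have hn : 0 ≤ PAC a c * PBC b c / PC c :=
              div_nonneg (mul_nonneg (prob_nonneg hp.1 _) (prob_nonneg hp.1 _)) h0
            by_cases h3 : P3 (a, b, c) = 0
            · rw [h3, zero_mul]; exact hn
            · simp only [hg]
              rw [← mul_div_assoc, mul_div_mul_left _ _ h3]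
        _ = PC c := by
            simp only [mul_div_assoc, ← Finset.mul_sum, ← Finset.sum_div, hPB, ← Finset.sum_mul, hPA]
            by_cases h : PC c = 0
            · simp [h]
            · field_simp
    calc ∑ w, P3 w * g w = ∑ c, ∑ a, ∑ b, P3 (a, b, c) * g (a, b, c) := by
          simp only [Fintype.sum_prod_type]
          rw [Finset.sum_comm' (t' := Finset.univ) (s' := fun _ => Finset.univ) (by simp)]
          refine Eq.trans ?_ Finset.sum_comm
          rw [Finset.sum_comm]
          exact Finset.sum_congr rfl fun a _ => Finset.sum_comm
      _ ≤ ∑ c, PC c := Finset.sum_le_sum fun c _ => hc c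
      _ = 1 := (law_mem hp C).2
  have hlog : ∀ ω, p ω * (1 - g (A ω, B ω, C ω)) / Real.log 2 ≤ p ω * Real.logb 2
      ((P3 (A ω, B ω, C ω) * PC (C ω)) / (PAC (A ω) (C ω) * PBC (B ω) (C ω))) := by
    intro ω
    rcases (hp.1 ω).eq_or_lt with h | h
    · simp [← h]
    have key : ∀ E : Ω → Prop, E ω → 0 < prob p E := fun E hE => h.trans_le (le_prob hp.1 hE)
    have h1 : 0 < P3 (A ω, B ω, C ω) := key _ ⟨rfl, rfl, rfl⟩
    have h2 : 0 < PC (C ω) := key _ rfl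
    have h3 : 0 < PAC (A ω) (C ω) := key _ ⟨rfl, rfl⟩
    have h4 : 0 < PBC (B ω) (C ω) := key _ ⟨rfl, rfl⟩
    have hx := Real.one_sub_inv_le_log_of_pos (div_pos (mul_pos h1 h2) (mul_pos h3 h4))
    rw [inv_div] at hx
    rw [Real.logb, mul_div_assoc]
    exact mul_le_mul_of_nonneg_left
      (div_le_div_of_nonneg_right hx (Real.log_pos one_lt_two).le) h.le
  have : ∑ ω, p ω * (1 - g (A ω, B ω, C ω)) / Real.log 2 ≤ condMI p A B C :=
    Finset.sum_le_sum fun ω _ => hlog ω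
  refine le_trans ?_ this
  rw [← Finset.sum_div]
  refine div_nonneg ?_ (Real.log_pos one_lt_two).le
  simp only [mul_sub, mul_one, Finset.sum_sub_distrib, hp.2]
  linarith

/-- Conditional independence makes the conditional mutual information vanish. -/
lemma condMI_eq_zero (hp : ∀ ω, 0 ≤ p ω) {A : Ω → α} {B : Ω → β} {C : Ω → γ}
    (h : ∀ a b c, prob p (fun η => A η = a ∧ B η = b ∧ C η = c) * prob p (fun η => C η = c) =
      prob p (fun η => A η = a ∧ C η = c) * prob p (fun η => B η = b ∧ C η = c)) :
    condMI p A B C = 0 := by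
  refine Finset.sum_eq_zero fun ω _ => ?_
  rcases (hp ω).eq_or_lt with h0 | h0
  · simp [← h0]
  have key : ∀ E : Ω → Prop, E ω → 0 < prob p E := fun E hE => h0.trans_le (le_prob hp hE)
  rw [h, div_self (mul_pos (key _ ⟨rfl, rfl⟩) (key _ ⟨rfl, rfl⟩)).ne']
  simp

/-- A product form of the joint law makes the conditional mutual information vanish. -/
lemma condMI_eq_zero_of_factor [Fintype α] [Fintype β] (hp : ∀ ω, 0 ≤ p ω)
    {A : Ω → α} {B : Ω → β} {C : Ω → γ} (f : α → γ → ℝ) (g : β → γ → ℝ)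
    (h : ∀ a b c, prob p (fun η => A η = a ∧ B η = b ∧ C η = c) = f a c * g b c) :
    condMI p A B C = 0 := by
  refine condMI_eq_zero hp fun a b c => ?_
  -- Summing the factorization over a, b or both gives all marginals, and then the criterion of
  -- `condMI_eq_zero` is an identity of products.
  have hB : ∀ b, prob p (fun η => B η = b ∧ C η = c) = (∑ a, f a c) * g b c := fun b => by
    rw [← sum_prob_and p A, Finset.sum_mul]
    exact Finset.sum_congr rfl fun a _ => h a b c
  have hA : prob p (fun η => A η = a ∧ C η = c) = f a c * ∑ b, g b c := by
    rw [← sum_prob_and p B, Finset.mul_sum]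
    exact Finset.sum_congr rfl fun b _ => by rw [← h]; exact prob_congr fun _ => by tauto
  have hC : prob p (fun η => C η = c) = (∑ a, f a c) * ∑ b, g b c := by
    rw [← sum_prob_and p B, Finset.mul_sum]
    exact Finset.sum_congr rfl fun b _ => hB b
  rw [h, hA, hB, hC]; ring

/-- Conditional mutual information only depends on the joint law. -/
lemma condMI_comp {Ω' : Type*} [Fintype Ω'] {p' : Ω' → ℝ} (f : Ω → Ω')
    (hf : ∀ ω', p' ω' = prob p (fun ω => f ω = ω')) (A : Ω' → α) (B : Ω' → β) (C : Ω' → γ) :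
    condMI p' A B C = condMI p (fun ω => A (f ω)) (fun ω => B (f ω)) (fun ω => C (f ω)) := by
  have hE : ∀ E : Ω' → Prop, prob p' E = prob p (fun ω => E (f ω)) := fun E => by
    rw [prob_eq_expect, prob_eq_expect, expect_comp p f (fun ω' => ind (E ω'))]
    simp [expect, hf]
  have := expect_comp p f (fun ω' => Real.logb 2
    ((prob p' (fun η => A η = A ω' ∧ B η = B ω' ∧ C η = C ω') * prob p' (fun η => C η = C ω')) /
      (prob p' (fun η => A η = A ω' ∧ C η = C ω') * prob p' (fun η => B η = B ω' ∧ C η = C ω'))))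
  simp only [expect, ← hf] at this
  rw [condMI, ← this]
  simp only [condMI, hE]

lemma mutualInfo_comp {Ω' : Type*} [Fintype Ω'] {p' : Ω' → ℝ} (f : Ω → Ω')
    (hf : ∀ ω', p' ω' = prob p (fun ω => f ω = ω')) (A : Ω' → α) (B : Ω' → β) :
    mutualInfo p' A B = mutualInfo p (fun ω => A (f ω)) (fun ω => B (f ω)) :=
  condMI_comp f hf A B _

end entropy

/-! ### The joint distribution of the scheme -/

section expect

variable {A : Type*} [Fintype A]

lemma expect_ind_mul (q f : A → ℝ) (a₀ : A) :
    expect q (fun a => ind (a = a₀) * f a) = q a₀ * f a₀ := by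
  classical
  rw [expect, Finset.sum_eq_single a₀]
  · simp [ind]
  · intro b _ hb; simp [ind, hb]
  · simp

lemma expect_ind (q : A → ℝ) (a₀ : A) : expect q (fun a => ind (a = a₀)) = q a₀ := by
  simpa using expect_ind_mul q (fun _ => 1) a₀

lemma prob_eq_single {Ω : Type*} [Fintype Ω] (p : Ω → ℝ) {E : Ω → Prop} {ω₀ : Ω}
    (h : ∀ ω, E ω ↔ ω = ω₀) : prob p E = p ω₀ := by
  rw [prob_congr h, prob_eq_expect, expect_ind]

end expect

namespace HKPDFDist

variable {X₁ X₂ Y₁ Y₂ Y : Type*} [Fintype X₁] [Fintype X₂] [Fintype Y₁] [Fintype Y₂] [Fintype Y]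
variable (P : HKPDFDist X₁ X₂) (ch : CRC X₁ X₂ Y₁ Y₂ Y)

/-- In this nested form an indicator of a value selects one factor and a kernel that is no longer
needed integrates to one; the marginal laws below are computed in this way. -/
lemma expect_joint (g : P.Sample Y₁ Y₂ Y → ℝ) : expect (P.joint ch) g =
    expect P.pT₁₀ fun t => expect (P.pU₁₀ t) fun u₁₀ => expect P.pU₁₁ fun u₁₁ =>
    expect (P.pX₁ t u₁₀ u₁₁) fun x₁ => expect P.pU₂₁ fun u₂₁ => expect (P.pU₂₂ u₂₁ t) fun u₂₂ =>
    expect (P.pX₂ t u₂₁ u₂₂) fun x₂ => expect (ch.trans x₁ x₂) fun y =>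
      g ⟨t, u₁₀, u₁₁, x₁, u₂₁, u₂₂, x₂, y.1, y.2.1, y.2.2⟩ := by
  let e : P.Sample Y₁ Y₂ Y ≃ Fin P.kT₁₀ × Fin P.kU₁₀ × Fin P.kU₁₁ × X₁ × Fin P.kU₂₁ ×
      Fin P.kU₂₂ × X₂ × Y₁ × Y₂ × Y :=
    { toFun := fun ⟨a, b, c, d, e, f, g, h, i, j⟩ => ⟨a, b, c, d, e, f, g, h, i, j⟩
      invFun := fun ⟨a, b, c, d, e, f, g, h, i, j⟩ => ⟨a, b, c, d, e, f, g, h, i, j⟩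
      left_inv := fun _ => rfl
      right_inv := fun _ => rfl }
  rw [expect, ← Equiv.sum_comp e.symm]
  simp only [expect, Fintype.sum_prod_type]
  refine Finset.sum_congr rfl fun t _ => ?_
  iterate 6 (rw [Finset.mul_sum]; refine Finset.sum_congr rfl fun _ _ => ?_; rw [← mul_assoc])
  simp only [Finset.mul_sum, ← mul_assoc]
  rfl

lemma expect_trans_const (x₁ : X₁) (x₂ : X₂) (c : ℝ) : expect (ch.trans x₁ x₂) (fun _ => c) = c :=
  expect_const (ch.trans_mem x₁ x₂).2 c

lemma expect_pT₁₀_const (c : ℝ) : expect P.pT₁₀ (fun _ => c) = c := expect_const P.pT₁₀_mem.2 c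

lemma expect_pU₁₀_const (t) (c : ℝ) : expect (P.pU₁₀ t) (fun _ => c) = c :=
  expect_const (P.pU₁₀_mem t).2 c

lemma expect_pU₁₁_const (c : ℝ) : expect P.pU₁₁ (fun _ => c) = c := expect_const P.pU₁₁_mem.2 c

lemma expect_pX₁_const (t u v) (c : ℝ) : expect (P.pX₁ t u v) (fun _ => c) = c :=
  expect_const (P.pX₁_mem t u v).2 c

lemma expect_pU₂₁_const (c : ℝ) : expect P.pU₂₁ (fun _ => c) = c := expect_const P.pU₂₁_mem.2 c

lemma expect_pU₂₂_const (t u) (c : ℝ) : expect (P.pU₂₂ t u) (fun _ => c) = c :=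
  expect_const (P.pU₂₂_mem t u).2 c

lemma expect_pX₂_const (t u v) (c : ℝ) : expect (P.pX₂ t u v) (fun _ => c) = c :=
  expect_const (P.pX₂_mem t u v).2 c

lemma joint_mem : P.joint ch ∈ stdSimplex ℝ (P.Sample Y₁ Y₂ Y) := by
  refine ⟨fun s => ?_, ?_⟩
  · have h1 := P.pT₁₀_mem.1 s.t₁₀
    have h2 := (P.pU₁₀_mem s.t₁₀).1 s.u₁₀
    have h3 := P.pU₁₁_mem.1 s.u₁₁
    have h4 := (P.pX₁_mem s.t₁₀ s.u₁₀ s.u₁₁).1 s.x₁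
    have h5 := P.pU₂₁_mem.1 s.u₂₁
    have h6 := (P.pU₂₂_mem s.u₂₁ s.t₁₀).1 s.u₂₂
    have h7 := (P.pX₂_mem s.t₁₀ s.u₂₁ s.u₂₂).1 s.x₂
    have h8 := (ch.trans_mem s.x₁ s.x₂).1 (s.y₁, s.y₂, s.y)
    unfold joint
    positivity
  · have := P.expect_joint ch (fun _ => 1)
    simp only [expect_trans_const, expect_pT₁₀_const, expect_pU₁₀_const, expect_pU₁₁_const,
      expect_pX₁_const, expect_pU₂₁_const, expect_pU₂₂_const, expect_pX₂_const] at this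
    simpa [expect] using this

lemma law_sender₁_public₂ (t u v x w) : prob (P.joint ch)
    (fun s => s.t₁₀ = t ∧ s.u₁₀ = u ∧ s.u₁₁ = v ∧ s.x₁ = x ∧ s.u₂₁ = w) =
    P.pT₁₀ t * P.pU₁₀ t u * P.pU₁₁ v * P.pX₁ t u v x * P.pU₂₁ w := by
  rw [prob_eq_expect, expect_joint]
  simp only [ind_and, expect_mul_left, expect_ind_mul, expect_ind, expect_trans_const,
    expect_pU₂₂_const, expect_pX₂_const]
  ring

lemma law_auxiliary (t u v w) : prob (P.joint ch)
    (fun s => s.t₁₀ = t ∧ s.u₁₀ = u ∧ s.u₁₁ = v ∧ s.u₂₁ = w) =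
    P.pT₁₀ t * P.pU₁₀ t u * P.pU₁₁ v * P.pU₂₁ w := by
  rw [prob_eq_expect, expect_joint]
  simp only [ind_and, expect_mul_left, expect_ind_mul, expect_ind, expect_trans_const,
    expect_pU₂₂_const, expect_pX₂_const, expect_pX₁_const]
  ring

lemma law_relay (t u) : prob (P.joint ch) (fun s => s.t₁₀ = t ∧ s.u₁₀ = u) =
    P.pT₁₀ t * P.pU₁₀ t u := by
  rw [prob_eq_expect, expect_joint]
  simp only [ind_and, expect_mul_left, expect_ind_mul, expect_ind, expect_trans_const,
    expect_pU₂₂_const, expect_pX₂_const, expect_pX₁_const, expect_pU₂₁_const, expect_pU₁₁_const]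

lemma law_t₁₀ (t) : prob (P.joint ch) (fun s => s.t₁₀ = t) = P.pT₁₀ t := by
  rw [prob_eq_expect, expect_joint]
  simp only [expect_ind, expect_trans_const, expect_pU₁₀_const,
    expect_pU₂₂_const, expect_pX₂_const, expect_pX₁_const, expect_pU₂₁_const, expect_pU₁₁_const]

lemma law_binning (t w z) : prob (P.joint ch) (fun s => s.t₁₀ = t ∧ s.u₂₁ = w ∧ s.u₂₂ = z) =
    P.pT₁₀ t * P.pU₂₁ w * P.pU₂₂ w t z := by
  rw [prob_eq_expect, expect_joint]
  simp only [ind_and, expect_mul_left, expect_ind_mul, expect_ind, expect_trans_const,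
    expect_pX₂_const, expect_pX₁_const, expect_pU₁₁_const, expect_pU₁₀_const]
  ring

/-- The conditional law `p(u₂₂|u₂₁)` from which the codewords `u₂₂` are drawn. -/
noncomputable def pU₂₂Marg (w : Fin P.kU₂₁) (z : Fin P.kU₂₂) : ℝ :=
  ∑ t, P.pT₁₀ t * P.pU₂₂ w t z

lemma pU₂₂Marg_mem (w) : P.pU₂₂Marg w ∈ stdSimplex ℝ (Fin P.kU₂₂) := by
  refine ⟨fun z => Finset.sum_nonneg fun t _ =>
    mul_nonneg (P.pT₁₀_mem.1 t) ((P.pU₂₂_mem w t).1 z), ?_⟩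
  simp only [pU₂₂Marg]
  rw [Finset.sum_comm]
  simp only [← Finset.mul_sum, (P.pU₂₂_mem _ _).2, mul_one, P.pT₁₀_mem.2]

/-- This is the law from which T₂'s codewords are drawn: averaging over T₁₀, which is independent of
U₂₁, turns p(u₂₂|u₂₁,t₁₀) into the codebook kernel. -/
lemma law_sender₂_public₁ (v w z) : prob (P.joint ch)
    (fun s => s.u₁₁ = v ∧ s.u₂₁ = w ∧ s.u₂₂ = z) = P.pU₁₁ v * P.pU₂₁ w * P.pU₂₂Marg w z := by
  rw [prob_eq_expect, expect_joint]
  simp only [ind_and, expect_mul_left, expect_ind_mul, expect_ind, expect_trans_const,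
    expect_pX₂_const, expect_pX₁_const, expect_pU₁₀_const]
  simp only [expect, pU₂₂Marg, Finset.mul_sum]
  exact Finset.sum_congr rfl fun _ _ => by ring

/-- The first factor carries all dependence on u₁₁ and the second one all dependence on y₁; hence
U₁₁ acts on Y₁ only through X₁. -/
lemma law_markov_u₁₁ (t u v x w y₁) : prob (P.joint ch)
    (fun s => s.u₁₁ = v ∧ s.y₁ = y₁ ∧ s.t₁₀ = t ∧ s.u₁₀ = u ∧ s.x₁ = x ∧ s.u₂₁ = w) =
    (P.pU₁₁ v * P.pX₁ t u v x) * (P.pT₁₀ t * P.pU₁₀ t u * P.pU₂₁ w *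
      expect (P.pU₂₂ w t) fun z => expect (P.pX₂ t w z) fun x₂ => expect (ch.trans x x₂) fun y =>
        ind (y.1 = y₁)) := by
  have hE : ∀ s : P.Sample Y₁ Y₂ Y, (s.u₁₁ = v ∧ s.y₁ = y₁ ∧ s.t₁₀ = t ∧ s.u₁₀ = u ∧ s.x₁ = x ∧
      s.u₂₁ = w) ↔ (s.t₁₀ = t ∧ s.u₁₀ = u ∧ s.u₁₁ = v ∧ s.x₁ = x ∧ s.u₂₁ = w ∧ s.y₁ = y₁) := by
    intro s; tauto
  rw [prob_congr hE, prob_eq_expect, expect_joint]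
  simp only [ind_and, expect_mul_left, expect_ind_mul]
  ring

lemma condMI_joint_nonneg {α β γ : Type*} [Fintype α] [Fintype β] [Fintype γ]
    (A : P.Sample Y₁ Y₂ Y → α) (B : P.Sample Y₁ Y₂ Y → β) (C : P.Sample Y₁ Y₂ Y → γ) :
    0 ≤ condMI (P.joint ch) A B C := condMI_nonneg (P.joint_mem ch) A B C

lemma mutualInfo_joint_nonneg {α β : Type*} [Fintype α] [Fintype β]
    (A : P.Sample Y₁ Y₂ Y → α) (B : P.Sample Y₁ Y₂ Y → β) :
    0 ≤ mutualInfo (P.joint ch) A B := condMI_nonneg (P.joint_mem ch) A B _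

lemma condMI_joint {α β γ : Type*} (A : P.Sample Y₁ Y₂ Y → α) (B : P.Sample Y₁ Y₂ Y → β)
    (C : P.Sample Y₁ Y₂ Y → γ) : condMI (P.joint ch) A B C =
      relEntropy (P.joint ch) (fun η ω => A η = A ω ∧ C η = C ω) +
      relEntropy (P.joint ch) (fun η ω => B η = B ω ∧ C η = C ω) -
      relEntropy (P.joint ch) (fun η ω => A η = A ω ∧ B η = B ω ∧ C η = C ω) -
      relEntropy (P.joint ch) (fun η ω => C η = C ω) :=
  condMI_eq_relEntropy (P.joint_mem ch).1 A B C

lemma mutualInfo_joint {α β : Type*} (A : P.Sample Y₁ Y₂ Y → α) (B : P.Sample Y₁ Y₂ Y → β) :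
    mutualInfo (P.joint ch) A B = relEntropy (P.joint ch) (fun η ω => A η = A ω) +
      relEntropy (P.joint ch) (fun η ω => B η = B ω) -
      relEntropy (P.joint ch) (fun η ω => A η = A ω ∧ B η = B ω) :=
  mutualInfo_eq_relEntropy (P.joint_mem ch) A B

/-! ### Independences of the auxiliary variables. -/

lemma condMI_u₁₀_u₁₁_u₂₁ : condMI (P.joint ch) (·.u₁₀) (fun s => (s.u₁₁, s.u₂₁)) (·.t₁₀) = 0 :=
  condMI_eq_zero_of_factor (P.joint_mem ch).1 (fun u t => P.pT₁₀ t * P.pU₁₀ t u)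
    (fun v _ => P.pU₁₁ v.1 * P.pU₂₁ v.2) fun u v t => by
      rw [← mul_assoc, ← P.law_auxiliary ch]
      exact prob_congr fun s => by simp only [Prod.ext_iff]; tauto

lemma condMI_u₁₁_u₁₀_u₂₁ : condMI (P.joint ch) (·.u₁₁) (fun s => (s.u₁₀, s.u₂₁)) (·.t₁₀) = 0 :=
  condMI_eq_zero_of_factor (P.joint_mem ch).1 (fun v _ => P.pU₁₁ v)
    (fun u t => P.pT₁₀ t * P.pU₁₀ t u.1 * P.pU₂₁ u.2) fun v u t => by
      rw [show P.pU₁₁ v * (P.pT₁₀ t * P.pU₁₀ t u.1 * P.pU₂₁ u.2) =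
        P.pT₁₀ t * P.pU₁₀ t u.1 * P.pU₁₁ v * P.pU₂₁ u.2 by ring, ← P.law_auxiliary ch]
      exact prob_congr fun s => by simp only [Prod.ext_iff]; tauto

lemma mutualInfo_u₂₁_aux :
    mutualInfo (P.joint ch) (·.u₂₁) (fun s => (s.t₁₀, s.u₁₀, s.u₁₁)) = 0 :=
  condMI_eq_zero_of_factor (P.joint_mem ch).1 (fun w _ => P.pU₂₁ w)
    (fun u _ => P.pT₁₀ u.1 * P.pU₁₀ u.1 u.2.1 * P.pU₁₁ u.2.2) fun w u _ => by
      rw [mul_comm, ← P.law_auxiliary ch]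
      exact prob_congr fun s => by simp only [Prod.ext_iff]; tauto

lemma condMI_u₁₁_y₁ :
    condMI (P.joint ch) (·.u₁₁) (·.y₁) (fun s => (s.t₁₀, s.u₁₀, s.x₁, s.u₂₁)) = 0 :=
  condMI_eq_zero_of_factor (P.joint_mem ch).1 (fun v c => P.pU₁₁ v * P.pX₁ c.1 c.2.1 v c.2.2.1)
    (fun y₁ c => P.pT₁₀ c.1 * P.pU₁₀ c.1 c.2.1 * P.pU₂₁ c.2.2.2 * expect (P.pU₂₂ c.2.2.2 c.1)
      fun z => expect (P.pX₂ c.1 c.2.2.2 z) fun x₂ => expect (ch.trans c.2.2.1 x₂) fun y =>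
        ind (y.1 = y₁)) fun v y₁ c => by
      rw [← P.law_markov_u₁₁ ch]
      exact prob_congr fun s => by simp only [Prod.ext_iff]

/-! ### Inequalities between the information quantities I₁, …, I₁₄. -/

lemma I₁_nonneg : 0 ≤ P.I₁ ch := P.condMI_joint_nonneg ch _ _ _

lemma I₂_nonneg : 0 ≤ P.I₂ ch := P.condMI_joint_nonneg ch _ _ _

lemma I₃_nonneg : 0 ≤ P.I₃ ch := P.condMI_joint_nonneg ch _ _ _

lemma I₅_nonneg : 0 ≤ P.I₅ ch := P.condMI_joint_nonneg ch _ _ _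

lemma I₇_nonneg : 0 ≤ P.I₇ ch := P.condMI_joint_nonneg ch _ _ _

lemma I₃_le_I₄ : P.I₃ ch ≤ P.I₄ ch := by
  have h1 := P.condMI_joint_nonneg ch (·.u₁₀) (·.y₁) (fun s => (s.t₁₀, s.u₁₁, s.u₂₁))
  have h2 := P.mutualInfo_joint_nonneg ch (·.t₁₀) (·.y₁)
  -- All quantities become combinations of joint entropies. The `and` lemmas sort the conjunctions
  -- so that equal entropies become syntactically equal, and the claim is then a linear consequence
  -- of the listed Shannon inequalities. The lemmas below follow the same pattern.
  simp only [I₃, I₄, condMI_joint, mutualInfo_joint,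
    Prod.mk.injEq, and_assoc, and_comm, and_left_comm] at *
  linarith

/-- By the chain rule I₆ − I₄ = I(U₁₁;Y₁|T₁₀,U₂₁). Conditioning in addition on U₁₀, which is
independent of U₁₁ given T₁₀ and U₂₁, can only increase this, and the result is at most I₅. -/
lemma I₆_le : P.I₆ ch ≤ P.I₄ ch + P.I₅ ch := by
  have h1 := P.condMI_u₁₁_u₁₀_u₂₁ ch
  have h2 := P.condMI_joint_nonneg ch (·.u₁₁) (·.u₂₁) (·.t₁₀)
  have h3 := P.condMI_joint_nonneg ch (·.u₁₁) (·.u₁₀) (fun s => (s.t₁₀, s.u₂₁, s.y₁))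
  have h4 := P.I₃_nonneg ch
  simp only [I₃, I₄, I₅, I₆, condMI_joint, mutualInfo_joint,
    Prod.mk.injEq, and_assoc, and_comm, and_left_comm] at *
  linarith

lemma I₇_le_I₉ : P.I₇ ch ≤ P.I₉ ch := by
  have h1 := P.condMI_joint_nonneg ch (·.u₁₁) (·.y₁) (fun s => (s.t₁₀, s.u₁₀))
  simp only [I₇, I₉, condMI_joint, mutualInfo_joint,
    Prod.mk.injEq, and_assoc, and_comm, and_left_comm] at *
  linarith

lemma I₇_le_I₈ : P.I₇ ch ≤ P.I₈ ch := by
  have h1 := P.condMI_joint_nonneg ch (·.u₁₀) (·.y₁) (fun s => (s.t₁₀, s.u₁₁))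
  have h2 := P.mutualInfo_joint_nonneg ch (·.t₁₀) (·.y₁)
  simp only [I₇, I₈, condMI_joint, mutualInfo_joint,
    Prod.mk.injEq, and_assoc, and_comm, and_left_comm] at *
  linarith

/-- I₉ − I₇ = I(U₁₁;Y₁|T₁₀,U₁₀), which grows when the independent U₂₁ is added to the condition. -/
lemma I₉_le : P.I₉ ch ≤ P.I₅ ch + P.I₇ ch := by
  have h1 := P.condMI_u₁₁_u₁₀_u₂₁ ch
  have h2 := P.condMI_joint_nonneg ch (·.u₁₁) (·.u₁₀) (·.t₁₀)
  have h3 := P.condMI_joint_nonneg ch (·.u₁₁) (·.u₂₁) (fun s => (s.t₁₀, s.u₁₀, s.y₁))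
  have h4 := P.I₃_nonneg ch
  simp only [I₃, I₅, I₇, I₉, condMI_joint, mutualInfo_joint,
    Prod.mk.injEq, and_assoc, and_comm, and_left_comm] at *
  linarith

/-- I₁₀ − I₈ = I(U₁₁;Y₁|T₁₀), which grows when U₁₀ and U₂₁ are added to the condition. -/
lemma I₁₀_le : P.I₁₀ ch ≤ P.I₅ ch + P.I₈ ch := by
  have h1 := P.condMI_u₁₁_u₁₀_u₂₁ ch
  have h2 := P.condMI_joint_nonneg ch (·.u₁₁) (fun s => (s.u₁₀, s.u₂₁)) (fun s => (s.t₁₀, s.y₁))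
  have h3 := P.I₃_nonneg ch
  simp only [I₁₀, I₃, I₅, I₈, condMI_joint, mutualInfo_joint,
    Prod.mk.injEq, and_assoc, and_comm, and_left_comm] at *
  linarith

/-- The two differences I₁₀ − I₈ and I₉ − I₇ are I(U₁₁;Y₁|T₁₀) and I(U₁₁;Y₁|T₁₀,U₁₀); the second has
the independent U₁₀ in the condition. -/
lemma I₇_add_I₁₀_le : P.I₇ ch + P.I₁₀ ch ≤ P.I₈ ch + P.I₉ ch := by
  have h1 := P.condMI_u₁₁_u₁₀_u₂₁ ch
  have h2 := P.condMI_joint_nonneg ch (·.u₁₁) (·.u₂₁) (fun s => (s.t₁₀, s.u₁₀))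
  have h3 := P.condMI_joint_nonneg ch (·.u₁₁) (·.u₁₀) (fun s => (s.t₁₀, s.y₁))
  simp only [I₁₀, I₇, I₈, I₉, condMI_joint, mutualInfo_joint,
    Prod.mk.injEq, and_assoc, and_comm, and_left_comm] at *
  linarith

/-- I₁₀ − I₉ = I(T₁₀;Y₁) + I(U₁₀;Y₁|T₁₀), and the last term grows when the independent U₁₁ and U₂₁
are added to the condition. -/
lemma I₁₀_le' : P.I₁₀ ch ≤ P.I₄ ch + P.I₉ ch := by
  have h1 := P.condMI_u₁₀_u₁₁_u₂₁ ch
  have h2 := P.condMI_joint_nonneg ch (·.u₁₀) (fun s => (s.u₁₁, s.u₂₁)) (fun s => (s.t₁₀, s.y₁))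
  have h3 := P.I₃_nonneg ch
  simp only [I₁₀, I₃, I₄, I₉, condMI_joint, mutualInfo_joint,
    Prod.mk.injEq, and_assoc, and_comm, and_left_comm] at *
  linarith

lemma I₅_le_I₉ : P.I₅ ch ≤ P.I₉ ch := by
  have h1 := P.condMI_joint_nonneg ch (·.u₂₁) (·.y₁) (fun s => (s.t₁₀, s.u₁₀))
  simp only [I₅, I₉, condMI_joint, mutualInfo_joint,
    Prod.mk.injEq, and_assoc, and_comm, and_left_comm] at *
  linarith

lemma I₆_le_I₁₀ : P.I₆ ch ≤ P.I₁₀ ch := by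
  have h1 := P.condMI_joint_nonneg ch (·.u₂₁) (·.y₁) (·.t₁₀)
  simp only [I₁₀, I₆, condMI_joint, mutualInfo_joint,
    Prod.mk.injEq, and_assoc, and_comm, and_left_comm] at *
  linarith

lemma I₁₁_le_I₁₂ : P.I₁₁ ch ≤ P.I₁₂ ch := by
  have h1 := P.condMI_joint_nonneg ch (·.u₂₁) (·.y₂) (·.u₁₁)
  simp only [I₁₁, I₁₂, condMI_joint, mutualInfo_joint,
    Prod.mk.injEq, and_assoc, and_comm, and_left_comm] at *
  linarith

lemma I₁₂_le_I₁₄ : P.I₁₂ ch ≤ P.I₁₄ ch := by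
  have h1 := P.mutualInfo_joint_nonneg ch (·.u₁₁) (·.y₂)
  simp only [I₁₂, I₁₄, condMI_joint, mutualInfo_joint,
    Prod.mk.injEq, and_assoc, and_comm, and_left_comm] at *
  linarith

lemma I₁₁_le_I₁₃ : P.I₁₁ ch ≤ P.I₁₃ ch := by
  have h1 := P.condMI_joint_nonneg ch (·.u₁₁) (·.y₂) (·.u₂₁)
  simp only [I₁₁, I₁₃, condMI_joint, mutualInfo_joint,
    Prod.mk.injEq, and_assoc, and_comm, and_left_comm] at *
  linarith

lemma I₁₃_le_I₁₄ : P.I₁₃ ch ≤ P.I₁₄ ch := by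
  have h1 := P.mutualInfo_joint_nonneg ch (·.u₂₁) (·.y₂)
  simp only [I₁₃, I₁₄, condMI_joint, mutualInfo_joint,
    Prod.mk.injEq, and_assoc, and_comm, and_left_comm] at *
  linarith

end HKPDFDist

/-! ### Fourier-Motzkin elimination of the rates of the message parts -/

namespace HKPDFDist

variable {X₁ X₂ Y₁ Y₂ Y : Type*} [Fintype X₁] [Fintype X₂] [Fintype Y₁] [Fintype Y₂] [Fintype Y]
variable (P : HKPDFDist X₁ X₂) (ch : CRC X₁ X₂ Y₁ Y₂ Y)

lemma sum_mul_mem_stdSimplex {A B : Type*} [Fintype A] [Fintype B] {q : A → ℝ} {k : A → B → ℝ}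
    (hq : q ∈ stdSimplex ℝ A) (hk : ∀ a, k a ∈ stdSimplex ℝ B) :
    (fun b => ∑ a, q a * k a b) ∈ stdSimplex ℝ B := by
  refine ⟨fun b => Finset.sum_nonneg fun a _ => mul_nonneg (hq.1 a) ((hk a).1 b), ?_⟩
  rw [Finset.sum_comm]
  simp only [← Finset.mul_sum, (hk _).2, mul_one, hq.2]

lemma one_mem_stdSimplex : (fun _ => 1 : Fin 1 → ℝ) ∈ stdSimplex ℝ (Fin 1) :=
  ⟨fun _ => zero_le_one, by simp⟩

/-- The distribution without the public auxiliary variable `U₁₁`. -/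
noncomputable abbrev dropU₁₁ : HKPDFDist X₁ X₂ :=
  { P with
    kU₁₁ := 1
    pU₁₁ := fun _ => 1
    pX₁ := fun t u _ x => ∑ v, P.pU₁₁ v * P.pX₁ t u v x
    pU₁₁_mem := one_mem_stdSimplex
    pX₁_mem := fun t u _ => sum_mul_mem_stdSimplex P.pU₁₁_mem fun v => P.pX₁_mem t u v }

/-- The distribution without the private auxiliary variable `U₂₂`. -/
noncomputable abbrev dropU₂₂ : HKPDFDist X₁ X₂ :=
  { P with
    kU₂₂ := 1
    pU₂₂ := fun _ _ _ => 1
    pX₂ := fun t w _ x => ∑ z, P.pU₂₂ w t z * P.pX₂ t w z x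
    pU₂₂_mem := fun _ _ => one_mem_stdSimplex
    pX₂_mem := fun t w _ => sum_mul_mem_stdSimplex (P.pU₂₂_mem w t) fun z => P.pX₂_mem t w z }

/-- The distribution whose private auxiliary variable absorbs `U₂₁`. -/
noncomputable abbrev mergeU₂₁ : HKPDFDist X₁ X₂ :=
  { P with
    kU₂₁ := 1
    kU₂₂ := P.kU₂₁ * P.kU₂₂
    pU₂₁ := fun _ => 1
    pU₂₂ := fun _ t i =>
      P.pU₂₁ (finProdFinEquiv.symm i).1 * P.pU₂₂ (finProdFinEquiv.symm i).1 t (finProdFinEquiv.symm i).2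
    pX₂ := fun t _ i => P.pX₂ t (finProdFinEquiv.symm i).1 (finProdFinEquiv.symm i).2
    pU₂₁_mem := one_mem_stdSimplex
    pU₂₂_mem := fun _ t => by
      refine ⟨fun i => mul_nonneg (P.pU₂₁_mem.1 _) ((P.pU₂₂_mem _ _).1 _), ?_⟩
      rw [Equiv.sum_comp finProdFinEquiv.symm (fun q => P.pU₂₁ q.1 * P.pU₂₂ q.1 t q.2),
        Fintype.sum_prod_type]
      simp only [← Finset.mul_sum, (P.pU₂₂_mem _ _).2, mul_one, P.pU₂₁_mem.2]
    pX₂_mem := fun t _ i => P.pX₂_mem _ _ _ }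

/-- The sample of `dropU₁₁` that corresponds to a sample of `P`. -/
abbrev toDropU₁₁ (s : P.Sample Y₁ Y₂ Y) : P.dropU₁₁.Sample Y₁ Y₂ Y :=
  ⟨s.t₁₀, s.u₁₀, (0 : Fin 1), s.x₁, s.u₂₁, s.u₂₂, s.x₂, s.y₁, s.y₂, s.y⟩

/-- The sample of `dropU₂₂` that corresponds to a sample of `P`. -/
abbrev toDropU₂₂ (s : P.Sample Y₁ Y₂ Y) : P.dropU₂₂.Sample Y₁ Y₂ Y :=
  ⟨s.t₁₀, s.u₁₀, s.u₁₁, s.x₁, s.u₂₁, (0 : Fin 1), s.x₂, s.y₁, s.y₂, s.y⟩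

/-- The sample of `mergeU₂₁` that corresponds to a sample of `P`. -/
abbrev toMergeU₂₁ (s : P.Sample Y₁ Y₂ Y) : P.mergeU₂₁.Sample Y₁ Y₂ Y :=
  ⟨s.t₁₀, s.u₁₀, s.u₁₁, s.x₁, (0 : Fin 1), finProdFinEquiv (s.u₂₁, s.u₂₂), s.x₂, s.y₁, s.y₂, s.y⟩

/-- The reduced law is the image of the old one under forgetting u₁₁. By `condMI_comp` every
quantity of the reduced distribution can therefore be read in the old variables; the same is done
for the other two reductions. -/
lemma dropU₁₁_joint (s' : P.dropU₁₁.Sample Y₁ Y₂ Y) : P.dropU₁₁.joint ch s' =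
    prob (P.joint ch) (fun s => P.toDropU₁₁ s = s') := by
  obtain ⟨t, u, v, x₁, w, z, x₂, y₁, y₂, y⟩ := s'
  obtain rfl : v = (0 : Fin 1) := Subsingleton.elim (α := Fin 1) _ _
  rw [prob_eq_expect, expect_joint]
  simp only [HKPDFSample.mk.injEq, ind_and, expect_mul_left, expect_ind_mul, true_and, dropU₁₁,
    joint]
  have : ∀ x₁ x₂, expect (ch.trans x₁ x₂) (fun a => ind (a.1 = y₁) * (ind (a.2.1 = y₂) *
      ind (a.2.2 = y))) = ch.trans x₁ x₂ (y₁, y₂, y) := fun x₁ x₂ => by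
    rw [← expect_ind (ch.trans x₁ x₂)]
    exact expect_congr fun a => by simp only [← ind_and, Prod.ext_iff]
  simp only [this]
  simp only [expect, Finset.mul_sum, Finset.sum_mul]
  exact Finset.sum_congr rfl fun _ _ => by ring

lemma dropU₂₂_joint (s' : P.dropU₂₂.Sample Y₁ Y₂ Y) : P.dropU₂₂.joint ch s' =
    prob (P.joint ch) (fun s => P.toDropU₂₂ s = s') := by
  obtain ⟨t, u, v, x₁, w, z, x₂, y₁, y₂, y⟩ := s'
  obtain rfl : z = (0 : Fin 1) := Subsingleton.elim (α := Fin 1) _ _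
  rw [prob_eq_expect, expect_joint]
  simp only [HKPDFSample.mk.injEq, ind_and, expect_mul_left, expect_ind_mul, true_and, dropU₂₂,
    joint]
  have : ∀ x₁ x₂, expect (ch.trans x₁ x₂) (fun a => ind (a.1 = y₁) * (ind (a.2.1 = y₂) *
      ind (a.2.2 = y))) = ch.trans x₁ x₂ (y₁, y₂, y) := fun x₁ x₂ => by
    rw [← expect_ind (ch.trans x₁ x₂)]
    exact expect_congr fun a => by simp only [← ind_and, Prod.ext_iff]
  simp only [this]
  simp only [expect, Finset.mul_sum, Finset.sum_mul]
  exact Finset.sum_congr rfl fun _ _ => by ring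

lemma mergeU₂₁_joint (s' : P.mergeU₂₁.Sample Y₁ Y₂ Y) : P.mergeU₂₁.joint ch s' =
    prob (P.joint ch) (fun s => P.toMergeU₂₁ s = s') := by
  obtain ⟨t, u, v, x₁, w, z, x₂, y₁, y₂, y⟩ := s'
  obtain rfl : w = (0 : Fin 1) := Subsingleton.elim (α := Fin 1) _ _
  obtain ⟨⟨z₁, z₂⟩, rfl⟩ := (finProdFinEquiv (m := P.kU₂₁) (n := P.kU₂₂)).surjective z
  rw [prob_eq_single (P.joint ch) (ω₀ := ⟨t, u, v, x₁, z₁, z₂, x₂, y₁, y₂, y⟩)]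
  · simp only [mergeU₂₁, joint, Equiv.symm_apply_apply]; ring
  · rintro ⟨⟩
    simp only [toMergeU₂₁, HKPDFSample.mk.injEq, true_and, EmbeddingLike.apply_eq_iff_eq,
      Prod.mk.injEq, and_assoc]

/-! ### The information quantities of the three reduced distributions. -/

section transforms

lemma dropU₁₁_condMI {α β γ : Type*} (A : P.dropU₁₁.Sample Y₁ Y₂ Y → α)
    (B : P.dropU₁₁.Sample Y₁ Y₂ Y → β) (C : P.dropU₁₁.Sample Y₁ Y₂ Y → γ) :
    condMI (P.dropU₁₁.joint ch) A B C = condMI (P.joint ch) (fun s => A (P.toDropU₁₁ s))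
      (fun s => B (P.toDropU₁₁ s)) (fun s => C (P.toDropU₁₁ s)) :=
  condMI_comp _ (P.dropU₁₁_joint ch) A B C

lemma dropU₁₁_mutualInfo {α β : Type*} (A : P.dropU₁₁.Sample Y₁ Y₂ Y → α)
    (B : P.dropU₁₁.Sample Y₁ Y₂ Y → β) :
    mutualInfo (P.dropU₁₁.joint ch) A B = mutualInfo (P.joint ch) (fun s => A (P.toDropU₁₁ s))
      (fun s => B (P.toDropU₁₁ s)) :=
  mutualInfo_comp _ (P.dropU₁₁_joint ch) A B

lemma dropU₂₂_condMI {α β γ : Type*} (A : P.dropU₂₂.Sample Y₁ Y₂ Y → α)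
    (B : P.dropU₂₂.Sample Y₁ Y₂ Y → β) (C : P.dropU₂₂.Sample Y₁ Y₂ Y → γ) :
    condMI (P.dropU₂₂.joint ch) A B C = condMI (P.joint ch) (fun s => A (P.toDropU₂₂ s))
      (fun s => B (P.toDropU₂₂ s)) (fun s => C (P.toDropU₂₂ s)) :=
  condMI_comp _ (P.dropU₂₂_joint ch) A B C

lemma dropU₂₂_mutualInfo {α β : Type*} (A : P.dropU₂₂.Sample Y₁ Y₂ Y → α)
    (B : P.dropU₂₂.Sample Y₁ Y₂ Y → β) :
    mutualInfo (P.dropU₂₂.joint ch) A B = mutualInfo (P.joint ch) (fun s => A (P.toDropU₂₂ s))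
      (fun s => B (P.toDropU₂₂ s)) :=
  mutualInfo_comp _ (P.dropU₂₂_joint ch) A B

lemma mergeU₂₁_condMI {α β γ : Type*} (A : P.mergeU₂₁.Sample Y₁ Y₂ Y → α)
    (B : P.mergeU₂₁.Sample Y₁ Y₂ Y → β) (C : P.mergeU₂₁.Sample Y₁ Y₂ Y → γ) :
    condMI (P.mergeU₂₁.joint ch) A B C = condMI (P.joint ch) (fun s => A (P.toMergeU₂₁ s))
      (fun s => B (P.toMergeU₂₁ s)) (fun s => C (P.toMergeU₂₁ s)) :=
  condMI_comp _ (P.mergeU₂₁_joint ch) A B C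

lemma mergeU₂₁_mutualInfo {α β : Type*} (A : P.mergeU₂₁.Sample Y₁ Y₂ Y → α)
    (B : P.mergeU₂₁.Sample Y₁ Y₂ Y → β) :
    mutualInfo (P.mergeU₂₁.joint ch) A B = mutualInfo (P.joint ch) (fun s => A (P.toMergeU₂₁ s))
      (fun s => B (P.toMergeU₂₁ s)) :=
  mutualInfo_comp _ (P.mergeU₂₁_joint ch) A B

/-- Here and below the constant `0 : Fin 1` takes the place of the removed variable, so that its
equalities later simplify to `True`. -/
lemma dropU₁₁_I₃ : P.dropU₁₁.I₃ ch = condMI (P.joint ch) (fun s => s.x₁)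
      (fun s => s.y₁) (fun s => (s.t₁₀, s.u₁₀, (0 : Fin 1), s.u₂₁)) :=
  P.dropU₁₁_condMI ch _ _ _

lemma dropU₁₁_I₄ : P.dropU₁₁.I₄ ch = condMI (P.joint ch) (fun s => (s.u₁₀, s.x₁))
      (fun s => s.y₁) (fun s => (s.t₁₀, (0 : Fin 1), s.u₂₁)) +
      mutualInfo (P.joint ch) (fun s => s.t₁₀) (fun s => s.y₁) :=
  congrArg₂ (· + ·) (P.dropU₁₁_condMI ch _ _ _) (P.dropU₁₁_mutualInfo ch _ _)

lemma dropU₁₁_I₅ : P.dropU₁₁.I₅ ch = condMI (P.joint ch) (fun s => ((0 : Fin 1), s.x₁))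
      (fun s => s.y₁) (fun s => (s.t₁₀, s.u₁₀, s.u₂₁)) :=
  P.dropU₁₁_condMI ch _ _ _

lemma dropU₁₁_I₆ : P.dropU₁₁.I₆ ch = condMI (P.joint ch) (fun s => (s.u₁₀, (0 : Fin 1), s.x₁))
      (fun s => s.y₁) (fun s => (s.t₁₀, s.u₂₁)) +
      mutualInfo (P.joint ch) (fun s => s.t₁₀) (fun s => s.y₁) :=
  congrArg₂ (· + ·) (P.dropU₁₁_condMI ch _ _ _) (P.dropU₁₁_mutualInfo ch _ _)

lemma dropU₁₁_I₇ : P.dropU₁₁.I₇ ch = condMI (P.joint ch) (fun s => (s.x₁, s.u₂₁))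
      (fun s => s.y₁) (fun s => (s.t₁₀, s.u₁₀, (0 : Fin 1))) :=
  P.dropU₁₁_condMI ch _ _ _

lemma dropU₁₁_I₈ : P.dropU₁₁.I₈ ch = condMI (P.joint ch) (fun s => (s.u₁₀, s.x₁, s.u₂₁))
      (fun s => s.y₁) (fun s => (s.t₁₀, (0 : Fin 1))) +
      mutualInfo (P.joint ch) (fun s => s.t₁₀) (fun s => s.y₁) :=
  congrArg₂ (· + ·) (P.dropU₁₁_condMI ch _ _ _) (P.dropU₁₁_mutualInfo ch _ _)

lemma dropU₁₁_I₉ : P.dropU₁₁.I₉ ch = condMI (P.joint ch) (fun s => ((0 : Fin 1), s.x₁, s.u₂₁))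
      (fun s => s.y₁) (fun s => (s.t₁₀, s.u₁₀)) :=
  P.dropU₁₁_condMI ch _ _ _

lemma dropU₁₁_I₁₀ : P.dropU₁₁.I₁₀ ch = mutualInfo (P.joint ch) (fun s => (s.t₁₀, s.u₁₀, (0 : Fin 1), s.x₁, s.u₂₁)) (fun s => s.y₁) :=
  P.dropU₁₁_mutualInfo ch _ _

lemma dropU₁₁_I₁₁ : P.dropU₁₁.I₁₁ ch = condMI (P.joint ch) (fun s => s.u₂₂)
      (fun s => s.y₂) (fun s => (s.u₂₁, (0 : Fin 1))) :=
  P.dropU₁₁_condMI ch _ _ _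

lemma dropU₁₁_I₁₂ : P.dropU₁₁.I₁₂ ch = condMI (P.joint ch) (fun s => (s.u₂₁, s.u₂₂))
      (fun s => s.y₂) (fun _ => (0 : Fin 1)) :=
  P.dropU₁₁_condMI ch _ _ _

lemma dropU₁₁_I₁₃ : P.dropU₁₁.I₁₃ ch = condMI (P.joint ch) (fun s => ((0 : Fin 1), s.u₂₂))
      (fun s => s.y₂) (fun s => s.u₂₁) :=
  P.dropU₁₁_condMI ch _ _ _

lemma dropU₁₁_I₁₄ : P.dropU₁₁.I₁₄ ch = mutualInfo (P.joint ch) (fun s => ((0 : Fin 1), s.u₂₁, s.u₂₂)) (fun s => s.y₂) :=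
  P.dropU₁₁_mutualInfo ch _ _

lemma dropU₂₂_I₁ : P.dropU₂₂.I₁ ch = condMI (P.joint ch) (fun _ => (0 : Fin 1))
      (fun s => s.t₁₀) (fun s => s.u₂₁) :=
  P.dropU₂₂_condMI ch _ _ _

lemma dropU₂₂_I₁₁ : P.dropU₂₂.I₁₁ ch = condMI (P.joint ch) (fun _ => (0 : Fin 1))
      (fun s => s.y₂) (fun s => (s.u₂₁, s.u₁₁)) :=
  P.dropU₂₂_condMI ch _ _ _

lemma dropU₂₂_I₁₂ : P.dropU₂₂.I₁₂ ch = condMI (P.joint ch) (fun s => (s.u₂₁, (0 : Fin 1)))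
      (fun s => s.y₂) (fun s => s.u₁₁) :=
  P.dropU₂₂_condMI ch _ _ _

lemma dropU₂₂_I₁₃ : P.dropU₂₂.I₁₃ ch = condMI (P.joint ch) (fun s => (s.u₁₁, (0 : Fin 1)))
      (fun s => s.y₂) (fun s => s.u₂₁) :=
  P.dropU₂₂_condMI ch _ _ _

lemma dropU₂₂_I₁₄ : P.dropU₂₂.I₁₄ ch = mutualInfo (P.joint ch) (fun s => (s.u₁₁, s.u₂₁, (0 : Fin 1))) (fun s => s.y₂) :=
  P.dropU₂₂_mutualInfo ch _ _

lemma mergeU₂₁_I₁ : P.mergeU₂₁.I₁ ch = condMI (P.joint ch) (fun s => finProdFinEquiv (s.u₂₁, s.u₂₂))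
      (fun s => s.t₁₀) (fun _ => (0 : Fin 1)) :=
  P.mergeU₂₁_condMI ch _ _ _

lemma mergeU₂₁_I₃ : P.mergeU₂₁.I₃ ch = condMI (P.joint ch) (fun s => s.x₁)
      (fun s => s.y₁) (fun s => (s.t₁₀, s.u₁₀, s.u₁₁, (0 : Fin 1))) :=
  P.mergeU₂₁_condMI ch _ _ _

lemma mergeU₂₁_I₄ : P.mergeU₂₁.I₄ ch = condMI (P.joint ch) (fun s => (s.u₁₀, s.x₁))
      (fun s => s.y₁) (fun s => (s.t₁₀, s.u₁₁, (0 : Fin 1))) +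
      mutualInfo (P.joint ch) (fun s => s.t₁₀) (fun s => s.y₁) :=
  congrArg₂ (· + ·) (P.mergeU₂₁_condMI ch _ _ _) (P.mergeU₂₁_mutualInfo ch _ _)

lemma mergeU₂₁_I₅ : P.mergeU₂₁.I₅ ch = condMI (P.joint ch) (fun s => (s.u₁₁, s.x₁))
      (fun s => s.y₁) (fun s => (s.t₁₀, s.u₁₀, (0 : Fin 1))) :=
  P.mergeU₂₁_condMI ch _ _ _

lemma mergeU₂₁_I₆ : P.mergeU₂₁.I₆ ch = condMI (P.joint ch) (fun s => (s.u₁₀, s.u₁₁, s.x₁))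
      (fun s => s.y₁) (fun s => (s.t₁₀, (0 : Fin 1))) +
      mutualInfo (P.joint ch) (fun s => s.t₁₀) (fun s => s.y₁) :=
  congrArg₂ (· + ·) (P.mergeU₂₁_condMI ch _ _ _) (P.mergeU₂₁_mutualInfo ch _ _)

lemma mergeU₂₁_I₇ : P.mergeU₂₁.I₇ ch = condMI (P.joint ch) (fun s => (s.x₁, (0 : Fin 1)))
      (fun s => s.y₁) (fun s => (s.t₁₀, s.u₁₀, s.u₁₁)) :=
  P.mergeU₂₁_condMI ch _ _ _

lemma mergeU₂₁_I₈ : P.mergeU₂₁.I₈ ch = condMI (P.joint ch) (fun s => (s.u₁₀, s.x₁, (0 : Fin 1)))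
      (fun s => s.y₁) (fun s => (s.t₁₀, s.u₁₁)) +
      mutualInfo (P.joint ch) (fun s => s.t₁₀) (fun s => s.y₁) :=
  congrArg₂ (· + ·) (P.mergeU₂₁_condMI ch _ _ _) (P.mergeU₂₁_mutualInfo ch _ _)

lemma mergeU₂₁_I₉ : P.mergeU₂₁.I₉ ch = condMI (P.joint ch) (fun s => (s.u₁₁, s.x₁, (0 : Fin 1)))
      (fun s => s.y₁) (fun s => (s.t₁₀, s.u₁₀)) :=
  P.mergeU₂₁_condMI ch _ _ _

lemma mergeU₂₁_I₁₀ : P.mergeU₂₁.I₁₀ ch = mutualInfo (P.joint ch) (fun s => (s.t₁₀, s.u₁₀, s.u₁₁, s.x₁, (0 : Fin 1))) (fun s => s.y₁) :=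
  P.mergeU₂₁_mutualInfo ch _ _

lemma mergeU₂₁_I₁₁ : P.mergeU₂₁.I₁₁ ch = condMI (P.joint ch) (fun s => finProdFinEquiv (s.u₂₁, s.u₂₂))
      (fun s => s.y₂) (fun s => ((0 : Fin 1), s.u₁₁)) :=
  P.mergeU₂₁_condMI ch _ _ _

lemma mergeU₂₁_I₁₂ : P.mergeU₂₁.I₁₂ ch = condMI (P.joint ch) (fun s => ((0 : Fin 1), finProdFinEquiv (s.u₂₁, s.u₂₂)))
      (fun s => s.y₂) (fun s => s.u₁₁) :=
  P.mergeU₂₁_condMI ch _ _ _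

lemma mergeU₂₁_I₁₃ : P.mergeU₂₁.I₁₃ ch = condMI (P.joint ch) (fun s => (s.u₁₁, finProdFinEquiv (s.u₂₁, s.u₂₂)))
      (fun s => s.y₂) (fun _ => (0 : Fin 1)) :=
  P.mergeU₂₁_condMI ch _ _ _

lemma mergeU₂₁_I₁₄ : P.mergeU₂₁.I₁₄ ch = mutualInfo (P.joint ch) (fun s => (s.u₁₁, (0 : Fin 1), finProdFinEquiv (s.u₂₁, s.u₂₂))) (fun s => s.y₂) :=
  P.mergeU₂₁_mutualInfo ch _ _

lemma dropU₁₁_I_one_two : P.dropU₁₁.I₁ ch = P.I₁ ch ∧ P.dropU₁₁.I₂ ch = P.I₂ ch :=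
  ⟨P.dropU₁₁_condMI ch _ _ _, P.dropU₁₁_condMI ch _ _ _⟩

/-- Given X₁ and the other variables, U₁₁ tells nothing more about Y₁, so U₁₁ may be deleted next to
X₁. After the deletion each quantity with U₁₁ in the condition becomes the one with U₁₁ among the
decoded variables. -/
lemma dropU₁₁_I_receiver₁ : P.dropU₁₁.I₃ ch = P.I₅ ch ∧ P.dropU₁₁.I₄ ch = P.I₆ ch ∧
    P.dropU₁₁.I₅ ch = P.I₅ ch ∧ P.dropU₁₁.I₆ ch = P.I₆ ch ∧ P.dropU₁₁.I₇ ch = P.I₉ ch ∧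
    P.dropU₁₁.I₈ ch = P.I₁₀ ch ∧ P.dropU₁₁.I₉ ch = P.I₉ ch ∧ P.dropU₁₁.I₁₀ ch = P.I₁₀ ch := by
  have h := P.condMI_u₁₁_y₁ ch
  refine ⟨?_, ?_, ?_, ?_, ?_, ?_, ?_, ?_⟩
  all_goals try simp only [dropU₁₁_I₃, dropU₁₁_I₄, dropU₁₁_I₅, dropU₁₁_I₆, dropU₁₁_I₇, dropU₁₁_I₈, dropU₁₁_I₉, dropU₁₁_I₁₀]
  all_goals try simp only [I₅, I₆, I₉, I₁₀,
    condMI_joint,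
    mutualInfo_joint, Prod.mk.injEq, true_and, and_true] at *
  all_goals try simp only [and_assoc, and_comm, and_left_comm] at *
  all_goals linarith

/-- The difference I₁₄ − I₁₃ is I(U₂₁;Y₂) and does not involve U₁₁. -/
lemma dropU₁₁_I_receiver₂ : P.dropU₁₁.I₁₁ ch = P.dropU₁₁.I₁₃ ch ∧
    P.dropU₁₁.I₁₂ ch = P.dropU₁₁.I₁₄ ch ∧
    P.dropU₁₁.I₁₄ ch - P.dropU₁₁.I₁₃ ch = P.I₁₄ ch - P.I₁₃ ch := by
  refine ⟨?_, ?_, ?_⟩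
  all_goals try simp only [dropU₁₁_I₁₁, dropU₁₁_I₁₂, dropU₁₁_I₁₃, dropU₁₁_I₁₄]
  all_goals try simp only [I₁₃, I₁₄,
    condMI_joint,
    mutualInfo_joint, Prod.mk.injEq, true_and, and_true] at *
  have h : relEntropy (P.joint ch) (fun _ _ => True) = 0 := by
    simp [relEntropy, prob_true (P.joint_mem ch)]
  all_goals try simp only [and_assoc, and_comm, and_left_comm] at *
  all_goals linarith

lemma dropU₂₂_I_receiver₁ : P.dropU₂₂.I₂ ch = P.I₂ ch ∧
    P.dropU₂₂.I₃ ch = P.I₃ ch ∧ P.dropU₂₂.I₄ ch = P.I₄ ch ∧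
    P.dropU₂₂.I₅ ch = P.I₅ ch ∧ P.dropU₂₂.I₆ ch = P.I₆ ch ∧ P.dropU₂₂.I₇ ch = P.I₇ ch ∧
    P.dropU₂₂.I₈ ch = P.I₈ ch ∧ P.dropU₂₂.I₉ ch = P.I₉ ch ∧ P.dropU₂₂.I₁₀ ch = P.I₁₀ ch := by
  exact ⟨P.dropU₂₂_condMI ch _ _ _, P.dropU₂₂_condMI ch _ _ _,
    congrArg₂ (· + ·) (P.dropU₂₂_condMI ch _ _ _) (P.dropU₂₂_mutualInfo ch _ _),
    P.dropU₂₂_condMI ch _ _ _,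
    congrArg₂ (· + ·) (P.dropU₂₂_condMI ch _ _ _) (P.dropU₂₂_mutualInfo ch _ _),
    P.dropU₂₂_condMI ch _ _ _,
    congrArg₂ (· + ·) (P.dropU₂₂_condMI ch _ _ _) (P.dropU₂₂_mutualInfo ch _ _),
    P.dropU₂₂_condMI ch _ _ _, P.dropU₂₂_mutualInfo ch _ _⟩

/-- By the chain rule T₂'s quantities lose exactly I₁₁, the contribution of U₂₂, while the cost I₁
of binning disappears. Dropping U₂₂ is thus a gain when I₁ exceeds I₁₁. -/
lemma dropU₂₂_I_receiver₂ : P.dropU₂₂.I₁ ch = 0 ∧ P.dropU₂₂.I₁₁ ch = 0 ∧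
    P.dropU₂₂.I₁₂ ch = P.I₁₂ ch - P.I₁₁ ch ∧ P.dropU₂₂.I₁₃ ch = P.I₁₃ ch - P.I₁₁ ch ∧
    P.dropU₂₂.I₁₄ ch = P.I₁₄ ch - P.I₁₁ ch := by
  refine ⟨?_, ?_, ?_, ?_, ?_⟩
  all_goals try simp only [dropU₂₂_I₁, dropU₂₂_I₁₁, dropU₂₂_I₁₂, dropU₂₂_I₁₃, dropU₂₂_I₁₄]
  all_goals try simp only [I₁₁, I₁₂, I₁₃, I₁₄,
    condMI_joint,
    mutualInfo_joint, Prod.mk.injEq, true_and, and_true] at *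
  all_goals try simp only [and_assoc, and_comm, and_left_comm] at *
  all_goals linarith

/-- T₁ no longer decodes anything of the second user, so the quantities with and without U₂₁
coincide in pairs. The lower bounds are chain rules from which a nonnegative I(X₁;Y₁|T₁₀,U₁₀,U₁₁) is
discarded. -/
lemma mergeU₂₁_I_receiver₁ : P.mergeU₂₁.I₂ ch = P.I₂ ch ∧
    P.mergeU₂₁.I₇ ch = P.mergeU₂₁.I₃ ch ∧ P.mergeU₂₁.I₈ ch = P.mergeU₂₁.I₄ ch ∧
    P.mergeU₂₁.I₉ ch = P.mergeU₂₁.I₅ ch ∧ P.mergeU₂₁.I₁₀ ch = P.mergeU₂₁.I₆ ch ∧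
    P.I₈ ch - P.I₇ ch ≤ P.mergeU₂₁.I₄ ch ∧ P.I₉ ch - P.I₇ ch ≤ P.mergeU₂₁.I₅ ch ∧
    P.I₁₀ ch - P.I₇ ch ≤ P.mergeU₂₁.I₆ ch := by
  have h1 := P.condMI_joint_nonneg ch (·.x₁) (·.y₁) (fun s => (s.t₁₀, s.u₁₀, s.u₁₁))
  refine ⟨P.mergeU₂₁_condMI ch _ _ _, ?_⟩
  refine ⟨?_, ?_, ?_, ?_, ?_, ?_, ?_⟩
  all_goals try simp only [mergeU₂₁_I₃, mergeU₂₁_I₄, mergeU₂₁_I₅, mergeU₂₁_I₆, mergeU₂₁_I₇, mergeU₂₁_I₈, mergeU₂₁_I₉, mergeU₂₁_I₁₀]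
  all_goals try simp only [I₂, I₇, I₈, I₉, I₁₀,
    condMI_joint,
    mutualInfo_joint, Prod.mk.injEq, true_and, and_true] at *
  all_goals try simp only [and_assoc, and_comm, and_left_comm] at *
  all_goals linarith

/-- The cost of binning does not change, I(U₂₁,U₂₂;T₁₀) = I(U₂₂;T₁₀|U₂₁), because U₂₁ is independent
of T₁₀. -/
lemma mergeU₂₁_I_receiver₂ : P.mergeU₂₁.I₁ ch = P.I₁ ch ∧ P.mergeU₂₁.I₁₁ ch = P.I₁₂ ch ∧
    P.mergeU₂₁.I₁₂ ch = P.I₁₂ ch ∧ P.mergeU₂₁.I₁₃ ch = P.I₁₄ ch ∧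
    P.mergeU₂₁.I₁₄ ch = P.I₁₄ ch := by
  have h1 := P.mutualInfo_u₂₁_aux ch
  have h2 := P.mutualInfo_joint_nonneg ch (·.u₂₁) (·.t₁₀)
  have h3 := P.condMI_joint_nonneg ch (·.u₂₁) (fun s => (s.u₁₀, s.u₁₁)) (·.t₁₀)
  have h : relEntropy (P.joint ch) (fun _ _ => True) = 0 := by
    simp [relEntropy, prob_true (P.joint_mem ch)]
  refine ⟨?_, ?_, ?_, ?_, ?_⟩
  all_goals try simp only [mergeU₂₁_I₁, mergeU₂₁_I₁₁, mergeU₂₁_I₁₂, mergeU₂₁_I₁₃, mergeU₂₁_I₁₄]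
  all_goals try simp only [I₁, I₁₂, I₁₄,
    condMI_joint,
    mutualInfo_joint, Prod.mk.injEq, true_and, and_true, EmbeddingLike.apply_eq_iff_eq] at *
  all_goals try simp only [and_assoc, and_comm, and_left_comm] at *
  all_goals linarith

end transforms

/-! ### Elimination of the part rates for a fixed distribution. -/

/-- The rates of the message parts satisfy the bounds of the scheme up to boundary cases; `a`, `b`, `c`,
`d`, `e` are the rates of `w₁₀`, `w₁₁`, `w₁₂`, `w₂₁`, `w₂₂`. -/
structure RatesFit (a b c d e : ℝ) : Prop where
  ha : 0 ≤ a
  hb : 0 ≤ b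
  hc : 0 ≤ c
  hd : 0 ≤ d
  he : 0 ≤ e
  h₂ : a ≤ P.I₂ ch
  h₃ : c ≤ P.I₃ ch
  h₄ : a + c ≤ P.I₄ ch
  h₅ : b + c ≤ P.I₅ ch
  h₆ : a + b + c ≤ P.I₆ ch
  h₇ : c + d ≤ P.I₇ ch
  h₈ : a + c + d ≤ P.I₈ ch
  h₉ : b + c + d ≤ P.I₉ ch
  h₁₀ : a + b + c + d ≤ P.I₁₀ ch
  h₁₁ : e ≤ P.I₁₁ ch - P.I₁ ch
  h₁₂ : d + e ≤ P.I₁₂ ch - P.I₁ ch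
  h₁₃ : b + e ≤ P.I₁₃ ch - P.I₁ ch
  h₁₄ : b + d + e ≤ P.I₁₄ ch - P.I₁ ch

lemma exists_max₃ (x y z : ℝ) : ∃ m, x ≤ m ∧ y ≤ m ∧ z ≤ m ∧ (m = x ∨ m = y ∨ m = z) := by
  refine ⟨max x (max y z), le_max_left _ _, (le_max_left _ _).trans (le_max_right _ _),
    (le_max_right _ _).trans (le_max_right _ _), ?_⟩
  rcases max_choice x (max y z) with h | h
  · exact Or.inl h
  · exact Or.inr (by rw [h]; exact max_choice y z)

lemma exists_min (x y : ℝ) : ∃ m, min x y = m ∧ m ≤ x ∧ m ≤ y ∧ (m = x ∨ m = y) :=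
  ⟨min x y, rfl, min_le_left _ _, min_le_right _ _, min_choice x y⟩

/-- The three inequalities that the elimination produces in addition to those of the region. -/
lemma exists_ratesFit_of_extra {R : ℝ × ℝ} (h : R ∈ P.region ch) (h1 : P.I₁ ch ≤ P.I₁₁ ch)
    (e1 : R.1 ≤ min (P.I₂ ch + P.I₃ ch) (P.I₄ ch) + P.I₁₃ ch - P.I₁ ch)
    (e2 : R.2 ≤ P.I₇ ch + P.I₁₁ ch - P.I₁ ch)
    (e3 : R.1 + R.2 ≤ min (P.I₂ ch + P.I₃ ch) (P.I₄ ch) + P.I₁₃ ch - P.I₁ ch + P.I₇ ch) :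
    ∃ a b c d e, P.RatesFit ch a b c d e ∧ a + b + c = R.1 ∧ d + e = R.2 := by
  obtain ⟨hR1, hR2, k1, k2, k3, k4, k5, k6, k7⟩ := h
  have i1 := P.I₂_nonneg ch
  have i2 := P.I₃_nonneg ch
  have i3 := P.I₅_nonneg ch
  have i4 := P.I₇_nonneg ch
  have i5 := P.I₃_le_I₄ ch
  have i7 := P.I₆_le ch
  have i8 := P.I₇_le_I₉ ch
  have i9 := P.I₇_le_I₈ ch
  have i10 := P.I₉_le ch
  have i11 := P.I₁₀_le ch
  have i12 := P.I₇_add_I₁₀_le ch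
  have i13 := P.I₁₀_le' ch
  have i14 := P.I₅_le_I₉ ch
  have i15 := P.I₆_le_I₁₀ ch
  have i16 := P.I₁₁_le_I₁₂ ch
  have i17 := P.I₁₂_le_I₁₄ ch
  have i18 := P.I₁₁_le_I₁₃ ch
  have i19 := P.I₁₃_le_I₁₄ ch
  -- Each minimum combines two bounds of the same error pattern: one with w₁₀ right, paid by I₂, and
  -- one with w₁₀ wrong.
  obtain ⟨A, hA, A1, A2, A3⟩ := exists_min (P.I₂ ch + P.I₃ ch) (P.I₄ ch)
  obtain ⟨D, hD, D1, D2, D3⟩ := exists_min (P.I₂ ch + P.I₅ ch) (P.I₆ ch)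
  obtain ⟨E, hE, E1, E2, E3⟩ := exists_min (P.I₂ ch + P.I₇ ch) (P.I₈ ch)
  obtain ⟨G, hG, G1, G2, G3⟩ := exists_min (P.I₂ ch + P.I₉ ch) (P.I₁₀ ch)
  rw [hA] at e1 e3 k4 k6
  rw [hD] at k1
  rw [hE] at k3 k7
  rw [hG] at k5 k6
  have s1 : D ≤ A + P.I₅ ch := by rcases A3 with h | h <;> linarith
  have s2 : D ≤ G := by rcases G3 with h | h <;> linarith
  have s3 : G ≤ E + P.I₅ ch := by rcases E3 with h | h <;> linarith
  have s4 : P.I₇ ch + G ≤ E + P.I₉ ch := by rcases E3 with h | h <;> linarith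
  have s5 : G ≤ A + P.I₉ ch := by rcases A3 with h | h <;> linarith
  have s0 : 0 ≤ A := by rcases A3 with h | h <;> linarith
  have s6 : P.I₇ ch ≤ E := by rcases E3 with h | h <;> linarith
  -- The least admissible d: the first bound is e ≤ I₁₁ − I₁, and the third makes b ≥ R₁ − A
  -- compatible with b + e ≤ I₁₃ − I₁. The bounds `t1` to `t4` are what remains to be checked for d
  -- from above; the three extra hypotheses and I₁ ≤ I₁₁ enter there.
  obtain ⟨d, d1, d2, d3, d4⟩ := exists_max₃ (R.2 - (P.I₁₁ ch - P.I₁ ch)) 0 (R.1 + R.2 - A - (P.I₁₃ ch - P.I₁ ch))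
  have t1 : d ≤ R.2 := by rcases d4 with h | h | h <;> linarith
  have t2 : d ≤ P.I₇ ch := by rcases d4 with h | h | h <;> linarith
  have t3 : d ≤ G - R.1 := by rcases d4 with h | h | h <;> linarith
  have t4 : d ≤ E + (P.I₁₄ ch - P.I₁ ch) - R.1 - R.2 := by rcases d4 with h | h | h <;> linarith
  -- The least admissible b: a + c = R₁ − b must not exceed A, nor E − d.
  obtain ⟨b, b1, b2, b3, b4⟩ := exists_max₃ (R.1 - A) 0 (d + R.1 - E)
  have u1 : b ≤ R.1 := by rcases b4 with h | h | h <;> linarith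
  have u2 : b ≤ P.I₅ ch := by rcases b4 with h | h | h <;> linarith
  have u3 : b ≤ P.I₁₃ ch - P.I₁ ch - R.2 + d := by rcases b4 with h | h | h <;> linarith
  have u4 : b ≤ P.I₁₄ ch - P.I₁ ch - R.2 := by rcases b4 with h | h | h <;> linarith
  have u5 : b ≤ P.I₉ ch - d := by rcases b4 with h | h | h <;> linarith
  -- Forwarding as much as the relay can decode makes c as small as possible. Either a = I₂, and a
  -- bound on c follows from one on a + c, or c = 0.
  obtain ⟨a, -, a1, a2, a3⟩ := exists_min (P.I₂ ch) (R.1 - b)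
  refine ⟨a, b, R.1 - b - a, d, R.2 - d, ⟨?_, ?_, ?_, ?_, ?_, ?_, ?_, ?_, ?_, ?_, ?_, ?_, ?_, ?_, ?_, ?_,
    ?_, ?_⟩, by ring, by ring⟩
  all_goals first | linarith | (rcases a3 with h | h <;> linarith)

end HKPDFDist

/-! ### The extra conditions disappear in the union over the distributions. -/

namespace HKPDFDist

variable {X₁ X₂ Y₁ Y₂ Y : Type*} [Fintype X₁] [Fintype X₂] [Fintype Y₁] [Fintype Y₂] [Fintype Y]
variable (P : HKPDFDist X₁ X₂) (ch : CRC X₁ X₂ Y₁ Y₂ Y)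

/-- The region as a system of linear inequalities. -/
lemma mem_region_iff (R : ℝ × ℝ) : R ∈ P.region ch ↔ 0 ≤ R.1 ∧ 0 ≤ R.2 ∧
    R.1 ≤ P.I₂ ch + P.I₅ ch ∧ R.1 ≤ P.I₆ ch ∧ R.2 ≤ P.I₁₂ ch - P.I₁ ch ∧
    R.1 + R.2 ≤ P.I₂ ch + P.I₇ ch + P.I₁₃ ch - P.I₁ ch ∧
    R.1 + R.2 ≤ P.I₈ ch + P.I₁₃ ch - P.I₁ ch ∧
    R.1 + R.2 ≤ P.I₂ ch + P.I₃ ch + P.I₁₄ ch - P.I₁ ch ∧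
    R.1 + R.2 ≤ P.I₄ ch + P.I₁₄ ch - P.I₁ ch ∧
    R.1 + R.2 ≤ P.I₂ ch + P.I₉ ch + P.I₁₁ ch - P.I₁ ch ∧
    R.1 + R.2 ≤ P.I₁₀ ch + P.I₁₁ ch - P.I₁ ch ∧
    2 * R.1 + R.2 ≤ P.I₂ ch + P.I₃ ch + (P.I₂ ch + P.I₉ ch) + P.I₁₃ ch - P.I₁ ch ∧
    2 * R.1 + R.2 ≤ P.I₂ ch + P.I₃ ch + P.I₁₀ ch + P.I₁₃ ch - P.I₁ ch ∧
    2 * R.1 + R.2 ≤ P.I₄ ch + (P.I₂ ch + P.I₉ ch) + P.I₁₃ ch - P.I₁ ch ∧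
    2 * R.1 + R.2 ≤ P.I₄ ch + P.I₁₀ ch + P.I₁₃ ch - P.I₁ ch ∧
    R.1 + 2 * R.2 ≤ P.I₂ ch + P.I₇ ch + P.I₁₁ ch - P.I₁ ch + P.I₁₄ ch - P.I₁ ch ∧
    R.1 + 2 * R.2 ≤ P.I₈ ch + P.I₁₁ ch - P.I₁ ch + P.I₁₄ ch - P.I₁ ch := by
  obtain ⟨A, hA, A1, A2, A3⟩ := exists_min (P.I₂ ch + P.I₃ ch) (P.I₄ ch)
  obtain ⟨D, hD, D1, D2, D3⟩ := exists_min (P.I₂ ch + P.I₅ ch) (P.I₆ ch)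
  obtain ⟨E, hE, E1, E2, E3⟩ := exists_min (P.I₂ ch + P.I₇ ch) (P.I₈ ch)
  obtain ⟨G, hG, G1, G2, G3⟩ := exists_min (P.I₂ ch + P.I₉ ch) (P.I₁₀ ch)
  simp only [region, Set.mem_ofPred_eq, hA, hD, hE, hG]
  constructor
  · rintro ⟨h1, h2, h3, h4, h5, h6, h7, h8, h9⟩
    exact ⟨h1, h2, by linarith, by linarith, by linarith, by linarith, by linarith, by linarith,
      by linarith, by linarith, by linarith, by linarith, by linarith, by linarith, by linarith,
      by linarith, by linarith⟩
  · rintro ⟨h1, h2, h3, h4, h5, h6, h7, h8, h9, h10, h11, h12, h13, h14, h15, h16, h17⟩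
    refine ⟨h1, h2, ?_, ?_, ?_, ?_, ?_, ?_, ?_⟩
    · rcases D3 with h | h <;> linarith
    · exact h5
    · rcases E3 with h | h <;> linarith
    · rcases A3 with h | h <;> linarith
    · rcases G3 with h | h <;> linarith
    · rcases A3 with h | h <;> rcases G3 with h' | h' <;> linarith
    · rcases E3 with h | h <;> linarith

variable {P ch}

/-- With U₂₁ merged into U₂₂ the inequalities of the region and the extra ones all follow from the
four hypotheses and R₂ ≤ I₁₂ − I₁. -/
lemma exists_ratesFit_of_merge {R : ℝ × ℝ} (h : R ∈ P.region ch)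
    (hd1 : R.1 ≤ P.I₂ ch + (P.I₉ ch - P.I₇ ch)) (hd2 : R.1 ≤ P.I₁₀ ch - P.I₇ ch)
    (hs1 : R.1 + R.2 ≤ P.I₂ ch + P.I₁₄ ch - P.I₁ ch)
    (hs2 : R.1 + R.2 ≤ P.I₈ ch - P.I₇ ch + P.I₁₄ ch - P.I₁ ch) :
    ∃ a b c d e, P.mergeU₂₁.RatesFit ch a b c d e ∧ a + b + c = R.1 ∧ d + e = R.2 := by
  rw [mem_region_iff] at h
  obtain ⟨k1, k2, -, -, k5, -⟩ := h
  obtain ⟨m1, m2, m3, m4, m5, m6, m7, m8⟩ := P.mergeU₂₁_I_receiver₁ ch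
  obtain ⟨n1, n2, n3, n4, n5⟩ := P.mergeU₂₁_I_receiver₂ ch
  have p1 := P.mergeU₂₁.I₃_nonneg ch
  have p2 := P.I₁₁_le_I₁₂ ch
  have hr : R ∈ P.mergeU₂₁.region ch := by
    rw [mem_region_iff, m2, m3, m4, m5, n1, n2, n3, n4, n5, m1]
    refine ⟨k1, k2, ?_, ?_, ?_, ?_, ?_, ?_, ?_, ?_, ?_, ?_, ?_, ?_, ?_, ?_, ?_⟩ <;> linarith
  refine exists_ratesFit_of_extra _ _ hr ?_ ?_ ?_ ?_
  · linarith
  · obtain ⟨A, hA, A1, A2, A3⟩ := exists_min (P.mergeU₂₁.I₂ ch + P.mergeU₂₁.I₃ ch)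
      (P.mergeU₂₁.I₄ ch)
    rw [hA]
    rcases A3 with h | h <;> linarith
  · linarith
  · obtain ⟨A, hA, A1, A2, A3⟩ := exists_min (P.mergeU₂₁.I₂ ch + P.mergeU₂₁.I₃ ch)
      (P.mergeU₂₁.I₄ ch)
    rw [hA]
    rcases A3 with h | h <;> linarith

/-- If one of the other two extra inequalities fails, merging U₂₁ helps: subtracting the reversed
inequality from the bounds on sums of rates leaves exactly what `exists_ratesFit_of_merge` asks for.
-/
lemma exists_ratesFit_of_sum_le {R : ℝ × ℝ} (h : R ∈ P.region ch) (h1 : P.I₁ ch ≤ P.I₁₁ ch)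
    (e1 : R.1 ≤ min (P.I₂ ch + P.I₃ ch) (P.I₄ ch) + P.I₁₃ ch - P.I₁ ch) :
    ∃ (P' : HKPDFDist X₁ X₂) (a b c d e : ℝ),
      P'.RatesFit ch a b c d e ∧ a + b + c = R.1 ∧ d + e = R.2 := by
  have hm := (P.mem_region_iff ch R).1 h
  obtain ⟨k1, k2, k3, k4, k5, k6, k7, k8, k9, k10, k11, k12, k13, k14, k15, k16, k17⟩ := hm
  obtain ⟨A, hA, A1, A2, A3⟩ := exists_min (P.I₂ ch + P.I₃ ch) (P.I₄ ch)
  have i1 := P.I₇_nonneg ch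
  have i2 := P.I₁₃_le_I₁₄ ch
  by_cases e2 : R.2 ≤ P.I₇ ch + P.I₁₁ ch - P.I₁ ch
  · by_cases e3 : R.1 + R.2 ≤ min (P.I₂ ch + P.I₃ ch) (P.I₄ ch) + P.I₁₃ ch - P.I₁ ch + P.I₇ ch
    · exact ⟨P, exists_ratesFit_of_extra P ch h h1 e1 e2 e3⟩
    · rw [hA] at e3
      push Not at e3
      refine ⟨_, exists_ratesFit_of_merge h ?_ ?_ ?_ ?_⟩ <;>
        rcases A3 with hx | hx <;> linarith
  · push Not at e2
    refine ⟨_, exists_ratesFit_of_merge h ?_ ?_ ?_ ?_⟩ <;> linarith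

/-- If the extra bound `e1` on R₁ fails, the public part of the first user is useless. Subtracting
its negation from the bounds on 2R₁ + R₂ and R₁ + R₂ puts the pair into the region without U₁₁,
where the new version of `e1` follows from R₁ ≤ min{I₂ + I₅, I₆}. -/
lemma exists_ratesFit_of_le {R : ℝ × ℝ} (h : R ∈ P.region ch) (h1 : P.I₁ ch ≤ P.I₁₁ ch) :
    ∃ (P' : HKPDFDist X₁ X₂) (a b c d e : ℝ),
      P'.RatesFit ch a b c d e ∧ a + b + c = R.1 ∧ d + e = R.2 := by
  by_cases e1 : R.1 ≤ min (P.I₂ ch + P.I₃ ch) (P.I₄ ch) + P.I₁₃ ch - P.I₁ ch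
  · exact exists_ratesFit_of_sum_le h h1 e1
  have hm := (P.mem_region_iff ch R).1 h
  obtain ⟨k1, k2, k3, k4, k5, k6, k7, k8, k9, k10, k11, k12, k13, k14, k15, k16, k17⟩ := hm
  obtain ⟨A, hA, A1, A2, A3⟩ := exists_min (P.I₂ ch + P.I₃ ch) (P.I₄ ch)
  rw [hA] at e1
  push Not at e1
  have f1 : R.1 + R.2 ≤ A + P.I₁₄ ch - P.I₁ ch := by rcases A3 with hx | hx <;> linarith
  have f2 : 2 * R.1 + R.2 ≤ A + (P.I₂ ch + P.I₉ ch) + P.I₁₃ ch - P.I₁ ch := by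
    rcases A3 with hx | hx <;> linarith
  have f3 : 2 * R.1 + R.2 ≤ A + P.I₁₀ ch + P.I₁₃ ch - P.I₁ ch := by
    rcases A3 with hx | hx <;> linarith
  obtain ⟨m1, m2⟩ := P.dropU₁₁_I_one_two ch
  obtain ⟨m3, m4, m5, m6, m7, m8, m9, m10⟩ := P.dropU₁₁_I_receiver₁ ch
  obtain ⟨n1, n2, n3⟩ := P.dropU₁₁_I_receiver₂ ch
  by_cases h2 : P.dropU₁₁.I₁ ch ≤ P.dropU₁₁.I₁₁ ch
  · have hr : R ∈ P.dropU₁₁.region ch := by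
      rw [mem_region_iff]
      refine ⟨k1, k2, ?_, ?_, ?_, ?_, ?_, ?_, ?_, ?_, ?_, ?_, ?_, ?_, ?_, ?_, ?_⟩ <;> linarith
    refine exists_ratesFit_of_sum_le hr h2 ?_
    obtain ⟨B, hB, B1, B2, B3⟩ := exists_min (P.dropU₁₁.I₂ ch + P.dropU₁₁.I₃ ch)
      (P.dropU₁₁.I₄ ch)
    rw [hB]
    rcases B3 with hx | hx <;> linarith
  -- Without U₁₁ the binning of U₂₂ may have become too costly for T₂; then U₂₂ is dropped as well.
  · obtain ⟨q2, q3, q4, q5, q6, q7, q8, q9, q10⟩ := P.dropU₁₁.dropU₂₂_I_receiver₁ ch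
    obtain ⟨r1, r11, r12, r13, r14⟩ := P.dropU₁₁.dropU₂₂_I_receiver₂ ch
    have hr : R ∈ P.dropU₁₁.dropU₂₂.region ch := by
      rw [mem_region_iff, q2, q3, q4, q5, q6, q7, q8, q9, q10, r1, r11, r12, r13, r14]
      refine ⟨k1, k2, ?_, ?_, ?_, ?_, ?_, ?_, ?_, ?_, ?_, ?_, ?_, ?_, ?_, ?_, ?_⟩ <;> linarith
    refine exists_ratesFit_of_sum_le hr (by rw [r1, r11]) ?_
    rw [q2, q3, q4, r1, r13]
    obtain ⟨B, hB, B1, B2, B3⟩ := exists_min (P.dropU₁₁.I₂ ch + P.dropU₁₁.I₃ ch)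
      (P.dropU₁₁.I₄ ch)
    rw [hB]
    rcases B3 with hx | hx <;> linarith

/-- Every pair of the region splits into rates that fit some input distribution. -/
theorem exists_ratesFit {R : ℝ × ℝ} (h : R ∈ P.region ch) :
    ∃ (P' : HKPDFDist X₁ X₂) (a b c d e : ℝ),
      P'.RatesFit ch a b c d e ∧ a + b + c = R.1 ∧ d + e = R.2 := by
  by_cases h1 : P.I₁ ch ≤ P.I₁₁ ch
  · exact exists_ratesFit_of_le h h1
  obtain ⟨q2, q3, q4, q5, q6, q7, q8, q9, q10⟩ := P.dropU₂₂_I_receiver₁ ch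
  obtain ⟨r1, r11, r12, r13, r14⟩ := P.dropU₂₂_I_receiver₂ ch
  -- Now I₁ > I₁₁: each of T₂'s quantities minus I₁ is smaller than the same quantity minus I₁₁, so
  -- no bound is lost without U₂₂.
  have hr : R ∈ P.dropU₂₂.region ch := by
    rw [mem_region_iff] at h ⊢
    obtain ⟨k1, k2, k3, k4, k5, k6, k7, k8, k9, k10, k11, k12, k13, k14, k15, k16, k17⟩ := h
    refine ⟨k1, k2, ?_, ?_, ?_, ?_, ?_, ?_, ?_, ?_, ?_, ?_, ?_, ?_, ?_, ?_, ?_⟩ <;> linarith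
  exact exists_ratesFit_of_le hr (by rw [r1, r11])

end HKPDFDist

/-! ### The PDF-binning region and the Han-Kobayashi region -/

section regions

variable {X₁ X₂ Y₁ Y₂ Y : Type*} [Fintype X₁] [Fintype X₂] [Fintype Y₁] [Fintype Y₂] [Fintype Y]

/-- A PDF-binning distribution as a distribution of the combined scheme without public parts. -/
noncomputable abbrev PDFDist.toHKPDF (P : PDFDist X₁ X₂) : HKPDFDist X₁ X₂ where
  kT₁₀ := P.kT₁₀
  kU₁₀ := P.kU₁₀
  kU₁₁ := 1
  kU₂₁ := 1
  kU₂₂ := P.kU₂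
  pT₁₀ := P.pT₁₀
  pU₁₀ := P.pU₁₀
  pU₁₁ := fun _ => 1
  pX₁ := fun t u _ => P.pX₁ t u
  pU₂₁ := fun _ => 1
  pU₂₂ := fun _ t => P.pU₂ t
  pX₂ := fun t _ z => P.pX₂ t z
  pT₁₀_mem := P.pT₁₀_mem
  pU₁₀_mem := P.pU₁₀_mem
  pU₁₁_mem := HKPDFDist.one_mem_stdSimplex
  pX₁_mem := fun t u _ => P.pX₁_mem t u
  pU₂₁_mem := HKPDFDist.one_mem_stdSimplex
  pU₂₂_mem := fun _ t => P.pU₂_mem t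
  pX₂_mem := fun t _ z => P.pX₂_mem t z

/-- The variables of the PDF-binning scheme among those of the combined scheme. -/
abbrev PDFDist.ofHKPDFSample (P : PDFDist X₁ X₂) (s : P.toHKPDF.Sample Y₁ Y₂ Y) :
    Fin P.kT₁₀ × Fin P.kU₁₀ × X₁ × Fin P.kU₂ × X₂ × Y₁ × Y₂ × Y :=
  (s.t₁₀, s.u₁₀, s.x₁, s.u₂₂, s.x₂, s.y₁, s.y₂, s.y)

lemma PDFDist.joint_eq (P : PDFDist X₁ X₂) (ch : CRC X₁ X₂ Y₁ Y₂ Y)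
    (w : Fin P.kT₁₀ × Fin P.kU₁₀ × X₁ × Fin P.kU₂ × X₂ × Y₁ × Y₂ × Y) :
    P.joint ch w = prob (P.toHKPDF.joint ch) (fun s => P.ofHKPDFSample s = w) := by
  obtain ⟨t, u, x₁, z, x₂, y₁, y₂, y⟩ := w
  rw [prob_eq_single (P.toHKPDF.joint ch) (ω₀ := ⟨t, u, (0 : Fin 1), x₁, (0 : Fin 1), z, x₂, y₁, y₂, y⟩)]
  · simp only [PDFDist.joint, HKPDFDist.joint, mul_one]
  · rintro ⟨a, b, c, d, e, f, g, h, i, j⟩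
    obtain rfl : c = (0 : Fin 1) := Subsingleton.elim (α := Fin 1) _ _
    obtain rfl : e = (0 : Fin 1) := Subsingleton.elim (α := Fin 1) _ _
    simp only [PDFDist.ofHKPDFSample, HKPDFSample.mk.injEq, Prod.mk.injEq, true_and]

/-- With U₁₁ and U₂₁ constant the minima in all inequalities coincide, and the bounds on sums of
rates are sums of the bounds on R₁ and R₂. -/
lemma PDFDist.region_subset (P : PDFDist X₁ X₂) (ch : CRC X₁ X₂ Y₁ Y₂ Y) :
    P.region ch ⊆ P.toHKPDF.region ch := by
  rintro R ⟨h1, h2, h3, h4, h5⟩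
  simp only [condMI_comp _ (P.joint_eq ch), mutualInfo_comp _ (P.joint_eq ch)] at h3 h4 h5
  have hu : ∀ η ω : P.toHKPDF.Sample Y₁ Y₂ Y, (η.u₁₁ = ω.u₁₁) = True :=
    fun η ω => eq_true (Subsingleton.elim (α := Fin 1) _ _)
  have hw : ∀ η ω : P.toHKPDF.Sample Y₁ Y₂ Y, (η.u₂₁ = ω.u₂₁) = True :=
    fun η ω => eq_true (Subsingleton.elim (α := Fin 1) _ _)
  have h0 : relEntropy (P.toHKPDF.joint ch) (fun _ _ => True) = 0 := by
    simp [relEntropy, prob_true (P.toHKPDF.joint_mem ch)]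
  rw [HKPDFDist.mem_region_iff]
  simp only [HKPDFDist.I₁, HKPDFDist.I₂, HKPDFDist.I₃, HKPDFDist.I₄, HKPDFDist.I₅, HKPDFDist.I₆,
    HKPDFDist.I₇, HKPDFDist.I₈, HKPDFDist.I₉, HKPDFDist.I₁₀, HKPDFDist.I₁₁, HKPDFDist.I₁₂,
    HKPDFDist.I₁₃, HKPDFDist.I₁₄, HKPDFDist.condMI_joint, HKPDFDist.mutualInfo_joint,
    Prod.mk.injEq, hu, hw, true_and, and_true, and_self] at *
  refine ⟨h1, h2, ?_, ?_, ?_, ?_, ?_, ?_, ?_, ?_, ?_, ?_, ?_, ?_, ?_, ?_, ?_⟩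
  all_goals try simp only [and_assoc, and_comm, and_left_comm] at *
  all_goals linarith

lemma ind_mem_stdSimplex {A : Type*} [Fintype A] (a : A) :
    (fun x => ind (x = a)) ∈ stdSimplex ℝ A := by
  classical
  exact ⟨fun _ => ind_nonneg _, by simp [ind]⟩

lemma expect_dirac {A : Type*} [Fintype A] (a : A) (f : A → ℝ) :
    expect (fun x => ind (x = a)) f = f a := by
  classical
  simp [expect, ind]

lemma expect_one_fin_one (f : Fin 1 → ℝ) : expect (fun _ => 1) f = f 0 := by
  simp [expect]

/-- A Han-Kobayashi distribution as a distribution of the combined scheme without forwarded part;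
the private auxiliary variable of the second user is its input. -/
noncomputable abbrev HKDist.toHKPDF (P : HKDist X₁ X₂) : HKPDFDist X₁ X₂ where
  kT₁₀ := 1
  kU₁₀ := 1
  kU₁₁ := P.kU₁
  kU₂₁ := P.kU₂
  kU₂₂ := Fintype.card X₂
  pT₁₀ := fun _ => 1
  pU₁₀ := fun _ _ => 1
  pU₁₁ := P.pU₁
  pX₁ := fun _ _ v => P.pX₁ v
  pU₂₁ := P.pU₂
  pU₂₂ := fun w _ i => P.pX₂ w ((Fintype.equivFin X₂).symm i)
  pX₂ := fun _ _ i x => ind (x = (Fintype.equivFin X₂).symm i)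
  pT₁₀_mem := HKPDFDist.one_mem_stdSimplex
  pU₁₀_mem := fun _ => HKPDFDist.one_mem_stdSimplex
  pU₁₁_mem := P.pU₁_mem
  pX₁_mem := fun _ _ v => P.pX₁_mem v
  pU₂₁_mem := P.pU₂_mem
  pU₂₂_mem := fun w _ => by
    refine ⟨fun i => (P.pX₂_mem w).1 _, ?_⟩
    rw [Equiv.sum_comp (Fintype.equivFin X₂).symm (P.pX₂ w)]
    exact (P.pX₂_mem w).2
  pX₂_mem := fun _ _ _ => ind_mem_stdSimplex _

/-- The variables of the Han-Kobayashi scheme among those of the combined scheme. -/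
noncomputable abbrev HKDist.ofHKPDFSample (P : HKDist X₁ X₂) (s : P.toHKPDF.Sample Y₁ Y₂ Y) :
    Fin P.kU₁ × X₁ × Fin P.kU₂ × X₂ × Y₁ × Y₂ :=
  (s.u₁₁, s.x₁, s.u₂₁, (Fintype.equivFin X₂).symm s.u₂₂, s.y₁, s.y₂)

lemma HKDist.joint_eq (P : HKDist X₁ X₂) (ch : CRC X₁ X₂ Y₁ Y₂ Y)
    (w : Fin P.kU₁ × X₁ × Fin P.kU₂ × X₂ × Y₁ × Y₂) :
    P.joint ch w = prob (P.toHKPDF.joint ch) (fun s => P.ofHKPDFSample s = w) := by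
  obtain ⟨v, x₁, w, x₂, y₁, y₂⟩ := w
  obtain ⟨z, rfl⟩ := (Fintype.equivFin X₂).symm.surjective x₂
  rw [prob_eq_expect, HKPDFDist.expect_joint]
  simp only [expect_one_fin_one, expect_dirac, HKDist.ofHKPDFSample, Prod.mk.injEq, ind_and,
    EmbeddingLike.apply_eq_iff_eq, expect_mul_left, expect_ind_mul]
  have : ∀ x₁ x₂, expect (ch.trans x₁ x₂) (fun a => ind (a.1 = y₁) * ind (a.2.1 = y₂)) =
      ∑ y, ch.trans x₁ x₂ (y₁, y₂, y) := fun x₁ x₂ => by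
    rw [expect, Fintype.sum_prod_type, Finset.sum_eq_single y₁, Fintype.sum_prod_type,
      Finset.sum_eq_single y₂]
    · simp [ind]
    · intro b _ hb; simp [ind, hb]
    · simp
    · intro b _ hb; simp [ind, hb]
    · simp
  simp only [this, HKDist.joint]
  ring

/-- U₂₂ is the input X₂ itself, so U₂₁ tells nothing more about Y₂; this identifies
I(U₂₁,U₂₂;Y₂|U₁₁) with I(X₂;Y₂|U₁). -/
lemma HKDist.condMI_public₂ (P : HKDist X₁ X₂) (ch : CRC X₁ X₂ Y₁ Y₂ Y) :
    condMI (P.toHKPDF.joint ch) (·.u₂₁) (·.y₂) (fun s => (s.u₁₁, s.u₂₂)) = 0 :=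
  condMI_eq_zero_of_factor (P.toHKPDF.joint_mem ch).1
    (fun w c => P.pU₂ w * P.pX₂ w ((Fintype.equivFin X₂).symm c.2))
    (fun y₂ c => P.pU₁ c.1 * expect (P.pX₁ c.1) fun x₁ =>
      expect (ch.trans x₁ ((Fintype.equivFin X₂).symm c.2)) fun y => ind (y.2.1 = y₂))
    fun w y₂ c => by
      have hE : ∀ s : P.toHKPDF.Sample Y₁ Y₂ Y, (s.u₂₁ = w ∧ s.y₂ = y₂ ∧ (s.u₁₁, s.u₂₂) = c) ↔
          (s.u₁₁ = c.1 ∧ s.u₂₁ = w ∧ s.u₂₂ = c.2 ∧ s.y₂ = y₂) := fun s => by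
        simp only [Prod.ext_iff]; tauto
      rw [prob_congr hE, prob_eq_expect, HKPDFDist.expect_joint]
      simp only [expect_one_fin_one, expect_dirac, ind_and, expect_mul_left, expect_ind_mul]
      ring

/-- With T₁₀ and U₁₀ constant, I₁ = I₂ = 0, and the quantities with and without the forwarded part
coincide. The two Markov relations `m1` and `m2` remove U₁₁ next to X₁ and U₂₁ next to U₂₂. -/
lemma HKDist.region_subset (P : HKDist X₁ X₂) (ch : CRC X₁ X₂ Y₁ Y₂ Y) :
    P.region ch ⊆ P.toHKPDF.region ch := by
  rintro R ⟨h1, h2, h3, h4, h5, h6, h7, h8, h9⟩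
  simp only [condMI_comp _ (P.joint_eq ch), mutualInfo_comp _ (P.joint_eq ch)] at h3 h4 h5 h6 h7 h8 h9
  have ht : ∀ η ω : P.toHKPDF.Sample Y₁ Y₂ Y, (η.t₁₀ = ω.t₁₀) = True :=
    fun η ω => eq_true (Subsingleton.elim (α := Fin 1) _ _)
  have hu : ∀ η ω : P.toHKPDF.Sample Y₁ Y₂ Y, (η.u₁₀ = ω.u₁₀) = True :=
    fun η ω => eq_true (Subsingleton.elim (α := Fin 1) _ _)
  have h0 : relEntropy (P.toHKPDF.joint ch) (fun _ _ => True) = 0 := by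
    simp [relEntropy, prob_true (P.toHKPDF.joint_mem ch)]
  have m1 := P.toHKPDF.condMI_u₁₁_y₁ ch
  have m2 := P.condMI_public₂ ch
  rw [HKPDFDist.mem_region_iff]
  simp only [HKPDFDist.I₁, HKPDFDist.I₂, HKPDFDist.I₃, HKPDFDist.I₄, HKPDFDist.I₅, HKPDFDist.I₆,
    HKPDFDist.I₇, HKPDFDist.I₈, HKPDFDist.I₉, HKPDFDist.I₁₀, HKPDFDist.I₁₁, HKPDFDist.I₁₂,
    HKPDFDist.I₁₃, HKPDFDist.I₁₄, HKPDFDist.condMI_joint, HKPDFDist.mutualInfo_joint,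
    Prod.mk.injEq, ht, hu, true_and, and_true, and_self, EmbeddingLike.apply_eq_iff_eq] at *
  refine ⟨h1, h2, ?_, ?_, ?_, ?_, ?_, ?_, ?_, ?_, ?_, ?_, ?_, ?_, ?_, ?_, ?_⟩
  all_goals try simp only [and_assoc, and_comm, and_left_comm] at *
  all_goals linarith

lemma CRC.pdfRegion_subset (ch : CRC X₁ X₂ Y₁ Y₂ Y) : ch.pdfRegion ⊆ ch.hkpdfRegion :=
  Set.iUnion_subset fun P => (P.region_subset ch).trans (Set.subset_iUnion_of_subset P.toHKPDF subset_rfl)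

lemma CRC.hkRegion_subset (ch : CRC X₁ X₂ Y₁ Y₂ Y) : ch.hkRegion ⊆ ch.hkpdfRegion :=
  Set.iUnion_subset fun P => (P.region_subset ch).trans (Set.subset_iUnion_of_subset P.toHKPDF subset_rfl)

end regions

/-! ### Product mass functions -/

/-- The product of the mass functions `q i`. -/
noncomputable def piProd {ι A : Type*} [Fintype ι] (q : ι → A → ℝ) (x : ι → A) : ℝ := ∏ i, q i (x i)

section piProd

variable {ι A B : Type*} [Fintype ι] [DecidableEq ι] [Fintype A] [Fintype B]

lemma piProd_nonneg {q : ι → A → ℝ} (hq : ∀ i a, 0 ≤ q i a) (x : ι → A) : 0 ≤ piProd q x :=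
  Finset.prod_nonneg fun i _ => hq i _

lemma expect_piProd_prod (q f : ι → A → ℝ) :
    expect (piProd q) (fun x => ∏ i, f i (x i)) = ∏ i, expect (q i) (f i) := by
  simp only [expect, piProd, ← Finset.prod_mul_distrib]
  rw [Finset.prod_univ_sum, Fintype.piFinset_univ]

lemma sum_piProd (q : ι → A → ℝ) : ∑ x, piProd q x = ∏ i, ∑ a, q i a := by
  have := expect_piProd_prod q (fun _ _ => 1)
  simpa [expect] using this

lemma piProd_mem {q : ι → A → ℝ} (hq : ∀ i, q i ∈ stdSimplex ℝ A) :
    piProd q ∈ stdSimplex ℝ (ι → A) :=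
  ⟨piProd_nonneg fun i => (hq i).1, by rw [sum_piProd]; simp [(hq _).2]⟩

/-- Splitting off one coordinate of a product. -/
lemma expect_piProd_split (q : ι → A → ℝ) (i₀ : ι) (f : (ι → A) → ℝ) :
    expect (piProd q) f = expect (q i₀) (fun a =>
      expect (piProd (fun j : {j // j ≠ i₀} => q j)) (fun r =>
        f (fun j => if h : j = i₀ then a else r ⟨j, h⟩))) := by
  rw [expect_expect, expect, expect, ← (Equiv.funSplitAt i₀ A).symm.sum_comp]
  refine Finset.sum_congr rfl fun z _ => ?_
  have : piProd q ((Equiv.funSplitAt i₀ A).symm z) =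
      q i₀ z.1 * piProd (fun j : {j // j ≠ i₀} => q j) z.2 := by
    rw [piProd, Fintype.prod_eq_mul_prod_subtype_ne _ i₀]
    congr 1
    · simp [Equiv.funSplitAt, Equiv.piSplitAt]
    · refine Finset.prod_congr rfl fun j _ => ?_
      simp [Equiv.funSplitAt, Equiv.piSplitAt, j.2]
  rw [this]
  refine congrArg (_ * f ·) (funext fun j => ?_)
  by_cases h : j = i₀ <;> simp [Equiv.funSplitAt, Equiv.piSplitAt, h]

lemma expect_piProd_eval {q : ι → A → ℝ} (hq : ∀ i, ∑ a, q i a = 1) (i₀ : ι) (g : A → ℝ) :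
    expect (piProd q) (fun x => g (x i₀)) = expect (q i₀) g := by
  rw [expect_piProd_split q i₀]
  refine expect_congr fun a => ?_
  simp only [dite_true]
  exact expect_const (by rw [sum_piProd]; simp [hq]) _

open Classical in
/-- The kernel that repeats `a` if `E` holds, and draws from `q` otherwise. -/
noncomputable def repeatKernel (E : Prop) (q : A → ℝ) (a b : A) : ℝ :=
  if E then ind (b = a) else q b

lemma repeatKernel_true {E : Prop} (h : E) (q : A → ℝ) (a : A) :
    repeatKernel E q a = fun b => ind (b = a) := by
  funext b; simp [repeatKernel, h]

lemma repeatKernel_false {E : Prop} (h : ¬E) (q : A → ℝ) (a : A) : repeatKernel E q a = q := by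
  funext b; simp [repeatKernel, h]

lemma repeatKernel_mem (E : Prop) {q : A → ℝ} (hq : q ∈ stdSimplex ℝ A) (a : A) :
    repeatKernel E q a ∈ stdSimplex ℝ A := by
  by_cases h : E
  · rw [repeatKernel_true h]; exact ind_mem_stdSimplex a
  · rwa [repeatKernel_false h]

/-- The joint law of two coordinates of a product. -/
lemma expect_piProd_pair {q : ι → A → ℝ} (hq : ∀ i, ∑ a, q i a = 1) (i₀ i₁ : ι) (g : A → A → ℝ) :
    expect (piProd q) (fun x => g (x i₀) (x i₁)) =
      expect (q i₀) (fun a => expect (repeatKernel (i₁ = i₀) (q i₁) a) (g a)) := by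
  by_cases h : i₁ = i₀
  · subst h
    simp only [repeatKernel_true, expect_dirac]
    exact expect_piProd_eval hq i₁ (fun a => g a a)
  · rw [expect_piProd_split q i₀]
    refine expect_congr fun a => ?_
    simp only [dite_true, h, dite_false, repeatKernel_false, not_false_eq_true]
    exact expect_piProd_eval (q := fun j : {j // j ≠ i₀} => q j) (fun i => hq i) ⟨i₁, h⟩ (g a)

/-- Merging two sequences of independent draws. -/
lemma expect_piProd_piProd (q : ι → A → ℝ) (q' : ι → A → B → ℝ) (f : (ι → A) → (ι → B) → ℝ) :
    expect (piProd q) (fun a => expect (piProd fun i => q' i (a i)) (f a)) =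
      expect (piProd fun i (z : A × B) => q i z.1 * q' i z.1 z.2)
        (fun z => f (fun i => (z i).1) (fun i => (z i).2)) := by
  rw [expect_expect, expect, expect, ← (Equiv.arrowProdEquivProdArrow ι (fun _ => A) (fun _ => B)).sum_comp]
  refine Finset.sum_congr rfl fun z _ => ?_
  simp only [piProd, Finset.prod_mul_distrib]
  rfl

/-- The variance of a sum of independent centred terms. -/
lemma expect_piProd_sum_sq {q : ι → A → ℝ} (hq : ∀ i, ∑ a, q i a = 1) {f : ι → A → ℝ}
    (hf : ∀ i, expect (q i) (f i) = 0) :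
    expect (piProd q) (fun x => (∑ i, f i (x i)) ^ 2) = ∑ i, expect (q i) (fun a => f i a ^ 2) := by
  have : ∀ x : ι → A, (∑ i, f i (x i)) ^ 2 = ∑ i, ∑ j, f i (x i) * f j (x j) := fun x => by
    rw [sq, Finset.sum_mul_sum]
  simp only [this, expect_sum]
  refine Finset.sum_congr rfl fun i _ => ?_
  rw [Finset.sum_eq_single i]
  · rw [expect_piProd_eval hq i (fun a => f i a * f i a)]
    exact expect_congr fun a => by ring
  · intro j _ hj
    rw [expect_piProd_pair hq i j (fun a b => f i a * f j b)]
    simp only [repeatKernel_false hj, expect_mul_left, hf, mul_zero]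
    simp [expect]
  · simp

end piProd

/-! ### Typical sequences -/

section typical

variable {Ω α β γ : Type*} [Fintype Ω] {p : Ω → ℝ} {n : ℕ}

lemma card_filter_eq_sum_ind (s : Fin n → α) (a : α) [DecidablePred fun k => s k = a] :
    ((Finset.univ.filter (fun k => s k = a)).card : ℝ) = ∑ k, ind (s k = a) := by
  classical
  simp only [ind]
  rw [Finset.card_filter]
  push_cast
  exact Finset.sum_congr rfl fun _ _ => by congr

lemma typical_iff (A : Ω → α) (ε : ℝ) (s : Fin n → α) : Typical p A ε s ↔
    ∀ a, |(∑ k, ind (s k = a)) / n - prob p (fun ω => A ω = a)| ≤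
      ε * prob p (fun ω => A ω = a) := by
  simp only [Typical, card_filter_eq_sum_ind]

/-- Empirical averages along a typical sequence. -/
lemma Typical.abs_sum_sub_le [Fintype α] {A : Ω → α} {ε : ℝ} {s : Fin n → α} (h : Typical p A ε s)
    (f : α → ℝ) : |(∑ k, f (s k)) / n - ∑ a, prob p (fun ω => A ω = a) * f a| ≤
      ε * ∑ a, prob p (fun ω => A ω = a) * |f a| := by
  rw [typical_iff] at h
  have h1 : ∑ k, f (s k) = ∑ a, (∑ k, ind (s k = a)) * f a := by
    simp only [Finset.sum_mul]
    rw [Finset.sum_comm]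
    refine Finset.sum_congr rfl fun k _ => ?_
    rw [Finset.sum_eq_single (s k)]
    · simp [ind]
    · intro b _ hb; simp [ind, hb.symm]
    · simp
  rw [h1, Finset.sum_div, ← Finset.sum_sub_distrib, Finset.mul_sum]
  refine (Finset.abs_sum_le_sum_abs _ _).trans (Finset.sum_le_sum fun a _ => ?_)
  rw [mul_div_right_comm, ← sub_mul, abs_mul, ← mul_assoc]
  exact mul_le_mul_of_nonneg_right (h a) (abs_nonneg _)

/-- The deviation for a symbol b is an empirical average of a nonnegative indicator, so the relative
tolerance is inherited without loss. Joint typicality of all sequences of a block thus passes every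
test of the scheme. -/
lemma Typical.map [Fintype α] {A : Ω → α} {ε : ℝ} {s : Fin n → α} (h : Typical p A ε s)
    (f : α → β) : Typical p (fun ω => f (A ω)) ε (fun k => f (s k)) := by
  rw [typical_iff]
  intro b
  have := h.abs_sum_sub_le (fun a => ind (f a = b))
  have h2 : ∑ a, prob p (fun ω => A ω = a) * ind (f a = b) = prob p (fun ω => f (A ω) = b) := by
    rw [prob_eq_expect, expect_comp p A (fun a => ind (f a = b)), expect]
  simpa only [abs_of_nonneg (ind_nonneg _), h2] using this

/-- The tolerance is relative: a symbol of probability zero must have frequency exactly zero. -/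
lemma Typical.prob_pos (hp : ∀ ω, 0 ≤ p ω) {A : Ω → α} {ε : ℝ} {s : Fin n → α}
    (h : Typical p A ε s) (k : Fin n) : 0 < prob p (fun ω => A ω = s k) := by
  refine (prob_nonneg hp _).lt_of_ne fun h0 => ?_
  have h1 := (typical_iff A ε s).1 h (s k)
  rw [← h0, mul_zero, sub_zero] at h1
  have hn : (0 : ℝ) < n := by exact_mod_cast k.pos
  have h2 := abs_nonpos_iff.1 h1
  rw [div_eq_zero_iff, or_iff_left hn.ne'] at h2
  have h3 := (Finset.sum_eq_zero_iff_of_nonneg fun i _ => ind_nonneg _).1 h2 k (Finset.mem_univ k)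
  rw [ind_true rfl] at h3
  exact one_ne_zero h3

/-! ### Information density along typical sequences, packing and covering. -/

/-- The argument of the logarithm in the conditional mutual information. -/
noncomputable def infoRatio (p : Ω → ℝ) (A : Ω → α) (B : Ω → β) (C : Ω → γ) (w : α × β × γ) : ℝ :=
  (prob p (fun η => A η = w.1 ∧ B η = w.2.1 ∧ C η = w.2.2) * prob p (fun η => C η = w.2.2)) /
    (prob p (fun η => A η = w.1 ∧ C η = w.2.2) * prob p (fun η => B η = w.2.1 ∧ C η = w.2.2))

/-- The mean of the absolute value of the information density. -/
noncomputable def infoDev [Fintype α] [Fintype β] [Fintype γ] (p : Ω → ℝ) (A : Ω → α) (B : Ω → β)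
    (C : Ω → γ) : ℝ :=
  ∑ w, prob p (fun ω => (A ω, B ω, C ω) = w) * |Real.logb 2 (infoRatio p A B C w)|

lemma infoDev_nonneg [Fintype α] [Fintype β] [Fintype γ] (hp : ∀ ω, 0 ≤ p ω) (A : Ω → α) (B : Ω → β)
    (C : Ω → γ) : 0 ≤ infoDev p A B C :=
  Finset.sum_nonneg fun _ _ => mul_nonneg (prob_nonneg hp _) (abs_nonneg _)

variable [Fintype α] [Fintype β] [Fintype γ] {A : Ω → α} {B : Ω → β} {C : Ω → γ} {ε : ℝ}
  {a : Fin n → α} {b : Fin n → β} {c : Fin n → γ}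

lemma Typical.marginals_pos (hp : ∀ ω, 0 ≤ p ω)
    (h : Typical p (fun ω => (A ω, B ω, C ω)) ε (fun k => (a k, b k, c k))) (k : Fin n) :
    0 < prob p (fun η => A η = a k ∧ B η = b k ∧ C η = c k) ∧
    0 < prob p (fun η => A η = a k ∧ C η = c k) ∧
    0 < prob p (fun η => B η = b k ∧ C η = c k) ∧ 0 < prob p (fun η => C η = c k) := by
  have h1 := h.prob_pos hp k
  simp only [Prod.mk.injEq] at h1
  exact ⟨h1, h1.trans_le (prob_mono hp fun _ h => ⟨h.1, h.2.2⟩),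
    h1.trans_le (prob_mono hp fun _ h => ⟨h.2.1, h.2.2⟩),
    h1.trans_le (prob_mono hp fun _ h => h.2.2)⟩

/-- The logarithm of the product is n times the empirical average of the information density, whose
mean is the conditional mutual information and whose relative deviation is weighted by `infoDev`. -/
lemma Typical.infoRatio_bounds (hp : ∀ ω, 0 ≤ p ω)
    (h : Typical p (fun ω => (A ω, B ω, C ω)) ε (fun k => (a k, b k, c k))) :
    (2 : ℝ) ^ (n * (condMI p A B C - ε * infoDev p A B C)) ≤
      ∏ k, infoRatio p A B C (a k, b k, c k) ∧
    ∏ k, infoRatio p A B C (a k, b k, c k) ≤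
      (2 : ℝ) ^ (n * (condMI p A B C + ε * infoDev p A B C)) := by
  have hpos : ∀ k, 0 < infoRatio p A B C (a k, b k, c k) := fun k => by
    obtain ⟨h1, h2, h3, h4⟩ := h.marginals_pos hp k
    exact div_pos (mul_pos h1 h4) (mul_pos h2 h3)
  have hI : condMI p A B C = ∑ w, prob p (fun ω => (A ω, B ω, C ω) = w) *
      Real.logb 2 (infoRatio p A B C w) :=
    expect_comp p (fun ω => (A ω, B ω, C ω)) (fun w => Real.logb 2 (infoRatio p A B C w))
  have h1 := h.abs_sum_sub_le (fun w => Real.logb 2 (infoRatio p A B C w))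
  rw [← hI] at h1
  change _ ≤ ε * infoDev p A B C at h1
  have h2 : ∏ k, infoRatio p A B C (a k, b k, c k) =
      (2 : ℝ) ^ (∑ k, Real.logb 2 (infoRatio p A B C (a k, b k, c k))) := by
    rw [Real.rpow_sum_of_pos two_pos]
    exact Finset.prod_congr rfl fun k _ => (Real.rpow_logb two_pos (by norm_num) (hpos k)).symm
  rw [h2]
  rw [abs_le] at h1
  rcases n.eq_zero_or_pos with hn | hn
  · subst hn; simp
  have hn' : (0 : ℝ) < n := by exact_mod_cast hn
  have h3 : ∑ k, Real.logb 2 (infoRatio p A B C (a k, b k, c k)) =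
      n * ((∑ k, Real.logb 2 (infoRatio p A B C (a k, b k, c k))) / n) := by field_simp
  rw [h3]
  exact ⟨Real.rpow_le_rpow_of_exponent_le one_le_two
      (mul_le_mul_of_nonneg_left (by linarith) hn'.le),
    Real.rpow_le_rpow_of_exponent_le one_le_two (mul_le_mul_of_nonneg_left (by linarith) hn'.le)⟩

/-- Change of measure from the kernel `p(a|c)` to the kernel `p(a|b,c)` along a typical sequence. -/
lemma Typical.prod_kernel (hp : ∀ ω, 0 ≤ p ω)
    (h : Typical p (fun ω => (A ω, B ω, C ω)) ε (fun k => (a k, b k, c k)))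
    {q : γ → α → ℝ} (hq : ∀ c, ∑ a, q c a = 1) {f : γ → ℝ}
    (hf : ∀ a c, prob p (fun ω => A ω = a ∧ C ω = c) = f c * q c a) :
    ∏ k, prob p (fun ω => A ω = a k ∧ B ω = b k ∧ C ω = c k) /
        prob p (fun ω => B ω = b k ∧ C ω = c k) =
      (∏ k, infoRatio p A B C (a k, b k, c k)) * ∏ k, q (c k) (a k) := by
  rw [← Finset.prod_mul_distrib]
  refine Finset.prod_congr rfl fun k _ => ?_
  obtain ⟨h1, h2, h3, h4⟩ := h.marginals_pos hp k
  have hC : prob p (fun ω => C ω = c k) = f (c k) := by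
    rw [← sum_prob_and p A]
    simp only [hf, ← Finset.mul_sum, hq, mul_one]
  rw [hf] at h2
  simp only [infoRatio, hf, hC]
  rw [hC] at h4
  have h5 : q (c k) (a k) ≠ 0 := fun h => by simp [h] at h2
  field_simp

/-- Packing: an independently drawn sequence is unlikely to be jointly typical. -/
lemma expect_typical_le (hp : ∀ ω, 0 ≤ p ω) {q : γ → α → ℝ} (hq : ∀ c, q c ∈ stdSimplex ℝ α)
    {f : γ → ℝ} (hf : ∀ a c, prob p (fun ω => A ω = a ∧ C ω = c) = f c * q c a) :
    expect (piProd fun k => q (c k)) (fun a => ind (Typical p (fun ω => (A ω, B ω, C ω)) ε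
      (fun k => (a k, b k, c k)))) ≤ (2 : ℝ) ^ (-(n * (condMI p A B C - ε * infoDev p A B C))) := by
  -- The conditional law p(a|b,c). Where its denominator vanishes it is identically zero, so its
  -- mass is only known to be at most one, which is enough.
  set r : Fin n → α → ℝ := fun k a => prob p (fun ω => A ω = a ∧ B ω = b k ∧ C ω = c k) /
        prob p (fun ω => B ω = b k ∧ C ω = c k) with hr
  set K := (n : ℝ) * (condMI p A B C - ε * infoDev p A B C)
  have hr0 : ∀ k a, 0 ≤ r k a := fun k a => div_nonneg (prob_nonneg hp _) (prob_nonneg hp _)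
  have hr1 : ∀ k, ∑ a, r k a ≤ 1 := fun k => by
    simp only [hr]
    rw [← Finset.sum_div, sum_prob_and p A]
    exact div_self_le_one _
  calc _ ≤ ∑ a : Fin n → α, (2 : ℝ) ^ (-K) * piProd r a := by
        refine Finset.sum_le_sum fun a _ => ?_
        beta_reduce
        by_cases h : Typical p (fun ω => (A ω, B ω, C ω)) ε (fun k => (a k, b k, c k))
        · rw [ind_true h, mul_one]
          have h1 := h.prod_kernel hp (fun c => (hq c).2) hf
          have h2 := (h.infoRatio_bounds hp).1
          have h3 : (0 : ℝ) ≤ ∏ k, q (c k) (a k) := Finset.prod_nonneg fun k _ => (hq _).1 _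
          rw [Real.rpow_neg two_pos.le, inv_mul_eq_div, le_div_iff₀ (Real.rpow_pos_of_pos two_pos _)]
          change (∏ k, q (c k) (a k)) * _ ≤ ∏ k, r k (a k)
          simp only [hr]
          rw [h1, mul_comm]
          exact mul_le_mul_of_nonneg_right h2 h3
        · rw [ind_false h, mul_zero]
          exact mul_nonneg (Real.rpow_nonneg two_pos.le _) (piProd_nonneg hr0 _)
    _ = (2 : ℝ) ^ (-K) * ∏ k, ∑ a, r k a := by rw [← Finset.mul_sum, sum_piProd]
    _ ≤ (2 : ℝ) ^ (-K) * 1 := by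
        refine mul_le_mul_of_nonneg_left ?_ (Real.rpow_nonneg two_pos.le _)
        exact Finset.prod_le_one (fun k _ => Finset.sum_nonneg fun a _ => hr0 k a) fun k _ => hr1 k
    _ = _ := mul_one _

/-- The probability that an independently drawn sequence is jointly typical is not much smaller than
allowed by the mutual information. -/
lemma le_expect_typical (hp : ∀ ω, 0 ≤ p ω) {q : γ → α → ℝ} (hq : ∀ c, q c ∈ stdSimplex ℝ α)
    {f : γ → ℝ} (hf : ∀ a c, prob p (fun ω => A ω = a ∧ C ω = c) = f c * q c a)
    {r : β → γ → α → ℝ}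
    (hr : ∀ a b c, prob p (fun ω => A ω = a ∧ B ω = b ∧ C ω = c) =
      prob p (fun ω => B ω = b ∧ C ω = c) * r b c a) :
    (2 : ℝ) ^ (-(n * (condMI p A B C + ε * infoDev p A B C))) *
      expect (piProd fun k => r (b k) (c k)) (fun a => ind (Typical p (fun ω => (A ω, B ω, C ω)) ε
        (fun k => (a k, b k, c k)))) ≤
    expect (piProd fun k => q (c k)) (fun a => ind (Typical p (fun ω => (A ω, B ω, C ω)) ε
      (fun k => (a k, b k, c k)))) := by
  rw [expect, expect, Finset.mul_sum]
  refine Finset.sum_le_sum fun a _ => ?_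
  by_cases h : Typical p (fun ω => (A ω, B ω, C ω)) ε (fun k => (a k, b k, c k))
  · rw [ind_true h, mul_one, mul_one]
    have h1 := h.prod_kernel hp (fun c => (hq c).2) hf
    have h2 := (h.infoRatio_bounds hp).2
    have h3 : (0 : ℝ) ≤ ∏ k, q (c k) (a k) := Finset.prod_nonneg fun k _ => (hq _).1 _
    rw [Real.rpow_neg two_pos.le, inv_mul_le_iff₀ (Real.rpow_pos_of_pos two_pos _)]
    -- The kernel r is determined by the joint law only where (b,c) has positive probability;
    -- typicality ensures this at every position.
    have h4 : piProd (fun k => r (b k) (c k)) a =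
        ∏ k, prob p (fun ω => A ω = a k ∧ B ω = b k ∧ C ω = c k) /
          prob p (fun ω => B ω = b k ∧ C ω = c k) := by
      refine Finset.prod_congr rfl fun k _ => ?_
      have := (h.marginals_pos hp k).2.2.1
      rw [hr, mul_div_cancel_left₀ _ this.ne']
    rw [h4, h1]
    exact mul_le_mul_of_nonneg_right h2 h3
  · rw [ind_false h, mul_zero, mul_zero, mul_zero]

/-- (1 − y)^M ≤ exp(−M t x), and by convexity the exponential lies below its chord between x = 0 and
x = 1. This is the estimate of the covering lemma, with x close to one and t small. -/
lemma one_sub_pow_le {x y t : ℝ} {M : ℕ} (hx0 : 0 ≤ x) (hx1 : x ≤ 1) (hy : t * x ≤ y)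
    (hy1 : y ≤ 1) : (1 - y) ^ M ≤ 1 - x + Real.exp (-(M * t)) := by
  have h1 : (1 - y) ^ M ≤ Real.exp (-(M * t) * x) := by
    calc (1 - y) ^ M ≤ (Real.exp (-(t * x))) ^ M := by
          refine pow_le_pow_left₀ (by linarith) ?_ M
          have := Real.add_one_le_exp (-(t * x))
          linarith
      _ = Real.exp (-(M * t) * x) := by rw [← Real.exp_nat_mul]; congr 1; ring
  have h2 := convexOn_exp.2 (Set.mem_univ 0) (Set.mem_univ (-(M * t))) (sub_nonneg.2 hx1) hx0
    (by ring)
  simp only [smul_eq_mul, mul_zero, zero_add, Real.exp_zero, mul_one] at h2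
  rw [mul_comm x] at h2
  have h3 : x * Real.exp (-(M * t)) ≤ Real.exp (-(M * t)) :=
    mul_le_of_le_one_left (Real.exp_pos _).le hx1
  linarith

/-- Covering: with many independently drawn sequences one of them is likely to be jointly typical. -/
lemma expect_no_typical_le (hp : ∀ ω, 0 ≤ p ω) {q : γ → α → ℝ} (hq : ∀ c, q c ∈ stdSimplex ℝ α)
    {f : γ → ℝ} (hf : ∀ a c, prob p (fun ω => A ω = a ∧ C ω = c) = f c * q c a)
    {r : β → γ → α → ℝ} (hr1 : ∀ b c, r b c ∈ stdSimplex ℝ α)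
    (hr : ∀ a b c, prob p (fun ω => A ω = a ∧ B ω = b ∧ C ω = c) =
      prob p (fun ω => B ω = b ∧ C ω = c) * r b c a) (V : Type*) [Fintype V] [DecidableEq V] :
    expect (piProd fun _ : V => piProd fun k => q (c k)) (fun a => ind (∀ v,
      ¬Typical p (fun ω => (A ω, B ω, C ω)) ε (fun k => (a v k, b k, c k)))) ≤
    expect (piProd fun k => r (b k) (c k)) (fun a => ind (¬Typical p (fun ω => (A ω, B ω, C ω)) ε
        (fun k => (a k, b k, c k)))) +
      Real.exp (-(Fintype.card V *
        (2 : ℝ) ^ (-(n * (condMI p A B C + ε * infoDev p A B C))))) := by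
  have hind : ∀ a : V → Fin n → α, ind (∀ v,
      ¬Typical p (fun ω => (A ω, B ω, C ω)) ε (fun k => (a v k, b k, c k))) =
      ∏ v, ind (¬Typical p (fun ω => (A ω, B ω, C ω)) ε (fun k => (a v k, b k, c k))) := fun a => by
    by_cases h : ∀ v, ¬Typical p (fun ω => (A ω, B ω, C ω)) ε (fun k => (a v k, b k, c k))
    · rw [ind_true h, Finset.prod_eq_one fun v _ => ind_true (h v)]
    · rw [ind_false h]
      push Not at h
      obtain ⟨v, hv⟩ := h
      exact (Finset.prod_eq_zero (Finset.mem_univ v) (ind_false (not_not.2 hv))).symm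
  simp only [hind]
  rw [expect_piProd_prod (fun _ : V => piProd fun k => q (c k)) (fun _ a =>
    ind (¬Typical p (fun ω => (A ω, B ω, C ω)) ε (fun k => (a k, b k, c k)))), Finset.prod_const,
    Finset.card_univ]
  have hsub : ∀ {q : (Fin n → α) → ℝ}, q ∈ stdSimplex ℝ (Fin n → α) → ∀ E : (Fin n → α) → Prop,
      expect q (fun a => ind (¬E a)) = 1 - expect q (fun a => ind (E a)) := fun {q} hq E => by
    simp only [ind_not, expect, mul_sub, mul_one, Finset.sum_sub_distrib, hq.2]
  have hq' : piProd (fun k => q (c k)) ∈ stdSimplex ℝ (Fin n → α) := piProd_mem fun k => hq _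
  have hr' : piProd (fun k => r (b k) (c k)) ∈ stdSimplex ℝ (Fin n → α) := piProd_mem fun k => hr1 _ _
  rw [hsub hq', hsub hr']
  -- Here y is the chance that one independent draw is typical, x the chance under the conditional
  -- kernel, and t the factor lost by the change of measure.
  exact one_sub_pow_le (expect_nonneg hr'.1 fun _ => ind_nonneg _)
    (expect_le hr' fun _ => ind_le_one _)
    (le_expect_typical hp hq hf hr) (expect_le hq' fun _ => ind_le_one _)

end typical

/-! ### Conditional typicality. -/

section conditionallyTypical

variable {Ω α β : Type*} [Fintype Ω] [Fintype α] [Fintype β] {p : Ω → ℝ} {n : ℕ}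
  {A : Ω → α} {B : Ω → β} {ε' ε : ℝ}

/-- The constant in the bound on the probability that conditional typicality fails. -/
noncomputable def typicalityConst (p : Ω → ℝ) (A : Ω → α) (B : Ω → β) (η : ℝ) : ℝ :=
  ∑ w : α × β, (η * prob p (fun ω => A ω = w.1 ∧ B ω = w.2))⁻¹ ^ 2

/-- Conditional typicality: if `B` is drawn along a typical sequence for `A` according to its
conditional law, then the pair is typical with high probability, for a larger parameter. -/
lemma expect_not_typical_le (hp : ∀ ω, 0 ≤ p ω) (hε : ε' < ε) {κ : α → β → ℝ}
    (hκ : ∀ a, κ a ∈ stdSimplex ℝ β)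
    (hAB : ∀ a b, prob p (fun ω => A ω = a ∧ B ω = b) = prob p (fun ω => A ω = a) * κ a b)
    {s : Fin n → α} (hs : Typical p A ε' s) :
    expect (piProd fun k => κ (s k)) (fun r => ind (¬Typical p (fun ω => (A ω, B ω)) ε
      (fun k => (s k, r k)))) ≤
    typicalityConst p A B (ε - ε') / n := by
  -- For n = 0 the bound reads 0, so failure must be impossible; typicality of the empty sequence
  -- passes from A to the pair by multiplying with κ.
  rcases n.eq_zero_or_pos with hn | hn
  · subst hn
    simp only [Nat.cast_zero, div_zero]
    refine le_of_eq (Finset.sum_eq_zero fun r _ => ?_)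
    have : Typical p (fun ω => (A ω, B ω)) ε (fun k => (s k, r k)) := by
      rw [typical_iff] at hs ⊢
      intro w
      have h0 := hs w.1
      simp only [Finset.univ_eq_empty, Finset.sum_empty, Nat.cast_zero, div_zero, zero_sub,
        abs_neg, abs_of_nonneg (prob_nonneg hp _)] at h0 ⊢
      have h1 : prob p (fun ω => (A ω, B ω) = w) = prob p (fun ω => A ω = w.1) * κ w.1 w.2 := by
        rw [← hAB]; exact prob_congr fun ω => by simp [Prod.ext_iff]
      rw [h1, ← mul_assoc]
      refine mul_le_mul_of_nonneg_right (h0.trans ?_) ((hκ _).1 _)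
      exact mul_le_mul_of_nonneg_right hε.le (prob_nonneg hp _)
    beta_reduce
    rw [ind_false (not_not.2 this), mul_zero]
  have hn' : (0 : ℝ) < n := by exact_mod_cast hn
  set X : α × β → (Fin n → β) → ℝ := fun w r => ∑ k, ind (s k = w.1) * (ind (r k = w.2) - κ w.1 w.2)
    with hX
  set P : α × β → ℝ := fun w => prob p (fun ω => A ω = w.1 ∧ B ω = w.2) with hP
  have hP0 : ∀ w, 0 ≤ P w := fun w => prob_nonneg hp _
  have hκ' : piProd (fun k => κ (s k)) ∈ stdSimplex ℝ (Fin n → β) := piProd_mem fun k => hκ _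
  -- The terms are independent and centred, and each is at most one in absolute value, so the
  -- variance is at most n.
  have hsq : ∀ w, expect (piProd fun k => κ (s k)) (fun r => X w r ^ 2) ≤ n := fun w => by
    have h1 := expect_piProd_sum_sq (q := fun k => κ (s k)) (fun k => (hκ _).2)
      (f := fun k b => ind (s k = w.1) * (ind (b = w.2) - κ w.1 w.2)) fun k => by
        by_cases h : s k = w.1
        · simp only [ind_true h, one_mul, sub_eq_add_neg, expect_add, expect_ind,
            expect_const (hκ (s k)).2]
          rw [h]; ring
        · simp only [ind_false h, zero_mul]
          exact expect_const (hκ _).2 0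
    simp only [hX]
    rw [h1]
    refine (Finset.sum_le_sum (g := fun _ => (1 : ℝ)) fun k _ => ?_).trans (by simp)
    refine expect_le (hκ _) fun b => ?_
    have k1 := (hκ w.1).1 w.2
    have k2 : κ w.1 w.2 ≤ 1 := by
      rw [← (hκ w.1).2]
      exact Finset.single_le_sum (fun b _ => (hκ w.1).1 b) (Finset.mem_univ _)
    have k3 := ind_nonneg (s k = w.1)
    have k4 := ind_le_one (s k = w.1)
    have k5 := ind_nonneg (b = w.2)
    have k6 := ind_le_one (b = w.2)
    rw [sq_le_one_iff_abs_le_one, abs_mul, abs_of_nonneg k3]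
    refine mul_le_one₀ k4 (abs_nonneg _) ?_
    rw [abs_le]
    constructor <;> linarith
  -- Chebyshev for all symbols at once. The inequality is weighted by the law because it can fail on
  -- sequences of mass zero: a symbol with P w = 0 enters the sum with inverse 0.
  have hpt : ∀ r, piProd (fun k => κ (s k)) r * ind (¬Typical p (fun ω => (A ω, B ω)) ε
      (fun k => (s k, r k))) ≤
      piProd (fun k => κ (s k)) r * ∑ w, ((ε - ε') * P w)⁻¹ ^ 2 * (X w r ^ 2 / n ^ 2) := fun r => by
    have hpos := hκ'.1 r
    have hsum : 0 ≤ ∑ w, ((ε - ε') * P w)⁻¹ ^ 2 * (X w r ^ 2 / n ^ 2) :=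
      Finset.sum_nonneg fun w _ => by positivity
    by_cases h0 : piProd (fun k => κ (s k)) r = 0
    · rw [h0, zero_mul, zero_mul]
    refine mul_le_mul_of_nonneg_left ?_ hpos
    by_cases ht : Typical p (fun ω => (A ω, B ω)) ε (fun k => (s k, r k))
    · rw [ind_false (not_not.2 ht)]; exact hsum
    rw [ind_true ht]
    rw [typical_iff] at ht
    push Not at ht
    obtain ⟨w, hw⟩ := ht
    have hPw : prob p (fun ω => (A ω, B ω) = w) = P w :=
      prob_congr fun ω => by simp [Prod.ext_iff]
    have hiw : ∀ k, ind ((s k, r k) = w) = ind (s k = w.1) * ind (r k = w.2) := fun k => by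
      rw [← ind_and]; congr 1; simp [Prod.ext_iff]
    rw [hPw] at hw
    simp only [hiw] at hw
    have hXw : X w r / n = (∑ k, ind (s k = w.1) * ind (r k = w.2)) / n -
        (∑ k, ind (s k = w.1)) / n * κ w.1 w.2 := by
      simp only [hX, mul_sub, Finset.sum_sub_distrib, ← Finset.sum_mul]
      ring
    have hsw := (typical_iff A ε' s).1 hs w.1
    have hPκ : P w = prob p (fun ω => A ω = w.1) * κ w.1 w.2 := hAB _ _
    -- The pair deviates by more than ε P w, of which the given sequence accounts for at most ε' P
    -- w.
    have hdev : (ε - ε') * P w < |X w r / n| := by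
      have t1 : |(∑ k, ind (s k = w.1)) / n * κ w.1 w.2 - P w| ≤ ε' * P w := by
        rw [hPκ, ← sub_mul, abs_mul, abs_of_nonneg ((hκ _).1 _), ← mul_assoc]
        exact mul_le_mul_of_nonneg_right hsw ((hκ _).1 _)
      have t2 := abs_add_le (X w r / n) ((∑ k, ind (s k = w.1)) / n * κ w.1 w.2 - P w)
      rw [hXw] at t2 ⊢
      have t3 : (∑ k, ind (s k = w.1) * ind (r k = w.2)) / n -
        (∑ k, ind (s k = w.1)) / n * κ w.1 w.2 + ((∑ k, ind (s k = w.1)) / n * κ w.1 w.2 - P w) =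
        (∑ k, ind (s k = w.1) * ind (r k = w.2)) / n - P w := by ring
      rw [t3] at t2
      linarith
    -- If P w were zero, the deviating pair w would occur although its first component has positive
    -- probability; then κ vanishes there and the sequence has mass zero, which was excluded.
    have hPpos : 0 < P w := by
      refine (hP0 w).lt_of_ne fun hz => ?_
      rw [← hz, mul_zero, sub_zero, abs_pos] at hw
      obtain ⟨k, -, hk⟩ := Finset.exists_ne_zero_of_sum_ne_zero (div_ne_zero_iff.1 hw).1
      have hk1 : s k = w.1 := by
        by_contra hc; rw [ind_false hc, zero_mul] at hk; exact hk rfl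
      have hk2 : r k = w.2 := by
        by_contra hc; rw [ind_false hc, mul_zero] at hk; exact hk rfl
      have hs0 := hs.prob_pos hp k
      rw [hk1] at hs0
      have hκ0 : κ (s k) (r k) = 0 := by
        rw [hk1, hk2]
        rcases mul_eq_zero.1 (hPκ ▸ hz.symm) with h | h
        · exact absurd h hs0.ne'
        · exact h
      exact h0 (Finset.prod_eq_zero (Finset.mem_univ k) hκ0)
    have hδ : 0 < (ε - ε') * P w := mul_pos (sub_pos.2 hε) hPpos
    refine le_trans ?_ (Finset.single_le_sum (f := fun w => ((ε - ε') * P w)⁻¹ ^ 2 *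
      (X w r ^ 2 / n ^ 2)) (fun w _ => by positivity) (Finset.mem_univ w))
    rw [← div_pow, ← mul_pow, inv_mul_eq_div, ← sq_abs, abs_div, abs_of_pos hδ]
    have : 1 ≤ |X w r / n| / ((ε - ε') * P w) := (one_le_div hδ).2 hdev.le
    exact one_le_pow₀ this
  refine (Finset.sum_le_sum fun r _ => hpt r).trans ?_
  change expect (piProd fun k => κ (s k)) (fun r => ∑ w, ((ε - ε') * P w)⁻¹ ^ 2 *
    (X w r ^ 2 / n ^ 2)) ≤ _
  rw [expect_sum, typicalityConst, Finset.sum_div]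
  refine Finset.sum_le_sum fun w _ => ?_
  rw [expect_mul_left, div_eq_mul_inv]
  refine mul_le_mul_of_nonneg_left ?_ (by positivity)
  simp only [div_eq_inv_mul, expect_mul_left]
  rw [inv_mul_le_iff₀ (by positivity)]
  refine (hsq w).trans (le_of_eq ?_)
  field_simp

end conditionallyTypical

/-! ### Marginals of layered random codebooks -/

section layers

variable {ι κ μ ν A : Type*} [Fintype ι] [Fintype κ] [Fintype μ] [Fintype ν] [DecidableEq ι]
  [DecidableEq κ] [DecidableEq μ] [DecidableEq ν] [Fintype A]

lemma piProd_stdSimplex_sum {q : ι → A → ℝ} (hq : ∀ i, ∑ a, q i a = 1) : ∑ x, piProd q x = 1 := by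
  rw [sum_piProd]; simp [hq]

/-- A family of draws with two indices is a family of draws indexed by pairs. -/
lemma expect_piProd_curry (q : ι → κ → A → ℝ) (f : (ι → κ → A) → ℝ) :
    expect (piProd fun i => piProd (q i)) f =
      expect (piProd fun ij : ι × κ => q ij.1 ij.2) (fun x => f (fun i j => x (i, j))) := by
  rw [expect, expect, ← (Equiv.curry ι κ A).sum_comp]
  refine Finset.sum_congr rfl fun x _ => ?_
  simp only [piProd, Fintype.prod_prod_type]
  rfl

lemma expect_piProd₂_pair {q : ι → κ → A → ℝ} (hq : ∀ i j, ∑ a, q i j a = 1) (i₀ i₁ : ι) (j₀ j₁ : κ)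
    (g : A → A → ℝ) :
    expect (piProd fun i => piProd (q i)) (fun x => g (x i₀ j₀) (x i₁ j₁)) =
      expect (q i₀ j₀) (fun a =>
        expect (repeatKernel ((i₁, j₁) = (i₀, j₀)) (q i₁ j₁) a) (g a)) := by
  rw [expect_piProd_curry]
  exact expect_piProd_pair (q := fun ij : ι × κ => q ij.1 ij.2) (fun _ => hq _ _) (i₀, j₀) (i₁, j₁) g

lemma expect_piProd_eval_pair {q : ι → κ → A → ℝ} (hq : ∀ i j, ∑ a, q i j a = 1) (i₀ : ι)
    (j₀ j₁ : κ) (g : A → A → ℝ) :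
    expect (piProd fun i => piProd (q i)) (fun x => g (x i₀ j₀) (x i₀ j₁)) =
      expect (q i₀ j₀) (fun a => expect (repeatKernel (j₁ = j₀) (q i₀ j₁) a) (g a)) := by
  rw [expect_piProd_eval (q := fun i => piProd (q i)) (fun i => piProd_stdSimplex_sum (hq i)) i₀
    (fun x => g (x j₀) (x j₁))]
  exact expect_piProd_pair (hq i₀) j₀ j₁ g

lemma expect_piProd₄_eval_pair {q : ι → κ → μ → ν → A → ℝ} (hq : ∀ i j k l, ∑ a, q i j k l a = 1)
    (i₀ : ι) (j₀ j₁ : κ) (k₀ k₁ : μ) (l₀ l₁ : ν) (g : A → A → ℝ) :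
    expect (piProd fun i => piProd fun j => piProd fun k => piProd (q i j k))
      (fun x => g (x i₀ j₀ k₀ l₀) (x i₀ j₁ k₁ l₁)) =
      expect (q i₀ j₀ k₀ l₀) (fun a =>
        expect (repeatKernel ((j₁, k₁, l₁) = (j₀, k₀, l₀)) (q i₀ j₁ k₁ l₁) a) (g a)) := by
  rw [expect_piProd_eval (q := fun i => piProd fun j => piProd fun k => piProd (q i j k))
    (fun i => piProd_stdSimplex_sum fun j => piProd_stdSimplex_sum fun k =>
      piProd_stdSimplex_sum (hq i j k)) i₀ (fun x => g (x j₀ k₀ l₀) (x j₁ k₁ l₁)),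
    expect_piProd_curry (fun j k => piProd (q i₀ j k)),
    expect_piProd₂_pair (q := fun jk : κ × μ => q i₀ jk.1 jk.2) (fun jk => hq i₀ jk.1 jk.2)
    (j₀, k₀) (j₁, k₁) l₀ l₁ g]
  simp only [Prod.mk.injEq, and_assoc]

lemma expect_piProd₄_eval {q : ι → κ → μ → ν → A → ℝ} (hq : ∀ i j k l, ∑ a, q i j k l a = 1)
    (i₀ : ι) (j₀ : κ) (k₀ : μ) (l₀ : ν) (g : A → ℝ) :
    expect (piProd fun i => piProd fun j => piProd fun k => piProd (q i j k))
      (fun x => g (x i₀ j₀ k₀ l₀)) = expect (q i₀ j₀ k₀ l₀) g := by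
  rw [expect_piProd₄_eval_pair hq i₀ j₀ j₀ k₀ k₀ l₀ l₀ (fun a _ => g a)]
  simp only [repeatKernel_true, expect_dirac]

end layers

section layered

variable {ι κ μ ν ο V τ α β γ δ ξ₁ ξ₂ ζ : Type*} [Fintype ι] [Fintype κ] [Fintype μ] [Fintype ν]
  [Fintype ο] [Fintype V] [DecidableEq ι] [DecidableEq κ] [DecidableEq μ] [DecidableEq ν]
  [DecidableEq ο] [DecidableEq V] [Fintype τ] [Fintype α] [Fintype β] [Fintype γ] [Fintype δ]
  [Fintype ξ₁] [Fintype ξ₂] [Fintype ζ]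

/-- The expectation of a function of the codewords of a layered random codebook that belong to two
index tuples and of the output `z`, which depends on the codewords of the first tuple only. -/
lemma expect_layers {qT : τ → ℝ} {qA : α → ℝ} {qB : α → β → ℝ} {qC : τ → γ → ℝ} {qD : δ → ℝ}
    {qE : τ → γ → δ → ξ₁ → ℝ} {qG : τ → α → β → ξ₂ → ℝ} (qZ : ξ₁ → ξ₂ → ζ → ℝ)
    (hT : ∑ x, qT x = 1) (hA : ∑ x, qA x = 1) (hB : ∀ a, ∑ x, qB a x = 1) (hC : ∀ t, ∑ x, qC t x = 1)
    (hD : ∑ x, qD x = 1) (hE : ∀ t c d, ∑ x, qE t c d x = 1) (hG : ∀ t a b, ∑ x, qG t a b x = 1)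
    (bin : τ → α → (V → β) → V) (i i' j j' : ι) (k k' : κ) (l l' : μ) (m m' : ν) (o o' : ο)
    (F : τ → τ → α → α → (V → β) → (V → β) → γ → γ → δ → δ → ξ₁ → ξ₁ → ξ₂ → ζ → ℝ) :
    expect (piProd fun _ : ι => qT) (fun t =>
    expect (piProd fun _ : ν => qA) fun a =>
    expect (piProd fun m => piProd fun _ : ο => piProd fun _ : V => qB (a m)) fun b =>
    expect (piProd fun i => piProd fun _ : ι => qC (t i)) fun c =>
    expect (piProd fun _ : κ => qD) fun d =>
    expect (piProd fun i => piProd fun j => piProd fun k => piProd fun _ : μ =>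
      qE (t i) (c i j) (d k)) fun e =>
    expect (piProd fun i => piProd fun m => piProd fun o => piProd fun v =>
      qG (t i) (a m) (b m o v)) fun g =>
    expect (qZ (e i j k l) (g i m o (bin (t i) (a m) (b m o)))) fun z =>
      F (t i) (t i') (a m) (a m') (b m o) (b m' o') (c i j) (c i j') (d k) (d k')
        (e i j k l) (e i j' k' l') (g i m o (bin (t i) (a m) (b m o))) z) =
    expect qT fun t => expect qA fun a => expect (piProd fun _ : V => qB a) fun b =>
    expect (qC t) fun c => expect qD fun d => expect (qE t c d) fun e =>
    expect (qG t a (b (bin t a b))) fun g => expect (qZ e g) fun z =>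
    expect (repeatKernel (i' = i) qT t) fun t' =>
    expect (repeatKernel (m' = m) qA a) fun a' =>
    expect (repeatKernel ((m', o') = (m, o)) (piProd fun _ : V => qB a') b) fun b' =>
    expect (repeatKernel (j' = j) (qC t) c) fun c' =>
    expect (repeatKernel (k' = k) qD d) fun d' =>
    expect (repeatKernel ((j', k', l') = (j, k, l)) (qE t c' d') e) fun e' =>
      F t t' a a' b b' c c' d d' e e' g z := by
  have hB' : ∀ a, ∑ x, piProd (fun _ : V => qB a) x = 1 := fun a => piProd_stdSimplex_sum fun _ => hB a
  -- In the intermediate form each second codeword is drawn right after the first one of its layer,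
  -- as the pair lemmas produce it. It repeats the first codeword if the indices agree and is fresh
  -- otherwise.
  trans expect qT fun t => expect (repeatKernel (i' = i) qT t) fun t' =>
    expect qA fun a => expect (repeatKernel (m' = m) qA a) fun a' =>
    expect (piProd fun _ : V => qB a) fun b =>
    expect (repeatKernel ((m', o') = (m, o)) (piProd fun _ : V => qB a') b) fun b' =>
    expect (qC t) fun c => expect (repeatKernel (j' = j) (qC t) c) fun c' =>
    expect qD fun d => expect (repeatKernel (k' = k) qD d) fun d' =>
    expect (qE t c d) fun e =>
    expect (repeatKernel ((j', k', l') = (j, k, l)) (qE t c' d') e) fun e' =>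
    expect (qG t a (b (bin t a b))) fun g => expect (qZ e g) fun z =>
      F t t' a a' b b' c c' d d' e e' g z
  · refine (expect_congr fun t => ?_).trans (expect_piProd_pair (fun _ => hT) i i' _)
    refine (expect_congr fun a => ?_).trans (expect_piProd_pair (fun _ => hA) m m' _)
    refine (expect_congr fun b => ?_).trans
      (expect_piProd₂_pair (q := fun m _ => piProd fun _ : V => qB (a m)) (fun _ _ => hB' _) m m' o o' _)
    refine (expect_congr fun c => ?_).trans
      (expect_piProd_eval_pair (q := fun i _ => qC (t i)) (fun _ _ => hC _) i j j' _)
    refine (expect_congr fun d => ?_).trans (expect_piProd_pair (fun _ => hD) k k' _)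
    refine (expect_congr fun e => ?_).trans
      (expect_piProd₄_eval_pair (q := fun i j k (_ : μ) => qE (t i) (c i j) (d k))
        (fun _ _ _ _ => hE _ _ _) i j j' k k' l l' _)
    exact expect_piProd₄_eval (q := fun i m o v => qG (t i) (a m) (b m o v))
      (fun _ _ _ _ => hG _ _ _) i m o (bin (t i) (a m) (b m o)) (fun g =>
        expect (qZ (e i j k l) g) fun z =>
        F (t i) (t i') (a m) (a m') (b m o) (b m' o') (c i j) (c i j') (d k) (d k')
        (e i j k l) (e i j' k' l') g z)
  -- The kernels of the sent codewords and the output do not depend on the second codewords, whose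
  -- draws may therefore be moved to the end.
  · simp only [expect_comm (repeatKernel _ _ _) qA, expect_comm (repeatKernel _ _ _) (piProd _),
      expect_comm (repeatKernel _ _ _) (qC _), expect_comm (repeatKernel _ _ _) qD,
      expect_comm (repeatKernel _ _ _) (qE _ _ _), expect_comm (repeatKernel _ _ _) (qG _ _ _),
      expect_comm (repeatKernel _ _ _) (qZ _ _)]

end layered

/-! ### Packing of several superposed codewords -/

section packing

variable {Ω α α₁ α₂ α₃ α₄ β γ : Type*} [Fintype Ω] {p : Ω → ℝ} {n : ℕ} [Fintype α₁] [Fintype α₂]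
  [Fintype α₃] [Fintype α₄] [Fintype β] [Fintype γ] {A₁ : Ω → α₁} {A₂ : Ω → α₂} {A₃ : Ω → α₃}
  {A₄ : Ω → α₄} {B : Ω → β} {C : Ω → γ} {ε : ℝ} {b : Fin n → β} {c : Fin n → γ}

lemma mul_kernel_mem {A B : Type*} [Fintype A] [Fintype B] {q : A → ℝ} (hq : q ∈ stdSimplex ℝ A)
    {q' : A → B → ℝ} (hq' : ∀ a, q' a ∈ stdSimplex ℝ B) :
    (fun z : A × B => q z.1 * q' z.1 z.2) ∈ stdSimplex ℝ (A × B) := by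
  refine ⟨fun z => mul_nonneg (hq.1 _) ((hq' _).1 _), ?_⟩
  have := expect_expect q q' (fun _ _ => 1)
  simp only [expect, mul_one, (hq' _).2, hq.2] at this
  exact this.symm

/-- Superposed codewords drawn one after the other form a single codeword over the product alphabet,
with the product of the kernels; the versions with three and four layers iterate this. -/
lemma expect_typical_le₂ (hp : ∀ ω, 0 ≤ p ω) {q₁ : γ → α₁ → ℝ} {q₂ : γ → α₁ → α₂ → ℝ}
    (hq₁ : ∀ c, q₁ c ∈ stdSimplex ℝ α₁) (hq₂ : ∀ c a₁, q₂ c a₁ ∈ stdSimplex ℝ α₂) {f : γ → ℝ}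
    (hf : ∀ a₁ a₂ c, prob p (fun ω => A₁ ω = a₁ ∧ A₂ ω = a₂ ∧ C ω = c) = f c * (q₁ c a₁ * q₂ c a₁ a₂)) :
    expect (piProd fun k => q₁ (c k)) (fun a₁ => expect (piProd fun k => q₂ (c k) (a₁ k)) fun a₂ =>
      ind (Typical p (fun ω => ((A₁ ω, A₂ ω), B ω, C ω)) ε (fun k => ((a₁ k, a₂ k), b k, c k)))) ≤
    (2 : ℝ) ^ (-(n * (condMI p (fun ω => (A₁ ω, A₂ ω)) B C -
      ε * infoDev p (fun ω => (A₁ ω, A₂ ω)) B C))) := by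
  rw [expect_piProd_piProd (fun k => q₁ (c k)) (fun k => q₂ (c k))]
  exact expect_typical_le (A := fun ω => (A₁ ω, A₂ ω)) (α := α₁ × α₂) hp
    (q := fun c z => q₁ c z.1 * q₂ c z.1 z.2) (fun c => mul_kernel_mem (hq₁ c) (hq₂ c)) (f := f)
    fun a c => by rw [← hf]; exact prob_congr fun ω => by rw [Prod.ext_iff, and_assoc]

lemma expect_typical_le₃ (hp : ∀ ω, 0 ≤ p ω) {q₁ : γ → α₁ → ℝ} {q₂ : γ → α₁ → α₂ → ℝ}
    {q₃ : γ → α₁ → α₂ → α₃ → ℝ}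
    (hq₁ : ∀ c, q₁ c ∈ stdSimplex ℝ α₁) (hq₂ : ∀ c a₁, q₂ c a₁ ∈ stdSimplex ℝ α₂)
    (hq₃ : ∀ c a₁ a₂, q₃ c a₁ a₂ ∈ stdSimplex ℝ α₃) {f : γ → ℝ}
    (hf : ∀ a₁ a₂ a₃ c, prob p (fun ω => A₁ ω = a₁ ∧ A₂ ω = a₂ ∧ A₃ ω = a₃ ∧ C ω = c) =
      f c * (q₁ c a₁ * q₂ c a₁ a₂ * q₃ c a₁ a₂ a₃)) :
    expect (piProd fun k => q₁ (c k)) (fun a₁ => expect (piProd fun k => q₂ (c k) (a₁ k)) fun a₂ =>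
      expect (piProd fun k => q₃ (c k) (a₁ k) (a₂ k)) fun a₃ =>
      ind (Typical p (fun ω => (((A₁ ω, A₂ ω), A₃ ω), B ω, C ω)) ε
        (fun k => (((a₁ k, a₂ k), a₃ k), b k, c k)))) ≤
    (2 : ℝ) ^ (-(n * (condMI p (fun ω => ((A₁ ω, A₂ ω), A₃ ω)) B C -
      ε * infoDev p (fun ω => ((A₁ ω, A₂ ω), A₃ ω)) B C))) := by
  rw [expect_piProd_piProd (fun k => q₁ (c k)) (fun k => q₂ (c k))
    (fun a₁ a₂ => expect (piProd fun k => q₃ (c k) (a₁ k) (a₂ k)) fun a₃ =>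
      ind (Typical p (fun ω => (((A₁ ω, A₂ ω), A₃ ω), B ω, C ω)) ε
        (fun k => (((a₁ k, a₂ k), a₃ k), b k, c k))))]
  exact expect_typical_le₂ (A₁ := fun ω => (A₁ ω, A₂ ω)) (A₂ := A₃) (α₁ := α₁ × α₂) hp
    (q₁ := fun c z => q₁ c z.1 * q₂ c z.1 z.2) (q₂ := fun c z => q₃ c z.1 z.2)
    (fun c => mul_kernel_mem (hq₁ c) (hq₂ c)) (fun c z => hq₃ c z.1 z.2) (f := f)
    fun a a₃ c => by rw [← hf]; exact prob_congr fun ω => by rw [Prod.ext_iff, and_assoc]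

lemma expect_typical_le₄ (hp : ∀ ω, 0 ≤ p ω) {q₁ : γ → α₁ → ℝ} {q₂ : γ → α₁ → α₂ → ℝ}
    {q₃ : γ → α₁ → α₂ → α₃ → ℝ} {q₄ : γ → α₁ → α₂ → α₃ → α₄ → ℝ}
    (hq₁ : ∀ c, q₁ c ∈ stdSimplex ℝ α₁) (hq₂ : ∀ c a₁, q₂ c a₁ ∈ stdSimplex ℝ α₂)
    (hq₃ : ∀ c a₁ a₂, q₃ c a₁ a₂ ∈ stdSimplex ℝ α₃)
    (hq₄ : ∀ c a₁ a₂ a₃, q₄ c a₁ a₂ a₃ ∈ stdSimplex ℝ α₄) {f : γ → ℝ}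
    (hf : ∀ a₁ a₂ a₃ a₄ c, prob p (fun ω => A₁ ω = a₁ ∧ A₂ ω = a₂ ∧ A₃ ω = a₃ ∧ A₄ ω = a₄ ∧ C ω = c) =
      f c * (q₁ c a₁ * q₂ c a₁ a₂ * q₃ c a₁ a₂ a₃ * q₄ c a₁ a₂ a₃ a₄)) :
    expect (piProd fun k => q₁ (c k)) (fun a₁ => expect (piProd fun k => q₂ (c k) (a₁ k)) fun a₂ =>
      expect (piProd fun k => q₃ (c k) (a₁ k) (a₂ k)) fun a₃ =>
      expect (piProd fun k => q₄ (c k) (a₁ k) (a₂ k) (a₃ k)) fun a₄ =>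
      ind (Typical p (fun ω => ((((A₁ ω, A₂ ω), A₃ ω), A₄ ω), B ω, C ω)) ε
        (fun k => ((((a₁ k, a₂ k), a₃ k), a₄ k), b k, c k)))) ≤
    (2 : ℝ) ^ (-(n * (condMI p (fun ω => (((A₁ ω, A₂ ω), A₃ ω), A₄ ω)) B C -
      ε * infoDev p (fun ω => (((A₁ ω, A₂ ω), A₃ ω), A₄ ω)) B C))) := by
  rw [expect_piProd_piProd (fun k => q₁ (c k)) (fun k => q₂ (c k))
    (fun a₁ a₂ => expect (piProd fun k => q₃ (c k) (a₁ k) (a₂ k)) fun a₃ =>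
      expect (piProd fun k => q₄ (c k) (a₁ k) (a₂ k) (a₃ k)) fun a₄ =>
      ind (Typical p (fun ω => ((((A₁ ω, A₂ ω), A₃ ω), A₄ ω), B ω, C ω)) ε
        (fun k => ((((a₁ k, a₂ k), a₃ k), a₄ k), b k, c k))))]
  exact expect_typical_le₃ (A₁ := fun ω => (A₁ ω, A₂ ω)) (A₂ := A₃) (A₃ := A₄) (α₁ := α₁ × α₂) hp
    (q₁ := fun c z => q₁ c z.1 * q₂ c z.1 z.2) (q₂ := fun c z => q₃ c z.1 z.2)
    (q₃ := fun c z => q₄ c z.1 z.2)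
    (fun c => mul_kernel_mem (hq₁ c) (hq₂ c)) (fun c z => hq₃ c z.1 z.2)
    (fun c z => hq₄ c z.1 z.2) (f := f)
    fun a a₃ a₄ c => by rw [← hf]; exact prob_congr fun ω => by rw [Prod.ext_iff, and_assoc]

end packing

/-! ### Packing for the decoders of the scheme -/

namespace HKPDFDist

variable {X₁ X₂ Y₁ Y₂ Y : Type*} [Fintype X₁] [Fintype X₂] [Fintype Y₁] [Fintype Y₂] [Fintype Y]
variable (P : HKPDFDist X₁ X₂) (ch : CRC X₁ X₂ Y₁ Y₂ Y) {n : ℕ}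

/-- The typicality test at the second sender. -/
def RelayTypical (ε : ℝ) (t : Fin n → Fin P.kT₁₀) (u : Fin n → Fin P.kU₁₀) (y : Fin n → Y) : Prop :=
  Typical (P.joint ch) (fun s => (s.t₁₀, s.u₁₀, s.y)) ε fun k => (t k, u k, y k)

/-- The typicality test at the first receiver in a block. -/
def RecvTypical₁ (ε : ℝ) (t : Fin n → Fin P.kT₁₀) (u : Fin n → Fin P.kU₁₀) (v : Fin n → Fin P.kU₁₁)
    (x : Fin n → X₁) (w : Fin n → Fin P.kU₂₁) (y₁ : Fin n → Y₁) : Prop :=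
  Typical (P.joint ch) (fun s => (s.t₁₀, s.u₁₀, s.u₁₁, s.x₁, s.u₂₁, s.y₁)) ε
    fun k => (t k, u k, v k, x k, w k, y₁ k)

/-- The typicality test at the first receiver in the next block. -/
def NextTypical₁ (ε : ℝ) (t : Fin n → Fin P.kT₁₀) (y₁ : Fin n → Y₁) : Prop :=
  Typical (P.joint ch) (fun s => (s.t₁₀, s.y₁)) ε fun k => (t k, y₁ k)

/-- The typicality test at the second receiver. -/
def RecvTypical₂ (ε : ℝ) (v : Fin n → Fin P.kU₁₁) (w : Fin n → Fin P.kU₂₁) (z : Fin n → Fin P.kU₂₂)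
    (y₂ : Fin n → Y₂) : Prop :=
  Typical (P.joint ch) (fun s => (s.u₁₁, s.u₂₁, s.u₂₂, s.y₂)) ε fun k => (v k, w k, z k, y₂ k)

/-- In this and the following bounds D is chosen before n, ε and the sequences, so that a single ε
serves all blocks and lengths. -/
lemma packing_relay : ∃ D, 0 ≤ D ∧ ∀ (n : ℕ) (ε : ℝ) (t : Fin n → Fin P.kT₁₀) (y : Fin n → Y),
    expect (piProd fun k => P.pU₁₀ (t k)) (fun u => ind (P.RelayTypical ch ε t u y)) ≤
      (2 : ℝ) ^ (-(n * (P.I₂ ch - ε * D))) := by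
  refine ⟨_, infoDev_nonneg (P.joint_mem ch).1 (·.u₁₀) (·.y) (·.t₁₀), fun n ε t y => ?_⟩
  refine (expect_mono (piProd_nonneg fun k => (P.pU₁₀_mem _).1) fun u => ind_mono fun h => ?_).trans
    (expect_typical_le (p := P.joint ch) (b := y) (c := t) (joint_mem P ch).1 (q := P.pU₁₀) P.pU₁₀_mem
      (f := P.pT₁₀) fun u t => by
        rw [← P.law_relay ch]; exact prob_congr fun _ => and_comm)
  -- The test of the decoder lists the variables in another order than the packing lemma.
  exact h.map fun w => (w.2.1, w.2.2, w.1)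

/-- Unconditional packing, as the case of a constant conditioning variable. -/
lemma packing_next : ∃ D, 0 ≤ D ∧ ∀ (n : ℕ) (ε : ℝ) (y₁ : Fin n → Y₁),
    expect (piProd fun _ => P.pT₁₀) (fun t => ind (P.NextTypical₁ ch ε t y₁)) ≤
      (2 : ℝ) ^ (-(n * (mutualInfo (P.joint ch) (·.t₁₀) (·.y₁) - ε * D))) := by
  refine ⟨_, infoDev_nonneg (P.joint_mem ch).1 (·.t₁₀) (·.y₁) (fun _ => ()), fun n ε y => ?_⟩
  refine (expect_mono (piProd_nonneg fun k => P.pT₁₀_mem.1) fun u => ind_mono fun h => ?_).trans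
    (expect_typical_le (p := P.joint ch) (b := y) (c := fun _ => ()) (joint_mem P ch).1
      (q := fun _ => P.pT₁₀) (fun _ => P.pT₁₀_mem) (f := fun _ => 1) fun t _ => by
        rw [one_mul, ← P.law_t₁₀ ch]; exact prob_congr fun _ => by simp)
  exact h.map fun w => (w.1, w.2, ())

/-! ### Packing at the first receiver, by the pattern of wrong indices. -/

section receiver₁

lemma packing_x₁ : ∃ D, 0 ≤ D ∧ ∀ (n : ℕ) (ε : ℝ) (t : Fin n → Fin P.kT₁₀)
    (u : Fin n → Fin P.kU₁₀) (v : Fin n → Fin P.kU₁₁) (w : Fin n → Fin P.kU₂₁) (y₁ : Fin n → Y₁),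
    expect (piProd fun k => P.pX₁ (t k) (u k) (v k))
      (fun x => ind (P.RecvTypical₁ ch ε t u v x w y₁)) ≤
      (2 : ℝ) ^ (-(n * (P.I₃ ch - ε * D))) := by
  refine ⟨_, infoDev_nonneg (P.joint_mem ch).1 (·.x₁) (·.y₁)
    (fun s => (s.t₁₀, s.u₁₀, s.u₁₁, s.u₂₁)), fun n ε t u v w y₁ => ?_⟩
  refine (expect_mono (piProd_nonneg fun k => (P.pX₁_mem _ _ _).1) fun x =>
    ind_mono fun h => ?_).trans
    (expect_typical_le (p := P.joint ch) (A := (·.x₁)) (B := (·.y₁)) (b := y₁)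
      (C := fun s => (s.t₁₀, s.u₁₀, s.u₁₁, s.u₂₁)) (c := fun k => (t k, u k, v k, w k))
      (joint_mem P ch).1 (q := fun c => P.pX₁ c.1 c.2.1 c.2.2.1) (fun _ => P.pX₁_mem _ _ _)
      (f := fun c => P.pT₁₀ c.1 * P.pU₁₀ c.1 c.2.1 * P.pU₁₁ c.2.2.1 * P.pU₂₁ c.2.2.2) fun x c =>
        (prob_congr fun s => by simp only [Prod.ext_iff]; tauto).trans
          ((P.law_sender₁_public₂ ch c.1 c.2.1 c.2.2.1 x c.2.2.2).trans (by ring)))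
  exact h.map fun a => (a.2.2.2.1, a.2.2.2.2.2, a.1, a.2.1, a.2.2.1, a.2.2.2.2.1)

lemma packing_u₁₀_x₁ : ∃ D, 0 ≤ D ∧ ∀ (n : ℕ) (ε : ℝ) (t : Fin n → Fin P.kT₁₀)
    (v : Fin n → Fin P.kU₁₁) (w : Fin n → Fin P.kU₂₁) (y₁ : Fin n → Y₁),
    expect (piProd fun k => P.pU₁₀ (t k)) (fun u => expect (piProd fun k => P.pX₁ (t k) (u k) (v k))
      (fun x => ind (P.RecvTypical₁ ch ε t u v x w y₁))) ≤
      (2 : ℝ) ^ (-(n * (condMI (P.joint ch) (fun s => (s.u₁₀, s.x₁)) (·.y₁)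
        (fun s => (s.t₁₀, s.u₁₁, s.u₂₁)) - ε * D))) := by
  refine ⟨_, infoDev_nonneg (P.joint_mem ch).1 (fun s => (s.u₁₀, s.x₁)) (·.y₁)
    (fun s => (s.t₁₀, s.u₁₁, s.u₂₁)), fun n ε t v w y₁ => ?_⟩
  refine (expect_mono (piProd_nonneg fun k => (P.pU₁₀_mem _).1) fun u =>
    expect_mono (piProd_nonneg fun k => (P.pX₁_mem _ _ _).1) fun x => ind_mono fun h => ?_).trans
    (expect_typical_le₂ (p := P.joint ch) (A₁ := (·.u₁₀)) (A₂ := (·.x₁)) (B := (·.y₁)) (b := y₁)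
      (C := fun s => (s.t₁₀, s.u₁₁, s.u₂₁)) (c := fun k => (t k, v k, w k)) (joint_mem P ch).1
      (q₁ := fun c => P.pU₁₀ c.1) (q₂ := fun c u => P.pX₁ c.1 u c.2.1)
      (fun _ => P.pU₁₀_mem _) (fun _ _ => P.pX₁_mem _ _ _)
      (f := fun c => P.pT₁₀ c.1 * P.pU₁₁ c.2.1 * P.pU₂₁ c.2.2) fun u x c =>
        (prob_congr fun s => by simp only [Prod.ext_iff]; tauto).trans
          ((P.law_sender₁_public₂ ch c.1 u c.2.1 x c.2.2).trans (by ring)))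
  exact h.map fun a => ((a.2.1, a.2.2.2.1), a.2.2.2.2.2, a.1, a.2.2.1, a.2.2.2.2.1)

lemma packing_u₁₁_x₁ : ∃ D, 0 ≤ D ∧ ∀ (n : ℕ) (ε : ℝ) (t : Fin n → Fin P.kT₁₀)
    (u : Fin n → Fin P.kU₁₀) (w : Fin n → Fin P.kU₂₁) (y₁ : Fin n → Y₁),
    expect (piProd fun _ => P.pU₁₁) (fun v => expect (piProd fun k => P.pX₁ (t k) (u k) (v k))
      (fun x => ind (P.RecvTypical₁ ch ε t u v x w y₁))) ≤
      (2 : ℝ) ^ (-(n * (P.I₅ ch - ε * D))) := by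
  refine ⟨_, infoDev_nonneg (P.joint_mem ch).1 (fun s => (s.u₁₁, s.x₁)) (·.y₁)
    (fun s => (s.t₁₀, s.u₁₀, s.u₂₁)), fun n ε t u w y₁ => ?_⟩
  refine (expect_mono (piProd_nonneg fun k => P.pU₁₁_mem.1) fun v =>
    expect_mono (piProd_nonneg fun k => (P.pX₁_mem _ _ _).1) fun x => ind_mono fun h => ?_).trans
    (expect_typical_le₂ (p := P.joint ch) (A₁ := (·.u₁₁)) (A₂ := (·.x₁)) (B := (·.y₁)) (b := y₁)
      (C := fun s => (s.t₁₀, s.u₁₀, s.u₂₁)) (c := fun k => (t k, u k, w k)) (joint_mem P ch).1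
      (q₁ := fun _ => P.pU₁₁) (q₂ := fun c v => P.pX₁ c.1 c.2.1 v)
      (fun _ => P.pU₁₁_mem) (fun _ _ => P.pX₁_mem _ _ _)
      (f := fun c => P.pT₁₀ c.1 * P.pU₁₀ c.1 c.2.1 * P.pU₂₁ c.2.2) fun v x c =>
        (prob_congr fun s => by simp only [Prod.ext_iff]; tauto).trans
          ((P.law_sender₁_public₂ ch c.1 c.2.1 v x c.2.2).trans (by ring)))
  exact h.map fun a => ((a.2.2.1, a.2.2.2.1), a.2.2.2.2.2, a.1, a.2.1, a.2.2.2.2.1)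

lemma packing_u₁₀_u₁₁_x₁ : ∃ D, 0 ≤ D ∧ ∀ (n : ℕ) (ε : ℝ) (t : Fin n → Fin P.kT₁₀)
    (w : Fin n → Fin P.kU₂₁) (y₁ : Fin n → Y₁),
    expect (piProd fun k => P.pU₁₀ (t k)) (fun u => expect (piProd fun _ => P.pU₁₁) (fun v =>
      expect (piProd fun k => P.pX₁ (t k) (u k) (v k))
      (fun x => ind (P.RecvTypical₁ ch ε t u v x w y₁)))) ≤
      (2 : ℝ) ^ (-(n * (condMI (P.joint ch) (fun s => (s.u₁₀, s.u₁₁, s.x₁)) (·.y₁)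
        (fun s => (s.t₁₀, s.u₂₁)) - ε * D))) := by
  refine ⟨_, infoDev_nonneg (P.joint_mem ch).1 (fun s => ((s.u₁₀, s.u₁₁), s.x₁)) (·.y₁)
    (fun s => (s.t₁₀, s.u₂₁)), fun n ε t w y₁ => ?_⟩
  have hI : condMI (P.joint ch) (fun s => (s.u₁₀, s.u₁₁, s.x₁)) (·.y₁) (fun s => (s.t₁₀, s.u₂₁)) =
      condMI (P.joint ch) (fun s => ((s.u₁₀, s.u₁₁), s.x₁)) (·.y₁) (fun s => (s.t₁₀, s.u₂₁)) := by
    simp only [condMI, Prod.mk.injEq, and_assoc]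
  rw [hI]
  refine (expect_mono (piProd_nonneg fun k => (P.pU₁₀_mem _).1) fun u =>
    expect_mono (piProd_nonneg fun k => P.pU₁₁_mem.1) fun v =>
    expect_mono (piProd_nonneg fun k => (P.pX₁_mem _ _ _).1) fun x => ind_mono fun h => ?_).trans
    (expect_typical_le₃ (p := P.joint ch) (A₁ := (·.u₁₀)) (A₂ := (·.u₁₁)) (A₃ := (·.x₁))
      (B := (·.y₁)) (b := y₁)
      (C := fun s => (s.t₁₀, s.u₂₁)) (c := fun k => (t k, w k)) (joint_mem P ch).1
      (q₁ := fun c => P.pU₁₀ c.1) (q₂ := fun _ _ => P.pU₁₁) (q₃ := fun c u v => P.pX₁ c.1 u v)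
      (fun _ => P.pU₁₀_mem _) (fun _ _ => P.pU₁₁_mem) (fun _ _ _ => P.pX₁_mem _ _ _)
      (f := fun c => P.pT₁₀ c.1 * P.pU₂₁ c.2) fun u v x c =>
        (prob_congr fun s => by simp only [Prod.ext_iff]; tauto).trans
          ((P.law_sender₁_public₂ ch c.1 u v x c.2).trans (by ring)))
  exact h.map fun a => (((a.2.1, a.2.2.1), a.2.2.2.1), a.2.2.2.2.2, a.1, a.2.2.2.2.1)

/-- T₁ does not care about w₂₁, but a wrong w₂₁ together with a wrong w₁₂ still has to be excluded;
u₂₁ is drawn first because x₁ does not depend on it. -/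
lemma packing_u₂₁_x₁ : ∃ D, 0 ≤ D ∧ ∀ (n : ℕ) (ε : ℝ) (t : Fin n → Fin P.kT₁₀)
    (u : Fin n → Fin P.kU₁₀) (v : Fin n → Fin P.kU₁₁) (y₁ : Fin n → Y₁),
    expect (piProd fun _ => P.pU₂₁) (fun w => expect (piProd fun k => P.pX₁ (t k) (u k) (v k))
      (fun x => ind (P.RecvTypical₁ ch ε t u v x w y₁))) ≤
      (2 : ℝ) ^ (-(n * (P.I₇ ch - ε * D))) := by
  refine ⟨_, infoDev_nonneg (P.joint_mem ch).1 (fun s => (s.u₂₁, s.x₁)) (·.y₁)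
    (fun s => (s.t₁₀, s.u₁₀, s.u₁₁)), fun n ε t u v y₁ => ?_⟩
  have hI : P.I₇ ch = condMI (P.joint ch) (fun s => (s.u₂₁, s.x₁)) (·.y₁)
      (fun s => (s.t₁₀, s.u₁₀, s.u₁₁)) := by
    simp only [I₇, condMI_joint, Prod.mk.injEq, and_assoc, and_left_comm]
  rw [hI]
  refine (expect_mono (piProd_nonneg fun k => P.pU₂₁_mem.1) fun w =>
    expect_mono (piProd_nonneg fun k => (P.pX₁_mem _ _ _).1) fun x => ind_mono fun h => ?_).trans
    (expect_typical_le₂ (p := P.joint ch) (A₁ := (·.u₂₁)) (A₂ := (·.x₁)) (B := (·.y₁)) (b := y₁)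
      (C := fun s => (s.t₁₀, s.u₁₀, s.u₁₁)) (c := fun k => (t k, u k, v k)) (joint_mem P ch).1
      (q₁ := fun _ => P.pU₂₁) (q₂ := fun c _ => P.pX₁ c.1 c.2.1 c.2.2)
      (fun _ => P.pU₂₁_mem) (fun _ _ => P.pX₁_mem _ _ _)
      (f := fun c => P.pT₁₀ c.1 * P.pU₁₀ c.1 c.2.1 * P.pU₁₁ c.2.2) fun w x c =>
        (prob_congr fun s => by simp only [Prod.ext_iff]; tauto).trans
          ((P.law_sender₁_public₂ ch c.1 c.2.1 c.2.2 x w).trans (by ring)))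
  exact h.map fun a => ((a.2.2.2.2.1, a.2.2.2.1), a.2.2.2.2.2, a.1, a.2.1, a.2.2.1)

lemma packing_u₂₁_u₁₀_x₁ : ∃ D, 0 ≤ D ∧ ∀ (n : ℕ) (ε : ℝ) (t : Fin n → Fin P.kT₁₀)
    (v : Fin n → Fin P.kU₁₁) (y₁ : Fin n → Y₁),
    expect (piProd fun _ => P.pU₂₁) (fun w => expect (piProd fun k => P.pU₁₀ (t k)) (fun u =>
      expect (piProd fun k => P.pX₁ (t k) (u k) (v k))
      (fun x => ind (P.RecvTypical₁ ch ε t u v x w y₁)))) ≤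
      (2 : ℝ) ^ (-(n * (condMI (P.joint ch) (fun s => (s.u₁₀, s.x₁, s.u₂₁)) (·.y₁)
        (fun s => (s.t₁₀, s.u₁₁)) - ε * D))) := by
  refine ⟨_, infoDev_nonneg (P.joint_mem ch).1 (fun s => ((s.u₂₁, s.u₁₀), s.x₁)) (·.y₁)
    (fun s => (s.t₁₀, s.u₁₁)), fun n ε t v y₁ => ?_⟩
  have hI : condMI (P.joint ch) (fun s => (s.u₁₀, s.x₁, s.u₂₁)) (·.y₁) (fun s => (s.t₁₀, s.u₁₁)) =
      condMI (P.joint ch) (fun s => ((s.u₂₁, s.u₁₀), s.x₁)) (·.y₁) (fun s => (s.t₁₀, s.u₁₁)) := by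
    simp only [condMI_joint, Prod.mk.injEq, and_assoc, and_left_comm]
  rw [hI]
  refine (expect_mono (piProd_nonneg fun k => P.pU₂₁_mem.1) fun w =>
    expect_mono (piProd_nonneg fun k => (P.pU₁₀_mem _).1) fun u =>
    expect_mono (piProd_nonneg fun k => (P.pX₁_mem _ _ _).1) fun x => ind_mono fun h => ?_).trans
    (expect_typical_le₃ (p := P.joint ch) (A₁ := (·.u₂₁)) (A₂ := (·.u₁₀)) (A₃ := (·.x₁))
      (B := (·.y₁)) (b := y₁)
      (C := fun s => (s.t₁₀, s.u₁₁)) (c := fun k => (t k, v k)) (joint_mem P ch).1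
      (q₁ := fun _ => P.pU₂₁) (q₂ := fun c _ => P.pU₁₀ c.1) (q₃ := fun c _ u => P.pX₁ c.1 u c.2)
      (fun _ => P.pU₂₁_mem) (fun _ _ => P.pU₁₀_mem _) (fun _ _ _ => P.pX₁_mem _ _ _)
      (f := fun c => P.pT₁₀ c.1 * P.pU₁₁ c.2) fun w u x c =>
        (prob_congr fun s => by simp only [Prod.ext_iff]; tauto).trans
          ((P.law_sender₁_public₂ ch c.1 u c.2 x w).trans (by ring)))
  exact h.map fun a => (((a.2.2.2.2.1, a.2.1), a.2.2.2.1), a.2.2.2.2.2, a.1, a.2.2.1)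

lemma packing_u₂₁_u₁₁_x₁ : ∃ D, 0 ≤ D ∧ ∀ (n : ℕ) (ε : ℝ) (t : Fin n → Fin P.kT₁₀)
    (u : Fin n → Fin P.kU₁₀) (y₁ : Fin n → Y₁),
    expect (piProd fun _ => P.pU₂₁) (fun w => expect (piProd fun _ => P.pU₁₁) (fun v =>
      expect (piProd fun k => P.pX₁ (t k) (u k) (v k))
      (fun x => ind (P.RecvTypical₁ ch ε t u v x w y₁)))) ≤
      (2 : ℝ) ^ (-(n * (P.I₉ ch - ε * D))) := by
  refine ⟨_, infoDev_nonneg (P.joint_mem ch).1 (fun s => ((s.u₂₁, s.u₁₁), s.x₁)) (·.y₁)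
    (fun s => (s.t₁₀, s.u₁₀)), fun n ε t u y₁ => ?_⟩
  have hI : P.I₉ ch =
      condMI (P.joint ch) (fun s => ((s.u₂₁, s.u₁₁), s.x₁)) (·.y₁) (fun s => (s.t₁₀, s.u₁₀)) := by
    simp only [I₉, condMI_joint, Prod.mk.injEq, and_assoc, and_left_comm]
  rw [hI]
  refine (expect_mono (piProd_nonneg fun k => P.pU₂₁_mem.1) fun w =>
    expect_mono (piProd_nonneg fun k => P.pU₁₁_mem.1) fun v =>
    expect_mono (piProd_nonneg fun k => (P.pX₁_mem _ _ _).1) fun x => ind_mono fun h => ?_).trans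
    (expect_typical_le₃ (p := P.joint ch) (A₁ := (·.u₂₁)) (A₂ := (·.u₁₁)) (A₃ := (·.x₁))
      (B := (·.y₁)) (b := y₁)
      (C := fun s => (s.t₁₀, s.u₁₀)) (c := fun k => (t k, u k)) (joint_mem P ch).1
      (q₁ := fun _ => P.pU₂₁) (q₂ := fun _ _ => P.pU₁₁) (q₃ := fun c _ v => P.pX₁ c.1 c.2 v)
      (fun _ => P.pU₂₁_mem) (fun _ _ => P.pU₁₁_mem) (fun _ _ _ => P.pX₁_mem _ _ _)
      (f := fun c => P.pT₁₀ c.1 * P.pU₁₀ c.1 c.2) fun w v x c =>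
        (prob_congr fun s => by simp only [Prod.ext_iff]; tauto).trans
          ((P.law_sender₁_public₂ ch c.1 c.2 v x w).trans (by ring)))
  exact h.map fun a => (((a.2.2.2.2.1, a.2.2.1), a.2.2.2.1), a.2.2.2.2.2, a.1, a.2.1)

lemma packing_u₂₁_u₁₀_u₁₁_x₁ : ∃ D, 0 ≤ D ∧ ∀ (n : ℕ) (ε : ℝ) (t : Fin n → Fin P.kT₁₀)
    (y₁ : Fin n → Y₁),
    expect (piProd fun _ => P.pU₂₁) (fun w => expect (piProd fun k => P.pU₁₀ (t k)) (fun u =>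
      expect (piProd fun _ => P.pU₁₁) (fun v => expect (piProd fun k => P.pX₁ (t k) (u k) (v k))
      (fun x => ind (P.RecvTypical₁ ch ε t u v x w y₁))))) ≤
      (2 : ℝ) ^ (-(n * (condMI (P.joint ch) (fun s => (s.u₁₀, s.u₁₁, s.x₁, s.u₂₁)) (·.y₁)
        (·.t₁₀) - ε * D))) := by
  refine ⟨_, infoDev_nonneg (P.joint_mem ch).1 (fun s => (((s.u₂₁, s.u₁₀), s.u₁₁), s.x₁)) (·.y₁)
    (·.t₁₀), fun n ε t y₁ => ?_⟩
  have hI : condMI (P.joint ch) (fun s => (s.u₁₀, s.u₁₁, s.x₁, s.u₂₁)) (·.y₁) (·.t₁₀) =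
      condMI (P.joint ch) (fun s => (((s.u₂₁, s.u₁₀), s.u₁₁), s.x₁)) (·.y₁) (·.t₁₀) := by
    simp only [condMI_joint, Prod.mk.injEq, and_assoc, and_left_comm]
  rw [hI]
  refine (expect_mono (piProd_nonneg fun k => P.pU₂₁_mem.1) fun w =>
    expect_mono (piProd_nonneg fun k => (P.pU₁₀_mem _).1) fun u =>
    expect_mono (piProd_nonneg fun k => P.pU₁₁_mem.1) fun v =>
    expect_mono (piProd_nonneg fun k => (P.pX₁_mem _ _ _).1) fun x => ind_mono fun h => ?_).trans
    (expect_typical_le₄ (p := P.joint ch) (A₁ := (·.u₂₁)) (A₂ := (·.u₁₀)) (A₃ := (·.u₁₁))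
      (A₄ := (·.x₁)) (B := (·.y₁)) (b := y₁) (C := (·.t₁₀)) (c := t) (joint_mem P ch).1
      (q₁ := fun _ => P.pU₂₁) (q₂ := fun c _ => P.pU₁₀ c) (q₃ := fun _ _ _ => P.pU₁₁)
      (q₄ := fun c _ u v => P.pX₁ c u v)
      (fun _ => P.pU₂₁_mem) (fun _ _ => P.pU₁₀_mem _) (fun _ _ _ => P.pU₁₁_mem)
      (fun _ _ _ _ => P.pX₁_mem _ _ _)
      (f := fun c => P.pT₁₀ c) fun w u v x c =>
        (prob_congr fun s => by tauto).trans
          ((P.law_sender₁_public₂ ch c u v x w).trans (by ring)))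
  exact h.map fun a => ((((a.2.2.2.2.1, a.2.1), a.2.2.1), a.2.2.2.1), a.2.2.2.2.2, a.1)

end receiver₁

/-! ### Packing at the second receiver, by the pattern of wrong indices. -/

section receiver₂

/-- The codebook kernel p(u₂₂|u₂₁) is also the conditional law given (U₂₁,U₁₁), as U₁₁ is
independent of the second user's variables; no loss for binning arises here, it is paid by the
number of bin indices. -/
lemma packing_u₂₂ : ∃ D, 0 ≤ D ∧ ∀ (n : ℕ) (ε : ℝ) (v : Fin n → Fin P.kU₁₁)
    (w : Fin n → Fin P.kU₂₁) (y₂ : Fin n → Y₂),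
    expect (piProd fun k => P.pU₂₂Marg (w k)) (fun z => ind (P.RecvTypical₂ ch ε v w z y₂)) ≤
      (2 : ℝ) ^ (-(n * (P.I₁₁ ch - ε * D))) := by
  refine ⟨_, infoDev_nonneg (P.joint_mem ch).1 (·.u₂₂) (·.y₂)
    (fun s => (s.u₂₁, s.u₁₁)), fun n ε v w y₂ => ?_⟩
  refine (expect_mono (piProd_nonneg fun k => (P.pU₂₂Marg_mem _).1) fun z =>
    ind_mono fun h => ?_).trans
    (expect_typical_le (p := P.joint ch) (A := (·.u₂₂)) (B := (·.y₂)) (b := y₂)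
      (C := fun s => (s.u₂₁, s.u₁₁)) (c := fun k => (w k, v k))
      (joint_mem P ch).1 (q := fun c => P.pU₂₂Marg c.1) (fun _ => P.pU₂₂Marg_mem _)
      (f := fun c => P.pU₁₁ c.2 * P.pU₂₁ c.1) fun z c =>
        (prob_congr fun s => by simp only [Prod.ext_iff]; tauto).trans
          (P.law_sender₂_public₁ ch c.2 c.1 z))
  exact h.map fun a => (a.2.2.1, a.2.2.2, a.2.1, a.1)

lemma packing_u₂₁_u₂₂ : ∃ D, 0 ≤ D ∧ ∀ (n : ℕ) (ε : ℝ) (v : Fin n → Fin P.kU₁₁)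
    (y₂ : Fin n → Y₂),
    expect (piProd fun _ => P.pU₂₁) (fun w => expect (piProd fun k => P.pU₂₂Marg (w k))
      (fun z => ind (P.RecvTypical₂ ch ε v w z y₂))) ≤
      (2 : ℝ) ^ (-(n * (P.I₁₂ ch - ε * D))) := by
  refine ⟨_, infoDev_nonneg (P.joint_mem ch).1 (fun s => (s.u₂₁, s.u₂₂)) (·.y₂)
    (·.u₁₁), fun n ε v y₂ => ?_⟩
  refine (expect_mono (piProd_nonneg fun k => P.pU₂₁_mem.1) fun w =>
    expect_mono (piProd_nonneg fun k => (P.pU₂₂Marg_mem _).1) fun z => ind_mono fun h => ?_).trans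
    (expect_typical_le₂ (p := P.joint ch) (A₁ := (·.u₂₁)) (A₂ := (·.u₂₂)) (B := (·.y₂)) (b := y₂)
      (C := (·.u₁₁)) (c := v) (joint_mem P ch).1 (q₁ := fun _ => P.pU₂₁)
      (q₂ := fun _ w => P.pU₂₂Marg w) (fun _ => P.pU₂₁_mem) (fun _ _ => P.pU₂₂Marg_mem _)
      (f := fun c => P.pU₁₁ c) fun w z c =>
        (prob_congr fun s => by tauto).trans
          ((P.law_sender₂_public₁ ch c w z).trans (by ring)))
  exact h.map fun a => ((a.2.1, a.2.2.1), a.2.2.2, a.1)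

lemma packing_u₂₂_u₁₁ : ∃ D, 0 ≤ D ∧ ∀ (n : ℕ) (ε : ℝ) (w : Fin n → Fin P.kU₂₁)
    (y₂ : Fin n → Y₂),
    expect (piProd fun k => P.pU₂₂Marg (w k)) (fun z => expect (piProd fun _ => P.pU₁₁) (fun v =>
      ind (P.RecvTypical₂ ch ε v w z y₂))) ≤ (2 : ℝ) ^ (-(n * (P.I₁₃ ch - ε * D))) := by
  refine ⟨_, infoDev_nonneg (P.joint_mem ch).1 (fun s => (s.u₂₂, s.u₁₁)) (·.y₂)
    (·.u₂₁), fun n ε w y₂ => ?_⟩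
  have hI : P.I₁₃ ch = condMI (P.joint ch) (fun s => (s.u₂₂, s.u₁₁)) (·.y₂) (·.u₂₁) := by
    simp only [I₁₃, condMI_joint, Prod.mk.injEq, and_assoc, and_left_comm]
  rw [hI]
  refine (expect_mono (piProd_nonneg fun k => (P.pU₂₂Marg_mem _).1) fun z =>
    expect_mono (piProd_nonneg fun k => P.pU₁₁_mem.1) fun v => ind_mono fun h => ?_).trans
    (expect_typical_le₂ (p := P.joint ch) (A₁ := (·.u₂₂)) (A₂ := (·.u₁₁)) (B := (·.y₂)) (b := y₂)
      (C := (·.u₂₁)) (c := w) (joint_mem P ch).1 (q₁ := fun w => P.pU₂₂Marg w)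
      (q₂ := fun _ _ => P.pU₁₁) (fun _ => P.pU₂₂Marg_mem _) (fun _ _ => P.pU₁₁_mem)
      (f := fun c => P.pU₂₁ c) fun z v c =>
        (prob_congr fun s => by tauto).trans
          ((P.law_sender₂_public₁ ch v c z).trans (by ring)))
  exact h.map fun a => ((a.2.2.1, a.1), a.2.2.2, a.2.1)

lemma packing_u₂₁_u₂₂_u₁₁ : ∃ D, 0 ≤ D ∧ ∀ (n : ℕ) (ε : ℝ) (y₂ : Fin n → Y₂),
    expect (piProd fun _ => P.pU₂₁) (fun w => expect (piProd fun k => P.pU₂₂Marg (w k)) (fun z =>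
      expect (piProd fun _ => P.pU₁₁) (fun v => ind (P.RecvTypical₂ ch ε v w z y₂)))) ≤
      (2 : ℝ) ^ (-(n * (P.I₁₄ ch - ε * D))) := by
  refine ⟨_, infoDev_nonneg (P.joint_mem ch).1 (fun s => ((s.u₂₁, s.u₂₂), s.u₁₁)) (·.y₂)
    (fun _ => ()), fun n ε y₂ => ?_⟩
  have hI : P.I₁₄ ch =
      condMI (P.joint ch) (fun s => ((s.u₂₁, s.u₂₂), s.u₁₁)) (·.y₂) (fun _ => ()) := by
    simp only [I₁₄, mutualInfo, condMI_joint, Prod.mk.injEq, and_assoc, and_left_comm, and_comm]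
  rw [hI]
  refine (expect_mono (piProd_nonneg fun k => P.pU₂₁_mem.1) fun w =>
    expect_mono (piProd_nonneg fun k => (P.pU₂₂Marg_mem _).1) fun z =>
    expect_mono (piProd_nonneg fun k => P.pU₁₁_mem.1) fun v => ind_mono fun h => ?_).trans
    (expect_typical_le₃ (p := P.joint ch) (A₁ := (·.u₂₁)) (A₂ := (·.u₂₂)) (A₃ := (·.u₁₁))
      (B := (·.y₂)) (b := y₂) (C := fun _ => ()) (c := fun _ => ()) (joint_mem P ch).1
      (q₁ := fun _ => P.pU₂₁) (q₂ := fun _ w => P.pU₂₂Marg w)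
      (q₃ := fun _ _ _ => P.pU₁₁) (fun _ => P.pU₂₁_mem) (fun _ _ => P.pU₂₂Marg_mem _)
      (fun _ _ _ => P.pU₁₁_mem) (f := fun _ => 1) fun w z v c =>
        (prob_congr fun s => by tauto).trans
          ((P.law_sender₂_public₁ ch v w z).trans (by ring)))
  exact h.map fun a => (((a.2.1, a.2.2.1), a.1), a.2.2.2, ())

end receiver₂

end HKPDFDist

/-! ### The packing bounds of all error patterns together. -/

namespace HKPDFDist

variable {X₁ X₂ Y₁ Y₂ Y : Type*} [Fintype X₁] [Fintype X₂] [Fintype Y₁] [Fintype Y₂] [Fintype Y]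
variable (P : HKPDFDist X₁ X₂) (ch : CRC X₁ X₂ Y₁ Y₂ Y)

open Classical in
/-- The exponent of the error of the first receiver, according to which of the indices `w₁₀`, `w₁₁`,
`w₂₁` are right. -/
noncomputable def recvInfo₁ (E₁₀ E₁₁ E₂₁ : Prop) : ℝ :=
  if E₁₀ then
    if E₁₁ then (if E₂₁ then P.I₃ ch else P.I₇ ch) else (if E₂₁ then P.I₅ ch else P.I₉ ch)
  else
    if E₁₁ then (if E₂₁ then P.I₄ ch else P.I₈ ch) else (if E₂₁ then P.I₆ ch else P.I₁₀ ch)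

open Classical in
/-- The exponent of the error of the second receiver, according to which of the indices `w₂₁`, `w₁₁`
are right. -/
noncomputable def recvInfo₂ (E₂₁ E₁₁ : Prop) : ℝ :=
  if E₂₁ then (if E₁₁ then P.I₁₁ ch else P.I₁₃ ch) else (if E₁₁ then P.I₁₂ ch else P.I₁₄ ch)

open Classical in
/-- The part of the exponent of the first receiver that is due to the next block. -/
noncomputable def nextInfo₁ (E₁₀ : Prop) : ℝ :=
  if E₁₀ then 0 else mutualInfo (P.joint ch) (·.t₁₀) (·.y₁)

/-- The chain rule separates the information gained in the block itself from the part I(T₁₀;Y₁),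
which the next block supplies. -/
lemma I₁₀_eq : P.I₁₀ ch = condMI (P.joint ch) (fun s => (s.u₁₀, s.u₁₁, s.x₁, s.u₂₁)) (·.y₁) (·.t₁₀) +
    mutualInfo (P.joint ch) (·.t₁₀) (·.y₁) := by
  simp only [I₁₀, condMI_joint, mutualInfo_joint, Prod.mk.injEq, and_assoc, and_comm, and_left_comm]
  ring

lemma rpow_info_mono {n : ℕ} {ε D D' I : ℝ} (hε : 0 ≤ ε) (h : D ≤ D') :
    (2 : ℝ) ^ (-(n * (I - ε * D))) ≤ (2 : ℝ) ^ (-(n * (I - ε * D'))) := by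
  refine Real.rpow_le_rpow_of_exponent_le one_le_two (neg_le_neg ?_)
  refine mul_le_mul_of_nonneg_left ?_ (Nat.cast_nonneg n)
  linarith [mul_le_mul_of_nonneg_left h hε]

/-- The propositions say which indices are right. As ¬E, the codeword x₁ is always fresh, even if
w₁₀ and w₁₁ are right and only w₁₂ is wrong. The exponent is that of a single block, hence without
the contribution of the next one. -/
lemma packing_receiver₁ : ∃ D, 0 ≤ D ∧ ∀ (n : ℕ) (ε : ℝ), 0 ≤ ε → ∀ (E₁₀ E₁₁ E₂₁ E : Prop), ¬E →
    ∀ (t : Fin n → Fin P.kT₁₀) (u : Fin n → Fin P.kU₁₀) (v : Fin n → Fin P.kU₁₁) (x : Fin n → X₁)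
    (w : Fin n → Fin P.kU₂₁) (y₁ : Fin n → Y₁),
    expect (repeatKernel E₂₁ (piProd fun _ => P.pU₂₁) w) (fun w' =>
      expect (repeatKernel E₁₀ (piProd fun k => P.pU₁₀ (t k)) u) fun u' =>
      expect (repeatKernel E₁₁ (piProd fun _ => P.pU₁₁) v) fun v' =>
      expect (repeatKernel E (piProd fun k => P.pX₁ (t k) (u' k) (v' k)) x) fun x' =>
        ind (P.RecvTypical₁ ch ε t u' v' x' w' y₁)) ≤
      (2 : ℝ) ^ (-(n * (P.recvInfo₁ ch E₁₀ E₁₁ E₂₁ - P.nextInfo₁ ch E₁₀ - ε * D))) := by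
  obtain ⟨D₁, h₁, H₁⟩ := P.packing_x₁ ch
  obtain ⟨D₂, h₂, H₂⟩ := P.packing_u₁₀_x₁ ch
  obtain ⟨D₃, h₃, H₃⟩ := P.packing_u₁₁_x₁ ch
  obtain ⟨D₄, h₄, H₄⟩ := P.packing_u₁₀_u₁₁_x₁ ch
  obtain ⟨D₅, h₅, H₅⟩ := P.packing_u₂₁_x₁ ch
  obtain ⟨D₆, h₆, H₆⟩ := P.packing_u₂₁_u₁₀_x₁ ch
  obtain ⟨D₇, h₇, H₇⟩ := P.packing_u₂₁_u₁₁_x₁ ch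
  obtain ⟨D₈, h₈, H₈⟩ := P.packing_u₂₁_u₁₀_u₁₁_x₁ ch
  refine ⟨D₁ + D₂ + D₃ + D₄ + D₅ + D₆ + D₇ + D₈, by positivity, ?_⟩
  intro n ε hε E₁₀ E₁₁ E₂₁ E hE t u v x w y₁
  simp only [repeatKernel_false hE]
  by_cases h10 : E₁₀ <;> by_cases h11 : E₁₁ <;> by_cases h21 : E₂₁ <;>
    simp only [repeatKernel_true, repeatKernel_false, expect_dirac, h10, h11, h21,
      not_false_eq_true, recvInfo₁, nextInfo₁, if_true, if_false, sub_zero, I₄, I₆, I₈, I₁₀_eq,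
      add_sub_cancel_right]
  · exact (H₁ n ε t u v w y₁).trans (rpow_info_mono hε (by linarith))
  · exact (H₅ n ε t u v y₁).trans (rpow_info_mono hε (by linarith))
  · exact (H₃ n ε t u w y₁).trans (rpow_info_mono hε (by linarith))
  · exact (H₇ n ε t u y₁).trans (rpow_info_mono hε (by linarith))
  · exact (H₂ n ε t v w y₁).trans (rpow_info_mono hε (by linarith))
  · exact (H₆ n ε t v y₁).trans (rpow_info_mono hε (by linarith))
  · exact (H₄ n ε t w y₁).trans (rpow_info_mono hε (by linarith))
  · exact (H₈ n ε t y₁).trans (rpow_info_mono hε (by linarith))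

lemma packing_receiver₂ : ∃ D, 0 ≤ D ∧ ∀ (n : ℕ) (ε : ℝ), 0 ≤ ε → ∀ (E₂₁ E₁₁ : Prop)
    (v : Fin n → Fin P.kU₁₁) (w : Fin n → Fin P.kU₂₁) (y₂ : Fin n → Y₂),
    expect (repeatKernel E₂₁ (piProd fun _ => P.pU₂₁) w) (fun w' =>
      expect (piProd fun k => P.pU₂₂Marg (w' k)) fun z' =>
      expect (repeatKernel E₁₁ (piProd fun _ => P.pU₁₁) v) fun v' =>
        ind (P.RecvTypical₂ ch ε v' w' z' y₂)) ≤
      (2 : ℝ) ^ (-(n * (P.recvInfo₂ ch E₂₁ E₁₁ - ε * D))) := by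
  obtain ⟨D₁, h₁, H₁⟩ := P.packing_u₂₂ ch
  obtain ⟨D₂, h₂, H₂⟩ := P.packing_u₂₁_u₂₂ ch
  obtain ⟨D₃, h₃, H₃⟩ := P.packing_u₂₂_u₁₁ ch
  obtain ⟨D₄, h₄, H₄⟩ := P.packing_u₂₁_u₂₂_u₁₁ ch
  refine ⟨D₁ + D₂ + D₃ + D₄, by positivity, ?_⟩
  intro n ε hε E₂₁ E₁₁ v w y₂
  by_cases h11 : E₁₁ <;> by_cases h21 : E₂₁ <;>
    simp only [repeatKernel_true, repeatKernel_false, expect_dirac, h11, h21,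
      not_false_eq_true, recvInfo₂, if_true, if_false]
  · exact (H₁ n ε v w y₂).trans (rpow_info_mono hε (by linarith))
  · exact (H₂ n ε v y₂).trans (rpow_info_mono hε (by linarith))
  · exact (H₃ n ε w y₂).trans (rpow_info_mono hε (by linarith))
  · exact (H₄ n ε y₂).trans (rpow_info_mono hε (by linarith))

/-! ### Typicality of the transmitted codewords -/

/-- Joint typicality of all the sequences of a block. -/
def FullTypical {n : ℕ} (ε : ℝ) (t : Fin n → Fin P.kT₁₀) (a : Fin n → Fin P.kU₂₁)
    (z : Fin n → Fin P.kU₂₂) (c : Fin n → Fin P.kU₁₀) (d : Fin n → Fin P.kU₁₁) (e : Fin n → X₁)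
    (g : Fin n → X₂) (y : Fin n → Y₁ × Y₂ × Y) : Prop :=
  Typical (P.joint ch) (fun s => s) ε
    fun k => ⟨t k, c k, d k, e k, a k, z k, g k, (y k).1, (y k).2.1, (y k).2.2⟩

/-- The typicality test for binning at the second sender. -/
def BinTypical {n : ℕ} (ε : ℝ) (t : Fin n → Fin P.kT₁₀) (a : Fin n → Fin P.kU₂₁)
    (z : Fin n → Fin P.kU₂₂) : Prop :=
  Typical (P.joint ch) (fun s => (s.t₁₀, s.u₂₁, s.u₂₂)) ε fun k => (t k, a k, z k)

/-- Once (t₁₀,u₂₁,u₂₂) is typical, the remaining variables are generated along it by their true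
conditional law, although u₂₂ was not drawn from p(u₂₂|u₂₁,t₁₀). Conditional typicality applies
because ε exceeds ε'. -/
lemma expect_not_fullTypical_le {ε' ε : ℝ} (hε : ε' < ε) : ∃ K : ℝ, ∀ (n : ℕ)
    (t : Fin n → Fin P.kT₁₀) (a : Fin n → Fin P.kU₂₁) (z : Fin n → Fin P.kU₂₂),
    P.BinTypical ch ε' t a z →
    expect (piProd fun k => P.pU₁₀ (t k)) (fun c => expect (piProd fun _ => P.pU₁₁) fun d =>
      expect (piProd fun k => P.pX₁ (t k) (c k) (d k)) fun e =>
      expect (piProd fun k => P.pX₂ (t k) (a k) (z k)) fun g =>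
      expect (piProd fun k => ch.trans (e k) (g k)) fun y =>
        ind (¬P.FullTypical ch ε t a z c d e g y)) ≤ K / n := by
  refine ⟨typicalityConst (P.joint ch) (fun s => (s.t₁₀, s.u₂₁, s.u₂₂))
    (fun s => ((((s.u₁₀, s.u₁₁), s.x₁), s.x₂), (s.y₁, s.y₂, s.y))) (ε - ε'), fun n t a z h => ?_⟩
  rw [expect_piProd_piProd (fun k => P.pU₁₀ (t k)) (fun _ _ => P.pU₁₁),
    expect_piProd_piProd _ (fun k (z : Fin P.kU₁₀ × Fin P.kU₁₁) => P.pX₁ (t k) z.1 z.2),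
    expect_piProd_piProd _ (fun k (_ : (Fin P.kU₁₀ × Fin P.kU₁₁) × X₁) => P.pX₂ (t k) (a k) (z k)),
    expect_piProd_piProd _ (fun k (z : ((Fin P.kU₁₀ × Fin P.kU₁₁) × X₁) × X₂) =>
      ch.trans z.1.2 z.2)]
  refine le_trans (expect_mono (piProd_nonneg fun k b => ?_) fun b => ind_mono (mt fun hh => ?_))
    (expect_not_typical_le (p := P.joint ch) (A := fun s => (s.t₁₀, s.u₂₁, s.u₂₂))
      (B := fun s => ((((s.u₁₀, s.u₁₁), s.x₁), s.x₂), (s.y₁, s.y₂, s.y))) (P.joint_mem ch).1 hε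
      (s := fun k => (t k, a k, z k)) (κ := fun s b => P.pU₁₀ s.1 b.1.1.1.1 * P.pU₁₁ b.1.1.1.2 *
        P.pX₁ s.1 b.1.1.1.1 b.1.1.1.2 b.1.1.2 * P.pX₂ s.1 s.2.1 s.2.2 b.1.2 *
        ch.trans b.1.1.2 b.1.2 b.2) (fun s => ?_) (fun s b => ?_) h)
  · have h1 := (P.pU₁₀_mem (t k)).1 b.1.1.1.1
    have h2 := P.pU₁₁_mem.1 b.1.1.1.2
    have h3 := (P.pX₁_mem (t k) b.1.1.1.1 b.1.1.1.2).1 b.1.1.2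
    have h4 := (P.pX₂_mem (t k) (a k) (z k)).1 b.1.2
    have h5 := (ch.trans_mem b.1.1.2 b.1.2).1 b.2
    positivity
  · have := hh.map (β := P.Sample Y₁ Y₂ Y) fun w => ⟨w.1.1, w.2.1.1.1.1, w.2.1.1.1.2, w.2.1.1.2,
      w.1.2.1, w.1.2.2, w.2.1.2, w.2.2.1, w.2.2.2.1, w.2.2.2.2⟩
    exact this
  · have k1 := mul_kernel_mem (P.pU₁₀_mem s.1) (q' := fun _ => P.pU₁₁) fun _ => P.pU₁₁_mem
    have k2 := mul_kernel_mem k1 (q' := fun z => P.pX₁ s.1 z.1 z.2) fun z => P.pX₁_mem s.1 z.1 z.2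
    have k3 := mul_kernel_mem k2 (q' := fun _ => P.pX₂ s.1 s.2.1 s.2.2)
      fun _ => P.pX₂_mem s.1 s.2.1 s.2.2
    exact mul_kernel_mem k3 (q' := fun z => ch.trans z.1.2 z.2) fun z => ch.trans_mem z.1.2 z.2
  · have h1 : prob (P.joint ch) (fun ω => (ω.t₁₀, ω.u₂₁, ω.u₂₂) = s) =
        P.pT₁₀ s.1 * P.pU₂₁ s.2.1 * P.pU₂₂ s.2.1 s.1 s.2.2 := by
      rw [← P.law_binning ch]; exact prob_congr fun _ => by simp only [Prod.ext_iff]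
    rw [h1, prob_eq_single (P.joint ch) (ω₀ := ⟨s.1, b.1.1.1.1, b.1.1.1.2, b.1.1.2, s.2.1, s.2.2,
      b.1.2, b.2.1, b.2.2.1, b.2.2.2⟩)]
    · simp only [joint]; ring
    · rintro ⟨⟩
      simp only [Prod.ext_iff, HKPDFSample.mk.injEq]
      tauto

/-- The law of large numbers as conditional typicality given a constant variable, whose sequence is
typical with parameter zero when n > 0. -/
lemma expect_not_binTypical_le {ε' : ℝ} (hε : 0 < ε') : ∃ K : ℝ, ∀ n : ℕ, 0 < n →
    expect (piProd fun _ : Fin n => P.pT₁₀) (fun t => expect (piProd fun _ => P.pU₂₁) fun a =>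
      expect (piProd fun k => P.pU₂₂ (a k) (t k)) fun z => ind (¬P.BinTypical ch ε' t a z)) ≤
      K / n := by
  refine ⟨typicalityConst (P.joint ch) (fun _ => ()) (fun s => ((s.t₁₀, s.u₂₁), s.u₂₂)) (ε' - 0),
    fun n hn => ?_⟩
  rw [expect_piProd_piProd (fun _ => P.pT₁₀) (fun _ _ => P.pU₂₁),
    expect_piProd_piProd _ (fun _ (z : Fin P.kT₁₀ × Fin P.kU₂₁) => P.pU₂₂ z.2 z.1)]
  have hs : Typical (P.joint ch) (fun _ => ()) 0 (fun _ : Fin n => ()) := by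
    rw [typical_iff]
    intro _
    have hn' : (n : ℝ) ≠ 0 := by exact_mod_cast hn.ne'
    simp [ind_true, prob_true (P.joint_mem ch), hn']
  refine le_trans (expect_mono (piProd_nonneg fun k b => ?_) fun b => ind_mono (mt fun hh => ?_))
    (expect_not_typical_le (p := P.joint ch) (A := fun _ => ())
      (B := fun s => ((s.t₁₀, s.u₂₁), s.u₂₂)) (P.joint_mem ch).1 hε
      (κ := fun _ b => P.pT₁₀ b.1.1 * P.pU₂₁ b.1.2 * P.pU₂₂ b.1.2 b.1.1 b.2)
      (fun s => ?_) (fun s b => ?_) hs)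
  · have h1 := P.pT₁₀_mem.1 b.1.1
    have h2 := P.pU₂₁_mem.1 b.1.2
    have h3 := (P.pU₂₂_mem b.1.2 b.1.1).1 b.2
    positivity
  · exact hh.map fun w => (w.2.1.1, w.2.1.2, w.2.2)
  · exact mul_kernel_mem (mul_kernel_mem P.pT₁₀_mem fun _ => P.pU₂₁_mem) fun z => P.pU₂₂_mem z.2 z.1
  · rw [prob_true (P.joint_mem ch) fun _ => rfl, one_mul, ← P.law_binning ch]
    exact prob_congr fun _ => by simp only [Prod.ext_iff]; tauto

/-- The deviation of the information density of the binning variables. -/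
noncomputable def binDev : ℝ := infoDev (P.joint ch) (·.u₂₂) (·.t₁₀) (·.u₂₁)

lemma binDev_nonneg : 0 ≤ P.binDev ch := infoDev_nonneg (P.joint_mem ch).1 _ _ _

/-- Covering: binning succeeds if there are more than `2 ^ (n I₁)` indices. -/
lemma expect_no_binTypical_le {ε' : ℝ} (hε : 0 < ε') : ∃ K : ℝ, ∀ n : ℕ, 0 < n →
    ∀ (V : Type) [Fintype V] [DecidableEq V],
    expect (piProd fun _ : Fin n => P.pT₁₀) (fun t => expect (piProd fun _ => P.pU₂₁) fun a =>
      expect (piProd fun _ : V => piProd fun k => P.pU₂₂Marg (a k)) fun b =>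
        ind (∀ v, ¬P.BinTypical ch ε' t a (b v))) ≤
      K / n + Real.exp (-(Fintype.card V * (2 : ℝ) ^ (-(n * (P.I₁ ch + ε' * P.binDev ch))))) := by
  obtain ⟨K, hK⟩ := P.expect_not_binTypical_le ch hε
  refine ⟨K, fun n hn V _ _ => ?_⟩
  set X := Real.exp (-(Fintype.card V * (2 : ℝ) ^ (-(n * (P.I₁ ch + ε' * P.binDev ch)))))
  have hqT : piProd (fun _ : Fin n => P.pT₁₀) ∈ stdSimplex ℝ (Fin n → Fin P.kT₁₀) :=
    piProd_mem fun _ => P.pT₁₀_mem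
  have hqA : piProd (fun _ : Fin n => P.pU₂₁) ∈ stdSimplex ℝ (Fin n → Fin P.kU₂₁) :=
    piProd_mem fun _ => P.pU₂₁_mem
  -- For fixed t and a, covering compares the bins with one draw from p(u₂₂|u₂₁,t₁₀); averaged over
  -- t and a, that draw follows the joint law and fails with probability at most K / n.
  refine le_trans (b := expect (piProd fun _ : Fin n => P.pT₁₀) (fun t =>
    expect (piProd fun _ => P.pU₂₁) fun a => expect (piProd fun k => P.pU₂₂ (a k) (t k)) (fun z =>
      ind (¬P.BinTypical ch ε' t a z)) + X)) ?_ ?_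
  · refine expect_mono hqT.1 fun t => expect_mono hqA.1 fun a => ?_
    have key := expect_no_typical_le (p := P.joint ch) (A := (·.u₂₂)) (B := (·.t₁₀)) (C := (·.u₂₁))
      (b := t) (c := a) (ε := ε') (P.joint_mem ch).1 (q := P.pU₂₂Marg) P.pU₂₂Marg_mem
      (f := P.pU₂₁) (r := fun t w => P.pU₂₂ w t) (fun z w => by
        rw [← sum_prob_and (P.joint ch) (·.t₁₀), pU₂₂Marg, Finset.mul_sum]
        refine Finset.sum_congr rfl fun t _ => ?_
        rw [prob_congr (F := fun s => s.t₁₀ = t ∧ s.u₂₁ = w ∧ s.u₂₂ = z) fun _ => by tauto,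
          P.law_binning ch]
        ring) (fun t w => P.pU₂₂_mem w t) (fun z t w => by
        rw [prob_congr (F := fun s => s.t₁₀ = t ∧ s.u₂₁ = w ∧ s.u₂₂ = z) fun _ => by tauto,
          P.law_binning ch, ← sum_prob_and (P.joint ch) (·.u₂₂) (fun s => s.t₁₀ = t ∧ s.u₂₁ = w)]
        rw [Finset.sum_congr rfl fun z _ => (prob_congr (p := P.joint ch)
          (F := fun s => s.t₁₀ = t ∧ s.u₂₁ = w ∧ s.u₂₂ = z) fun _ => by tauto).trans
          (P.law_binning ch t w z), ← Finset.mul_sum, (P.pU₂₂_mem w t).2, mul_one]) V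
    refine le_trans (expect_mono (piProd_nonneg fun _ => piProd_nonneg fun _ =>
      (P.pU₂₂Marg_mem _).1) fun b => ind_mono fun h v hh => h v (hh.map fun w => (w.2.1, w.2.2, w.1)))
      (key.trans (add_le_add ?_ le_rfl))
    exact expect_mono (piProd_nonneg fun k => (P.pU₂₂_mem _ _).1) fun z => ind_mono fun h hh =>
      h (hh.map fun w => (w.2.2, w.1, w.2.1))
  · simp only [expect_add, expect_const hqA.2, expect_const hqT.2]
    exact add_le_add (hK n hn) le_rfl

end HKPDFDist

/-! ### Error bounds for one block -/

namespace HKPDFDist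

variable {X₁ X₂ Y₁ Y₂ Y : Type*} [Fintype X₁] [Fintype X₂] [Fintype Y₁] [Fintype Y₂] [Fintype Y]
variable (P : HKPDFDist X₁ X₂) (ch : CRC X₁ X₂ Y₁ Y₂ Y) {r : HKPDFRates} {n : ℕ}

/-- The bin index for given codewords. -/
noncomputable def binIndex (ε' : ℝ) (t : Fin n → Fin P.kT₁₀) (a : Fin n → Fin P.kU₂₁)
    (b : Msg n r.r₂₂' → Fin n → Fin P.kU₂₂) : Msg n r.r₂₂' :=
  someOr (fun v => P.BinTypical ch ε' t a (b v)) 0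

/-- The expectation of a function of the codebooks and the outputs of one block, if the codewords of
`w'`, `m₁` and `m₂` are sent. -/
noncomputable def blockExpect (ε' : ℝ) (w' : Msg n r.r₁₀) (m₁ : r.Msg₁ n) (m₂ : r.Msg₂ n)
    (F : (Msg n r.r₁₀ → Fin n → Fin P.kT₁₀) → (Msg n r.r₂₁ → Fin n → Fin P.kU₂₁) →
      (Msg n r.r₂₁ → Msg n r.r₂₂ → Msg n r.r₂₂' → Fin n → Fin P.kU₂₂) →
      (Msg n r.r₁₀ → Msg n r.r₁₀ → Fin n → Fin P.kU₁₀) → (Msg n r.r₁₁ → Fin n → Fin P.kU₁₁) →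
      (Msg n r.r₁₀ → Msg n r.r₁₀ → Msg n r.r₁₁ → Msg n r.r₁₂ → Fin n → X₁) →
      (Msg n r.r₁₀ → Msg n r.r₂₁ → Msg n r.r₂₂ → Msg n r.r₂₂' → Fin n → X₂) →
      (Fin n → Y₁ × Y₂ × Y) → ℝ) : ℝ :=
  expect (piProd fun _ => piProd fun _ => P.pT₁₀) fun t =>
  expect (piProd fun _ => piProd fun _ => P.pU₂₁) fun a =>
  expect (piProd fun m => piProd fun _ => piProd fun _ => piProd fun k => P.pU₂₂Marg (a m k)) fun b =>
  expect (piProd fun i => piProd fun _ => piProd fun k => P.pU₁₀ (t i k)) fun c =>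
  expect (piProd fun _ => piProd fun _ => P.pU₁₁) fun d =>
  expect (piProd fun i => piProd fun j => piProd fun l => piProd fun _ => piProd fun k =>
    P.pX₁ (t i k) (c i j k) (d l k)) fun e =>
  expect (piProd fun i => piProd fun m => piProd fun o => piProd fun v => piProd fun k =>
    P.pX₂ (t i k) (a m k) (b m o v k)) fun g =>
  expect (piProd fun k => ch.trans (e w' m₁.1 m₁.2.1 m₁.2.2 k)
    (g w' m₂.1 m₂.2 (P.binIndex ch ε' (t w') (a m₂.1) (b m₂.1 m₂.2)) k)) fun z =>
  F t a b c d e g z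

lemma seq_pT₁₀_mem : (piProd fun _ : Fin n => P.pT₁₀) ∈ stdSimplex ℝ (Fin n → Fin P.kT₁₀) :=
  piProd_mem fun _ => P.pT₁₀_mem

lemma seq_pU₂₁_mem : (piProd fun _ : Fin n => P.pU₂₁) ∈ stdSimplex ℝ (Fin n → Fin P.kU₂₁) :=
  piProd_mem fun _ => P.pU₂₁_mem

lemma seq_pU₁₁_mem : (piProd fun _ : Fin n => P.pU₁₁) ∈ stdSimplex ℝ (Fin n → Fin P.kU₁₁) :=
  piProd_mem fun _ => P.pU₁₁_mem

lemma seq_pU₂₂Marg_mem (a : Fin n → Fin P.kU₂₁) :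
    (piProd fun k => P.pU₂₂Marg (a k)) ∈ stdSimplex ℝ (Fin n → Fin P.kU₂₂) :=
  piProd_mem fun _ => P.pU₂₂Marg_mem _

lemma seq_pU₁₀_mem (t : Fin n → Fin P.kT₁₀) :
    (piProd fun k => P.pU₁₀ (t k)) ∈ stdSimplex ℝ (Fin n → Fin P.kU₁₀) :=
  piProd_mem fun _ => P.pU₁₀_mem _

lemma seq_pX₁_mem (t : Fin n → Fin P.kT₁₀) (c : Fin n → Fin P.kU₁₀) (d : Fin n → Fin P.kU₁₁) :
    (piProd fun k => P.pX₁ (t k) (c k) (d k)) ∈ stdSimplex ℝ (Fin n → X₁) :=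
  piProd_mem fun _ => P.pX₁_mem _ _ _

lemma seq_pX₂_mem (t : Fin n → Fin P.kT₁₀) (a : Fin n → Fin P.kU₂₁) (b : Fin n → Fin P.kU₂₂) :
    (piProd fun k => P.pX₂ (t k) (a k) (b k)) ∈ stdSimplex ℝ (Fin n → X₂) :=
  piProd_mem fun _ => P.pX₂_mem _ _ _

lemma seq_trans_mem (e : Fin n → X₁) (g : Fin n → X₂) :
    (piProd fun k => ch.trans (e k) (g k)) ∈ stdSimplex ℝ (Fin n → Y₁ × Y₂ × Y) :=
  piProd_mem fun _ => ch.trans_mem _ _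

/-- `expect_layers` with whole sequences as letters. -/
lemma blockExpect_eq (ε' : ℝ) (w' i' j' : Msg n r.r₁₀) (m₁ : r.Msg₁ n) (k' : Msg n r.r₁₁)
    (l' : Msg n r.r₁₂) (m₂ : r.Msg₂ n) (m' : Msg n r.r₂₁) (o' : Msg n r.r₂₂)
    (F : (Fin n → Fin P.kT₁₀) → (Fin n → Fin P.kT₁₀) → (Fin n → Fin P.kU₂₁) →
      (Fin n → Fin P.kU₂₁) → (Msg n r.r₂₂' → Fin n → Fin P.kU₂₂) →
      (Msg n r.r₂₂' → Fin n → Fin P.kU₂₂) → (Fin n → Fin P.kU₁₀) → (Fin n → Fin P.kU₁₀) →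
      (Fin n → Fin P.kU₁₁) → (Fin n → Fin P.kU₁₁) → (Fin n → X₁) → (Fin n → X₁) → (Fin n → X₂) →
      (Fin n → Y₁ × Y₂ × Y) → ℝ) :
    P.blockExpect ch ε' w' m₁ m₂ (fun t a b c d e g z => F (t w') (t i') (a m₂.1) (a m')
      (b m₂.1 m₂.2) (b m' o') (c w' m₁.1) (c w' j') (d m₁.2.1) (d k') (e w' m₁.1 m₁.2.1 m₁.2.2)
      (e w' j' k' l') (g w' m₂.1 m₂.2 (P.binIndex ch ε' (t w') (a m₂.1) (b m₂.1 m₂.2))) z) =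
    expect (piProd fun _ => P.pT₁₀) fun t => expect (piProd fun _ => P.pU₂₁) fun a =>
    expect (piProd fun _ => piProd fun k => P.pU₂₂Marg (a k)) fun b =>
    expect (piProd fun k => P.pU₁₀ (t k)) fun c => expect (piProd fun _ => P.pU₁₁) fun d =>
    expect (piProd fun k => P.pX₁ (t k) (c k) (d k)) fun e =>
    expect (piProd fun k => P.pX₂ (t k) (a k) (b (P.binIndex ch ε' t a b) k)) fun g =>
    expect (piProd fun k => ch.trans (e k) (g k)) fun z =>
    expect (repeatKernel (i' = w') (piProd fun _ => P.pT₁₀) t) fun t' =>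
    expect (repeatKernel (m' = m₂.1) (piProd fun _ => P.pU₂₁) a) fun a' =>
    expect (repeatKernel ((m', o') = (m₂.1, m₂.2))
      (piProd fun _ => piProd fun k => P.pU₂₂Marg (a' k)) b) fun b' =>
    expect (repeatKernel (j' = m₁.1) (piProd fun k => P.pU₁₀ (t k)) c) fun c' =>
    expect (repeatKernel (k' = m₁.2.1) (piProd fun _ => P.pU₁₁) d) fun d' =>
    expect (repeatKernel ((j', k', l') = (m₁.1, m₁.2.1, m₁.2.2))
      (piProd fun k => P.pX₁ (t k) (c' k) (d' k)) e) fun e' =>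
      F t t' a a' b b' c c' d d' e e' g z :=
  expect_layers (qT := piProd fun _ => P.pT₁₀) (qA := piProd fun _ => P.pU₂₁)
    (qB := fun a => piProd fun k => P.pU₂₂Marg (a k)) (qC := fun t => piProd fun k => P.pU₁₀ (t k))
    (qD := piProd fun _ => P.pU₁₁) (qE := fun t c d => piProd fun k => P.pX₁ (t k) (c k) (d k))
    (qG := fun t a b => piProd fun k => P.pX₂ (t k) (a k) (b k))
    (fun e g => piProd fun k => ch.trans (e k) (g k)) P.seq_pT₁₀_mem.2 P.seq_pU₂₁_mem.2
    (fun a => (P.seq_pU₂₂Marg_mem a).2) (fun t => (P.seq_pU₁₀_mem t).2) P.seq_pU₁₁_mem.2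
    (fun t c d => (P.seq_pX₁_mem t c d).2) (fun t a b => (P.seq_pX₂_mem t a b).2)
    (P.binIndex ch ε') w' i' m₁.1 j' m₁.2.1 k' m₁.2.2 l' m₂.1 m' m₂.2 o' F

/-- Given the sent codewords and the output, the second codewords are fresh or repeated, so a bound
that is uniform in everything sent and received survives the outer expectation. -/
lemma blockExpect_le (ε' : ℝ) (w' i' j' : Msg n r.r₁₀) (m₁ : r.Msg₁ n) (k' : Msg n r.r₁₁)
    (l' : Msg n r.r₁₂) (m₂ : r.Msg₂ n) (m' : Msg n r.r₂₁) (o' : Msg n r.r₂₂)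
    (F : (Fin n → Fin P.kT₁₀) → (Fin n → Fin P.kT₁₀) → (Fin n → Fin P.kU₂₁) →
      (Msg n r.r₂₂' → Fin n → Fin P.kU₂₂) → (Fin n → Fin P.kU₁₀) →
      (Fin n → Fin P.kU₁₁) → (Fin n → X₁) → (Fin n → Y₁ × Y₂ × Y) → ℝ) (C : ℝ)
    (hC : ∀ t a b c d e z,
      expect (repeatKernel (i' = w') (piProd fun _ => P.pT₁₀) t) (fun t' =>
      expect (repeatKernel (m' = m₂.1) (piProd fun _ => P.pU₂₁) a) fun a' =>
      expect (repeatKernel ((m', o') = (m₂.1, m₂.2))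
        (piProd fun _ => piProd fun k => P.pU₂₂Marg (a' k)) b) fun b' =>
      expect (repeatKernel (j' = m₁.1) (piProd fun k => P.pU₁₀ (t k)) c) fun c' =>
      expect (repeatKernel (k' = m₁.2.1) (piProd fun _ => P.pU₁₁) d) fun d' =>
      expect (repeatKernel ((j', k', l') = (m₁.1, m₁.2.1, m₁.2.2))
        (piProd fun k => P.pX₁ (t k) (c' k) (d' k)) e) fun e' => F t t' a' b' c' d' e' z) ≤ C) :
    P.blockExpect ch ε' w' m₁ m₂ (fun t a b c d e _ z => F (t w') (t i') (a m')
      (b m' o') (c w' j') (d k') (e w' j' k' l') z) ≤ C := by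
  refine (P.blockExpect_eq ch ε' w' i' j' m₁ k' l' m₂ m' o'
    (fun t t' _ a' _ b' _ c' _ d' _ e' _ z => F t t' a' b' c' d' e' z)).trans_le ?_
  refine expect_le P.seq_pT₁₀_mem fun t => expect_le P.seq_pU₂₁_mem fun a =>
    expect_le (piProd_mem fun _ => P.seq_pU₂₂Marg_mem a) fun b => expect_le (P.seq_pU₁₀_mem t) fun c =>
    expect_le P.seq_pU₁₁_mem fun d => expect_le (P.seq_pX₁_mem t c d) fun e =>
    expect_le (P.seq_pX₂_mem t a _) fun g => expect_le (seq_trans_mem ch e g) fun z => hC t a b c d e z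

/-- The second sender rarely confuses `w₁₀` with another message. -/
lemma exists_relay_error_le : ∃ D, 0 ≤ D ∧ ∀ (r : HKPDFRates) (n : ℕ) (ε' ε : ℝ) (w' : Msg n r.r₁₀)
    (m₁ : r.Msg₁ n) (m₂ : r.Msg₂ n) (j' : Msg n r.r₁₀), j' ≠ m₁.1 →
    P.blockExpect ch ε' w' m₁ m₂ (fun t _ _ c _ _ _ z => ind (P.RelayTypical ch ε (t w') (c w' j')
      (fun k => (z k).2.2))) ≤ (2 : ℝ) ^ (-(n * (P.I₂ ch - ε * D))) := by
  obtain ⟨D, hD, H⟩ := P.packing_relay ch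
  refine ⟨D, hD, fun r n ε' ε w' m₁ m₂ j' hj => ?_⟩
  refine P.blockExpect_le ch ε' w' w' j' m₁ m₁.2.1 m₁.2.2 m₂ m₂.1 m₂.2
    (fun t _ _ _ c' _ _ z => ind (P.RelayTypical ch ε t c' (fun k => (z k).2.2))) _ ?_
  intro t a b c d e z
  refine le_trans (le_of_eq ?_) (H n ε t (fun k => (z k).2.2))
  simp only [repeatKernel_true, expect_dirac, repeatKernel_false hj]
  exact expect_congr fun c' =>
    expect_const (repeatKernel_mem _ (P.seq_pX₁_mem t c' d) e).2 _

/-- A wrong message is rarely consistent with the next block at the first receiver. -/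
lemma exists_next_error_le : ∃ D, 0 ≤ D ∧ ∀ (r : HKPDFRates) (n : ℕ) (ε' ε : ℝ) (w' : Msg n r.r₁₀)
    (m₁ : r.Msg₁ n) (m₂ : r.Msg₂ n) (i' : Msg n r.r₁₀), i' ≠ w' →
    P.blockExpect ch ε' w' m₁ m₂ (fun t _ _ _ _ _ _ z => ind (P.NextTypical₁ ch ε (t i')
      (fun k => (z k).1))) ≤
      (2 : ℝ) ^ (-(n * (mutualInfo (P.joint ch) (·.t₁₀) (·.y₁) - ε * D))) := by
  obtain ⟨D, hD, H⟩ := P.packing_next ch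
  refine ⟨D, hD, fun r n ε' ε w' m₁ m₂ i' hi => ?_⟩
  refine P.blockExpect_le ch ε' w' i' m₁.1 m₁ m₁.2.1 m₁.2.2 m₂ m₂.1 m₂.2
    (fun _ t' _ _ _ _ _ z => ind (P.NextTypical₁ ch ε t' (fun k => (z k).1))) _ ?_
  intro t a b c d e z
  refine le_trans (le_of_eq ?_) (H n ε (fun k => (z k).1))
  simp only [repeatKernel_true, expect_dirac, repeatKernel_false hi]

/-- The first receiver rarely confuses the message of a block with another one. -/
lemma exists_receiver₁_error_le : ∃ D, 0 ≤ D ∧ ∀ (r : HKPDFRates) (n : ℕ) (ε' ε : ℝ), 0 ≤ ε →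
    ∀ (w' : Msg n r.r₁₀) (m₁ : r.Msg₁ n) (m₂ : r.Msg₂ n) (m₁' : r.Msg₁ n) (m' : Msg n r.r₂₁),
    m₁' ≠ m₁ → P.blockExpect ch ε' w' m₁ m₂ (fun t a _ c d e _ z => ind (P.RecvTypical₁ ch ε
      (t w') (c w' m₁'.1) (d m₁'.2.1) (e w' m₁'.1 m₁'.2.1 m₁'.2.2) (a m') (fun k => (z k).1))) ≤
      (2 : ℝ) ^ (-(n * (P.recvInfo₁ ch (m₁'.1 = m₁.1) (m₁'.2.1 = m₁.2.1) (m' = m₂.1) -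
        P.nextInfo₁ ch (m₁'.1 = m₁.1) - ε * D))) := by
  obtain ⟨D, hD, H⟩ := P.packing_receiver₁ ch
  refine ⟨D, hD, fun r n ε' ε hε w' m₁ m₂ m₁' m' h => ?_⟩
  refine P.blockExpect_le ch ε' w' w' m₁'.1 m₁ m₁'.2.1 m₁'.2.2 m₂ m' m₂.2
    (fun t _ a' _ c' d' e' z => ind (P.RecvTypical₁ ch ε t c' d' e' a' (fun k => (z k).1))) _ ?_
  intro t a b c d e z
  refine le_trans (le_of_eq ?_) (H n ε hε (m₁'.1 = m₁.1) (m₁'.2.1 = m₁.2.1) (m' = m₂.1)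
    ((m₁'.1, m₁'.2.1, m₁'.2.2) = (m₁.1, m₁.2.1, m₁.2.2)) h t c d e a (fun k => (z k).1))
  simp only [repeatKernel_true, expect_dirac]
  exact expect_congr fun a' =>
    expect_const (repeatKernel_mem _ (piProd_mem fun _ => P.seq_pU₂₂Marg_mem a') b).2 _

/-- The second receiver rarely confuses the message of a block with another one. -/
lemma exists_receiver₂_error_le : ∃ D, 0 ≤ D ∧ ∀ (r : HKPDFRates) (n : ℕ) (ε' ε : ℝ), 0 ≤ ε →
    ∀ (w' : Msg n r.r₁₀) (m₁ : r.Msg₁ n) (m₂ m₂' : r.Msg₂ n) (k' : Msg n r.r₁₁) (v : Msg n r.r₂₂'),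
    m₂' ≠ m₂ → P.blockExpect ch ε' w' m₁ m₂ (fun _ a b _ d _ _ z => ind (P.RecvTypical₂ ch ε
      (d k') (a m₂'.1) (b m₂'.1 m₂'.2 v) (fun k => (z k).2.1))) ≤
      (2 : ℝ) ^ (-(n * (P.recvInfo₂ ch (m₂'.1 = m₂.1) (k' = m₁.2.1) - ε * D))) := by
  obtain ⟨D, hD, H⟩ := P.packing_receiver₂ ch
  refine ⟨D, hD, fun r n ε' ε hε w' m₁ m₂ m₂' k' v h => ?_⟩
  refine P.blockExpect_le ch ε' w' w' m₁.1 m₁ k' m₁.2.2 m₂ m₂'.1 m₂'.2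
    (fun _ _ a' b' _ d' _ z => ind (P.RecvTypical₂ ch ε d' a' (b' v) (fun k => (z k).2.1))) _ ?_
  intro t a b c d e z
  refine le_trans (le_of_eq ?_) (H n ε hε (m₂'.1 = m₂.1) (k' = m₁.2.1) d a (fun k => (z k).2.1))
  have h' : ¬((m₂'.1, m₂'.2) = (m₂.1, m₂.2)) := h
  simp only [repeatKernel_true, expect_dirac, repeatKernel_false h']
  refine expect_congr fun a' => ?_
  refine (expect_congr fun b' => expect_congr fun d' =>
    expect_const (repeatKernel_mem _ (P.seq_pX₁_mem t c d') e).2 _).trans ?_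
  -- Since (w₂₁,w₂₂) is wrong, the whole family of bins is fresh, and only its member v enters the
  -- test.
  exact expect_piProd_eval (fun _ => (P.seq_pU₂₂Marg_mem a').2) v (fun z' =>
    expect (repeatKernel (k' = m₁.2.1) (piProd fun _ => P.pU₁₁) d) fun d' =>
      ind (P.RecvTypical₂ ch ε d' a' z' fun k => (z k).2.1))

/-- The transmitted codewords and the outputs are jointly typical with high probability. -/
lemma exists_not_fullTypical_le {ε' ε : ℝ} (hε' : 0 < ε') (hε : ε' < ε) : ∃ K : ℝ,
    ∀ (r : HKPDFRates) (n : ℕ), 0 < n → ∀ (w' : Msg n r.r₁₀) (m₁ : r.Msg₁ n) (m₂ : r.Msg₂ n),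
    P.blockExpect ch ε' w' m₁ m₂ (fun t a b c d e g z => ind (¬P.FullTypical ch ε (t w') (a m₂.1)
      (b m₂.1 m₂.2 (P.binIndex ch ε' (t w') (a m₂.1) (b m₂.1 m₂.2))) (c w' m₁.1) (d m₁.2.1)
      (e w' m₁.1 m₁.2.1 m₁.2.2)
      (g w' m₂.1 m₂.2 (P.binIndex ch ε' (t w') (a m₂.1) (b m₂.1 m₂.2))) z)) ≤
      K / n + Real.exp (-(numMsg n r.r₂₂' * (2 : ℝ) ^ (-(n * (P.I₁ ch + ε' * P.binDev ch))))) := by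
  obtain ⟨K₁, H₁⟩ := P.expect_not_fullTypical_le ch hε
  obtain ⟨K₂, H₂⟩ := P.expect_no_binTypical_le ch hε'
  -- The maximum with 0 lets the term K / n be kept when binning fails, without knowing the sign of
  -- K₁.
  refine ⟨K₂ + max K₁ 0, fun r n hn w' m₁ m₂ => ?_⟩
  have hn' : (0 : ℝ) < n := by exact_mod_cast hn
  have h2 := H₂ n hn (Msg n r.r₂₂')
  rw [Fintype.card_fin] at h2
  refine (P.blockExpect_eq ch ε' w' w' m₁.1 m₁ m₁.2.1 m₁.2.2 m₂ m₂.1 m₂.2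
    (fun t _ a _ b _ c _ d _ e _ g z => ind (¬P.FullTypical ch ε t a
      (b (P.binIndex ch ε' t a b)) c d e g z))).trans_le ?_
  simp only [repeatKernel_true, expect_dirac]
  rw [add_div, add_right_comm]
  refine le_trans (b := expect (piProd fun _ : Fin n => P.pT₁₀) (fun t =>
    expect (piProd fun _ => P.pU₂₁) fun a =>
    expect (piProd fun _ : Msg n r.r₂₂' => piProd fun k => P.pU₂₂Marg (a k)) fun b =>
      ind (∀ v, ¬P.BinTypical ch ε' t a (b v)) + max K₁ 0 / n)) ?_ ?_
  · refine expect_mono P.seq_pT₁₀_mem.1 fun t => expect_mono P.seq_pU₂₁_mem.1 fun a =>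
      expect_mono (piProd_mem fun _ => P.seq_pU₂₂Marg_mem a).1 fun b => ?_
    -- If some bin index is typical, so is the chosen one and conditional typicality applies;
    -- otherwise the failure probability is bounded by one, which the covering term pays.
    by_cases hb : ∃ v, P.BinTypical ch ε' t a (b v)
    · have hs : P.BinTypical ch ε' t a (b (P.binIndex ch ε' t a b)) := by
        have : P.binIndex ch ε' t a b = hb.choose := by
          simp only [binIndex, someOr, dif_pos hb]
        rw [this]
        exact hb.choose_spec
      rw [ind_false (by simpa using hb), zero_add]
      exact (H₁ n t a _ hs).trans (div_le_div_of_nonneg_right (le_max_left _ _) hn'.le)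
    · rw [ind_true (by simpa using hb)]
      have h0 : 0 ≤ max K₁ 0 / n := div_nonneg (le_max_right _ _) hn'.le
      refine (expect_le (P.seq_pU₁₀_mem t) fun c =>
        expect_le P.seq_pU₁₁_mem fun d => expect_le (P.seq_pX₁_mem t c d) fun e =>
        expect_le (P.seq_pX₂_mem t a _) fun g => expect_le (seq_trans_mem ch e g)
        fun z => ind_le_one _).trans (by linarith)
  · simp only [expect_add]
    have hB := fun a => (piProd_mem fun _ : Msg n r.r₂₂' => P.seq_pU₂₂Marg_mem (n := n) a).2
    simp only [fun a => expect_const (hB a), expect_const (P.seq_pU₂₁_mem (n := n)).2,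
      expect_const (P.seq_pT₁₀_mem (n := n)).2]
    linarith

end HKPDFDist

/-! ### Correct decoding -/

lemma uniqueOr_eq {α : Type*} {S : α → Prop} {d a : α} (ha : S a) (h : ∀ b, b ≠ a → ¬S b) :
    uniqueOr S d = a := by
  have hu : ∃! a, S a := ⟨a, ha, fun b hb => by_contra fun hne => h b hne hb⟩
  rw [uniqueOr, dif_pos hu]
  exact by_contra fun hne => h _ hne hu.choose_spec.1

lemma blockMsg_castSucc {α : Type*} {b : ℕ} (w : Fin b → α) (d : α) (j : Fin b) :
    blockMsg w d j.castSucc = w j := by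
  simp [blockMsg]

lemma prevMsg_succ {α : Type*} {b : ℕ} (w : Fin b → α) (d : α) (j : Fin b) :
    prevMsg w d j.succ = w j := by
  simp [prevMsg]

lemma prevMsg_zero {α : Type*} {b : ℕ} (w : Fin b → α) (d : α) : prevMsg w d 0 = d := by
  simp [prevMsg]

namespace HKPDFBook

variable {X₁ X₂ Y₁ Y₂ Y : Type*} [Fintype X₁] [Fintype X₂] [Fintype Y₁] [Fintype Y₂] [Fintype Y]
variable {P : HKPDFDist X₁ X₂} {r : HKPDFRates} {n b : ℕ}
variable (bk : HKPDFBook P r n b) (ch : CRC X₁ X₂ Y₁ Y₂ Y)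

/-- The forwarded message of the previous block. -/
noncomputable def prev (w₁ : Fin b → r.Msg₁ n) (i : Fin (b + 1)) : Msg n r.r₁₀ := prevMsg (fun j => (w₁ j).1) 0 i

/-- The message of the first user in a block. -/
noncomputable def msg₁ (w₁ : Fin b → r.Msg₁ n) (i : Fin (b + 1)) : r.Msg₁ n := blockMsg w₁ (0, 0, 0) i

/-- The message of the second user in a block. -/
noncomputable def msg₂ (w₂ : Fin b → r.Msg₂ n) (i : Fin (b + 1)) : r.Msg₂ n := blockMsg w₂ (0, 0) i

/-- The bin index that is sent if the second sender knows the forwarded message. -/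
noncomputable def trueBin (ε' : ℝ) (w₁ : Fin b → r.Msg₁ n) (w₂ : Fin b → r.Msg₂ n)
    (i : Fin (b + 1)) : Msg n r.r₂₂' :=
  P.binIndex ch ε' (bk.t₁₀ i (prev w₁ i)) (bk.u₂₁ i (msg₂ w₂ i).1)
    (bk.u₂₂ i (msg₂ w₂ i).1 (msg₂ w₂ i).2)

/-- The events that make all decoders succeed: the transmitted codewords are typical with the outputs,
and no other codewords are. -/
structure Good (ε' ε : ℝ) (w₁ : Fin b → r.Msg₁ n) (w₂ : Fin b → r.Msg₂ n)
    (z : Fin (b + 1) → Fin n → Y₁ × Y₂ × Y) : Prop where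
  typical : ∀ i, P.FullTypical ch ε (bk.t₁₀ i (prev w₁ i)) (bk.u₂₁ i (msg₂ w₂ i).1)
    (bk.u₂₂ i (msg₂ w₂ i).1 (msg₂ w₂ i).2 (bk.trueBin ch ε' w₁ w₂ i))
    (bk.u₁₀ i (prev w₁ i) (msg₁ w₁ i).1) (bk.u₁₁ i (msg₁ w₁ i).2.1)
    (bk.x₁ i (prev w₁ i) (msg₁ w₁ i).1 (msg₁ w₁ i).2.1 (msg₁ w₁ i).2.2)
    (bk.x₂ i (prev w₁ i) (msg₂ w₂ i).1 (msg₂ w₂ i).2 (bk.trueBin ch ε' w₁ w₂ i)) (z i)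
  relay : ∀ (j : Fin b) (w : Msg n r.r₁₀), w ≠ (msg₁ w₁ j.castSucc).1 →
    ¬P.RelayTypical ch ε (bk.t₁₀ j.castSucc (prev w₁ j.castSucc))
      (bk.u₁₀ j.castSucc (prev w₁ j.castSucc) w) (fun k => (z j.castSucc k).2.2)
  receiver₁ : ∀ (j : Fin b) (w : r.Msg₁ n) (w₂₁ : Msg n r.r₂₁), w ≠ msg₁ w₁ j.castSucc →
    ¬(P.RecvTypical₁ ch ε (bk.t₁₀ j.castSucc (prev w₁ j.castSucc))
      (bk.u₁₀ j.castSucc (prev w₁ j.castSucc) w.1) (bk.u₁₁ j.castSucc w.2.1)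
      (bk.x₁ j.castSucc (prev w₁ j.castSucc) w.1 w.2.1 w.2.2) (bk.u₂₁ j.castSucc w₂₁)
      (fun k => (z j.castSucc k).1) ∧
      P.NextTypical₁ ch ε (bk.t₁₀ j.succ w.1) (fun k => (z j.succ k).1))
  receiver₂ : ∀ (j : Fin b) (w : r.Msg₂ n) (w₁₁ : Msg n r.r₁₁) (v : Msg n r.r₂₂'),
    w ≠ msg₂ w₂ j.castSucc →
    ¬P.RecvTypical₂ ch ε (bk.u₁₁ j.castSucc w₁₁) (bk.u₂₁ j.castSucc w.1)
      (bk.u₂₂ j.castSucc w.1 w.2 v) (fun k => (z j.castSucc k).2.1)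

variable {bk ch} {ε' ε : ℝ} {w₁ : Fin b → r.Msg₁ n} {w₂ : Fin b → r.Msg₂ n}
  {z : Fin ((b + 1) * n) → Y₁ × Y₂ × Y}

/-- Induction over the blocks: a right estimate for the previous block makes the decoder test the
right codewords, and `Good` leaves exactly one candidate. -/
lemma Good.relayEst_eq (h : bk.Good ch ε' ε w₁ w₂ (blockOf z)) (i : ℕ) (hi : i < b + 1) :
    bk.relayEst ch ε (fun k => (z k).2.2) i = prev w₁ ⟨i, hi⟩ := by
  induction i with
  | zero => exact (prevMsg_zero _ _).symm
  | succ i ih =>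
    have hi' : i < b := by omega
    have hc : i < b + 1 ∧ n * (i + 1) ≤ (b + 1) * n :=
      ⟨by omega, by rw [mul_comm]; exact Nat.mul_le_mul_right n (by omega)⟩
    rw [relayEst, dif_pos hc, ih hc.1]
    have hp : prev w₁ ⟨i + 1, hi⟩ = (msg₁ w₁ (Fin.castSucc ⟨i, hi'⟩)).1 := by
      rw [msg₁, blockMsg_castSucc]
      exact prevMsg_succ (fun j => (w₁ j).1) 0 ⟨i, hi'⟩
    rw [hp]
    refine uniqueOr_eq ?_ fun w hw => h.relay ⟨i, hi'⟩ w hw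
    exact (h.typical (Fin.castSucc ⟨i, hi'⟩)).map fun s => (s.t₁₀, s.u₁₀, s.y)

/-- The sent w₂₁ is the witness for the true triple; the second test concerns t₁₀ of the next block,
whose previous message is the w₁₀ of this block. -/
lemma Good.recvDec₁_eq (h : bk.Good ch ε' ε w₁ w₂ (blockOf z)) (j : Fin b) :
    bk.recvDec₁ ch ε j (prev w₁ j.castSucc) (fun k => (z k).1) = w₁ j := by
  have hm : w₁ j = msg₁ w₁ j.castSucc := (blockMsg_castSucc _ _ _).symm
  rw [hm]
  refine uniqueOr_eq ⟨(msg₂ w₂ j.castSucc).1, ?_, ?_⟩ fun w hw => ?_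
  · exact (h.typical j.castSucc).map fun s => (s.t₁₀, s.u₁₀, s.u₁₁, s.x₁, s.u₂₁, s.y₁)
  · have hp : (msg₁ w₁ j.castSucc).1 = prev w₁ j.succ := by
      rw [msg₁, blockMsg_castSucc]
      exact (prevMsg_succ (fun j => (w₁ j).1) 0 j).symm
    rw [hp]
    exact (h.typical j.succ).map fun s => (s.t₁₀, s.y₁)
  · rintro ⟨w₂₁, hw'⟩
    exact h.receiver₁ j w w₂₁ hw hw'

lemma Good.recvEst₁_eq (h : bk.Good ch ε' ε w₁ w₂ (blockOf z)) (i : ℕ) (hi : i < b + 1) :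
    bk.recvEst₁ ch ε (fun k => (z k).1) i = prev w₁ ⟨i, hi⟩ := by
  induction i with
  | zero => exact (prevMsg_zero _ _).symm
  | succ i ih =>
    have hi' : i < b := by omega
    rw [recvEst₁, dif_pos hi', ih (by omega)]
    exact (congrArg Prod.fst (h.recvDec₁_eq ⟨i, hi'⟩)).trans
      (prevMsg_succ (fun j => (w₁ j).1) 0 ⟨i, hi'⟩).symm

lemma Good.dec₁_eq (h : bk.Good ch ε' ε w₁ w₂ (blockOf z)) :
    (bk.code ch ε' ε).dec₁ (fun k => (z k).1) = w₁ := by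
  funext j
  change bk.recvDec₁ ch ε j (bk.recvEst₁ ch ε _ j) _ = _
  rw [h.recvEst₁_eq j (by omega)]
  exact h.recvDec₁_eq j

lemma Good.dec₂_eq (h : bk.Good ch ε' ε w₁ w₂ (blockOf z)) :
    (bk.code ch ε' ε).dec₂ (fun k => (z k).2.1) = w₂ := by
  funext j
  have hm : w₂ j = msg₂ w₂ j.castSucc := (blockMsg_castSucc _ _ _).symm
  rw [hm]
  refine uniqueOr_eq ⟨(msg₁ w₁ j.castSucc).2.1, bk.trueBin ch ε' w₁ w₂ j.castSucc, ?_⟩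
    fun w hw => ?_
  · exact (h.typical j.castSucc).map fun s => (s.u₁₁, s.u₂₁, s.u₂₂, s.y₂)
  · rintro ⟨w₁₁, v, hw'⟩
    exact h.receiver₂ j w w₁₁ v hw hw'

/-- The second sender's estimate from a prefix of the received sequence that contains all blocks
before block `i`. -/
lemma relayEst_prefix (y : Fin ((b + 1) * n) → Y) (m : ℕ) (hm : m ≤ (b + 1) * n) (i : ℕ)
    (hi : n * i ≤ m) :
    bk.relayEst ch ε (fun j : Fin m => y ⟨j, j.2.trans_le hm⟩) i = bk.relayEst ch ε y i := by
  induction i with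
  | zero => rfl
  | succ i ih =>
    have hi' : n * i ≤ m := (Nat.mul_le_mul_left n (Nat.le_succ i)).trans hi
    simp only [relayEst]
    by_cases hb : i < b + 1
    · rw [dif_pos ⟨hb, hi⟩, dif_pos ⟨hb, hi.trans hm⟩, ih hi']
    · rw [dif_neg fun h => hb h.1, dif_neg fun h => hb h.1]

/-- The law of the outputs of a block if the second sender knows the forwarded message. -/
noncomputable def outLaw (bk : HKPDFBook P r n b) (ch : CRC X₁ X₂ Y₁ Y₂ Y) (ε' : ℝ)
    (w₁ : Fin b → r.Msg₁ n) (w₂ : Fin b → r.Msg₂ n) (i : Fin (b + 1)) :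
    (Fin n → Y₁ × Y₂ × Y) → ℝ :=
  piProd fun k => ch.trans
    (bk.x₁ i (prev w₁ i) (msg₁ w₁ i).1 (msg₁ w₁ i).2.1 (msg₁ w₁ i).2.2 k)
    (bk.x₂ i (prev w₁ i) (msg₂ w₂ i).1 (msg₂ w₂ i).2 (bk.trueBin ch ε' w₁ w₂ i) k)

lemma outLaw_mem (bk : HKPDFBook P r n b) (ch : CRC X₁ X₂ Y₁ Y₂ Y) (ε' : ℝ)
    (w₁ : Fin b → r.Msg₁ n) (w₂ : Fin b → r.Msg₂ n) (i : Fin (b + 1)) :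
    bk.outLaw ch ε' w₁ w₂ i ∈ stdSimplex ℝ (Fin n → Y₁ × Y₂ × Y) :=
  piProd_mem fun _ => ch.trans_mem _ _

/-- On the good event the second sender's estimates are right at every time, and at a time within
block i its received prefix already contains all earlier blocks. The causal encoder then acts like
the one that knows w₁₀', so both laws give the same mass. -/
lemma Good.prod_trans_eq (h : bk.Good ch ε' ε w₁ w₂ (blockOf z)) :
    ∏ k, ch.trans ((bk.code ch ε' ε).enc₁ w₁ k)
      ((bk.code ch ε' ε).enc₂ w₂ k (fun j => (z ⟨j, j.2.trans k.2⟩).2.2)) (z k) =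
    piProd (bk.outLaw ch ε' w₁ w₂) (blockOf z) := by
  rw [← finProdFinEquiv.prod_comp, Fintype.prod_prod_type]
  refine Finset.prod_congr rfl fun i _ => Finset.prod_congr rfl fun l _ => ?_
  have hdm := finProdFinEquiv.symm_apply_apply (i, l)
  have hd : (finProdFinEquiv (i, l)).divNat = i := congrArg Prod.fst hdm
  have hmod : (finProdFinEquiv (i, l)).modNat = l := congrArg Prod.snd hdm
  have he : bk.relayEst ch ε (fun j : Fin (finProdFinEquiv (i, l)) =>
      (z ⟨j, j.2.trans (finProdFinEquiv (i, l)).2⟩).2.2) i = prev w₁ i := by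
    rw [← h.relayEst_eq i i.2]
    exact relayEst_prefix (fun k => (z k).2.2) _ (finProdFinEquiv (i, l)).2.le i
      (Nat.le_add_left _ _)
  simp only [code, hd, hmod, he]
  rfl

end HKPDFBook

/-! ### Total mass of a causally generated sequence -/

/-- Summing over the last symbol first, since nothing earlier depends on it. -/
lemma sum_prod_causal {Z : Type*} [Fintype Z] : ∀ (N : ℕ) (q : (k : Fin N) → (Fin k → Z) → Z → ℝ),
    (∀ k h, ∑ a, q k h a = 1) →
    ∑ z : Fin N → Z, ∏ k, q k (fun j => z ⟨j, j.2.trans k.2⟩) (z k) = 1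
  | 0, _, _ => by simp
  | N + 1, q, hq => by
    have ih := sum_prod_causal N (fun k => q k.castSucc) (fun k => hq k.castSucc)
    rw [← (Fin.snocEquiv (fun _ => Z)).sum_comp, Fintype.sum_prod_type, Finset.sum_comm]
    refine Eq.trans (Finset.sum_congr rfl fun z _ => ?_) ih
    have h1 : ∀ a : Z, ∏ k, q k (fun j => (Fin.snocEquiv (fun _ : Fin (N + 1) => Z)) (a, z)
        ⟨j, j.2.trans k.2⟩) ((Fin.snocEquiv (fun _ : Fin (N + 1) => Z)) (a, z) k) =
        (∏ k : Fin N, q k.castSucc (fun j => z ⟨j, j.2.trans k.2⟩) (z k)) *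
          q (Fin.last N) (fun j => z ⟨j, j.2⟩) a := fun a => by
      rw [Fin.prod_univ_castSucc]
      have hs : ∀ k : Fin N, (Fin.snocEquiv (fun _ : Fin (N + 1) => Z)) (a, z) k.castSucc = z k :=
        fun k => Fin.snoc_castSucc (α := fun _ => Z) a z k
      have hl : (Fin.snocEquiv (fun _ : Fin (N + 1) => Z)) (a, z) (Fin.last N) = a :=
        Fin.snoc_last (α := fun _ => Z) a z
      congr 1
      · refine Finset.prod_congr rfl fun k _ => ?_
        rw [hs]
        congr 1
        funext j
        exact hs ⟨j, j.2.trans k.2⟩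
      · rw [hl]
        congr 1
        funext j
        exact hs ⟨j, j.2⟩
    simp only [h1, ← Finset.mul_sum, hq, mul_one]
    rfl

/-! ### Reduction of the error probability of the scheme to single blocks -/

lemma sum_arrow_prod {ι A B : Type*} [Fintype ι] [DecidableEq ι] [Fintype A] [Fintype B]
    (F : (ι → A) → (ι → B) → ℝ) :
    ∑ f, ∑ g, F f g = ∑ z : ι → A × B, F (fun i => (z i).1) (fun i => (z i).2) := by
  rw [← Fintype.sum_prod_type']
  exact ((Equiv.arrowProdEquivProdArrow ι (fun _ => A) (fun _ => B)).sum_comp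
    (fun z => F z.1 z.2)).symm

/-- A sequence of `b + 1` blocks of length `n`. -/
def blockEquiv (α : Type*) (n b : ℕ) : (Fin ((b + 1) * n) → α) ≃ (Fin (b + 1) → Fin n → α) where
  toFun := blockOf
  invFun f k := f k.divNat k.modNat
  left_inv y := by
    funext k
    exact congrArg y (finProdFinEquiv.apply_symm_apply k)
  right_inv f := by
    funext i l
    have hdm := finProdFinEquiv.symm_apply_apply (i, l)
    have hd : (finProdFinEquiv (i, l)).divNat = i := congrArg Prod.fst hdm
    have hmod : (finProdFinEquiv (i, l)).modNat = l := congrArg Prod.snd hdm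
    simp only [blockOf, hd, hmod]

namespace HKPDFBook

variable {X₁ X₂ Y₁ Y₂ Y : Type*} [Fintype X₁] [Fintype X₂] [Fintype Y₁] [Fintype Y₂] [Fintype Y]
variable {P : HKPDFDist X₁ X₂} {r : HKPDFRates} {n b : ℕ}
variable (bk : HKPDFBook P r n b) (ch : CRC X₁ X₂ Y₁ Y₂ Y)

open Classical in
/-- The error probability given the messages is at most the probability that the codebooks and the
outputs are not good when the second sender knows the forwarded messages. -/
lemma sum_error_le (ε' ε : ℝ) (w₁ : Fin b → r.Msg₁ n) (w₂ : Fin b → r.Msg₂ n) :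
    (∑ y₁ : Fin ((b + 1) * n) → Y₁, ∑ y₂ : Fin ((b + 1) * n) → Y₂, ∑ y : Fin ((b + 1) * n) → Y,
      if (bk.code ch ε' ε).dec₁ y₁ = w₁ ∧ (bk.code ch ε' ε).dec₂ y₂ = w₂ then (0 : ℝ)
      else ∏ k, ch.trans ((bk.code ch ε' ε).enc₁ w₁ k)
        ((bk.code ch ε' ε).enc₂ w₂ k (fun j => y ⟨j, j.2.trans k.2⟩)) (y₁ k, y₂ k, y k)) ≤
    expect (piProd (bk.outLaw ch ε' w₁ w₂)) (fun z => ind (¬bk.Good ch ε' ε w₁ w₂ z)) := by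
  set law : (Fin ((b + 1) * n) → Y₁ × Y₂ × Y) → ℝ := fun z =>
    ∏ k, ch.trans ((bk.code ch ε' ε).enc₁ w₁ k)
      ((bk.code ch ε' ε).enc₂ w₂ k (fun j => (z ⟨j, j.2.trans k.2⟩).2.2)) (z k) with hlaw
  have hsum : ∑ z, law z = 1 :=
    sum_prod_causal _ (fun k h => ch.trans ((bk.code ch ε' ε).enc₁ w₁ k)
      ((bk.code ch ε' ε).enc₂ w₂ k fun j => (h j).2.2)) fun k h => (ch.trans_mem _ _).2
  have hlaw0 : ∀ z, 0 ≤ law z := fun z => Finset.prod_nonneg fun k _ => (ch.trans_mem _ _).1 _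
  have hgen : ∑ z, piProd (bk.outLaw ch ε' w₁ w₂) (blockOf z) = 1 := by
    exact ((blockEquiv (Y₁ × Y₂ × Y) n b).sum_comp (piProd (bk.outLaw ch ε' w₁ w₂))).trans
      (piProd_mem fun i => bk.outLaw_mem ch ε' w₁ w₂ i).2
  -- The true and the idealized laws agree on the good event. As both have mass one, they also give
  -- the complement the same probability, although they may differ pointwise there.
  have hgood : ∀ z, ind (bk.Good ch ε' ε w₁ w₂ (blockOf z)) * law z =
      ind (bk.Good ch ε' ε w₁ w₂ (blockOf z)) * piProd (bk.outLaw ch ε' w₁ w₂) (blockOf z) := by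
    intro z
    by_cases h : bk.Good ch ε' ε w₁ w₂ (blockOf z)
    · rw [← h.prod_trans_eq]
    · rw [ind_false h, zero_mul, zero_mul]
  have hrhs : expect (piProd (bk.outLaw ch ε' w₁ w₂)) (fun z => ind (¬bk.Good ch ε' ε w₁ w₂ z)) =
      ∑ z, (1 - ind (bk.Good ch ε' ε w₁ w₂ (blockOf z))) * law z := by
    rw [expect, ← (blockEquiv (Y₁ × Y₂ × Y) n b).sum_comp]
    simp only [sub_mul, one_mul, Finset.sum_sub_distrib, hsum, hgood, ind_not, mul_sub, mul_one]
    rw [show ∑ z, piProd (bk.outLaw ch ε' w₁ w₂) (blockEquiv (Y₁ × Y₂ × Y) n b z) = 1 from hgen]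
    congr 1
    exact Finset.sum_congr rfl fun z _ => mul_comm _ _
  simp only [sum_arrow_prod (fun (y₂ : Fin ((b + 1) * n) → Y₂) (y : Fin ((b + 1) * n) → Y) => _)]
  rw [sum_arrow_prod, hrhs]
  refine Finset.sum_le_sum fun z _ => ?_
  by_cases h : bk.Good ch ε' ε w₁ w₂ (blockOf z)
  · rw [if_pos ⟨h.dec₁_eq, h.dec₂_eq⟩, ind_true h, sub_self, zero_mul]
  · rw [ind_false h, sub_zero, one_mul]
    split_ifs
    · exact hlaw0 z
    · exact le_rfl

/-- The codebooks of one block: `t₁₀`, `u₁₀`, `u₁₁`, `x₁`, `u₂₁`, `u₂₂`, `x₂`. -/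
abbrev Block (P : HKPDFDist X₁ X₂) (r : HKPDFRates) (n : ℕ) : Type _ :=
  (Msg n r.r₁₀ → Fin n → Fin P.kT₁₀) × (Msg n r.r₁₀ → Msg n r.r₁₀ → Fin n → Fin P.kU₁₀) ×
  (Msg n r.r₁₁ → Fin n → Fin P.kU₁₁) ×
  (Msg n r.r₁₀ → Msg n r.r₁₀ → Msg n r.r₁₁ → Msg n r.r₁₂ → Fin n → X₁) ×
  (Msg n r.r₂₁ → Fin n → Fin P.kU₂₁) ×
  (Msg n r.r₂₁ → Msg n r.r₂₂ → Msg n r.r₂₂' → Fin n → Fin P.kU₂₂) ×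
  (Msg n r.r₁₀ → Msg n r.r₂₁ → Msg n r.r₂₂ → Msg n r.r₂₂' → Fin n → X₂)

/-- The codebooks of all blocks. -/
def ofBlocks (β : Fin (b + 1) → Block P r n) : HKPDFBook P r n b where
  t₁₀ i := (β i).1
  u₁₀ i := (β i).2.1
  u₁₁ i := (β i).2.2.1
  x₁ i := (β i).2.2.2.1
  u₂₁ i := (β i).2.2.2.2.1
  u₂₂ i := (β i).2.2.2.2.2.1
  x₂ i := (β i).2.2.2.2.2.2

/-- The law of the codebooks of one block. -/
noncomputable def blockLaw (P : HKPDFDist X₁ X₂) (r : HKPDFRates) (n : ℕ) (β : Block P r n) : ℝ :=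
  piProd (fun _ => piProd fun _ => P.pT₁₀) β.1 *
  piProd (fun i => piProd fun _ => piProd fun k => P.pU₁₀ (β.1 i k)) β.2.1 *
  piProd (fun _ => piProd fun _ => P.pU₁₁) β.2.2.1 *
  piProd (fun i => piProd fun j => piProd fun l => piProd fun _ => piProd fun k =>
    P.pX₁ (β.1 i k) (β.2.1 i j k) (β.2.2.1 l k)) β.2.2.2.1 *
  piProd (fun _ => piProd fun _ => P.pU₂₁) β.2.2.2.2.1 *
  piProd (fun m => piProd fun _ => piProd fun _ => piProd fun k =>
    P.pU₂₂Marg (β.2.2.2.2.1 m k)) β.2.2.2.2.2.1 *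
  piProd (fun i => piProd fun m => piProd fun o => piProd fun v => piProd fun k =>
    P.pX₂ (β.1 i k) (β.2.2.2.2.1 m k) (β.2.2.2.2.2.1 m o v k)) β.2.2.2.2.2.2

lemma expect_blockLaw (ε' : ℝ) (w' : Msg n r.r₁₀) (m₁ : r.Msg₁ n) (m₂ : r.Msg₂ n)
    (F : Block P r n → (Fin n → Y₁ × Y₂ × Y) → ℝ) :
    expect (blockLaw P r n) (fun β => expect (piProd fun k => ch.trans
      (β.2.2.2.1 w' m₁.1 m₁.2.1 m₁.2.2 k) (β.2.2.2.2.2.2 w' m₂.1 m₂.2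
        (P.binIndex ch ε' (β.1 w') (β.2.2.2.2.1 m₂.1) (β.2.2.2.2.2.1 m₂.1 m₂.2)) k)) (F β)) =
    P.blockExpect ch ε' w' m₁ m₂ (fun t a b c d e g z => F (t, c, d, e, a, b, g) z) := by
  let perm : (Msg n r.r₁₀ → Fin n → Fin P.kT₁₀) × (Msg n r.r₂₁ → Fin n → Fin P.kU₂₁) ×
      (Msg n r.r₂₁ → Msg n r.r₂₂ → Msg n r.r₂₂' → Fin n → Fin P.kU₂₂) ×
      (Msg n r.r₁₀ → Msg n r.r₁₀ → Fin n → Fin P.kU₁₀) × (Msg n r.r₁₁ → Fin n → Fin P.kU₁₁) ×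
      (Msg n r.r₁₀ → Msg n r.r₁₀ → Msg n r.r₁₁ → Msg n r.r₁₂ → Fin n → X₁) ×
      (Msg n r.r₁₀ → Msg n r.r₂₁ → Msg n r.r₂₂ → Msg n r.r₂₂' → Fin n → X₂) ≃ Block P r n :=
    { toFun := fun (t, a, b, c, d, e, g) => (t, c, d, e, a, b, g)
      invFun := fun (t, c, d, e, a, b, g) => (t, a, b, c, d, e, g)
      left_inv := fun _ => rfl
      right_inv := fun _ => rfl }
  rw [expect, ← perm.sum_comp, HKPDFDist.blockExpect]
  simp only [Fintype.sum_prod_type, perm, Equiv.coe_fn_mk, blockLaw]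
  rw [expect]
  refine Finset.sum_congr rfl fun t _ => ?_
  rw [expect, Finset.mul_sum]; refine Finset.sum_congr rfl fun a _ => ?_
  rw [expect, Finset.mul_sum, Finset.mul_sum]; refine Finset.sum_congr rfl fun b _ => ?_
  rw [expect, Finset.mul_sum, Finset.mul_sum, Finset.mul_sum]
  refine Finset.sum_congr rfl fun c _ => ?_
  rw [expect, Finset.mul_sum, Finset.mul_sum, Finset.mul_sum, Finset.mul_sum]
  refine Finset.sum_congr rfl fun d _ => ?_
  rw [expect, Finset.mul_sum, Finset.mul_sum, Finset.mul_sum, Finset.mul_sum, Finset.mul_sum]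
  refine Finset.sum_congr rfl fun e _ => ?_
  rw [expect, Finset.mul_sum, Finset.mul_sum, Finset.mul_sum, Finset.mul_sum, Finset.mul_sum,
    Finset.mul_sum]
  refine Finset.sum_congr rfl fun g _ => ?_
  ring

lemma blockLaw_mem : blockLaw P r n ∈ stdSimplex ℝ (Block P r n) := by
  refine ⟨fun β => ?_, ?_⟩
  · refine mul_nonneg (mul_nonneg (mul_nonneg (mul_nonneg (mul_nonneg (mul_nonneg ?_ ?_) ?_) ?_) ?_)
      ?_) ?_
    · exact piProd_nonneg (fun _ => P.seq_pT₁₀_mem.1) _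
    · exact piProd_nonneg (fun _ => piProd_nonneg fun _ => (P.seq_pU₁₀_mem _).1) _
    · exact piProd_nonneg (fun _ => P.seq_pU₁₁_mem.1) _
    · exact piProd_nonneg (fun _ => piProd_nonneg fun _ => piProd_nonneg fun _ =>
        piProd_nonneg fun _ => (P.seq_pX₁_mem _ _ _).1) _
    · exact piProd_nonneg (fun _ => P.seq_pU₂₁_mem.1) _
    · exact piProd_nonneg (fun _ => piProd_nonneg fun _ => piProd_nonneg fun _ =>
        (P.seq_pU₂₂Marg_mem _).1) _
    · exact piProd_nonneg (fun _ => piProd_nonneg fun _ => piProd_nonneg fun _ =>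
        piProd_nonneg fun _ => (P.seq_pX₂_mem _ _ _).1) _
  · simp only [Fintype.sum_prod_type, blockLaw, ← Finset.mul_sum]
    have hT := (piProd_mem fun _ : Msg n r.r₁₀ => P.seq_pT₁₀_mem (n := n)).2
    have hA := (piProd_mem fun _ : Msg n r.r₂₁ => P.seq_pU₂₁_mem (n := n)).2
    have hD := (piProd_mem fun _ : Msg n r.r₁₁ => P.seq_pU₁₁_mem (n := n)).2
    have hG := fun (t : Msg n r.r₁₀ → Fin n → Fin P.kT₁₀) (a : Msg n r.r₂₁ → Fin n → Fin P.kU₂₁)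
      (b : Msg n r.r₂₁ → Msg n r.r₂₂ → Msg n r.r₂₂' → Fin n → Fin P.kU₂₂) => (piProd_mem fun i : Msg n r.r₁₀ => piProd_mem fun m : Msg n r.r₂₁ =>
      piProd_mem fun o : Msg n r.r₂₂ => piProd_mem fun v : Msg n r.r₂₂' =>
        P.seq_pX₂_mem (n := n) (t i) (a m) (b m o v)).2
    have hB := fun (a : Msg n r.r₂₁ → Fin n → Fin P.kU₂₁) => (piProd_mem fun m : Msg n r.r₂₁ =>
      piProd_mem fun o : Msg n r.r₂₂ => piProd_mem fun v : Msg n r.r₂₂' =>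
        P.seq_pU₂₂Marg_mem (n := n) (a m)).2
    have hE := fun (t : Msg n r.r₁₀ → Fin n → Fin P.kT₁₀)
      (c : Msg n r.r₁₀ → Msg n r.r₁₀ → Fin n → Fin P.kU₁₀)
      (d : Msg n r.r₁₁ → Fin n → Fin P.kU₁₁) => (piProd_mem fun i : Msg n r.r₁₀ => piProd_mem fun j : Msg n r.r₁₀ =>
      piProd_mem fun l : Msg n r.r₁₁ => piProd_mem fun v : Msg n r.r₁₂ =>
        P.seq_pX₁_mem (n := n) (t i) (c i j) (d l)).2
    have hC := fun (t : Msg n r.r₁₀ → Fin n → Fin P.kT₁₀) => (piProd_mem fun i : Msg n r.r₁₀ => piProd_mem fun j : Msg n r.r₁₀ =>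
        P.seq_pU₁₀_mem (n := n) (t i)).2
    simp only [hG, mul_one]
    simp only [← Finset.mul_sum, hB, mul_one]
    simp only [← Finset.mul_sum, hA, mul_one]
    simp only [← Finset.mul_sum, hE, mul_one]
    simp only [← Finset.mul_sum, hD, mul_one]
    simp only [← Finset.mul_sum, hC, mul_one, hT]

/-- The weight is by definition a product over the blocks; regrouping the codebooks block by block
shows that the blocks are independent draws from `blockLaw`. -/
lemma sum_weight_mul (Φ : HKPDFBook P r n b → ℝ) :
    (∑ t₁₀, ∑ u₁₀, ∑ u₁₁, ∑ x₁, ∑ u₂₁, ∑ u₂₂, ∑ x₂,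
      (⟨t₁₀, u₁₀, u₁₁, x₁, u₂₁, u₂₂, x₂⟩ : HKPDFBook P r n b).weight *
        Φ ⟨t₁₀, u₁₀, u₁₁, x₁, u₂₁, u₂₂, x₂⟩) =
    expect (piProd fun _ : Fin (b + 1) => blockLaw P r n) (fun β => Φ (ofBlocks β)) := by
  simp only [sum_arrow_prod]
  rfl

end HKPDFBook

/-! ### The error probability of the random codebooks -/

/-- Error exponents depend on an index only through its being right or wrong; there are M − 1 wrong
values. Keeping the −1 makes the term vanish when the rate is zero. -/
lemma sum_eq_card_sub_one {ι : Type*} [Fintype ι] (x₀ : ι) (h : Prop → ℝ) :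
    ∑ x, h (x = x₀) = h True + ((Fintype.card ι : ℝ) - 1) * h False := by
  classical
  rw [← Finset.add_sum_erase _ _ (Finset.mem_univ x₀)]
  congr 1
  · simp
  · rw [Finset.sum_congr rfl fun x hx => by
      rw [show (x = x₀) = False from eq_false (Finset.ne_of_mem_erase hx)], Finset.sum_const,
      Finset.card_erase_of_mem (Finset.mem_univ _), nsmul_eq_mul, Finset.card_univ,
      Nat.cast_sub (Fintype.card_pos_iff.mpr ⟨x₀⟩), Nat.cast_one]

lemma expect_piProd_mul {ι A : Type*} [Fintype ι] [DecidableEq ι] [Fintype A] {q : ι → A → ℝ}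
    (hq : ∀ i, ∑ a, q i a = 1) {i j : ι} (h : j ≠ i) (f g : A → ℝ) :
    expect (piProd q) (fun x => f (x i) * g (x j)) = expect (q i) f * expect (q j) g := by
  rw [expect_piProd_pair hq i j (fun a a' => f a * g a')]
  simp only [repeatKernel_false h, expect_mul_left]
  rw [mul_comm, ← expect_mul_left]
  exact expect_congr fun a => mul_comm _ _

namespace HKPDFBook

variable {X₁ X₂ Y₁ Y₂ Y : Type*} [Fintype X₁] [Fintype X₂] [Fintype Y₁] [Fintype Y₂] [Fintype Y]
variable (P : HKPDFDist X₁ X₂) (ch : CRC X₁ X₂ Y₁ Y₂ Y) {r : HKPDFRates} {n b : ℕ}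

/-- The expectation of a function of the codebooks and the outputs of all blocks, if the second sender
knows the forwarded messages. -/
noncomputable def schemeExpect (ε' : ℝ) (w₁ : Fin b → r.Msg₁ n) (w₂ : Fin b → r.Msg₂ n)
    (F : (Fin (b + 1) → Block P r n) → (Fin (b + 1) → Fin n → Y₁ × Y₂ × Y) → ℝ) : ℝ :=
  expect (piProd fun _ => blockLaw P r n) fun β =>
    expect (piProd ((ofBlocks β).outLaw ch ε' w₁ w₂)) (F β)

/-- The expectation of a function of the codebooks and the outputs of block `i`. -/
noncomputable def singleExpect (ε' : ℝ) (w₁ : Fin b → r.Msg₁ n) (w₂ : Fin b → r.Msg₂ n)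
    (i : Fin (b + 1)) (f : Block P r n → (Fin n → Y₁ × Y₂ × Y) → ℝ) : ℝ :=
  P.blockExpect ch ε' (prev w₁ i) (msg₁ w₁ i) (msg₂ w₂ i)
    (fun t a b c d e g z => f (t, c, d, e, a, b, g) z)

variable {P ch} {ε' : ℝ} {w₁ : Fin b → r.Msg₁ n} {w₂ : Fin b → r.Msg₂ n}

lemma schemeExpect_single (i : Fin (b + 1)) (f : Block P r n → (Fin n → Y₁ × Y₂ × Y) → ℝ) :
    schemeExpect P ch ε' w₁ w₂ (fun β z => f (β i) (z i)) = singleExpect P ch ε' w₁ w₂ i f := by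
  rw [singleExpect, ← expect_blockLaw, schemeExpect,
    ← expect_piProd_eval (q := fun _ : Fin (b + 1) => blockLaw P r n) (fun _ => blockLaw_mem.2) i]
  refine expect_congr fun β => ?_
  rw [expect_piProd_eval fun i => ((ofBlocks β).outLaw_mem ch ε' w₁ w₂ i).2]
  rfl

/-- Distinct blocks have independent codebooks and, with the forwarded messages known, independent
outputs. This is why the comparison with the idealized code is needed. -/
lemma schemeExpect_pair {i j : Fin (b + 1)} (h : j ≠ i)
    (f g : Block P r n → (Fin n → Y₁ × Y₂ × Y) → ℝ) :
    schemeExpect P ch ε' w₁ w₂ (fun β z => f (β i) (z i) * g (β j) (z j)) =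
      singleExpect P ch ε' w₁ w₂ i f * singleExpect P ch ε' w₁ w₂ j g := by
  rw [singleExpect, singleExpect, ← expect_blockLaw, ← expect_blockLaw, schemeExpect,
    ← expect_piProd_mul (q := fun _ : Fin (b + 1) => blockLaw P r n) (fun _ => blockLaw_mem.2) h]
  refine expect_congr fun β => ?_
  exact expect_piProd_mul (fun i => ((ofBlocks β).outLaw_mem ch ε' w₁ w₂ i).2) h _ _

lemma schemeExpect_mono {F G : (Fin (b + 1) → Block P r n) → (Fin (b + 1) → Fin n → Y₁ × Y₂ × Y) → ℝ}
    (h : ∀ β z, F β z ≤ G β z) :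
    schemeExpect P ch ε' w₁ w₂ F ≤ schemeExpect P ch ε' w₁ w₂ G :=
  expect_mono (piProd_nonneg fun _ => blockLaw_mem.1) fun β =>
    expect_mono (piProd_nonneg fun i => ((ofBlocks β).outLaw_mem ch ε' w₁ w₂ i).1) fun z => h β z

lemma schemeExpect_zero :
    schemeExpect P ch ε' w₁ w₂ (fun _ _ => 0) = 0 := by
  simp [schemeExpect, expect]

lemma schemeExpect_add (F G : (Fin (b + 1) → Block P r n) → (Fin (b + 1) → Fin n → Y₁ × Y₂ × Y) → ℝ) :
    schemeExpect P ch ε' w₁ w₂ (fun β z => F β z + G β z) =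
      schemeExpect P ch ε' w₁ w₂ F + schemeExpect P ch ε' w₁ w₂ G := by
  simp only [schemeExpect, expect_add]

lemma schemeExpect_sum {ι : Type*} [Fintype ι]
    (F : ι → (Fin (b + 1) → Block P r n) → (Fin (b + 1) → Fin n → Y₁ × Y₂ × Y) → ℝ) :
    schemeExpect P ch ε' w₁ w₂ (fun β z => ∑ x, F x β z) =
      ∑ x, schemeExpect P ch ε' w₁ w₂ (F x) := by
  simp only [schemeExpect, expect_sum]

lemma schemeExpect_ind_and_le {E : Prop} {c : ℝ}
    {S : (Fin (b + 1) → Block P r n) → (Fin (b + 1) → Fin n → Y₁ × Y₂ × Y) → Prop}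
    (h : E → schemeExpect P ch ε' w₁ w₂ (fun β z => ind (S β z)) ≤ c) :
    schemeExpect P ch ε' w₁ w₂ (fun β z => ind (E ∧ S β z)) ≤ ind E * c := by
  by_cases hE : E
  · simpa only [hE, true_and, ind_true, one_mul] using h hE
  · simp only [hE, false_and, ind_false, not_false_eq_true, zero_mul, schemeExpect_zero, le_refl]

/-- The union bound over the events of which one occurs if decoding fails. -/
lemma schemeExpect_not_good_le (ε' ε : ℝ) (w₁ : Fin b → r.Msg₁ n) (w₂ : Fin b → r.Msg₂ n) :
    schemeExpect P ch ε' w₁ w₂ (fun β z => ind (¬(ofBlocks β).Good ch ε' ε w₁ w₂ z)) ≤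
      ∑ i, schemeExpect P ch ε' w₁ w₂ (fun β z => ind (¬P.FullTypical ch ε ((β i).1 (prev w₁ i))
        ((β i).2.2.2.2.1 (msg₂ w₂ i).1)
        ((β i).2.2.2.2.2.1 (msg₂ w₂ i).1 (msg₂ w₂ i).2 ((ofBlocks β).trueBin ch ε' w₁ w₂ i))
        ((β i).2.1 (prev w₁ i) (msg₁ w₁ i).1) ((β i).2.2.1 (msg₁ w₁ i).2.1)
        ((β i).2.2.2.1 (prev w₁ i) (msg₁ w₁ i).1 (msg₁ w₁ i).2.1 (msg₁ w₁ i).2.2)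
        ((β i).2.2.2.2.2.2 (prev w₁ i) (msg₂ w₂ i).1 (msg₂ w₂ i).2
          ((ofBlocks β).trueBin ch ε' w₁ w₂ i)) (z i))) +
      (∑ j : Fin b, ∑ w : Msg n r.r₁₀, schemeExpect P ch ε' w₁ w₂ (fun β z =>
        ind (w ≠ (msg₁ w₁ j.castSucc).1 ∧ P.RelayTypical ch ε
          ((β j.castSucc).1 (prev w₁ j.castSucc)) ((β j.castSucc).2.1 (prev w₁ j.castSucc) w)
          (fun k => (z j.castSucc k).2.2))) +
      (∑ j : Fin b, ∑ w : r.Msg₁ n, ∑ w₂₁ : Msg n r.r₂₁, schemeExpect P ch ε' w₁ w₂ (fun β z =>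
        ind (w ≠ msg₁ w₁ j.castSucc ∧ P.RecvTypical₁ ch ε
          ((β j.castSucc).1 (prev w₁ j.castSucc)) ((β j.castSucc).2.1 (prev w₁ j.castSucc) w.1)
          ((β j.castSucc).2.2.1 w.2.1)
          ((β j.castSucc).2.2.2.1 (prev w₁ j.castSucc) w.1 w.2.1 w.2.2)
          ((β j.castSucc).2.2.2.2.1 w₂₁) (fun k => (z j.castSucc k).1) ∧
          P.NextTypical₁ ch ε ((β j.succ).1 w.1) (fun k => (z j.succ k).1))) +
      ∑ j : Fin b, ∑ w : r.Msg₂ n, ∑ w₁₁ : Msg n r.r₁₁, ∑ v : Msg n r.r₂₂',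
        schemeExpect P ch ε' w₁ w₂ (fun β z => ind (w ≠ msg₂ w₂ j.castSucc ∧
          P.RecvTypical₂ ch ε ((β j.castSucc).2.2.1 w₁₁) ((β j.castSucc).2.2.2.2.1 w.1)
            ((β j.castSucc).2.2.2.2.2.1 w.1 w.2 v) (fun k => (z j.castSucc k).2.1))))) := by
  simp only [← schemeExpect_sum, ← schemeExpect_add]
  refine schemeExpect_mono fun β z => ?_
  by_cases h1 : ∃ i, ¬P.FullTypical ch ε ((β i).1 (prev w₁ i))
        ((β i).2.2.2.2.1 (msg₂ w₂ i).1)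
        ((β i).2.2.2.2.2.1 (msg₂ w₂ i).1 (msg₂ w₂ i).2 ((ofBlocks β).trueBin ch ε' w₁ w₂ i))
        ((β i).2.1 (prev w₁ i) (msg₁ w₁ i).1) ((β i).2.2.1 (msg₁ w₁ i).2.1)
        ((β i).2.2.2.1 (prev w₁ i) (msg₁ w₁ i).1 (msg₁ w₁ i).2.1 (msg₁ w₁ i).2.2)
        ((β i).2.2.2.2.2.2 (prev w₁ i) (msg₂ w₂ i).1 (msg₂ w₂ i).2
          ((ofBlocks β).trueBin ch ε' w₁ w₂ i)) (z i)
  · refine le_add_of_le_of_nonneg ?_ ?_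
    · exact (ind_mono fun _ => h1).trans (ind_exists_le _)
    · exact add_nonneg (Finset.sum_nonneg fun _ _ => Finset.sum_nonneg fun _ _ => ind_nonneg _)
        (add_nonneg (Finset.sum_nonneg fun _ _ => Finset.sum_nonneg fun _ _ =>
          Finset.sum_nonneg fun _ _ => ind_nonneg _)
        (Finset.sum_nonneg fun _ _ => Finset.sum_nonneg fun _ _ => Finset.sum_nonneg fun _ _ =>
          Finset.sum_nonneg fun _ _ => ind_nonneg _))
  refine le_add_of_nonneg_of_le (Finset.sum_nonneg fun _ _ => ind_nonneg _) ?_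
  refine (ind_mono (F := (∃ (j : Fin b) (w : Msg n r.r₁₀), w ≠ (msg₁ w₁ j.castSucc).1 ∧
      P.RelayTypical ch ε
          ((β j.castSucc).1 (prev w₁ j.castSucc)) ((β j.castSucc).2.1 (prev w₁ j.castSucc) w)
          (fun k => (z j.castSucc k).2.2)) ∨
      (∃ (j : Fin b) (w : r.Msg₁ n) (w₂₁ : Msg n r.r₂₁), w ≠ msg₁ w₁ j.castSucc ∧
          P.RecvTypical₁ ch ε
          ((β j.castSucc).1 (prev w₁ j.castSucc)) ((β j.castSucc).2.1 (prev w₁ j.castSucc) w.1)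
          ((β j.castSucc).2.2.1 w.2.1)
          ((β j.castSucc).2.2.2.1 (prev w₁ j.castSucc) w.1 w.2.1 w.2.2)
          ((β j.castSucc).2.2.2.2.1 w₂₁) (fun k => (z j.castSucc k).1) ∧
          P.NextTypical₁ ch ε ((β j.succ).1 w.1) (fun k => (z j.succ k).1)) ∨
      ∃ (j : Fin b) (w : r.Msg₂ n) (w₁₁ : Msg n r.r₁₁) (v : Msg n r.r₂₂'),
        w ≠ msg₂ w₂ j.castSucc ∧
          P.RecvTypical₂ ch ε ((β j.castSucc).2.2.1 w₁₁) ((β j.castSucc).2.2.2.2.1 w.1)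
            ((β j.castSucc).2.2.2.2.2.1 w.1 w.2 v) (fun k => (z j.castSucc k).2.1)) ?_).trans ?_
  · intro hbad
    by_contra hno
    push Not at hno h1
    exact hbad ⟨h1, hno.1, fun j w w₂₁ hw h => hno.2.1 j w w₂₁ hw h.1 h.2, hno.2.2⟩
  · refine (ind_or_le _ _).trans (add_le_add ?_ ((ind_or_le _ _).trans (add_le_add ?_ ?_)))
    · exact (ind_exists_le _).trans (Finset.sum_le_sum fun j _ => ind_exists_le _)
    · exact (ind_exists_le _).trans (Finset.sum_le_sum fun j _ => (ind_exists_le _).trans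
        (Finset.sum_le_sum fun w _ => ind_exists_le _))
    · exact (ind_exists_le _).trans (Finset.sum_le_sum fun j _ => (ind_exists_le _).trans
        (Finset.sum_le_sum fun w _ => (ind_exists_le _).trans
          (Finset.sum_le_sum fun w' _ => ind_exists_le _)))

variable (P ch)

/-- If w₁₀ is right, the test in the next block gives nothing and is ignored. If it is wrong, the
two blocks are independent and their exponents add up to the full quantity with I(T₁₀;Y₁). -/
lemma exists_receivers₁_error_le : ∃ D, 0 ≤ D ∧ ∀ (r : HKPDFRates) (n b : ℕ) (ε' ε : ℝ), 0 ≤ ε →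
    ∀ (w₁ : Fin b → r.Msg₁ n) (w₂ : Fin b → r.Msg₂ n) (j : Fin b) (w : r.Msg₁ n)
      (w₂₁ : Msg n r.r₂₁), w ≠ msg₁ w₁ j.castSucc →
    schemeExpect P ch ε' w₁ w₂ (fun β z => ind (P.RecvTypical₁ ch ε
          ((β j.castSucc).1 (prev w₁ j.castSucc)) ((β j.castSucc).2.1 (prev w₁ j.castSucc) w.1)
          ((β j.castSucc).2.2.1 w.2.1)
          ((β j.castSucc).2.2.2.1 (prev w₁ j.castSucc) w.1 w.2.1 w.2.2)
          ((β j.castSucc).2.2.2.2.1 w₂₁) (fun k => (z j.castSucc k).1) ∧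
          P.NextTypical₁ ch ε ((β j.succ).1 w.1) (fun k => (z j.succ k).1))) ≤
      (2 : ℝ) ^ (-(n * (P.recvInfo₁ ch (w.1 = (msg₁ w₁ j.castSucc).1)
        (w.2.1 = (msg₁ w₁ j.castSucc).2.1) (w₂₁ = (msg₂ w₂ j.castSucc).1) - ε * D))) := by
  obtain ⟨D₁, h₁, H₁⟩ := P.exists_receiver₁_error_le ch
  obtain ⟨D₂, h₂, H₂⟩ := P.exists_next_error_le ch
  refine ⟨D₁ + D₂, by positivity, fun r n b ε' ε hε w₁ w₂ j w w₂₁ hw => ?_⟩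
  have hR := H₁ r n ε' ε hε (prev w₁ j.castSucc) (msg₁ w₁ j.castSucc) (msg₂ w₂ j.castSucc) w w₂₁ hw
  let f : Block P r n → (Fin n → Y₁ × Y₂ × Y) → ℝ := fun β z => ind (P.RecvTypical₁ ch ε
          (β.1 (prev w₁ j.castSucc)) (β.2.1 (prev w₁ j.castSucc) w.1)
          (β.2.2.1 w.2.1) (β.2.2.2.1 (prev w₁ j.castSucc) w.1 w.2.1 w.2.2)
          (β.2.2.2.2.1 w₂₁) (fun k => (z k).1))
  let g : Block P r n → (Fin n → Y₁ × Y₂ × Y) → ℝ := fun β z =>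
    ind (P.NextTypical₁ ch ε (β.1 w.1) (fun k => (z k).1))
  by_cases hE : w.1 = (msg₁ w₁ j.castSucc).1
  · have h0 : P.nextInfo₁ ch (w.1 = (msg₁ w₁ j.castSucc).1) = 0 := if_pos hE
    rw [h0, sub_zero] at hR
    refine (schemeExpect_mono fun β z => ind_mono And.left).trans ?_
    exact (schemeExpect_single j.castSucc f).trans_le
      (hR.trans (HKPDFDist.rpow_info_mono hε (by linarith)))
  · have h0 : P.nextInfo₁ ch (w.1 = (msg₁ w₁ j.castSucc).1) =
      mutualInfo (P.joint ch) (·.t₁₀) (·.y₁) := if_neg hE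
    rw [h0] at hR
    have hp : prev w₁ j.succ = (msg₁ w₁ j.castSucc).1 := by
      rw [msg₁, blockMsg_castSucc]
      exact prevMsg_succ (fun j => (w₁ j).1) 0 j
    have hN := H₂ r n ε' ε (prev w₁ j.succ) (msg₁ w₁ j.succ) (msg₂ w₂ j.succ) w.1
      (fun h => hE (h.trans hp))
    have hne : j.succ ≠ j.castSucc := by
      intro h
      have := congrArg Fin.val h
      simp at this
    simp only [ind_and]
    refine (schemeExpect_pair hne f g).trans_le ?_
    refine (mul_le_mul hR hN ?_ (by positivity)).trans ?_
    · have h0 : 0 ≤ singleExpect P ch ε' w₁ w₂ j.succ g := by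
        rw [← schemeExpect_single j.succ g,
          ← schemeExpect_zero (P := P) (ch := ch) (ε' := ε') (w₁ := w₁) (w₂ := w₂)]
        exact schemeExpect_mono fun β z => ind_nonneg _
      exact h0
    · rw [← Real.rpow_add two_pos]
      refine Real.rpow_le_rpow_of_exponent_le one_le_two (le_of_eq ?_)
      ring

/-- The error probability of the random codebooks, given the messages. -/
lemma exists_schemeExpect_not_good_le : ∃ D, 0 ≤ D ∧ ∀ ε' ε : ℝ, 0 < ε' → ε' < ε → ∃ K : ℝ,
    ∀ (r : HKPDFRates) (n b : ℕ), 0 < n → ∀ (w₁ : Fin b → r.Msg₁ n) (w₂ : Fin b → r.Msg₂ n),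
    schemeExpect P ch ε' w₁ w₂ (fun β z => ind (¬(ofBlocks β).Good ch ε' ε w₁ w₂ z)) ≤
      (b + 1) * (K / n + Real.exp (-(numMsg n r.r₂₂' *
        (2 : ℝ) ^ (-(n * (P.I₁ ch + ε' * P.binDev ch)))))) +
      (∑ j : Fin b, ∑ w : Msg n r.r₁₀, ind (w ≠ (msg₁ w₁ j.castSucc).1) *
        (2 : ℝ) ^ (-(n * (P.I₂ ch - ε * D))) +
      (∑ j : Fin b, ∑ w : r.Msg₁ n, ∑ w₂₁ : Msg n r.r₂₁, ind (w ≠ msg₁ w₁ j.castSucc) *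
        (2 : ℝ) ^ (-(n * (P.recvInfo₁ ch (w.1 = (msg₁ w₁ j.castSucc).1)
          (w.2.1 = (msg₁ w₁ j.castSucc).2.1) (w₂₁ = (msg₂ w₂ j.castSucc).1) - ε * D))) +
      ∑ j : Fin b, ∑ w : r.Msg₂ n, ∑ w₁₁ : Msg n r.r₁₁, ∑ _ : Msg n r.r₂₂',
        ind (w ≠ msg₂ w₂ j.castSucc) *
        (2 : ℝ) ^ (-(n * (P.recvInfo₂ ch (w.1 = (msg₂ w₂ j.castSucc).1)
          (w₁₁ = (msg₁ w₁ j.castSucc).2.1) - ε * D))))) := by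
  obtain ⟨D₁, h₁, H₁⟩ := P.exists_relay_error_le ch
  obtain ⟨D₂, h₂, H₂⟩ := exists_receivers₁_error_le P ch
  obtain ⟨D₃, h₃, H₃⟩ := P.exists_receiver₂_error_le ch
  refine ⟨D₁ + D₂ + D₃, by positivity, fun ε' ε hε' hε => ?_⟩
  obtain ⟨K, HK⟩ := P.exists_not_fullTypical_le ch hε' hε
  have hε0 : 0 ≤ ε := (hε'.trans hε).le
  refine ⟨K, fun r n b hn w₁ w₂ => ?_⟩
  refine (schemeExpect_not_good_le ε' ε w₁ w₂).trans ?_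
  refine add_le_add ?_ (add_le_add ?_ (add_le_add ?_ ?_))
  · refine (Finset.sum_le_sum fun i _ => (schemeExpect_single i (fun β z =>
      ind (¬P.FullTypical ch ε (β.1 (prev w₁ i)) (β.2.2.2.2.1 (msg₂ w₂ i).1)
        (β.2.2.2.2.2.1 (msg₂ w₂ i).1 (msg₂ w₂ i).2 (P.binIndex ch ε' (β.1 (prev w₁ i))
          (β.2.2.2.2.1 (msg₂ w₂ i).1) (β.2.2.2.2.2.1 (msg₂ w₂ i).1 (msg₂ w₂ i).2)))
        (β.2.1 (prev w₁ i) (msg₁ w₁ i).1) (β.2.2.1 (msg₁ w₁ i).2.1)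
        (β.2.2.2.1 (prev w₁ i) (msg₁ w₁ i).1 (msg₁ w₁ i).2.1 (msg₁ w₁ i).2.2)
        (β.2.2.2.2.2.2 (prev w₁ i) (msg₂ w₂ i).1 (msg₂ w₂ i).2
          (P.binIndex ch ε' (β.1 (prev w₁ i))
          (β.2.2.2.2.1 (msg₂ w₂ i).1) (β.2.2.2.2.2.1 (msg₂ w₂ i).1 (msg₂ w₂ i).2))) z))).trans_le
      (HK r n hn _ _ _)).trans ?_
    rw [Finset.sum_const, Finset.card_univ, Fintype.card_fin, nsmul_eq_mul]
    push_cast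
    exact le_rfl
  · refine Finset.sum_le_sum fun j _ => Finset.sum_le_sum fun w _ =>
      schemeExpect_ind_and_le fun hw => ?_
    exact (schemeExpect_single j.castSucc (fun β z => ind (P.RelayTypical ch ε
      (β.1 (prev w₁ j.castSucc)) (β.2.1 (prev w₁ j.castSucc) w) (fun k => (z k).2.2)))).trans_le
      ((H₁ r n ε' ε _ _ _ w hw).trans (HKPDFDist.rpow_info_mono hε0 (by linarith)))
  · refine Finset.sum_le_sum fun j _ => Finset.sum_le_sum fun w _ => Finset.sum_le_sum fun w₂₁ _ =>
      schemeExpect_ind_and_le fun hw => ?_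
    exact (H₂ r n b ε' ε hε0 w₁ w₂ j w w₂₁ hw).trans (HKPDFDist.rpow_info_mono hε0 (by linarith))
  · refine Finset.sum_le_sum fun j _ => Finset.sum_le_sum fun w _ => Finset.sum_le_sum fun w₁₁ _ =>
      Finset.sum_le_sum fun v _ => schemeExpect_ind_and_le fun hw => ?_
    exact (schemeExpect_single j.castSucc (fun β z => ind (P.RecvTypical₂ ch ε
      (β.2.2.1 w₁₁) (β.2.2.2.2.1 w.1) (β.2.2.2.2.2.1 w.1 w.2 v) (fun k => (z k).2.1)))).trans_le
      ((H₃ r n ε' ε hε0 _ _ _ w w₁₁ v hw).trans (HKPDFDist.rpow_info_mono hε0 (by linarith)))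

end HKPDFBook

/-! ### Counting the wrong message tuples -/

lemma numMsg_sub_one_nonneg (n : ℕ) (ρ : ℝ) : 0 ≤ (numMsg n ρ : ℝ) - 1 :=
  sub_nonneg.mpr (by exact_mod_cast Nat.one_le_iff_ne_zero.mpr (NeZero.ne (numMsg n ρ)))

namespace HKPDFBook

variable {X₁ X₂ Y₁ Y₂ Y : Type*} [Fintype X₁] [Fintype X₂] [Fintype Y₁] [Fintype Y₂] [Fintype Y]
variable (P : HKPDFDist X₁ X₂) (ch : CRC X₁ X₂ Y₁ Y₂ Y) {r : HKPDFRates} {n b : ℕ}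

lemma sum_relay_eq (w₀ : Msg n r.r₁₀) (c : ℝ) :
    ∑ w, ind (w ≠ w₀) * c = ((numMsg n r.r₁₀ : ℝ) - 1) * c := by
  refine (sum_eq_card_sub_one w₀ (fun E => ind (¬E) * c)).trans ?_
  rw [Fintype.card_fin]
  simp [ind]

/-- Tuples are grouped by which of w₁₀, w₁₁ and w₂₁ are right. In each group the factor M − 1 is
kept for one index that must be wrong, and the other free indices are counted by M. -/
lemma sum_receiver₁_le (m₁ : r.Msg₁ n) (m : Msg n r.r₂₁) (e : ℝ → ℝ) (he : ∀ x, 0 ≤ e x) :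
    (∑ w : r.Msg₁ n, ∑ w₂₁ : Msg n r.r₂₁, ind (w ≠ m₁) *
        e (P.recvInfo₁ ch (w.1 = m₁.1) (w.2.1 = m₁.2.1) (w₂₁ = m))) ≤
      ((numMsg n r.r₁₂ : ℝ) - 1) * 1 * e (P.I₃ ch) +
      ((numMsg n r.r₁₂ : ℝ) - 1) * numMsg n r.r₂₁ * e (P.I₇ ch) +
      ((numMsg n r.r₁₁ : ℝ) - 1) * numMsg n r.r₁₂ * e (P.I₅ ch) +
      ((numMsg n r.r₁₁ : ℝ) - 1) * (numMsg n r.r₁₂ * numMsg n r.r₂₁) * e (P.I₉ ch) +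
      ((numMsg n r.r₁₀ : ℝ) - 1) * numMsg n r.r₁₂ * e (P.I₄ ch) +
      ((numMsg n r.r₁₀ : ℝ) - 1) * (numMsg n r.r₁₂ * numMsg n r.r₂₁) * e (P.I₈ ch) +
      ((numMsg n r.r₁₀ : ℝ) - 1) * (numMsg n r.r₁₁ * numMsg n r.r₁₂) * e (P.I₆ ch) +
      ((numMsg n r.r₁₀ : ℝ) - 1) * (numMsg n r.r₁₁ * numMsg n r.r₁₂ * numMsg n r.r₂₁) *
        e (P.I₁₀ ch) := by
  obtain ⟨a, b, c⟩ := m₁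
  -- The summand as a function of the four equalities, so that the sums can be evaluated one index
  -- at a time.
  let H : Prop → Prop → Prop → Prop → ℝ := fun E₁₀ E₁₁ E₁₂ E₂₁ =>
    ind (¬(E₁₀ ∧ E₁₁ ∧ E₁₂)) * e (P.recvInfo₁ ch E₁₀ E₁₁ E₂₁)
  have h1 : (∑ w : r.Msg₁ n, ∑ w₂₁ : Msg n r.r₂₁, ind (w ≠ (a, b, c)) *
        e (P.recvInfo₁ ch (w.1 = a) (w.2.1 = b) (w₂₁ = m))) =
      ∑ x, ∑ y, ∑ z, ∑ u, H (x = a) (y = b) (z = c) (u = m) := by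
    simp only [Fintype.sum_prod_type, H, ne_eq, Prod.mk.injEq]
  have h2 : ∀ E₁₀ E₁₁ E₁₂, ∑ u, H E₁₀ E₁₁ E₁₂ (u = m) = _ := fun E₁₀ E₁₁ E₁₂ =>
    sum_eq_card_sub_one m (H E₁₀ E₁₁ E₁₂)
  have h3 : ∀ E₁₀ E₁₁, ∑ z, ∑ u, H E₁₀ E₁₁ (z = c) (u = m) = _ := fun E₁₀ E₁₁ =>
    sum_eq_card_sub_one c (fun E => ∑ u, H E₁₀ E₁₁ E (u = m))
  have h4 : ∀ E₁₀, ∑ y, ∑ z, ∑ u, H E₁₀ (y = b) (z = c) (u = m) = _ := fun E₁₀ =>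
    sum_eq_card_sub_one b (fun E => ∑ z, ∑ u, H E₁₀ E (z = c) (u = m))
  have h5 : ∑ x, ∑ y, ∑ z, ∑ u, H (x = a) (y = b) (z = c) (u = m) = _ :=
    sum_eq_card_sub_one a (fun E => ∑ y, ∑ z, ∑ u, H E (y = b) (z = c) (u = m))
  refine h1.trans_le ?_
  rw [h5, h4, h4, h3, h3, h3, h3]
  simp only [h2]
  simp only [H, ind, Fintype.card_fin, HKPDFDist.recvInfo₁, if_true, if_false, and_true, and_false,
    not_true_eq_false, not_false_eq_true, zero_mul, one_mul, zero_add, false_and, true_and, mul_zero]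
  have g10 := numMsg_sub_one_nonneg n r.r₁₀
  have g11 := numMsg_sub_one_nonneg n r.r₁₁
  have g12 := numMsg_sub_one_nonneg n r.r₁₂
  generalize (numMsg n r.r₁₀ : ℝ) = M10 at *
  generalize (numMsg n r.r₁₁ : ℝ) = M11 at *
  generalize (numMsg n r.r₁₂ : ℝ) = M12 at *
  have hM12 : 0 ≤ M12 := by linarith
  have t7 := mul_nonneg g12 (he (P.I₇ ch))
  have t9 := mul_nonneg (mul_nonneg g11 hM12) (he (P.I₉ ch))
  have t8 := mul_nonneg (mul_nonneg g10 hM12) (he (P.I₈ ch))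
  have t6 := mul_nonneg (mul_nonneg g10 hM12) (he (P.I₆ ch))
  have t10 := mul_nonneg (mul_nonneg g10 (mul_nonneg g11 hM12)) (he (P.I₁₀ ch))
  have t10' := mul_nonneg (mul_nonneg g10 hM12) (mul_nonneg (Nat.cast_nonneg (numMsg n r.r₂₁)) (he (P.I₁₀ ch)))
  linarith

/-- Every bin index of a wrong pair is a candidate, hence the full factor for v₂₂ in each term. -/
lemma sum_receiver₂_le (m₂ : r.Msg₂ n) (k : Msg n r.r₁₁) (e : ℝ → ℝ) (he : ∀ x, 0 ≤ e x) :
    (∑ w : r.Msg₂ n, ∑ w₁₁ : Msg n r.r₁₁, ∑ _ : Msg n r.r₂₂', ind (w ≠ m₂) *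
        e (P.recvInfo₂ ch (w.1 = m₂.1) (w₁₁ = k))) ≤
      ((numMsg n r.r₂₂ : ℝ) - 1) * numMsg n r.r₂₂' * e (P.I₁₁ ch) +
      ((numMsg n r.r₂₂ : ℝ) - 1) * (numMsg n r.r₁₁ * numMsg n r.r₂₂') * e (P.I₁₃ ch) +
      ((numMsg n r.r₂₁ : ℝ) - 1) * (numMsg n r.r₂₂ * numMsg n r.r₂₂') * e (P.I₁₂ ch) +
      ((numMsg n r.r₂₁ : ℝ) - 1) * (numMsg n r.r₁₁ * numMsg n r.r₂₂ * numMsg n r.r₂₂') *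
        e (P.I₁₄ ch) := by
  obtain ⟨a, b⟩ := m₂
  let H : Prop → Prop → Prop → ℝ := fun E₂₁ E₂₂ E₁₁ =>
    numMsg n r.r₂₂' * (ind (¬(E₂₁ ∧ E₂₂)) * e (P.recvInfo₂ ch E₂₁ E₁₁))
  have h1 : (∑ w : r.Msg₂ n, ∑ w₁₁ : Msg n r.r₁₁, ∑ _ : Msg n r.r₂₂', ind (w ≠ (a, b)) *
        e (P.recvInfo₂ ch (w.1 = a) (w₁₁ = k))) =
      ∑ x, ∑ y, ∑ z, H (x = a) (y = b) (z = k) := by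
    simp only [Fintype.sum_prod_type, H, ne_eq, Prod.mk.injEq, Finset.sum_const, Finset.card_univ,
      Fintype.card_fin, nsmul_eq_mul]
  have h3 : ∀ E₁₀ E₁₁, ∑ z, H E₁₀ E₁₁ (z = k) = _ := fun E₁₀ E₁₁ =>
    sum_eq_card_sub_one k (fun E => H E₁₀ E₁₁ E)
  have h4 : ∀ E₁₀, ∑ y, ∑ z, H E₁₀ (y = b) (z = k) = _ := fun E₁₀ =>
    sum_eq_card_sub_one b (fun E => ∑ z, H E₁₀ E (z = k))
  have h5 : ∑ x, ∑ y, ∑ z, H (x = a) (y = b) (z = k) = _ :=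
    sum_eq_card_sub_one a (fun E => ∑ y, ∑ z, H E (y = b) (z = k))
  refine h1.trans_le ?_
  rw [h5, h4, h4]
  simp only [h3]
  simp only [H, ind, Fintype.card_fin, HKPDFDist.recvInfo₂, if_true, if_false, and_true, and_false,
    not_true_eq_false, not_false_eq_true, zero_mul, one_mul, zero_add, false_and, true_and, mul_zero]
  have g21 := numMsg_sub_one_nonneg n r.r₂₁
  have g22 := numMsg_sub_one_nonneg n r.r₂₂
  have hV := Nat.cast_nonneg (α := ℝ) (numMsg n r.r₂₂')
  generalize (numMsg n r.r₂₁ : ℝ) = M21 at *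
  generalize (numMsg n r.r₂₂ : ℝ) = M22 at *
  generalize (numMsg n r.r₂₂' : ℝ) = V at *
  have hM : 0 ≤ M22 := by linarith
  have t13 := mul_nonneg (mul_nonneg g22 hV) (he (P.I₁₃ ch))
  have t14 := mul_nonneg (mul_nonneg g21 (mul_nonneg hM hV)) (he (P.I₁₄ ch))
  linarith

/-- The bound on the error probability of the scheme. -/
noncomputable def errorBound (D ε' ε K : ℝ) (r : HKPDFRates) (b n : ℕ) : ℝ :=
  let e : ℝ → ℝ := fun I => (2 : ℝ) ^ (-(n * (I - ε * D)))
  (b + 1) * (K / n + Real.exp (-(numMsg n r.r₂₂' *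
        (2 : ℝ) ^ (-(n * (P.I₁ ch + ε' * P.binDev ch)))))) +
  b * (((numMsg n r.r₁₀ : ℝ) - 1) * 1 * e (P.I₂ ch) +
    (((numMsg n r.r₁₂ : ℝ) - 1) * 1 * e (P.I₃ ch) +
      ((numMsg n r.r₁₂ : ℝ) - 1) * numMsg n r.r₂₁ * e (P.I₇ ch) +
      ((numMsg n r.r₁₁ : ℝ) - 1) * numMsg n r.r₁₂ * e (P.I₅ ch) +
      ((numMsg n r.r₁₁ : ℝ) - 1) * (numMsg n r.r₁₂ * numMsg n r.r₂₁) * e (P.I₉ ch) +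
      ((numMsg n r.r₁₀ : ℝ) - 1) * numMsg n r.r₁₂ * e (P.I₄ ch) +
      ((numMsg n r.r₁₀ : ℝ) - 1) * (numMsg n r.r₁₂ * numMsg n r.r₂₁) * e (P.I₈ ch) +
      ((numMsg n r.r₁₀ : ℝ) - 1) * (numMsg n r.r₁₁ * numMsg n r.r₁₂) * e (P.I₆ ch) +
      ((numMsg n r.r₁₀ : ℝ) - 1) * (numMsg n r.r₁₁ * numMsg n r.r₁₂ * numMsg n r.r₂₁) *
        e (P.I₁₀ ch)) +
    (((numMsg n r.r₂₂ : ℝ) - 1) * numMsg n r.r₂₂' * e (P.I₁₁ ch) +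
      ((numMsg n r.r₂₂ : ℝ) - 1) * (numMsg n r.r₁₁ * numMsg n r.r₂₂') * e (P.I₁₃ ch) +
      ((numMsg n r.r₂₁ : ℝ) - 1) * (numMsg n r.r₂₂ * numMsg n r.r₂₂') * e (P.I₁₂ ch) +
      ((numMsg n r.r₂₁ : ℝ) - 1) * (numMsg n r.r₁₁ * numMsg n r.r₂₂ * numMsg n r.r₂₂') *
        e (P.I₁₄ ch)))

lemma exists_schemeExpect_le_errorBound : ∃ D, 0 ≤ D ∧ ∀ ε' ε : ℝ, 0 < ε' → ε' < ε → ∃ K : ℝ,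
    ∀ (r : HKPDFRates) (n b : ℕ), 0 < n → ∀ (w₁ : Fin b → r.Msg₁ n) (w₂ : Fin b → r.Msg₂ n),
    schemeExpect P ch ε' w₁ w₂ (fun β z => ind (¬(ofBlocks β).Good ch ε' ε w₁ w₂ z)) ≤
      errorBound P ch D ε' ε K r b n := by
  obtain ⟨D, hD, H⟩ := exists_schemeExpect_not_good_le P ch
  refine ⟨D, hD, fun ε' ε hε' hε => ?_⟩
  obtain ⟨K, HK⟩ := H ε' ε hε' hε
  refine ⟨K, fun r n b hn w₁ w₂ => (HK r n b hn w₁ w₂).trans ?_⟩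
  rw [errorBound]
  refine add_le_add_right ?_ _
  rw [← Finset.sum_add_distrib, ← Finset.sum_add_distrib]
  refine (Finset.sum_le_card_nsmul _ _ _ fun j _ => ?_).trans_eq
    (by rw [Finset.card_univ, Fintype.card_fin, nsmul_eq_mul])
  rw [sum_relay_eq, mul_one, add_assoc]
  exact add_le_add le_rfl (add_le_add
    (sum_receiver₁_le P ch _ _ (fun I => (2 : ℝ) ^ (-(n * (I - ε * D)))) fun x => by positivity)
    (sum_receiver₂_le P ch _ _ (fun I => (2 : ℝ) ^ (-(n * (I - ε * D)))) fun x => by positivity))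

variable {P ch}

lemma ensembleError_eq (ε' ε : ℝ) (r : HKPDFRates) (b n : ℕ) : P.ensembleError ch ε' ε r b n =
    expect (piProd fun _ : Fin (b + 1) => blockLaw P r n)
      (fun β => ((ofBlocks β).code ch ε' ε).errorProb ch) :=
  sum_weight_mul (fun bk => (bk.code ch ε' ε).errorProb ch)

lemma errorProb_code_le (bk : HKPDFBook P r n b) (ε' ε : ℝ) : (bk.code ch ε' ε).errorProb ch ≤
    ((Fintype.card (Fin b → r.Msg₁ n) : ℝ) * (Fintype.card (Fin b → r.Msg₂ n) : ℝ))⁻¹ *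
      ∑ w₁ : Fin b → r.Msg₁ n, ∑ w₂ : Fin b → r.Msg₂ n,
        expect (piProd (bk.outLaw ch ε' w₁ w₂)) (fun z => ind (¬bk.Good ch ε' ε w₁ w₂ z)) := by
  rw [CRCCode.errorProb]
  refine mul_le_mul_of_nonneg_left ?_
    (inv_nonneg.mpr (mul_nonneg (Nat.cast_nonneg _) (Nat.cast_nonneg _)))
  refine Finset.sum_le_sum fun w₁ _ => Finset.sum_le_sum fun w₂ _ => ?_
  refine le_of_eq_of_le ?_ (bk.sum_error_le ch ε' ε w₁ w₂)
  refine Finset.sum_congr rfl fun y₁ _ => Finset.sum_congr rfl fun y₂ _ =>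
    Finset.sum_congr rfl fun y _ => ?_
  congr

variable (P ch)

lemma ensembleError_le {ε' ε c : ℝ} {r : HKPDFRates} {b n : ℕ}
    (h : ∀ (w₁ : Fin b → r.Msg₁ n) (w₂ : Fin b → r.Msg₂ n), schemeExpect P ch ε' w₁ w₂
      (fun β z => ind (¬(ofBlocks β).Good ch ε' ε w₁ w₂ z)) ≤ c) :
    P.ensembleError ch ε' ε r b n ≤ c := by
  rw [ensembleError_eq]
  refine (expect_mono (piProd_nonneg fun _ => blockLaw_mem.1) fun β =>
    errorProb_code_le (ofBlocks β) ε' ε).trans ?_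
  rw [expect_mul_left, expect_sum]
  simp only [expect_sum]
  refine (mul_le_mul_of_nonneg_left (Finset.sum_le_sum fun w₁ _ => Finset.sum_le_sum fun w₂ _ =>
    h w₁ w₂) (inv_nonneg.mpr (mul_nonneg (Nat.cast_nonneg _) (Nat.cast_nonneg _)))).trans_eq ?_
  simp only [Finset.sum_const, Finset.card_univ, nsmul_eq_mul]
  have h1 : (Fintype.card (Fin b → r.Msg₁ n) : ℝ) ≠ 0 := by exact_mod_cast Fintype.card_ne_zero
  have h2 : (Fintype.card (Fin b → r.Msg₂ n) : ℝ) ≠ 0 := by exact_mod_cast Fintype.card_ne_zero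
  generalize (Fintype.card (Fin b → r.Msg₁ n) : ℝ) = x at *
  generalize (Fintype.card (Fin b → r.Msg₂ n) : ℝ) = y at *
  field_simp

lemma exists_ensembleError_le : ∃ D, 0 ≤ D ∧ ∀ ε' ε : ℝ, 0 < ε' → ε' < ε → ∃ K : ℝ,
    ∀ (r : HKPDFRates) (n b : ℕ), 0 < n →
    P.ensembleError ch ε' ε r b n ≤ errorBound P ch D ε' ε K r b n := by
  obtain ⟨D, hD, H⟩ := exists_schemeExpect_le_errorBound P ch
  refine ⟨D, hD, fun ε' ε hε' hε => ?_⟩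
  obtain ⟨K, HK⟩ := H ε' ε hε' hε
  exact ⟨K, fun r n b hn => ensembleError_le P ch (HK r n b hn)⟩

lemma errorProb_nonneg {N : ℕ} {M₁ M₂ : Type*} [Fintype M₁] [Fintype M₂]
    (c : CRCCode X₁ X₂ Y₁ Y₂ Y N M₁ M₂) : 0 ≤ c.errorProb ch := by
  refine mul_nonneg (by positivity) (Finset.sum_nonneg fun _ _ => Finset.sum_nonneg fun _ _ =>
    Finset.sum_nonneg fun _ _ => Finset.sum_nonneg fun _ _ => Finset.sum_nonneg fun _ _ => ?_)
  split_ifs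
  · exact le_rfl
  · exact Finset.prod_nonneg fun k _ => (ch.trans_mem _ _).1 _

lemma ensembleError_nonneg (ε' ε : ℝ) (r : HKPDFRates) (b n : ℕ) :
    0 ≤ P.ensembleError ch ε' ε r b n := by
  rw [ensembleError_eq]
  exact expect_nonneg (piProd_nonneg fun _ => blockLaw_mem.1) fun β => errorProb_nonneg ch _

end HKPDFBook

/-! ### The error probability of the random codebooks tends to zero -/

/-- Growth at most of the order of `2 ^ (n σ)`. -/
def GrowthLE (σ : ℝ) (X : ℕ → ℝ) : Prop :=
  ∃ C, ∀ n : ℕ, 0 ≤ X n ∧ X n ≤ C * (2 : ℝ) ^ (n * σ)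

lemma GrowthLE.one : GrowthLE 0 fun _ => 1 := ⟨1, fun n => by simp⟩

lemma GrowthLE.mul {σ τ : ℝ} {X Z : ℕ → ℝ} (hX : GrowthLE σ X) (hZ : GrowthLE τ Z) :
    GrowthLE (σ + τ) fun n => X n * Z n := by
  obtain ⟨C, hC⟩ := hX
  obtain ⟨C', hC'⟩ := hZ
  refine ⟨C * C', fun n => ⟨mul_nonneg (hC n).1 (hC' n).1, ?_⟩⟩
  refine (mul_le_mul (hC n).2 (hC' n).2 (hC' n).1 ((hC n).1.trans (hC n).2)).trans_eq ?_
  rw [mul_add, Real.rpow_add two_pos]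
  ring

lemma growthLE_numMsg {ρ : ℝ} (hρ : 0 ≤ ρ) : GrowthLE ρ fun n => numMsg n ρ := by
  refine ⟨2, fun n => ⟨Nat.cast_nonneg _, ?_⟩⟩
  have h1 : (1 : ℝ) ≤ (2 : ℝ) ^ ((n : ℝ) * ρ) := Real.one_le_rpow one_le_two (by positivity)
  have h2 := Nat.ceil_lt_add_one (a := (2 : ℝ) ^ ((n : ℝ) * ρ)) (by positivity)
  have h3 : (numMsg n ρ : ℝ) < (2 : ℝ) ^ ((n : ℝ) * ρ) + 1 := h2
  linarith

lemma numMsg_sub_one_le (n : ℕ) (ρ : ℝ) : (numMsg n ρ : ℝ) - 1 ≤ (2 : ℝ) ^ (n * ρ) := by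
  have h3 : (numMsg n ρ : ℝ) < (2 : ℝ) ^ ((n : ℝ) * ρ) + 1 := Nat.ceil_lt_add_one (by positivity)
  linarith

/-- A strict rate inequality gives geometric decay; at rate zero there is one message and the term
is identically zero, whatever the exponent. -/
lemma tendsto_numMsg_sub_one_mul {ρ σ κ : ℝ} {X : ℕ → ℝ} (hX : GrowthLE σ X)
    (h : ρ = 0 ∨ ρ + σ < κ) :
    Tendsto (fun n : ℕ => ((numMsg n ρ : ℝ) - 1) * X n * (2 : ℝ) ^ (-(n * κ))) atTop (𝓝 0) := by
  rcases h with h | h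
  · have h0 : ∀ n : ℕ, ((numMsg n ρ : ℝ) - 1) = 0 := fun n => by
      simp [numMsg, h]
    simp [h0]
  · obtain ⟨C, hC⟩ := hX
    have hr : (2 : ℝ) ^ (ρ + σ - κ) < 1 := Real.rpow_lt_one_of_one_lt_of_neg one_lt_two (by linarith)
    have ht := (tendsto_pow_atTop_nhds_zero_of_lt_one (by positivity) hr).const_mul C
    rw [mul_zero] at ht
    refine squeeze_zero (fun n => ?_) (fun n => ?_) ht
    · exact mul_nonneg (mul_nonneg (numMsg_sub_one_nonneg n ρ) (hC n).1) (by positivity)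
    · refine (mul_le_mul_of_nonneg_right (mul_le_mul (numMsg_sub_one_le n ρ) (hC n).2 (hC n).1
        (by positivity)) (by positivity)).trans_eq ?_
      rw [← Real.rpow_natCast, ← Real.rpow_mul two_pos.le, mul_left_comm, mul_assoc, ← Real.rpow_add two_pos,
        ← Real.rpow_add two_pos]
      congr 2
      ring

/-- With a bin rate above κ the expected number of typical bins grows exponentially. -/
lemma tendsto_exp_neg_numMsg {ρ κ : ℝ} (h : κ < ρ) :
    Tendsto (fun n : ℕ => Real.exp (-(numMsg n ρ * (2 : ℝ) ^ (-(n * κ))))) atTop (𝓝 0) := by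
  refine Real.tendsto_exp_neg_atTop_nhds_zero.comp ?_
  have hr : 1 < (2 : ℝ) ^ (ρ - κ) := Real.one_lt_rpow one_lt_two (by linarith)
  refine tendsto_atTop_mono (fun n => ?_) (tendsto_pow_atTop_atTop_of_one_lt hr)
  rw [← Real.rpow_natCast, ← Real.rpow_mul two_pos.le,
    show (ρ - κ) * (n : ℝ) = n * ρ + -(n * κ) by ring, Real.rpow_add two_pos]
  exact mul_le_mul_of_nonneg_right (Nat.le_ceil _) (by positivity)

namespace HKPDFBook

variable {X₁ X₂ Y₁ Y₂ Y : Type*} [Fintype X₁] [Fintype X₂] [Fintype Y₁] [Fintype Y₂] [Fintype Y]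
variable {P : HKPDFDist X₁ X₂} {ch : CRC X₁ X₂ Y₁ Y₂ Y}

lemma tendsto_errorBound {D ε' ε K : ℝ} {r : HKPDFRates} (b : ℕ) (h₁₁' : 0 ≤ r.r₁₁)
    (h₁₂' : 0 ≤ r.r₁₂) (h₂₁' : 0 ≤ r.r₂₁) (h₂₂' : 0 ≤ r.r₂₂) (hv' : 0 ≤ r.r₂₂')
    (hv : P.I₁ ch + ε' * P.binDev ch < r.r₂₂')
    (h₂ : r.r₁₀ = 0 ∨ r.r₁₀ + 0 < P.I₂ ch - ε * D)
    (h₃ : r.r₁₂ = 0 ∨ r.r₁₂ + 0 < P.I₃ ch - ε * D)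
    (h₄ : r.r₁₀ = 0 ∨ r.r₁₀ + r.r₁₂ < P.I₄ ch - ε * D)
    (h₅ : r.r₁₁ = 0 ∨ r.r₁₁ + r.r₁₂ < P.I₅ ch - ε * D)
    (h₆ : r.r₁₀ = 0 ∨ r.r₁₀ + (r.r₁₁ + r.r₁₂) < P.I₆ ch - ε * D)
    (h₇ : r.r₁₂ = 0 ∨ r.r₁₂ + r.r₂₁ < P.I₇ ch - ε * D)
    (h₈ : r.r₁₀ = 0 ∨ r.r₁₀ + (r.r₁₂ + r.r₂₁) < P.I₈ ch - ε * D)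
    (h₉ : r.r₁₁ = 0 ∨ r.r₁₁ + (r.r₁₂ + r.r₂₁) < P.I₉ ch - ε * D)
    (h₁₀ : r.r₁₀ = 0 ∨ r.r₁₀ + (r.r₁₁ + r.r₁₂ + r.r₂₁) < P.I₁₀ ch - ε * D)
    (h₁₁ : r.r₂₂ = 0 ∨ r.r₂₂ + r.r₂₂' < P.I₁₁ ch - ε * D)
    (h₁₂ : r.r₂₁ = 0 ∨ r.r₂₁ + (r.r₂₂ + r.r₂₂') < P.I₁₂ ch - ε * D)
    (h₁₃ : r.r₂₂ = 0 ∨ r.r₂₂ + (r.r₁₁ + r.r₂₂') < P.I₁₃ ch - ε * D)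
    (h₁₄ : r.r₂₁ = 0 ∨ r.r₂₁ + (r.r₁₁ + r.r₂₂ + r.r₂₂') < P.I₁₄ ch - ε * D) :
    Tendsto (fun n => errorBound P ch D ε' ε K r b n) atTop (𝓝 0) := by
  have g₁₁ := growthLE_numMsg h₁₁'
  have g₁₂ := growthLE_numMsg h₁₂'
  have g₂₁ := growthLE_numMsg h₂₁'
  have g₂₂ := growthLE_numMsg h₂₂'
  have gv := growthLE_numMsg hv'
  have hK : Tendsto (fun n : ℕ => K / n) atTop (𝓝 0) :=
    tendsto_const_nhds.div_atTop tendsto_natCast_atTop_atTop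
  have t3 := tendsto_numMsg_sub_one_mul .one h₃
  have t7 := tendsto_numMsg_sub_one_mul g₂₁ h₇
  have t5 := tendsto_numMsg_sub_one_mul g₁₂ h₅
  have t9 := tendsto_numMsg_sub_one_mul (g₁₂.mul g₂₁) h₉
  have t4 := tendsto_numMsg_sub_one_mul g₁₂ h₄
  have t8 := tendsto_numMsg_sub_one_mul (g₁₂.mul g₂₁) h₈
  have t6 := tendsto_numMsg_sub_one_mul (g₁₁.mul g₁₂) h₆
  have t10 := tendsto_numMsg_sub_one_mul ((g₁₁.mul g₁₂).mul g₂₁) h₁₀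
  have t11 := tendsto_numMsg_sub_one_mul gv h₁₁
  have t13 := tendsto_numMsg_sub_one_mul (g₁₁.mul gv) h₁₃
  have t12 := tendsto_numMsg_sub_one_mul (g₂₂.mul gv) h₁₂
  have t14 := tendsto_numMsg_sub_one_mul ((g₁₁.mul g₂₂).mul gv) h₁₄
  have t := (((hK.add (tendsto_exp_neg_numMsg hv)).const_mul ((b : ℝ) + 1)).add
    (((tendsto_numMsg_sub_one_mul .one h₂).add
      ((((((((t3.add t7).add t5).add t9).add t4).add t8).add t6).add t10).add
        (((t11.add t13).add t12).add t14))).const_mul (b : ℝ)))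
  simp only [add_zero, mul_zero] at t
  refine t.congr fun n => ?_
  simp only [errorBound, add_assoc]

/-- Reducing a rate by δ and truncating at zero gives either a strict inequality or rate zero, the
two cases in which an error term vanishes. -/
lemma max_sub_eq_zero_or {x δ s S κ : ℝ} (hs : s ≤ S) (h : x + S - δ < κ) :
    max (x - δ) 0 = 0 ∨ max (x - δ) 0 + s < κ := by
  rcases max_choice (x - δ) 0 with h' | h'
  · right; rw [h']; linarith
  · exact Or.inl h'

end HKPDFBook

-- The fitting rates satisfy non-strict bounds; each is lowered by d, which makes every bound strict
-- or its leading rate zero.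
open HKPDFBook in
theorem CRC.hkpdfRegion_subset_hkpdfAchieved {X₁ X₂ Y₁ Y₂ Y : Type*} [Fintype X₁] [Fintype X₂]
    [Fintype Y₁] [Fintype Y₂] [Fintype Y] (ch : CRC X₁ X₂ Y₁ Y₂ Y) :
    ch.hkpdfRegion ⊆ ch.hkpdfAchieved := by
  intro R hR
  obtain ⟨P₀, hP₀⟩ := Set.mem_iUnion.mp hR
  obtain ⟨P, x, y, z, u, v, hf, hR1, hR2⟩ := HKPDFDist.exists_ratesFit hP₀
  refine ⟨P, fun δ hδ => ?_⟩
  obtain ⟨D, hD, H⟩ := exists_ensembleError_le P ch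
  have hI₁ : 0 ≤ P.I₁ ch := P.I₁_nonneg ch
  have hB := P.binDev_nonneg ch
  -- The first message has three parts, each of which loses at most d. Of this margin d/2 pays for
  -- the bin rate above I₁ and d/4 for the typicality slack ε D; the rest gives strictness.
  set d := δ / 3 with hd
  have hd0 : 0 < d := by positivity
  set ε := d / (4 * (D + 1)) with hε
  have hε0 : 0 < ε := by positivity
  have hεD : ε * D ≤ d / 4 := by
    have : ε * (D + 1) = d / 4 := by rw [hε]; field_simp
    nlinarith
  set ε' := min (ε / 2) (d / (4 * (P.binDev ch + 1))) with hε'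
  have hε'0 : 0 < ε' := lt_min (by positivity) (by positivity)
  have hε'ε : ε' < ε := (min_le_left _ _).trans_lt (by linarith)
  have hε'B : ε' * P.binDev ch ≤ d / 4 := by
    have h1 : d / (4 * (P.binDev ch + 1)) * (P.binDev ch + 1) = d / 4 := by field_simp
    have h2 : ε' ≤ d / (4 * (P.binDev ch + 1)) := min_le_right _ _
    nlinarith
  obtain ⟨K, HK⟩ := H ε' ε hε'0 hε'ε
  obtain ⟨ha, hb, hc, hd', he, h₂, h₃, h₄, h₅, h₆, h₇, h₈, h₉, h₁₀, h₁₁, h₁₂, h₁₃, h₁₄⟩ := hf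
  have hle : ∀ {t : ℝ}, 0 ≤ t → max (t - d) 0 ≤ t := fun ht => max_le (by linarith) ht
  have hge : ∀ t : ℝ, t - d ≤ max (t - d) 0 := fun t => le_max_left _ _
  have lx := hle ha
  have ly := hle hb
  have lz := hle hc
  have lu := hle hd'
  have lv := hle he
  refine ⟨⟨max (x - d) 0, max (y - d) 0, max (z - d) 0, max (u - d) 0, max (v - d) 0,
    P.I₁ ch + d / 2⟩, ε', ε, le_max_right _ _, le_max_right _ _, le_max_right _ _,
    le_max_right _ _, le_max_right _ _, by positivity, hε'0, hε0, ?_, ?_, fun b => ?_⟩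
  · have := hge x; have := hge y; have := hge z
    simp only
    linarith
  · have := hge u; have := hge v
    simp only
    linarith
  refine squeeze_zero' (Eventually.of_forall fun n => ensembleError_nonneg P ch _ _ _ _ _)
    ((eventually_gt_atTop 0).mono fun n hn => HK _ n b hn) ?_
  refine tendsto_errorBound b (le_max_right _ _) (le_max_right _ _) (le_max_right _ _)
    (le_max_right _ _) (by positivity) (by simp only; linarith) ?_ ?_ ?_ ?_ ?_ ?_ ?_ ?_ ?_ ?_ ?_ ?_ ?_
  · exact max_sub_eq_zero_or le_rfl (by linarith)
  · exact max_sub_eq_zero_or le_rfl (by linarith)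
  · exact max_sub_eq_zero_or lz (by linarith)
  · exact max_sub_eq_zero_or lz (by linarith)
  · exact max_sub_eq_zero_or (add_le_add ly lz) (by linarith)
  · exact max_sub_eq_zero_or lu (by linarith)
  · exact max_sub_eq_zero_or (add_le_add lz lu) (by linarith)
  · exact max_sub_eq_zero_or (add_le_add lz lu) (by linarith)
  · exact max_sub_eq_zero_or (add_le_add (add_le_add ly lz) lu) (by linarith)
  · exact max_sub_eq_zero_or le_rfl (by linarith)
  · exact max_sub_eq_zero_or (add_le_add lv le_rfl) (by linarith)
  · exact max_sub_eq_zero_or (add_le_add ly le_rfl) (by linarith)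
  · exact max_sub_eq_zero_or (add_le_add (add_le_add ly lv) le_rfl) (by linarith)

/-! ### Operations on codes -/

namespace CRCCode

variable {X₁ X₂ Y₁ Y₂ Y : Type*} [Fintype Y₁] [Fintype Y₂] [Fintype Y]
variable {n m : ℕ} {M₁ M₂ M₁' M₂' : Type*} [Fintype M₁] [Fintype M₂] [Fintype M₁'] [Fintype M₂']
variable (c : CRCCode X₁ X₂ Y₁ Y₂ Y n M₁ M₂) (c' : CRCCode X₁ X₂ Y₁ Y₂ Y m M₁' M₂')
variable (ch : CRC X₁ X₂ Y₁ Y₂ Y)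

/-- The law of the outputs given the messages. -/
noncomputable def law (w₁ : M₁) (w₂ : M₂) (z : Fin n → Y₁ × Y₂ × Y) : ℝ :=
  ∏ k, ch.trans (c.enc₁ w₁ k) (c.enc₂ w₂ k (fun j => (z ⟨j, j.2.trans k.2⟩).2.2)) (z k)

/-- Both messages are decoded correctly. -/
def Correct (w₁ : M₁) (w₂ : M₂) (z : Fin n → Y₁ × Y₂ × Y) : Prop :=
  c.dec₁ (fun k => (z k).1) = w₁ ∧ c.dec₂ (fun k => (z k).2.1) = w₂

/-- The error probability given the messages. -/
noncomputable def condError (w₁ : M₁) (w₂ : M₂) : ℝ :=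
  expect (c.law ch w₁ w₂) (fun z => ind (¬c.Correct w₁ w₂ z))

lemma law_nonneg (w₁ : M₁) (w₂ : M₂) (z : Fin n → Y₁ × Y₂ × Y) : 0 ≤ c.law ch w₁ w₂ z :=
  Finset.prod_nonneg fun _ _ => (ch.trans_mem _ _).1 _

lemma sum_law (w₁ : M₁) (w₂ : M₂) : ∑ z, c.law ch w₁ w₂ z = 1 :=
  sum_prod_causal _ (fun k h => ch.trans (c.enc₁ w₁ k) (c.enc₂ w₂ k fun j => (h j).2.2))
    fun _ _ => (ch.trans_mem _ _).2

lemma errorProb_eq : c.errorProb ch =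
    ((Fintype.card M₁ : ℝ) * (Fintype.card M₂ : ℝ))⁻¹ * ∑ w₁, ∑ w₂, c.condError ch w₁ w₂ := by
  rw [errorProb]
  congr 1
  refine Finset.sum_congr rfl fun w₁ _ => Finset.sum_congr rfl fun w₂ _ => ?_
  simp only [sum_arrow_prod (fun (y₂ : Fin n → Y₂) (y : Fin n → Y) => _)]
  rw [sum_arrow_prod, condError, expect]
  refine Finset.sum_congr rfl fun z _ => ?_
  by_cases h : c.Correct w₁ w₂ z
  · rw [if_pos ⟨h.1, h.2⟩, ind_false (not_not.mpr h), mul_zero]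
  · rw [if_neg fun h' => h ⟨h'.1, h'.2⟩, ind_true h, mul_one]
    rfl

/-- The code that uses only the messages in the ranges of `f₁` and `f₂`. -/
noncomputable def restrict [Nonempty M₁'] [Nonempty M₂'] (f₁ : M₁' → M₁) (f₂ : M₂' → M₂) :
    CRCCode X₁ X₂ Y₁ Y₂ Y n M₁' M₂' where
  enc₁ w := c.enc₁ (f₁ w)
  enc₂ w := c.enc₂ (f₂ w)
  dec₁ y := Function.invFun f₁ (c.dec₁ y)
  dec₂ y := Function.invFun f₂ (c.dec₂ y)

/-- The left inverses of the injections recover the message whenever the original decoders do. -/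
lemma condError_restrict_le [Nonempty M₁'] [Nonempty M₂'] {f₁ : M₁' → M₁} {f₂ : M₂' → M₂}
    (h₁ : f₁.Injective) (h₂ : f₂.Injective) (w₁ : M₁') (w₂ : M₂') :
    (c.restrict f₁ f₂).condError ch w₁ w₂ ≤ c.condError ch (f₁ w₁) (f₂ w₂) := by
  refine expect_mono (c.law_nonneg ch (f₁ w₁) (f₂ w₂)) fun z => ind_mono (mt fun h => ?_)
  refine ⟨?_, ?_⟩
  · exact (congrArg (Function.invFun f₁) h.1).trans (Function.leftInverse_invFun h₁ w₁)
  · exact (congrArg (Function.invFun f₂) h.2).trans (Function.leftInverse_invFun h₂ w₂)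

/-- Use of two codes one after the other. -/
def append : CRCCode X₁ X₂ Y₁ Y₂ Y (n + m) (M₁ × M₁') (M₂ × M₂') where
  enc₁ w := Fin.append (c.enc₁ w.1) (c'.enc₁ w.2)
  enc₂ w k y :=
    if h : (k : ℕ) < n then c.enc₂ w.1 ⟨k, h⟩ y
    else c'.enc₂ w.2 ⟨k - n, by omega⟩ (fun j => y ⟨n + j, by have := j.2; simp only at this; omega⟩)
  dec₁ y := (c.dec₁ fun k => y (Fin.castAdd m k), c'.dec₁ fun k => y (Fin.natAdd n k))
  dec₂ y := (c.dec₂ fun k => y (Fin.castAdd m k), c'.dec₂ fun k => y (Fin.natAdd n k))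

/-- The type of the received prefix depends on the time index, so an equality of times has to be
transported together with the prefixes. -/
lemma enc₂_congr (w : M₂) {k k' : Fin n} (h : k = k') {y : Fin k → Y} {y' : Fin k' → Y}
    (hy : ∀ j hj hj', y ⟨j, hj⟩ = y' ⟨j, hj'⟩) : c.enc₂ w k y = c.enc₂ w k' y' := by
  subst h
  exact congrArg _ (funext fun j => hy j j.2 j.2)

/-- The second code ignores what was received before its start, so its part of the law does not
depend on the first part. -/
lemma law_append (w₁ : M₁ × M₁') (w₂ : M₂ × M₂') (z : Fin n → Y₁ × Y₂ × Y)
    (z' : Fin m → Y₁ × Y₂ × Y) : (c.append c').law ch w₁ w₂ (Fin.append z z') =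
    c.law ch w₁.1 w₂.1 z * c'.law ch w₁.2 w₂.2 z' := by
  rw [law, Fin.prod_univ_add, law, law]
  congr 1
  · refine Finset.prod_congr rfl fun k _ => ?_
    have h2 : (c.append c').enc₂ w₂ (Fin.castAdd m k)
        (fun j => (Fin.append z z' ⟨j, j.2.trans (Fin.castAdd m k).2⟩).2.2) =
        c.enc₂ w₂.1 k (fun j => (z ⟨j, j.2.trans k.2⟩).2.2) := by
      have hk : ((Fin.castAdd m k : Fin (n + m)) : ℕ) < n := k.2
      simp only [append, dif_pos hk]
      refine c.enc₂_congr w₂.1 rfl fun j hj hj' => ?_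
      exact congrArg (fun a : Y₁ × Y₂ × Y => a.2.2) (Fin.append_left z z' ⟨j, hj'.trans k.2⟩)
    rw [h2, Fin.append_left]
    simp only [append, Fin.append_left]
  · refine Finset.prod_congr rfl fun k _ => ?_
    have h2 : (c.append c').enc₂ w₂ (Fin.natAdd n k)
        (fun j => (Fin.append z z' ⟨j, j.2.trans (Fin.natAdd n k).2⟩).2.2) =
        c'.enc₂ w₂.2 k (fun j => (z' ⟨j, j.2.trans k.2⟩).2.2) := by
      have hk : ¬((Fin.natAdd n k : Fin (n + m)) : ℕ) < n := by simp
      simp only [append, dif_neg hk]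
      refine c'.enc₂_congr w₂.2 (Fin.ext (by simp)) fun j hj hj' => ?_
      exact congrArg (fun a : Y₁ × Y₂ × Y => a.2.2) (Fin.append_right z z' ⟨j, hj'.trans k.2⟩)
    rw [h2, Fin.append_right]
    simp only [append, Fin.append_right]

lemma condError_append_le (w₁ : M₁ × M₁') (w₂ : M₂ × M₂') :
    (c.append c').condError ch w₁ w₂ ≤ c.condError ch w₁.1 w₂.1 + c'.condError ch w₁.2 w₂.2 := by
  have hc : ∀ z z', ind (¬(c.append c').Correct w₁ w₂ (Fin.append z z')) ≤
      ind (¬c.Correct w₁.1 w₂.1 z) + ind (¬c'.Correct w₁.2 w₂.2 z') := fun z z' => by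
    refine (ind_mono fun h => ?_).trans (ind_or_le _ _)
    by_contra hno
    push Not at hno
    refine h ⟨?_, ?_⟩
    · refine Prod.ext ?_ ?_
      · simpa [append] using hno.1.1
      · simpa [append] using hno.2.1
    · refine Prod.ext ?_ ?_
      · simpa [append] using hno.1.2
      · simpa [append] using hno.2.2
  rw [condError, expect, ← (Fin.appendEquiv n m).sum_comp, Fintype.sum_prod_type]
  calc _ ≤ ∑ z, ∑ z', c.law ch w₁.1 w₂.1 z * c'.law ch w₁.2 w₂.2 z' *
        (ind (¬c.Correct w₁.1 w₂.1 z) + ind (¬c'.Correct w₁.2 w₂.2 z')) := by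
        refine Finset.sum_le_sum fun z _ => Finset.sum_le_sum fun z' _ => ?_
        have h := c.law_append c' ch w₁ w₂ z z'
        refine le_trans (le_of_eq ?_) (mul_le_mul_of_nonneg_left (hc z z')
          (mul_nonneg (c.law_nonneg ch _ _ z) (c'.law_nonneg ch _ _ z')))
        rw [← h]
        rfl
    _ = expect (c.law ch w₁.1 w₂.1) (fun z => expect (c'.law ch w₁.2 w₂.2) (fun z' =>
        ind (¬c.Correct w₁.1 w₂.1 z) + ind (¬c'.Correct w₁.2 w₂.2 z'))) := by
        simp only [expect, Finset.mul_sum, mul_assoc]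
    _ = c.condError ch w₁.1 w₂.1 + c'.condError ch w₁.2 w₂.2 := by
        simp only [expect_add, expect_const (c'.sum_law ch _ _)]
        rw [expect_const (c.sum_law ch _ _)]
        rfl

lemma errorProb_append_le [Nonempty M₁] [Nonempty M₂] [Nonempty M₁'] [Nonempty M₂'] :
    (c.append c').errorProb ch ≤ c.errorProb ch + c'.errorProb ch := by
  rw [errorProb_eq, errorProb_eq, errorProb_eq]
  have h : ∑ w₁, ∑ w₂, (c.append c').condError ch w₁ w₂ ≤
      (Fintype.card M₁' * Fintype.card M₂' : ℝ) * ∑ w₁, ∑ w₂, c.condError ch w₁ w₂ +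
      (Fintype.card M₁ * Fintype.card M₂ : ℝ) * ∑ w₁, ∑ w₂, c'.condError ch w₁ w₂ := by
    refine (Finset.sum_le_sum fun w₁ _ => Finset.sum_le_sum fun w₂ _ =>
      c.condError_append_le c' ch w₁ w₂).trans_eq ?_
    simp only [Finset.sum_add_distrib, Fintype.sum_prod_type, Finset.sum_const, Finset.card_univ,
      nsmul_eq_mul, ← Finset.mul_sum]
    ring
  have h1 : (0 : ℝ) < Fintype.card M₁ := by exact_mod_cast Fintype.card_pos
  have h2 : (0 : ℝ) < Fintype.card M₂ := by exact_mod_cast Fintype.card_pos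
  have h1' : (0 : ℝ) < Fintype.card M₁' := by exact_mod_cast Fintype.card_pos
  have h2' : (0 : ℝ) < Fintype.card M₂' := by exact_mod_cast Fintype.card_pos
  rw [Fintype.card_prod, Fintype.card_prod]
  push_cast
  refine (mul_le_mul_of_nonneg_left h (by positivity)).trans_eq ?_
  generalize (∑ w₁, ∑ w₂, c.condError ch w₁ w₂) = S
  generalize (∑ w₁, ∑ w₂, c'.condError ch w₁ w₂) = S'
  field_simp

/-- The code with one message for each user. -/
def trivial (x₁ : X₁) (x₂ : X₂) (n : ℕ) : CRCCode X₁ X₂ Y₁ Y₂ Y n (Fin 1) (Fin 1) where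
  enc₁ _ _ := x₁
  enc₂ _ _ _ := x₂
  dec₁ _ := 0
  dec₂ _ := 0

lemma errorProb_trivial (x₁ : X₁) (x₂ : X₂) (n : ℕ) :
    (trivial (Y₁ := Y₁) (Y₂ := Y₂) (Y := Y) x₁ x₂ n).errorProb ch = 0 := by
  rw [errorProb_eq]
  refine mul_eq_zero_of_right _ (Finset.sum_eq_zero fun w₁ _ => Finset.sum_eq_zero fun w₂ _ => ?_)
  refine Finset.sum_eq_zero fun z _ => ?_
  beta_reduce
  rw [ind_false (not_not.mpr ⟨Subsingleton.elim _ _, Subsingleton.elim _ _⟩), mul_zero]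

end CRCCode

/-- Some `K` of the elements of a finite type have at most the average value of a function. -/
lemma exists_injective_average_le {M : Type*} [Fintype M] (e : M → ℝ) {K : ℕ} (hK : 0 < K)
    (hKM : K ≤ Fintype.card M) : ∃ f : Fin K → M, f.Injective ∧
      (K : ℝ)⁻¹ * ∑ i, e (f i) ≤ (Fintype.card M : ℝ)⁻¹ * ∑ x, e x := by
  set N := Fintype.card M with hN
  have hN0 : 0 < N := hK.trans_le hKM
  have : NeZero N := ⟨hN0.ne'⟩
  let g : Fin N ≃ M := (Fintype.equivFin M).symm
  -- Take K consecutive elements in a cyclic order: over all N shifts every element is met K times,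
  -- so some shift is at most average.
  have hsum : ∑ s : Fin N, ∑ i : Fin K, e (g (Fin.castLE hKM i + s)) = K * ∑ x, e x := by
    rw [Finset.sum_comm]
    have : ∀ i : Fin K, ∑ s : Fin N, e (g (Fin.castLE hKM i + s)) = ∑ x, e x := fun i =>
      ((Equiv.addLeft (Fin.castLE hKM i)).trans g).sum_comp e
    simp [this]
  have hconst : ∑ _ : Fin N, (N : ℝ)⁻¹ * (K * ∑ x, e x) = K * ∑ x, e x := by
    rw [Finset.sum_const, Finset.card_univ, Fintype.card_fin, nsmul_eq_mul, ← mul_assoc,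
      mul_inv_cancel₀ (by exact_mod_cast hN0.ne'), one_mul]
  obtain ⟨s, -, hs⟩ := Finset.exists_le_of_sum_le (s := Finset.univ) ⟨(0 : Fin N), Finset.mem_univ _⟩
    (hsum.trans hconst.symm).le
  refine ⟨fun i => g (Fin.castLE hKM i + s), fun i j h => ?_, ?_⟩
  · exact Fin.castLE_injective hKM (add_right_cancel (g.injective h))
  · have hK' : (0 : ℝ) < K := by exact_mod_cast hK
    rw [inv_mul_le_iff₀ hK']
    linarith

/-! ### Reducing the number of messages without increasing the average error. -/

namespace CRCCode

variable {X₁ X₂ Y₁ Y₂ Y : Type*} [Fintype Y₁] [Fintype Y₂] [Fintype Y]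
variable {n : ℕ} {M₁ M₂ : Type*} [Fintype M₁] [Fintype M₂]

/-- The averaging argument is applied to one user at a time. -/
lemma exists_errorProb_le (c : CRCCode X₁ X₂ Y₁ Y₂ Y n M₁ M₂) (ch : CRC X₁ X₂ Y₁ Y₂ Y) {K₁ K₂ : ℕ}
    (h₁ : 0 < K₁) (h₂ : 0 < K₂) (h₁' : K₁ ≤ Fintype.card M₁) (h₂' : K₂ ≤ Fintype.card M₂) :
    ∃ c' : CRCCode X₁ X₂ Y₁ Y₂ Y n (Fin K₁) (Fin K₂), c'.errorProb ch ≤ c.errorProb ch := by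
  have : Nonempty (Fin K₁) := ⟨⟨0, h₁⟩⟩
  have : Nonempty (Fin K₂) := ⟨⟨0, h₂⟩⟩
  obtain ⟨f₁, hf₁, hle₁⟩ := exists_injective_average_le
    (fun w₁ => ∑ w₂, c.condError ch w₁ w₂) h₁ h₁'
  obtain ⟨f₂, hf₂, hle₂⟩ := exists_injective_average_le
    (fun w₂ => ∑ i, c.condError ch (f₁ i) w₂) h₂ h₂'
  refine ⟨c.restrict f₁ f₂, ?_⟩
  rw [errorProb_eq, errorProb_eq, Fintype.card_fin, Fintype.card_fin, mul_inv, mul_inv]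
  calc _ ≤ (K₁ : ℝ)⁻¹ * ((K₂ : ℝ)⁻¹ * ∑ j, ∑ i, c.condError ch (f₁ i) (f₂ j)) := by
        rw [mul_assoc]
        refine mul_le_mul_of_nonneg_left (mul_le_mul_of_nonneg_left ?_ (by positivity))
          (by positivity)
        rw [Finset.sum_comm]
        exact Finset.sum_le_sum fun j _ => Finset.sum_le_sum fun i _ =>
          c.condError_restrict_le ch hf₁ hf₂ i j
    _ ≤ (K₁ : ℝ)⁻¹ * ((Fintype.card M₂ : ℝ)⁻¹ * ∑ w₂, ∑ i, c.condError ch (f₁ i) w₂) :=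
        mul_le_mul_of_nonneg_left hle₂ (by positivity)
    _ = (Fintype.card M₂ : ℝ)⁻¹ * ((K₁ : ℝ)⁻¹ * ∑ i, ∑ w₂, c.condError ch (f₁ i) w₂) := by
        rw [Finset.sum_comm]; ring
    _ ≤ (Fintype.card M₂ : ℝ)⁻¹ * ((Fintype.card M₁ : ℝ)⁻¹ * ∑ w₁, ∑ w₂, c.condError ch w₁ w₂) :=
        mul_le_mul_of_nonneg_left hle₁ (by positivity)
    _ = _ := by ring

end CRCCode

/-! ### Achievability of the convex hull -/

namespace CRC

variable {X₁ X₂ Y₁ Y₂ Y : Type*} [Fintype Y₁] [Fintype Y₂] [Fintype Y]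
variable {ch : CRC X₁ X₂ Y₁ Y₂ Y} {N N' : ℕ} {κ₁ κ₂ ε κ₁' κ₂' ε' : ℝ}

/-- There is a code of length `N` with at least `2 ^ κ₁` and `2 ^ κ₂` messages and error probability at
most `ε`. -/
def HasCode (ch : CRC X₁ X₂ Y₁ Y₂ Y) (N : ℕ) (κ₁ κ₂ ε : ℝ) : Prop :=
  ∃ K₁ K₂ : ℕ, (2 : ℝ) ^ κ₁ ≤ K₁ ∧ (2 : ℝ) ^ κ₂ ≤ K₂ ∧
    ∃ c : CRCCode X₁ X₂ Y₁ Y₂ Y N (Fin K₁) (Fin K₂), c.errorProb ch ≤ ε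

lemma pos_of_rpow_le {κ : ℝ} {K : ℕ} (h : (2 : ℝ) ^ κ ≤ K) : 0 < K := by
  exact_mod_cast (Real.rpow_pos_of_pos two_pos κ).trans_le h

lemma HasCode.of_code {M₁ M₂ : Type*} [Fintype M₁] [Fintype M₂]
    (c : CRCCode X₁ X₂ Y₁ Y₂ Y N M₁ M₂) (h : c.errorProb ch ≤ ε)
    (h₁ : (2 : ℝ) ^ κ₁ ≤ Fintype.card M₁) (h₂ : (2 : ℝ) ^ κ₂ ≤ Fintype.card M₂) :
    ch.HasCode N κ₁ κ₂ ε := by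
  obtain ⟨c', hc'⟩ := c.exists_errorProb_le ch (pos_of_rpow_le h₁) (pos_of_rpow_le h₂) le_rfl le_rfl
  exact ⟨_, _, h₁, h₂, c', hc'.trans h⟩

lemma HasCode.mono (h : ch.HasCode N κ₁ κ₂ ε) (h₁ : κ₁' ≤ κ₁) (h₂ : κ₂' ≤ κ₂) (hε : ε ≤ ε') :
    ch.HasCode N κ₁' κ₂' ε' := by
  obtain ⟨K₁, K₂, hK₁, hK₂, c, hc⟩ := h
  exact ⟨K₁, K₂, (Real.rpow_le_rpow_of_exponent_le one_le_two h₁).trans hK₁,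
    (Real.rpow_le_rpow_of_exponent_le one_le_two h₂).trans hK₂, c, hc.trans hε⟩

lemma HasCode.append (h : ch.HasCode N κ₁ κ₂ ε) (h' : ch.HasCode N' κ₁' κ₂' ε') :
    ch.HasCode (N + N') (κ₁ + κ₁') (κ₂ + κ₂') (ε + ε') := by
  obtain ⟨K₁, K₂, hK₁, hK₂, c, hc⟩ := h
  obtain ⟨K₁', K₂', hK₁', hK₂', c', hc'⟩ := h'
  have : Nonempty (Fin K₁) := ⟨⟨0, pos_of_rpow_le hK₁⟩⟩
  have : Nonempty (Fin K₂) := ⟨⟨0, pos_of_rpow_le hK₂⟩⟩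
  have : Nonempty (Fin K₁') := ⟨⟨0, pos_of_rpow_le hK₁'⟩⟩
  have : Nonempty (Fin K₂') := ⟨⟨0, pos_of_rpow_le hK₂'⟩⟩
  refine .of_code (c.append c') ((c.errorProb_append_le c' ch).trans (add_le_add hc hc')) ?_ ?_
  · rw [Real.rpow_add two_pos, Fintype.card_prod, Fintype.card_fin, Fintype.card_fin, Nat.cast_mul]
    exact mul_le_mul hK₁ hK₁' (by positivity) (by positivity)
  · rw [Real.rpow_add two_pos, Fintype.card_prod, Fintype.card_fin, Fintype.card_fin, Nat.cast_mul]
    exact mul_le_mul hK₂ hK₂' (by positivity) (by positivity)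

lemma HasCode.trivial (x₁ : X₁) (x₂ : X₂) (N : ℕ) : ch.HasCode N 0 0 0 :=
  ⟨1, 1, by simp, by simp, CRCCode.trivial x₁ x₂ N, (CRCCode.errorProb_trivial ch x₁ x₂ N).le⟩

lemma HasCode.exists_code {R₁ R₂ : ℝ} (h : ch.HasCode N κ₁ κ₂ ε) (h₁ : N * R₁ ≤ κ₁ ∨ R₁ = 0)
    (h₂ : N * R₂ ≤ κ₂ ∨ R₂ = 0) :
    ∃ c : CRCCode X₁ X₂ Y₁ Y₂ Y N (Msg N R₁) (Msg N R₂), c.errorProb ch ≤ ε := by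
  obtain ⟨K₁, K₂, hK₁, hK₂, c, hc⟩ := h
  -- Rate zero asks for a single message, so any code will do, even if κ is negative.
  have key : ∀ {κ R : ℝ} {K : ℕ}, (2 : ℝ) ^ κ ≤ K → N * R ≤ κ ∨ R = 0 →
      numMsg N R ≤ Fintype.card (Fin K) := by
    intro κ R K hK h
    rw [Fintype.card_fin, numMsg, Nat.ceil_le]
    rcases h with h | h
    · exact (Real.rpow_le_rpow_of_exponent_le one_le_two h).trans hK
    · rw [h, mul_zero, Real.rpow_zero]
      exact_mod_cast pos_of_rpow_le hK
  obtain ⟨c', hc'⟩ := c.exists_errorProb_le ch (Nat.pos_of_neZero (numMsg N R₁))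
    (Nat.pos_of_neZero (numMsg N R₂)) (key hK₁ h₁) (key hK₂ h₂)
  exact ⟨c', hc'.trans hc⟩

/-- The pairs all of whose reductions by `δ > 0` are rates of codes with small error probability, for
all large lengths. -/
def approachable (ch : CRC X₁ X₂ Y₁ Y₂ Y) : Set (ℝ × ℝ) :=
  {R | ∀ δ : ℝ, 0 < δ → ∀ ε : ℝ, 0 < ε → ∀ᶠ N : ℕ in atTop,
    ch.HasCode N (N * (R.1 - δ)) (N * (R.2 - δ)) ε}

/-- The approximating pairs are reduced by 1/(k+1) and truncated at zero; truncated coordinates have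
exactly one message and need no rate bound. -/
lemma mem_closure_achievable {R : ℝ × ℝ} (h : R ∈ ch.approachable) (h₁ : 0 ≤ R.1) (h₂ : 0 ≤ R.2) :
    R ∈ closure ch.achievable := by
  have hlim : ∀ t : ℝ, 0 ≤ t → Tendsto (fun k : ℕ => max (t - 1 / ((k : ℝ) + 1)) 0) atTop (𝓝 t) := by
    intro t ht
    have h := ((tendsto_const_nhds (x := t)).sub
      (tendsto_one_div_add_atTop_nhds_zero_nat (𝕜 := ℝ))).max (tendsto_const_nhds (x := (0 : ℝ)))
    rwa [sub_zero, max_eq_left ht] at h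
  refine mem_closure_of_tendsto ((hlim R.1 h₁).prodMk_nhds (hlim R.2 h₂)) (Eventually.of_forall fun k => ?_)
  refine ⟨le_max_right _ _, le_max_right _ _, fun ε hε => ?_⟩
  refine (h (1 / ((k : ℝ) + 1)) Nat.one_div_pos_of_nat ε hε).mono fun N hN => hN.exists_code ?_ ?_
  · rcases max_choice (R.1 - 1 / ((k : ℝ) + 1)) 0 with h' | h'
    · left; rw [h']
    · exact Or.inr h'
  · rcases max_choice (R.2 - 1 / ((k : ℝ) + 1)) 0 with h' | h'
    · left; rw [h']
    · exact Or.inr h'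

/-- Time sharing: the first ⌊aN⌋ symbols are used for one code and the others for the second. Pairs
are not required to be nonnegative here. -/
lemma convex_approachable : Convex ℝ ch.approachable := by
  refine convex_iff_forall_pos.mpr fun R hR R' hR' a b ha hb hab δ hδ ε hε => ?_
  have hfl : Tendsto (fun N : ℕ => ⌊a * (N : ℝ)⌋₊) atTop atTop :=
    tendsto_nat_floor_atTop.comp (tendsto_natCast_atTop_atTop.const_mul_atTop ha)
  have hle : ∀ N : ℕ, (⌊a * (N : ℝ)⌋₊ : ℝ) ≤ a * N := fun N => Nat.floor_le (by positivity)
  have hleN : ∀ N : ℕ, ⌊a * (N : ℝ)⌋₊ ≤ N := fun N => by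
    have h1 := hle N
    have h2 : a * (N : ℝ) ≤ N := mul_le_of_le_one_left (Nat.cast_nonneg N) (by linarith)
    exact_mod_cast h1.trans h2
  have hcast : ∀ N : ℕ, ((N - ⌊a * (N : ℝ)⌋₊ : ℕ) : ℝ) = N - ⌊a * (N : ℝ)⌋₊ := fun N =>
    Nat.cast_sub (hleN N)
  have hfl' : Tendsto (fun N : ℕ => N - ⌊a * (N : ℝ)⌋₊) atTop atTop := by
    refine tendsto_natCast_atTop_iff (R := ℝ).mp ?_
    refine tendsto_atTop_mono (fun N => ?_) (tendsto_natCast_atTop_atTop.const_mul_atTop hb)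
    rw [hcast]
    have := hle N
    have : b * (N : ℝ) = N - a * N := by rw [eq_sub_of_add_eq' hab]; ring
    linarith
  have hlarge : ∀ x : ℝ, ∀ᶠ N : ℕ in atTop, x ≤ N * (δ / 2) := fun x =>
    (tendsto_natCast_atTop_atTop.atTop_mul_const (half_pos hδ)).eventually_ge_atTop x
  filter_upwards [hfl.eventually (hR (δ / 2) (half_pos hδ) (ε / 2) (half_pos hε)),
    hfl'.eventually (hR' (δ / 2) (half_pos hδ) (ε / 2) (half_pos hε)),
    hlarge (|R.1| + |R'.1|), hlarge (|R.2| + |R'.2|)] with N h h' hl₁ hl₂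
  have happ := h.append h'
  rw [Nat.add_sub_cancel' (hleN N)] at happ
  have hlt : a * (N : ℝ) < ⌊a * (N : ℝ)⌋₊ + 1 := Nat.lt_floor_add_one _
  -- Rounding moves less than one symbol from one code to the other, which costs at most |x| + |x'|
  -- bits; half of the loss N δ absorbs it.
  have key : ∀ x x' : ℝ, |x| + |x'| ≤ N * (δ / 2) → N * (a * x + b * x' - δ) ≤
      ⌊a * (N : ℝ)⌋₊ * (x - δ / 2) + ((N - ⌊a * (N : ℝ)⌋₊ : ℕ) : ℝ) * (x' - δ / 2) := by
    intro x x' hx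
    rw [hcast]
    have h1 := hle N
    have hb' : b = 1 - a := by linarith
    rw [hb']
    generalize (⌊a * (N : ℝ)⌋₊ : ℝ) = F at *
    have e1 : (a * N - F) * x ≤ |x| := by
      have := mul_le_mul_of_nonneg_left (le_abs_self x) (sub_nonneg.mpr h1)
      have := mul_le_mul_of_nonneg_right (show a * N - F ≤ 1 by linarith) (abs_nonneg x)
      linarith
    have e2 : -((a * N - F) * x') ≤ |x'| := by
      have := mul_le_mul_of_nonneg_left (neg_abs_le x') (sub_nonneg.mpr h1)
      have := mul_le_mul_of_nonneg_right (show a * N - F ≤ 1 by linarith) (abs_nonneg x')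
      linarith
    linarith
  exact happ.mono (key _ _ hl₁) (key _ _ hl₂) (by linarith)

end CRC

/-! ### From the block scheme to codes of every large length. -/

section

variable {X₁ X₂ Y₁ Y₂ Y : Type*} [Fintype X₁] [Fintype X₂] [Fintype Y₁] [Fintype Y₂] [Fintype Y]

lemma nonempty_of_mem_stdSimplex {A : Type*} [Fintype A] {p : A → ℝ} (h : p ∈ stdSimplex ℝ A) :
    Nonempty A := by
  by_contra hA
  rw [not_nonempty_iff] at hA
  simpa using h.2

lemma HKPDFDist.nonempty_inputs (P : HKPDFDist X₁ X₂) : Nonempty X₁ ∧ Nonempty X₂ := by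
  obtain ⟨t⟩ := nonempty_of_mem_stdSimplex P.pT₁₀_mem
  obtain ⟨u⟩ := nonempty_of_mem_stdSimplex (P.pU₁₀_mem t)
  obtain ⟨v⟩ := nonempty_of_mem_stdSimplex P.pU₁₁_mem
  obtain ⟨w⟩ := nonempty_of_mem_stdSimplex P.pU₂₁_mem
  obtain ⟨z⟩ := nonempty_of_mem_stdSimplex (P.pU₂₂_mem w t)
  exact ⟨nonempty_of_mem_stdSimplex (P.pX₁_mem t u v), nonempty_of_mem_stdSimplex (P.pX₂_mem t w z)⟩

lemma HKPDFBook.exists_code_errorProb_le {P : HKPDFDist X₁ X₂} {ch : CRC X₁ X₂ Y₁ Y₂ Y}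
    {ε' ε c : ℝ} {r : HKPDFRates} {b n : ℕ} (h : P.ensembleError ch ε' ε r b n < c) :
    ∃ bk : HKPDFBook P r n b, (bk.code ch ε' ε).errorProb ch ≤ c := by
  rw [HKPDFBook.ensembleError_eq] at h
  by_contra! hno
  have hm := piProd_mem fun _ : Fin (b + 1) => HKPDFBook.blockLaw_mem (P := P) (r := r) (n := n)
  have := expect_mono hm.1 fun β => (hno (HKPDFBook.ofBlocks β)).le
  rw [expect_const hm.2] at this
  linarith

lemma rpow_le_card_msg {n b : ℕ} {ρ : ℝ}
    {M : Type*} [Fintype M] (h : (2 : ℝ) ^ (n * ρ) ≤ Fintype.card M) :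
    (2 : ℝ) ^ ((n : ℝ) * b * ρ) ≤ Fintype.card (Fin b → M) := by
  rw [Fintype.card_fun, Fintype.card_fin, Nat.cast_pow,
    show (n : ℝ) * b * ρ = n * ρ * b by ring, Real.rpow_mul two_pos.le, Real.rpow_natCast]
  gcongr

lemma rpow_le_numMsg (n : ℕ) (ρ : ℝ) : (2 : ℝ) ^ ((n : ℝ) * ρ) ≤ numMsg n ρ := Nat.le_ceil _

/-- A length N is divided into b + 1 blocks, and the remaining N mod (b + 1) symbols are filled with
fixed inputs. Of the loss δ, one half is spent on the part rates, a quarter on the last block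
without new messages and a quarter on the remainder. -/
lemma CRC.hkpdfAchieved_subset_approachable (ch : CRC X₁ X₂ Y₁ Y₂ Y) :
    ch.hkpdfAchieved ⊆ ch.approachable := by
  rintro R ⟨P, hP⟩ δ hδ ε hε
  obtain ⟨⟨x₁⟩, ⟨x₂⟩⟩ := P.nonempty_inputs
  obtain ⟨r, η', η, h10, h11, h12, h21, h22, -, -, -, hR₁, hR₂, ht⟩ := hP (δ / 2) (half_pos hδ)
  set ρ₁ := r.r₁₀ + r.r₁₁ + r.r₁₂
  set ρ₂ := r.r₂₁ + r.r₂₂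
  have hρ₁ : 0 ≤ ρ₁ := by positivity
  have hρ₂ : 0 ≤ ρ₂ := by positivity
  -- The number of blocks is fixed before N: the idle block costs a fraction 1/(b + 1) of each rate,
  -- at most δ/4.
  obtain ⟨b, hb⟩ := exists_nat_ge ((ρ₁ + ρ₂) / (δ / 4))
  rw [div_le_iff₀ (by positivity)] at hb
  have hdiv : Tendsto (fun N : ℕ => N / (b + 1)) atTop atTop :=
    Nat.tendsto_div_const_atTop (Nat.succ_ne_zero b)
  have hlarge : ∀ x : ℝ, ∀ᶠ N : ℕ in atTop, x ≤ N * (δ / 4) := fun x =>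
    (tendsto_natCast_atTop_atTop.atTop_mul_const (by positivity)).eventually_ge_atTop x
  filter_upwards [hdiv.eventually ((ht b).eventually_lt_const hε),
    hlarge ((b + 1) * ρ₁), hlarge ((b + 1) * ρ₂)] with N hN hl₁ hl₂
  obtain ⟨bk, hbk⟩ := HKPDFBook.exists_code_errorProb_le hN
  have hcode : ch.HasCode ((b + 1) * (N / (b + 1))) (((N / (b + 1) : ℕ) : ℝ) * b * ρ₁)
      (((N / (b + 1) : ℕ) : ℝ) * b * ρ₂) ε := by
    refine .of_code _ hbk (rpow_le_card_msg ?_) (rpow_le_card_msg ?_)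
    · simp only [Fintype.card_prod, Fintype.card_fin, Nat.cast_mul, ρ₁, mul_add,
        Real.rpow_add two_pos, mul_assoc]
      gcongr <;> exact rpow_le_numMsg _ _
    · simp only [Fintype.card_prod, Fintype.card_fin, Nat.cast_mul, ρ₂, mul_add,
        Real.rpow_add two_pos]
      gcongr <;> exact rpow_le_numMsg _ _
  have happ := hcode.append (HasCode.trivial x₁ x₂ (N % (b + 1)))
  rw [Nat.div_add_mod] at happ
  have hN' : (N : ℝ) = (b + 1) * ((N / (b + 1) : ℕ) : ℝ) + ((N % (b + 1) : ℕ) : ℝ) := by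
    exact_mod_cast (Nat.div_add_mod N (b + 1)).symm
  have hmod : ((N % (b + 1) : ℕ) : ℝ) ≤ b + 1 := by
    exact_mod_cast (Nat.mod_lt N (Nat.succ_pos b)).le
  have hq : (0 : ℝ) ≤ ((N / (b + 1) : ℕ) : ℝ) := Nat.cast_nonneg _
  have hs : (0 : ℝ) ≤ ((N % (b + 1) : ℕ) : ℝ) := Nat.cast_nonneg _
  have key : ∀ x ρ : ℝ, 0 ≤ ρ → x - δ / 2 ≤ ρ → ρ ≤ b * (δ / 4) → (b + 1) * ρ ≤ N * (δ / 4) →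
      N * (x - δ) ≤ ((N / (b + 1) : ℕ) : ℝ) * b * ρ + 0 := by
    intro x ρ hρ hx hρb hl
    have hN0 : (0 : ℝ) ≤ N := Nat.cast_nonneg N
    generalize ((N / (b + 1) : ℕ) : ℝ) = q at *
    generalize ((N % (b + 1) : ℕ) : ℝ) = s at *
    have e1 : N * (x - δ) ≤ N * (ρ - δ / 2) := mul_le_mul_of_nonneg_left (by linarith) hN0
    have e2 : s * ρ ≤ (b + 1) * ρ := mul_le_mul_of_nonneg_right hmod hρ
    have e3 : q * ρ ≤ q * (b * (δ / 4)) := mul_le_mul_of_nonneg_left hρb hq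
    have e4 : q * (b * (δ / 4)) ≤ N * (δ / 4) := by
      rw [← mul_assoc]
      refine mul_le_mul_of_nonneg_right ?_ (by positivity)
      linarith
    have e5 : (N : ℝ) * ρ = (b + 1) * q * ρ + s * ρ := by rw [hN']; ring
    linarith
  exact happ.mono (key _ _ hρ₁ hR₁ (by linarith) hl₁) (key _ _ hρ₂ hR₂ (by linarith) hl₂) (by simp)

theorem CRC.convexHull_hkpdfRegion_subset (ch : CRC X₁ X₂ Y₁ Y₂ Y) :
    convexHull ℝ ch.hkpdfRegion ⊆ closure ch.achievable := by
  have hpos : Convex ℝ {R : ℝ × ℝ | 0 ≤ R} := convex_Ici 0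
  -- Nonnegativity is carried along separately, because `approachable` does not demand it but the
  -- limit of achievable pairs does.
  have hsub : ch.hkpdfRegion ⊆ ch.approachable ∩ {R : ℝ × ℝ | 0 ≤ R} := fun R hR => by
    refine ⟨ch.hkpdfAchieved_subset_approachable (ch.hkpdfRegion_subset_hkpdfAchieved hR), ?_⟩
    obtain ⟨P, hP⟩ := Set.mem_iUnion.mp hR
    exact ⟨hP.1, hP.2.1⟩
  intro R hR
  have h := convexHull_min hsub (convex_approachable.inter hpos) hR
  exact mem_closure_achievable h.1 h.2.1 h.2.2

end

theorem theorem2 {X₁ X₂ Y₁ Y₂ Y : Type*} [Fintype X₁] [Fintype X₂] [Fintype Y₁] [Fintype Y₂]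
    [Fintype Y] (ch : CRC X₁ X₂ Y₁ Y₂ Y) :
    ch.hkpdfRegion ⊆ ch.hkpdfAchieved ∧
    convexHull ℝ ch.hkpdfRegion ⊆ closure ch.achievable ∧
    convexHull ℝ ch.pdfRegion ⊆ convexHull ℝ ch.hkpdfRegion ∧
    convexHull ℝ ch.hkRegion ⊆ convexHull ℝ ch.hkpdfRegion := by
  exact ⟨ch.hkpdfRegion_subset_hkpdfAchieved, ch.convexHull_hkpdfRegion_subset,
    convexHull_mono ch.pdfRegion_subset, convexHull_mono ch.hkRegion_subset⟩
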